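/- **Setting.** Let $\mathcal G$ be the space of isomorphism classes of infinite, locally finite, connected rooted graphs, with the (Borel structure of the) metric $d(\Gamma_o,\Gamma'_{o'})=2^{-r}$, $r$ being the maximal radius for which the $r$-balls around the roots are isomorphic as rooted graphs. A graph is *rigid* if its automorphism group is trivial; $\mathcal G_\ni\subset\mathcal G$ is the subspace of rigid rooted graphs, $\mathcal T_\ni\subset\mathcal G_\ni$ the subspace of rigid rooted trees. Let $\mathcal R$ be the equivalence relation on $\mathcal G$ for which $\Gamma_o\sim\Gamma'_{o'}$ iff the unrooted graphs $\Gamma,\Gamma'$ are isomorphic; on each class there is the graph structure in which $\Gamma_o$ and $\Gamma_{o'}$ are neighbours iff $o,o'$ are neighbours in $\Gamma$. For $x\in\mathcal T_\ni$ let $T_x$ be the class of $x$ with this graph structure and root $x$ (it is isomorphic to the rooted tree $x$), and let $\widetilde{\mathcal T}_\ni=\{(x,\gamma):x\in\mathcal T_\ni,\ \gamma\in\partial T_x\}$ be the boundary bundle, where $\partial T_x$ is the space of geodesic rays of $T_x$ issued from $x$. A measure $M$ on $\mathcal G_\ni$ is *$\mathcal R$-invariant* if $\varphi(M|_A)=M|_B$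 for every measurable bijection $\varphi:A\to B$ between measurable subsets of $\mathcal G_\ni$ whose graph is contained in $\mathcal R$. For a rooted tree $(T,o)$ and $\gamma\in\partial T$ let $\beta_\gamma(x,y)=\lim_{z\to\gamma}[d(y,z)-d(x,z)]$ be the Busemann cocycle. The *horospheric product* of $(T,o,\gamma)$ and $(T',o',\gamma')$ is the graph with vertex set $\{(x,x')\in T\times T':\beta_\gamma(o,x)+\beta_{\gamma'}(o',x')=0\}$, in which $(x,x')$ and $(y,y')$ are adjacent iff $x,y$ are adjacent in $T$ and $x',y'$ are adjacent in $T'$; its root is $(o,o')$. For a probability distribution $p=(p_k)$ on $\{0,1,2,\dots\}$, the augmented Galton–Watson measure $\mathbf P'(p)$ is the law of the random rooted tree in which all individuals have independent numbers of offspring, distributed according to $p$ for every individual except the root, and according to $p'_k=p_{k-1}$ for the root. **Theorem.** Let $p=(p_k)$ and $q=(q_k)$ be two probability distributions on $\{0,1,2,\dots\}$ such that $p_0=q_0=0$, the support of each contains more than one point, $\sum_k k\log k\,p_k<\infty$, $\sum_k k\log k\,q_k<\infty$, and $p,q$ have the same mean $m=\sum_k k\,p_k=\sum_k k\,q_k$.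 Let $\mathbf P'=\mathbf P'(p)$ and $\mathbf Q'=\mathbf P'(q)$. Then: 1. $\mathbf P'$ and $\mathbf Q'$ are carried by $\mathcal T_\ni$. For $\mathbf P'$-a.e. and for $\mathbf Q'$-a.e. $x\in\mathcal T_\ni$ the branching measure $\nu_x$ exists, i.e. the counting measures on the spheres $S^n_x\subset T_x$ around the root, divided by $m^n$, converge weak$^*$ on the compactification $T_x\sqcup\partial T_x$ to a finite measure $\nu_x$ on $\partial T_x$; and $x\mapsto\nu_x$ is measurable (mod 0) with respect to $\mathbf P'$ and to $\mathbf Q'$. 2. Let $\widetilde{\mathbf P}'$ and $\widetilde{\mathbf Q}'$ be the measures on $\widetilde{\mathcal T}_\ni$ given by $$d\widetilde{\mathbf P}'(x,\gamma)=\frac{1}{\deg x}\,d\mathbf P'(x)\,d\nu_x(\gamma),\qquad d\widetilde{\mathbf Q}'(x,\gamma)=\frac1{\deg x}\,d\mathbf Q'(x)\,d\nu_x(\gamma),$$ where $\deg x$ is the degree of the root, that is, the boundary extensions of the measures $\frac1{\deg}\mathbf P'$ and $\frac1{\deg}\mathbf Q'$ by the branching measures. For $\widetilde{\mathbf P}'\times\widetilde{\mathbf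 Q}'$-a.e. pair $(T,T')$ of rooted trees pointed at infinity their horospheric product, rooted at the pair of the roots, is an infinite, locally finite, connected rigid graph; the (a.e. defined) map from pairs $(T,T')$ to the class of this rooted graph in $\mathcal G_\ni$ is measurable (mod 0); and the image of $\widetilde{\mathbf P}'\times\widetilde{\mathbf Q}'$ under this map is a finite $\mathcal R$-invariant measure on $\mathcal G_\ni$. -/

import Mathlib

open MeasureTheory Filter Topology
open scoped ENNReal

noncomputable section

namespace HorosphericGW

/-! ### Graphs, geodesic rays, boundaries and horospheric products -/

section Graphs

variable {V V' : Type*}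

/-- A graph is rigid if its group of automorphisms (isometries) is trivial. -/
def IsRigidGraph (G : SimpleGraph V) : Prop := ∀ e : G ≃g G, e = RelIso.refl G.Adj

/-- Infinite, connected and locally finite graphs. -/
def IsInfiniteLocallyFiniteConnected (G : SimpleGraph V) : Prop :=
  Infinite V ∧ G.Connected ∧ ∀ v, (G.neighborSet v).Finite

/-- The boundary of a tree `G`, identified with the space of geodesic rays issued from `o`. -/
def Boundary (G : SimpleGraph V) (o : V) : Type _ :=
  {γ : ℕ → V // γ 0 = o ∧ ∀ i j : ℕ, G.dist (γ i) (γ (i + j)) = j}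

/-- The topology of pointwise convergence, the vertex set being discrete. -/
instance (G : SimpleGraph V) (o : V) : TopologicalSpace (Boundary G o) :=
  TopologicalSpace.induced Subtype.val (@Pi.topologicalSpace ℕ (fun _ => V) (fun _ => ⊥))

instance (G : SimpleGraph V) (o : V) : MeasurableSpace (Boundary G o) := borel _

instance (G : SimpleGraph V) (o : V) : BorelSpace (Boundary G o) := ⟨rfl⟩

/-- The compactification of a tree: the disjoint union of its vertex set and its boundary. -/
inductive Compactification (G : SimpleGraph V) (o : V) : Type _
  | vertex (v : V) : Compactification G o
  | bdry (γ : Boundary G o) : Compactification G o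

open Classical in
/-- The geodesic segment `[o, v]`, run at unit speed from `o` and stopped at `v`. -/
def geodesicSegment (G : SimpleGraph V) (o v : V) : ℕ → V :=
  if h : G.Reachable o v then (h.exists_walk_length_eq_dist).choose.getVert else fun _ => v

/-- The geodesic from `o` to a point of the compactification. -/
def Compactification.trace {G : SimpleGraph V} {o : V} : Compactification G o → ℕ → V
  | .vertex v => geodesicSegment G o v
  | .bdry γ => γ.1

/-- The topology of the compactification: pointwise convergence of the geodesics from `o`. -/
instance (G : SimpleGraph V) (o : V) : TopologicalSpace (Compactification G o) :=
  TopologicalSpace.induced Compactification.trace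
    (@Pi.topologicalSpace ℕ (fun _ => V) (fun _ => ⊥))

/-- `ν` is the branching measure of `(G, o)` with normalization `m`: it is a finite measure on the
boundary, and the counting measures on the spheres `S^n` around `o`, divided by `m ^ n`, converge
to it in the weak* topology on the compactification. -/
def IsBranchingMeasure (G : SimpleGraph V) (o : V) (m : ℝ) (ν : Measure (Boundary G o)) : Prop :=
  IsFiniteMeasure ν ∧
    ∀ f : Compactification G o → ℝ, Continuous f →
      Tendsto (fun n : ℕ => (∑ᶠ v ∈ {v : V | G.dist o v = n}, f (.vertex v)) / m ^ n) atTop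
        (𝓝 (∫ γ, f (.bdry γ) ∂ν))

/-- The Busemann cocycle `β_γ(x, y)`, i.e. the limit of `d(y, z) - d(x, z)` as `z → γ`. -/
def busemann (G : SimpleGraph V) {o : V} (γ : Boundary G o) (x y : V) : ℤ :=
  limUnder atTop fun n : ℕ => (G.dist y (γ.1 n) : ℤ) - (G.dist x (γ.1 n) : ℤ)

theorem busemann_self (G : SimpleGraph V) {o : V} (γ : Boundary G o) (x : V) :
    busemann G γ x x = 0 := by
  simp only [busemann, sub_self]
  exact tendsto_const_nhds.limUnder_eq

/-- The vertex set of the horospheric product of `(G, o, γ)` and `(G', o', γ')`. -/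
def HorosphericVertex (G : SimpleGraph V) {o : V} (γ : Boundary G o)
    (G' : SimpleGraph V') {o' : V'} (γ' : Boundary G' o') : Type _ :=
  {w : V × V' // busemann G γ o w.1 + busemann G' γ' o' w.2 = 0}

/-- The horospheric product of two rooted trees pointed at infinity. -/
def horosphericProduct (G : SimpleGraph V) {o : V} (γ : Boundary G o)
    (G' : SimpleGraph V') {o' : V'} (γ' : Boundary G' o') :
    SimpleGraph (HorosphericVertex G γ G' γ') where
  Adj v w := G.Adj v.1.1 w.1.1 ∧ G'.Adj v.1.2 w.1.2
  symm := ⟨fun _ _ h => ⟨h.1.symm, h.2.symm⟩⟩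
  loopless := ⟨fun _ h => G.irrefl h.1⟩

/-- The root `(o, o')` of the horospheric product. -/
def horosphericRoot (G : SimpleGraph V) {o : V} (γ : Boundary G o)
    (G' : SimpleGraph V') {o' : V'} (γ' : Boundary G' o') : HorosphericVertex G γ G' γ' :=
  ⟨(o, o'), by simp [busemann_self]⟩

end Graphs

/-! ### The space of rooted graphs -/

/-- An infinite locally finite connected rooted graph. Such a graph is countably infinite, so that
up to isomorphism its vertex set is `ℕ`. -/
structure RootedGraph where
  graph : SimpleGraph ℕ
  root : ℕ
  connected : graph.Connected
  locallyFinite : ∀ v, (graph.neighborSet v).Finite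

/-- The same graph with another root. -/
def RootedGraph.reroot (g : RootedGraph) (v : ℕ) : RootedGraph := { g with root := v }

/-- Isomorphism of rooted graphs. -/
instance rootedSetoid : Setoid RootedGraph where
  r g h := ∃ e : g.graph ≃g h.graph, e g.root = h.root
  iseqv :=
    { refl := fun _ => ⟨RelIso.refl _, rfl⟩
      symm := fun ⟨e, he⟩ => ⟨e.symm, by rw [← he]; exact e.symm_apply_apply _⟩
      trans := fun ⟨e, he⟩ ⟨e', he'⟩ => ⟨e.trans e', by rw [← he', ← he]; rfl⟩ }

/-- The space of isomorphism classes of infinite locally finite connected rooted graphs. -/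
def GraphSpace : Type := Quotient rootedSetoid

/-- The isomorphism class of a rooted graph. -/
def RootedGraph.toClass (g : RootedGraph) : GraphSpace := Quotient.mk rootedSetoid g

namespace GraphSpace

/-- The class `Γ` is the isomorphism class of the rooted graph `(G, o)`. -/
def IsClassOf (Γ : GraphSpace) {V : Type*} (G : SimpleGraph V) (o : V) : Prop :=
  ∃ g : RootedGraph, g.toClass = Γ ∧ ∃ e : G ≃g g.graph, e o = g.root

/-- The balls of radius `r` around the roots are isomorphic as rooted graphs. -/
def SameBall (r : ℕ) (Γ Γ' : GraphSpace) : Prop :=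
  ∃ g h : RootedGraph, g.toClass = Γ ∧ h.toClass = Γ' ∧
    ∃ e : g.graph.induce {v | g.graph.dist g.root v ≤ r} ≃g
        h.graph.induce {v | h.graph.dist h.root v ≤ r},
      ∀ v, v.1 = g.root → (e v).1 = h.root

/-- The topology of the metric `d = 2 ^ (-r)`, where `r` is the maximal radius such that the
`r`-balls around the roots are isomorphic; it is generated by the balls of this metric. -/
instance : TopologicalSpace GraphSpace :=
  TopologicalSpace.generateFrom {U | ∃ (r : ℕ) (Γ : GraphSpace), U = {Γ' | SameBall r Γ Γ'}}

instance : MeasurableSpace GraphSpace := borel _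

instance : BorelSpace GraphSpace := ⟨rfl⟩

/-- Rigidity of the underlying graph. -/
def IsRigid (Γ : GraphSpace) : Prop := ∀ g : RootedGraph, g.toClass = Γ → IsRigidGraph g.graph

/-- The underlying graph is a tree. -/
def IsTree (Γ : GraphSpace) : Prop := ∀ g : RootedGraph, g.toClass = Γ → g.graph.IsTree

/-- The equivalence relation `ℛ`: the underlying unrooted graphs are isomorphic. -/
def Rel (Γ Γ' : GraphSpace) : Prop :=
  ∃ g h : RootedGraph, g.toClass = Γ ∧ h.toClass = Γ' ∧ Nonempty (g.graph ≃g h.graph)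

/-- The graph structure `𝒦` on `ℛ`: the root is moved to a neighbouring vertex. -/
def Edge (Γ Γ' : GraphSpace) : Prop :=
  ∃ (g : RootedGraph) (v : ℕ), g.graph.Adj g.root v ∧ g.toClass = Γ ∧ (g.reroot v).toClass = Γ'

theorem Rel.refl (Γ : GraphSpace) : Rel Γ Γ := by
  obtain ⟨g, hg⟩ := Quotient.exists_rep Γ
  exact ⟨g, g, hg, hg, ⟨RelIso.refl _⟩⟩

theorem Edge.symm {Γ Γ' : GraphSpace} (h : Edge Γ Γ') : Edge Γ' Γ := by
  obtain ⟨g, v, hv, rfl, rfl⟩ := h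
  exact ⟨g.reroot v, g.root, hv.symm, rfl, rfl⟩

/-- The `ℛ`-equivalence class of `Γ`. -/
def Leaf (Γ : GraphSpace) : Type := {Γ' : GraphSpace // Rel Γ Γ'}

/-- The point `Γ` of its own equivalence class. -/
def leafRoot (Γ : GraphSpace) : Leaf Γ := ⟨Γ, Rel.refl Γ⟩

/-- The leafwise graph on the equivalence class of `Γ`. -/
def leafGraph (Γ : GraphSpace) : SimpleGraph (Leaf Γ) where
  Adj a b := a ≠ b ∧ Edge a.1 b.1
  symm := ⟨fun _ _ h => ⟨h.1.symm, h.2.symm⟩⟩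
  loopless := ⟨fun _ h => h.1 rfl⟩

/-- The degree of the point `Γ` in its leafwise graph. -/
def degree (Γ : GraphSpace) : ℕ := ((leafGraph Γ).neighborSet (leafRoot Γ)).ncard

end GraphSpace

/-- The space of rigid rooted graphs. -/
abbrev RigidGraph : Type := {Γ : GraphSpace // Γ.IsRigid}

/-- The space of rigid rooted trees. -/
abbrev RigidTree : Type := {Γ : GraphSpace // Γ.IsTree ∧ Γ.IsRigid}

/-- The one-sided infinite path. -/
def rayGraph : SimpleGraph ℕ where
  Adj i j := i + 1 = j ∨ j + 1 = i
  symm := ⟨fun _ _ h => h.symm⟩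
  loopless := ⟨fun _ h => by rcases h with h | h <;> omega⟩

theorem rayGraph_connected : rayGraph.Connected := by
  have h : ∀ n, rayGraph.Reachable 0 n := by
    intro n
    induction n with
    | zero => exact SimpleGraph.Reachable.refl _
    | succ n ih =>
      have hadj : rayGraph.Adj n (n + 1) := Or.inl rfl
      exact ih.trans hadj.reachable
  exact ⟨fun a b => (h a).symm.trans (h b)⟩

theorem rayGraph_isRigidGraph : IsRigidGraph rayGraph := by
  intro e
  have h0 : e 0 = 0 := by
    by_contra hne
    obtain ⟨k, hk⟩ := Nat.exists_eq_succ_of_ne_zero hne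
    have h1 : ∀ j, rayGraph.Adj (e 0) j → e.symm j = 1 := by
      intro j hj
      have h2 : rayGraph.Adj (e.symm (e 0)) (e.symm j) := e.symm.map_rel_iff.2 hj
      rw [e.symm_apply_apply] at h2
      rcases h2 with h | h <;> omega
    have ha := h1 k (by right; omega)
    have hb := h1 (k + 2) (by left; omega)
    have := e.symm.injective (ha.trans hb.symm)
    omega
  have key : ∀ n, e n = n ∧ e (n + 1) = n + 1 := by
    intro n
    induction n with
    | zero =>
      refine ⟨h0, ?_⟩
      have h2 : rayGraph.Adj (e 0) (e 1) := e.map_rel_iff.2 (Or.inl rfl)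
      change e 1 = 1
      rcases h2 with h | h <;> omega
    | succ n ih =>
      refine ⟨ih.2, ?_⟩
      have h2 : rayGraph.Adj (e (n + 1)) (e (n + 1 + 1)) := e.map_rel_iff.2 (Or.inl rfl)
      have h3 : e (n + 1 + 1) ≠ e n := fun h => by
        have := e.injective h
        omega
      rcases h2 with h | h <;> omega
  exact RelIso.ext fun n => (key n).1

/-- The one-sided infinite path, rooted at its end vertex. -/
def rootedRay : RootedGraph where
  graph := rayGraph
  root := 0
  connected := rayGraph_connected
  locallyFinite v := (Set.finite_Iic (v + 1)).subset fun w hw => by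
    rcases hw with h | h <;> simp only [Set.mem_Iic] <;> omega

theorem rootedRay_isRigid : rootedRay.toClass.IsRigid := by
  intro g hg e
  obtain ⟨i, -⟩ : ∃ i : g.graph ≃g rootedRay.graph, i g.root = rootedRay.root :=
    Quotient.exact hg
  have h := rayGraph_isRigidGraph ((i.symm.trans e).trans i)
  refine RelIso.ext fun v => i.injective ?_
  have h' : i (e (i.symm (i v))) = i v :=
    congrArg (fun f : rayGraph ≃g rayGraph => f (i v)) h
  rw [i.symm_apply_apply] at h'
  exact h'

open Classical in
/-- The isomorphism class of the rooted graph `(G, o)`. The value of the second branch, taken when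
`G` is not infinite, connected and locally finite, is irrelevant. -/
def classOf {V : Type*} (G : SimpleGraph V) (o : V) : GraphSpace :=
  if h : ∃ Γ : GraphSpace, Γ.IsClassOf G o then h.choose else rootedRay.toClass

open Classical in
/-- The isomorphism class of `(G, o)` as a point of the space of rigid rooted graphs. The value of
the second branch, taken when `G` is not rigid, is irrelevant. -/
def rigidClassOf {V : Type*} (G : SimpleGraph V) (o : V) : RigidGraph :=
  if h : (classOf G o).IsRigid then ⟨classOf G o, h⟩ else ⟨rootedRay.toClass, rootedRay_isRigid⟩

/-- A measure on the space of rigid rooted graphs is `ℛ`-invariant if it is preserved by every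
partial transformation of `ℛ`, i.e. by every measurable bijection between measurable subsets whose
graph is contained in `ℛ`. -/
def IsRelInvariant (M : Measure RigidGraph) : Prop :=
  ∀ (A B : Set RigidGraph) (φ : RigidGraph → RigidGraph),
    MeasurableSet A → MeasurableSet B → Measurable φ → Set.BijOn φ A B →
    (∀ Γ ∈ A, GraphSpace.Rel Γ.1 (φ Γ).1) →
    (M.restrict A).map φ = M.restrict B

/-! ### The boundary bundle -/

/-- The leafwise tree of `x`. -/
abbrev leafTree (x : RigidTree) : SimpleGraph x.1.Leaf := x.1.leafGraph

/-- The boundary of the leafwise tree of `x`. -/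
abbrev LeafBoundary (x : RigidTree) : Type := Boundary (leafTree x) x.1.leafRoot

/-- The boundary bundle over the space of rigid rooted trees; its points are rooted (rigid) trees
pointed at infinity. -/
structure BoundaryBundle where
  base : RigidTree
  point : LeafBoundary base

/-- The consecutive points of the leafwise geodesic ray determined by a point of the bundle. -/
def BoundaryBundle.ray (z : BoundaryBundle) (n : ℕ) : GraphSpace := (z.point.1 n).1

/-- The Borel structure of the boundary bundle: a point `(x, γ)` is recorded by the leafwise
geodesic ray `x = x₀, x₁, x₂, …` issued from `x` in the direction of `γ`. -/
instance : MeasurableSpace BoundaryBundle := MeasurableSpace.comap BoundaryBundle.ray inferInstance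

/-- The boundary extension `dμ(x) dν_x(γ)` of a measure `μ` by a system of boundary measures. -/
def boundaryExtension (μ : Measure RigidTree) (ν : ∀ x : RigidTree, Measure (LeafBoundary x)) :
    Measure BoundaryBundle :=
  μ.bind fun x => (ν x).map (BoundaryBundle.mk x)

/-- Measurability (mod 0) of a system of boundary measures. -/
def IsMeasurableSystem (μ : Measure RigidTree) (ν : ∀ x : RigidTree, Measure (LeafBoundary x)) :
    Prop :=
  AEMeasurable (fun x => (ν x).map (BoundaryBundle.mk x)) μ

open Classical in
/-- The branching measure on the boundary of the leafwise tree of `x` (zero if it does not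
exist). -/
def branchingMeasure (m : ℝ) (x : RigidTree) : Measure (LeafBoundary x) :=
  if h : ∃ ν, IsBranchingMeasure (leafTree x) x.1.leafRoot m ν then h.choose else 0

/-- The horospheric product of the trees pointed at infinity `z.1` and `z.2`. -/
def bundleProduct (z : BoundaryBundle × BoundaryBundle) :
    SimpleGraph (HorosphericVertex (leafTree z.1.base) z.1.point
      (leafTree z.2.base) z.2.point) :=
  horosphericProduct _ z.1.point _ z.2.point

/-- The map which assigns to two rooted trees pointed at infinity the isomorphism class of their
rooted horospheric product. -/
def bundleProductClass (z : BoundaryBundle × BoundaryBundle) : RigidGraph :=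
  rigidClassOf (bundleProduct z) (horosphericRoot _ z.1.point _ z.2.point)

/-! ### Augmented Galton--Watson trees -/

/-- The words which are vertices of the genealogical tree in which the individual `u` has `N u`
offspring; the `i`-th child of `u` is `i :: u`, and the progenitor is `[]`. -/
inductive IsIndividual (N : List ℕ → ℕ) : List ℕ → Prop
  | root : IsIndividual N []
  | child (u : List ℕ) (i : ℕ) : IsIndividual N u → i < N u → IsIndividual N (i :: u)

/-- The genealogical tree with offspring numbers `N`. -/
def genealogicalTree (N : List ℕ → ℕ) : SimpleGraph {u : List ℕ // IsIndividual N u} where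
  Adj u v := (∃ i, v.1 = i :: u.1) ∨ (∃ i, u.1 = i :: v.1)
  symm := ⟨fun _ _ h => h.symm⟩
  loopless := ⟨fun u h => by rcases h with ⟨i, h⟩ | ⟨i, h⟩ <;> simp at h⟩

/-- The offspring law of the individual `u` in the augmented process: the progenitor has one more
offspring than the distribution `p` prescribes. -/
def augmentedOffspring (p : PMF ℕ) (u : List ℕ) : PMF ℕ :=
  if u = [] then p.map (fun k => k + 1) else p

/-- The law of the augmented Galton--Watson tree on the space of rooted graphs. -/
def augmentedLaw (p : PMF ℕ) : Measure GraphSpace :=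
  (Measure.infinitePi fun u : List ℕ => (augmentedOffspring p u).toMeasure).map
    fun N => classOf (genealogicalTree N) ⟨[], IsIndividual.root⟩

/-- The augmented Galton--Watson measure on the space of rigid rooted trees. -/
def augmentedGW (p : PMF ℕ) : Measure RigidTree := (augmentedLaw p).comap Subtype.val

/-- The augmented Galton--Watson measure divided by the degree function. -/
def invariantGW (p : PMF ℕ) : Measure RigidTree :=
  (augmentedGW p).withDensity fun x => ((x.1.degree : ℕ) : ℝ≥0∞)⁻¹

/-- The boundary extension of the measure `invariantGW p` by the branching measures. -/
def extendedGW (p : PMF ℕ) (m : ℝ) : Measure BoundaryBundle :=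
  boundaryExtension (invariantGW p) (branchingMeasure m)

end HorosphericGW

end

open HorosphericGW

noncomputable section

namespace HorosphericGW

/-! ### Isomorphism classes of rooted graphs -/

section Classes

variable {V V' : Type*}

/-! Invariance of a measure on rooted graphs is reduced to the single identity `Reversible`: the sum
of `H x y` over the moves of the root from `x` to a neighbour `y` has the same mean as the sum of `H
y x`. When all vertices are distinguishable, this implies invariance under every partial
transformation (`Reversible.isRelInvariant`), because the transformation can be realised as a
transport of mass along shortest walks. Distinguishability is used in the countable form
`WalkDistinct`: two different vertices issue different numbers of walks of some length. It implies
rigidity, it is a measurable condition, and it lets a vertex be recovered from the class of the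
graph rooted there. A ray in a tree can therefore be recorded as a sequence of classes, in one fixed
measurable space.

An augmented Galton–Watson tree is a pair of independent ordinary Galton–Watson trees joined by an
edge, which runs from the progenitor to a child of any prescribed index (`map_insertChild`). After
division by the degree, summation over the neighbours of the root becomes integration over such
pairs, and exchanging the two trees gives reversibility (`reversible_reversibleLaw`). Reversibility
carries almost sure properties of the root over to all vertices (`Reversible.ae_forall_clAt`). In
this way almost every tree is `Good`: its cones have convergent normalized sizes, by the martingale
of generation sizes, and its vertices are distinguishable. Convergence on cones yields the branching
measure through Riesz representation (`exists_isBranchingMeasure`), and Fatou's lemma bounds its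
total mass in the mean (`rayLaw_univ_lt_top`).

On the cone beyond an edge from `a` to `b` the branching measure seen from `a` is `1/m` times the
one seen from `b` (`bray_restrict`). Combined with reversibility, this says that the boundary
extension is multiplied by `m` when each ray is prolonged backwards in all possible ways
(`ShiftInvariant`). A move of the root in a horospheric product shortens the ray in one tree and
prolongs it in the other (`lintegral_nbr_hpClass`). Since both trees have the same factor `m`, the
two kinds of moves balance, and the image measure is reversible (`reversible_hpClass`).

It remains to distinguish the vertices of the product. The number of walks of length `L + 1` from
the progenitor of a random tree depends on the offspring number of the individual `0…0` of
generation `L`, whereas walks of that length started outside the tree end before they can leave this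
individual. As the offspring law is not a point mass, equality for all `L` has probability zero
(`ae_exists_wcount_ne`). Applied to walks in the product (`ae_not_twin`, once for each factor), this
distinguishes the root, and reversibility of the image measure then distinguishes all vertices. -/

theorem dist_map_le {G : SimpleGraph V} {G' : SimpleGraph V'} (f : G →g G') {a b : V}
    (h : G.Reachable a b) : G'.dist (f a) (f b) ≤ G.dist a b := by
  obtain ⟨p, hp⟩ := h.exists_walk_length_eq_dist
  calc G'.dist (f a) (f b) ≤ (p.map f).length := SimpleGraph.dist_le _
    _ = G.dist a b := by rw [SimpleGraph.Walk.length_map, hp]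

theorem dist_iso {G : SimpleGraph V} {G' : SimpleGraph V'} (hG : G.Connected) (e : G ≃g G')
    (a b : V) : G'.dist (e a) (e b) = G.dist a b := by
  refine le_antisymm (dist_map_le e.toHom (hG a b)) ?_
  have h := dist_map_le e.symm.toHom ((hG a b).map e.toHom)
  simpa using h

theorem iso_neighborSet_finite {G : SimpleGraph V} {G' : SimpleGraph V'} (e : G ≃g G')
    (h : ∀ v, (G.neighborSet v).Finite) (v : V') : (G'.neighborSet v).Finite := by
  refine ((h (e.symm v)).image e).subset fun w hw => ⟨e.symm w, ?_, e.apply_symm_apply w⟩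
  exact e.symm.map_rel_iff.2 hw

theorem IsInfiniteLocallyFiniteConnected.congr {G : SimpleGraph V} {G' : SimpleGraph V'}
    (e : G ≃g G') (h : IsInfiniteLocallyFiniteConnected G) :
    IsInfiniteLocallyFiniteConnected G' :=
  ⟨e.toEquiv.infinite_iff.1 h.1, (SimpleGraph.Iso.connected_iff e).1 h.2.1,
    iso_neighborSet_finite e h.2.2⟩

theorem RootedGraph.nice (g : RootedGraph) : IsInfiniteLocallyFiniteConnected g.graph :=
  ⟨inferInstance, g.connected, g.locallyFinite⟩

theorem RootedGraph.toClass_eq_iff {g h : RootedGraph} :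
    g.toClass = h.toClass ↔ ∃ e : g.graph ≃g h.graph, e g.root = h.root :=
  Quotient.eq (r := rootedSetoid)

theorem exists_rootedGraph_iso [Countable V] {G : SimpleGraph V}
    (hG : IsInfiniteLocallyFiniteConnected G) (o : V) :
    ∃ (g : RootedGraph) (e : G ≃g g.graph), e o = g.root := by
  have := hG.1
  obtain ⟨f⟩ : Nonempty (V ≃ ℕ) := nonempty_equiv_of_countable
  let e : G ≃g G.map f.toEmbedding := SimpleGraph.Iso.map f G
  have h := hG.congr e
  exact ⟨⟨G.map f.toEmbedding, f o, h.2.1, h.2.2⟩, e, rfl⟩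

theorem classOf_isClassOf [Countable V] {G : SimpleGraph V}
    (hG : IsInfiniteLocallyFiniteConnected G) (o : V) : (classOf G o).IsClassOf G o := by
  obtain ⟨g, e, he⟩ := exists_rootedGraph_iso hG o
  have h : ∃ Γ : GraphSpace, Γ.IsClassOf G o := ⟨g.toClass, g, rfl, e, he⟩
  rw [classOf, dif_pos h]
  exact h.choose_spec

theorem IsClassOf_unique {G : SimpleGraph V} {G' : SimpleGraph V'} {o : V} {o' : V'}
    {Γ Γ' : GraphSpace} (h : Γ.IsClassOf G o) (h' : Γ'.IsClassOf G' o') :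
    Γ = Γ' ↔ ∃ e : G ≃g G', e o = o' := by
  obtain ⟨g, rfl, e, he⟩ := h
  obtain ⟨g', rfl, e', he'⟩ := h'
  rw [RootedGraph.toClass_eq_iff]
  constructor
  · rintro ⟨f, hf⟩
    exact ⟨(e.trans f).trans e'.symm, by simp [he, hf, ← he']⟩
  · rintro ⟨f, hf⟩
    exact ⟨(e.symm.trans f).trans e', by simp [← he, hf, ← he']⟩

theorem classOf_eq_iff [Countable V] [Countable V'] {G : SimpleGraph V} {G' : SimpleGraph V'}
    (hG : IsInfiniteLocallyFiniteConnected G) (hG' : IsInfiniteLocallyFiniteConnected G')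
    {o : V} {o' : V'} : classOf G o = classOf G' o' ↔ ∃ e : G ≃g G', e o = o' :=
  IsClassOf_unique (classOf_isClassOf hG o) (classOf_isClassOf hG' o')

theorem classOf_congr [Countable V] {G : SimpleGraph V} {G' : SimpleGraph V'}
    (hG : IsInfiniteLocallyFiniteConnected G) (e : G ≃g G') {o : V} {o' : V'} (h : e o = o') :
    classOf G o = classOf G' o' :=
  have : Countable V' := e.toEquiv.symm.injective.countable
  (classOf_eq_iff hG (hG.congr e)).2 ⟨e, h⟩

/-- The class of a labelled graph rooted at `v`. -/
def RootedGraph.clAt (g : RootedGraph) (v : ℕ) : GraphSpace := (g.reroot v).toClass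

@[simp] theorem RootedGraph.clAt_root (g : RootedGraph) : g.clAt g.root = g.toClass := rfl

theorem RootedGraph.clAt_eq_iff {g h : RootedGraph} {v w : ℕ} :
    g.clAt v = h.clAt w ↔ ∃ e : g.graph ≃g h.graph, e v = w :=
  RootedGraph.toClass_eq_iff

theorem classOf_graph (g : RootedGraph) (v : ℕ) : classOf g.graph v = g.clAt v :=
  (IsClassOf_unique (classOf_isClassOf g.nice v)
    ⟨g.reroot v, rfl, RelIso.refl _, rfl⟩).2 ⟨RelIso.refl _, rfl⟩

theorem classOf_eq_clAt [Countable V] {G : SimpleGraph V} {g : RootedGraph} (e : G ≃g g.graph)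
    (v : V) : classOf G v = g.clAt (e v) := by
  rw [← classOf_graph]
  exact classOf_congr (g.nice.congr e.symm) e rfl

theorem exists_rep (Γ : GraphSpace) : ∃ g : RootedGraph, g.toClass = Γ := Quotient.exists_rep Γ

end Classes

/-! ### Balls -/

section Balls

variable {V V' V'' : Type*}

theorem ball_finite {G : SimpleGraph V} (hG : G.Connected) (hf : ∀ v, (G.neighborSet v).Finite)
    (o : V) (r : ℕ) : {v | G.dist o v ≤ r}.Finite := by
  induction r with
  | zero =>
    refine (Set.finite_singleton o).subset fun v hv => ?_
    have : G.dist o v = 0 := by simpa using hv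
    exact (hG.dist_eq_zero_iff.1 this).symm
  | succ r ih =>
    refine ((ih.biUnion fun v _ => hf v).union ih).subset fun v hv => ?_
    by_cases h : G.dist o v ≤ r
    · exact Or.inr h
    left
    obtain ⟨p, hp⟩ := hG.exists_walk_length_eq_dist v o
    cases p with
    | nil => simp at h
    | @cons _ w _ hadj q =>
      refine Set.mem_biUnion (x := w) ?_ hadj.symm
      have h1 : G.dist w o ≤ q.length := SimpleGraph.dist_le q
      have h2 : G.dist o v ≤ r + 1 := hv
      rw [SimpleGraph.dist_comm] at h2
      simp only [SimpleGraph.Walk.length_cons] at hp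
      change G.dist o w ≤ r
      rw [SimpleGraph.dist_comm]
      omega

/-- Two mutually inverse maps which identify the `r`-balls around the roots. -/
structure BallMaps (r : ℕ) (G : SimpleGraph V) (o : V) (G' : SimpleGraph V') (o' : V')
    (f : V → V') (f' : V' → V) : Prop where
  root : f o = o'
  mem : ∀ v, G.dist o v ≤ r → G'.dist o' (f v) ≤ r ∧ f' (f v) = v
  mem' : ∀ w, G'.dist o' w ≤ r → G.dist o (f' w) ≤ r ∧ f (f' w) = w
  adj : ∀ u v, G.dist o u ≤ r → G.dist o v ≤ r → (G'.Adj (f u) (f v) ↔ G.Adj u v)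

theorem BallMaps.symm {r : ℕ} {G : SimpleGraph V} {o : V} {G' : SimpleGraph V'} {o' : V'}
    {f : V → V'} {f' : V' → V} (h : BallMaps r G o G' o' f f') : BallMaps r G' o' G o f' f where
  root := by rw [← h.root]; exact (h.mem o (by simp)).2
  mem := h.mem'
  mem' := h.mem
  adj u v hu hv := by
    rw [← h.adj _ _ (h.mem' u hu).1 (h.mem' v hv).1, (h.mem' u hu).2, (h.mem' v hv).2]

theorem BallMaps.trans {r : ℕ} {G : SimpleGraph V} {o : V} {G' : SimpleGraph V'} {o' : V'}
    {G'' : SimpleGraph V''} {o'' : V''}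
    {f : V → V'} {f' : V' → V} {k : V' → V''} {k' : V'' → V'} (h : BallMaps r G o G' o' f f')
    (hk : BallMaps r G' o' G'' o'' k k') : BallMaps r G o G'' o'' (k ∘ f) (f' ∘ k') where
  root := by simp [h.root, hk.root]
  mem v hv := ⟨(hk.mem _ (h.mem v hv).1).1, by
    simp [(hk.mem _ (h.mem v hv).1).2, (h.mem v hv).2]⟩
  mem' v hv := ⟨(h.mem' _ (hk.mem' v hv).1).1, by
    simp [(h.mem' _ (hk.mem' v hv).1).2, (hk.mem' v hv).2]⟩
  adj u v hu hv := by
    simp only [Function.comp]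
    rw [hk.adj _ _ (h.mem u hu).1 (h.mem v hv).1, h.adj _ _ hu hv]

theorem BallMaps.of_iso {G : SimpleGraph V} (hG : G.Connected) {o : V} {G' : SimpleGraph V'}
    {o' : V'} (e : G ≃g G') (he : e o = o') (r : ℕ) : BallMaps r G o G' o' e e.symm where
  root := he
  mem v hv := ⟨by rw [← he, dist_iso hG]; exact hv, e.symm_apply_apply v⟩
  mem' w hw := ⟨by
    rw [← dist_iso hG e, he, e.apply_symm_apply]; exact hw, e.apply_symm_apply w⟩
  adj u v _ _ := e.map_rel_iff

/-- Only adjacency inside the ball is preserved, so distances need an argument: a geodesic from `v`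
to the root stays in the ball, and its image is a walk of the same length. -/
theorem BallMaps.dist_le {r : ℕ} {G : SimpleGraph V} (hG : G.Connected) {o : V}
    {G' : SimpleGraph V'} {o' : V'}
    {f : V → V'} {f' : V' → V} (h : BallMaps r G o G' o' f f') {v : V} (hv : G.dist o v ≤ r) :
    G'.dist o' (f v) ≤ G.dist o v := by
  have key : ∀ (n : ℕ) (v : V), G.dist o v = n → n ≤ r → ∃ p : G'.Walk (f v) o', p.length = n := by
    intro n
    induction n with
    | zero =>
      intro v hv _
      obtain rfl := hG.dist_eq_zero_iff.1 hv
      rw [h.root]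
      exact ⟨SimpleGraph.Walk.nil, rfl⟩
    | succ n ih =>
      intro v hv hn
      obtain ⟨p, hp⟩ := hG.exists_walk_length_eq_dist v o
      rw [SimpleGraph.dist_comm, hv] at hp
      cases p with
      | nil => simp at hp
      | @cons _ w _ hadj q =>
        simp only [SimpleGraph.Walk.length_cons, Nat.add_right_cancel_iff] at hp
        have h1 : G.dist w o ≤ n := hp ▸ SimpleGraph.dist_le q
        have h2 : G.dist o v ≤ G.dist o w + G.dist w v := hG.dist_triangle
        rw [SimpleGraph.dist_eq_one_iff_adj.2 hadj.symm] at h2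
        rw [SimpleGraph.dist_comm] at h1
        obtain ⟨p', hp'⟩ := ih w (by omega) (by omega)
        exact ⟨SimpleGraph.Walk.cons ((h.adj v w (by omega) (by omega)).2 hadj) p', by simp [hp']⟩
  obtain ⟨p, hp⟩ := key _ v rfl hv
  rw [SimpleGraph.dist_comm, ← hp]
  exact SimpleGraph.dist_le p

/-- Total maps on `ℕ` replace isomorphisms of induced subgraphs, since they can be composed and
passed to a limit as the radius varies. -/
theorem sameBall_iff {g h : RootedGraph} {r : ℕ} :
    GraphSpace.SameBall r g.toClass h.toClass ↔
      ∃ f f' : ℕ → ℕ, BallMaps r g.graph g.root h.graph h.root f f' := by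
  classical
  constructor
  · rintro ⟨g1, h1, hg, hh, e, he⟩
    obtain ⟨i, hi⟩ := RootedGraph.toClass_eq_iff.1 hg
    obtain ⟨j, hj⟩ := RootedGraph.toClass_eq_iff.1 hh
    -- The value `0` outside the balls is never inspected by `BallMaps`.
    have key : BallMaps r g1.graph g1.root h1.graph h1.root
        (fun v => if hv : g1.graph.dist g1.root v ≤ r then (e ⟨v, hv⟩).1 else 0)
        (fun w => if hw : h1.graph.dist h1.root w ≤ r then (e.symm ⟨w, hw⟩).1 else 0) := by
      refine ⟨?_, ?_, ?_, ?_⟩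
      · rw [dif_pos (by simp)]; exact he _ rfl
      · intro v hv
        have h3 : h1.graph.dist h1.root (e ⟨v, hv⟩).1 ≤ r := (e ⟨v, hv⟩).2
        simp only [dif_pos hv]
        refine ⟨h3, ?_⟩
        rw [dif_pos h3]
        simp
      · intro w hw
        have h3 : g1.graph.dist g1.root (e.symm ⟨w, hw⟩).1 ≤ r := (e.symm ⟨w, hw⟩).2
        simp only [dif_pos hw]
        refine ⟨h3, ?_⟩
        rw [dif_pos h3]
        simp
      · intro u v hu hv
        simp only [dif_pos hu, dif_pos hv]
        exact e.map_rel_iff (a := ⟨u, hu⟩) (b := ⟨v, hv⟩)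
    exact ⟨_, _, ((BallMaps.of_iso g1.connected i hi r).symm.trans key).trans
      (BallMaps.of_iso h1.connected j hj r)⟩
  · rintro ⟨f, f', hf⟩
    refine ⟨g, h, rfl, rfl, ⟨⟨fun v => ⟨f v.1, (hf.mem v.1 v.2).1⟩,
      fun w => ⟨f' w.1, (hf.mem' w.1 w.2).1⟩, fun v => Subtype.ext (hf.mem v.1 v.2).2,
      fun v => Subtype.ext (hf.mem' v.1 v.2).2⟩, ?_⟩, ?_⟩
    · intro u v
      exact hf.adj u.1 v.1 u.2 v.2
    · rintro ⟨v, hv⟩ rfl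
      exact hf.root

theorem sameBall_refl (r : ℕ) (Γ : GraphSpace) : GraphSpace.SameBall r Γ Γ := by
  obtain ⟨g, rfl⟩ := exists_rep Γ
  exact sameBall_iff.2 ⟨_, _, BallMaps.of_iso g.connected (RelIso.refl _) rfl r⟩

/-- A class is determined by its balls. -/
theorem eq_of_sameBall {Γ Γ' : GraphSpace} (h : ∀ r, GraphSpace.SameBall r Γ Γ') : Γ = Γ' := by
  obtain ⟨g, rfl⟩ := exists_rep Γ
  obtain ⟨g', rfl⟩ := exists_rep Γ'
  choose f f' hf using fun r => sameBall_iff.1 (h r)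
  -- A compactness argument: for large `r` the point `f r v` lies in a fixed finite ball, so the
  -- isomorphisms of balls converge pointwise along a nonprincipal ultrafilter. Every property
  -- required of the limit involves finitely many vertices at a time and is inherited.
  let U : Ultrafilter ℕ := hyperfilter ℕ
  have hU : ∀ n : ℕ, ∀ᶠ r in (U : Filter ℕ), n ≤ r := fun n =>
    (Filter.eventually_ge_atTop n).filter_mono (by
      rw [← Nat.cofinite_eq_atTop]; exact hyperfilter_le_cofinite)
  have aux : ∀ (g g' : RootedGraph) (f f' : ℕ → ℕ → ℕ),
      (∀ r, BallMaps r g.graph g.root g'.graph g'.root (f r) (f' r)) →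
      ∀ v, ∃ w, ∀ᶠ r in (U : Filter ℕ), f r v = w := by
    intro g g' f f' hf v
    have hfin := ball_finite g'.connected g'.locallyFinite g'.root (g.graph.dist g.root v)
    have : ∀ᶠ r in (U : Filter ℕ),
        ∃ w ∈ {w | g'.graph.dist g'.root w ≤ g.graph.dist g.root v}, f r v = w := by
      filter_upwards [hU (g.graph.dist g.root v)] with r hr
      exact ⟨f r v, (hf r).dist_le g.connected hr, rfl⟩
    obtain ⟨w, -, hw⟩ := (Ultrafilter.eventually_exists_mem_iff hfin).1 this
    exact ⟨w, hw⟩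
  choose e he using aux g g' f f' hf
  choose e' he' using aux g' g f' f (fun r => (hf r).symm)
  refine RootedGraph.toClass_eq_iff.2 ⟨⟨⟨e, e', fun v => ?_, fun w => ?_⟩, ?_⟩, ?_⟩
  · obtain ⟨r, h1, h2, h3⟩ := ((he v).and ((he' (e v)).and (hU (g.graph.dist g.root v)))).exists
    rw [← h2, ← h1]
    exact ((hf r).mem v h3).2
  · obtain ⟨r, h1, h2, h3⟩ := ((he' w).and ((he (e' w)).and (hU (g'.graph.dist g'.root w)))).exists
    rw [← h2, ← h1]
    exact ((hf r).mem' w h3).2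
  · intro u v
    obtain ⟨r, h1, h2, h3, h4⟩ := ((he u).and ((he v).and
      ((hU (g.graph.dist g.root u)).and (hU (g.graph.dist g.root v))))).exists
    change g'.graph.Adj (e u) (e v) ↔ _
    rw [← h1, ← h2]
    exact (hf r).adj u v h3 h4
  · obtain ⟨r, h1⟩ := (he g.root).exists
    change e g.root = g'.root
    rw [← h1]
    exact (hf r).root

end Balls
end HorosphericGW

namespace HorosphericGW

/-! ### The Borel structure of the space of rooted graphs -/

section Codes

variable {V : Type*}

/-- Codes of finite rooted graphs. -/
abbrev BallCode : Type := Σ n : ℕ, SimpleGraph (Fin n) × Fin n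

/-- `c` is a code of the `r`-ball of `(G, o)`, the ball being given by a predicate. -/
def HasCode (c : BallCode) (A : V → V → Prop) (o : V) (R : V → Prop) : Prop :=
  ∃ f : Fin c.1 → V, Function.Injective f ∧ f c.2.2 = o ∧
    (∀ i j, A (f i) (f j) ↔ c.2.1.Adj i j) ∧ ∀ v, (∃ i, f i = v) ↔ R v

theorem exists_hasCode {G : SimpleGraph V} (hG : G.Connected)
    (hf : ∀ v, (G.neighborSet v).Finite) (o : V) (r : ℕ) :
    ∃ c, HasCode c G.Adj o (fun v => G.dist o v ≤ r) := by
  obtain ⟨n, ⟨e⟩⟩ := (ball_finite hG hf o r).to_subtype.exists_equiv_fin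
  refine ⟨⟨n, G.comap (fun i => (e.symm i).1), e ⟨o, by simp⟩⟩, fun i => (e.symm i).1,
    fun i j h => e.symm.injective (Subtype.ext h), by simp, fun i j => Iff.rfl, fun v => ?_⟩
  constructor
  · rintro ⟨i, rfl⟩
    exact (e.symm i).2
  · intro h
    exact ⟨e ⟨v, h⟩, by simp⟩

theorem HasCode.ballMaps {V' : Type*} [Nonempty V] [Nonempty V'] {G : SimpleGraph V}
    {G' : SimpleGraph V'} {o : V} {o' : V'} {r : ℕ} {c : BallCode}
    (h : HasCode c G.Adj o (fun v => G.dist o v ≤ r))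
    (h' : HasCode c G'.Adj o' (fun v => G'.dist o' v ≤ r)) :
    ∃ f f', BallMaps r G o G' o' f f' := by
  obtain ⟨f, hf, hfo, hfA, hfR⟩ := h
  obtain ⟨k, hk, hko, hkA, hkR⟩ := h'
  have hne : Nonempty (Fin c.1) := ⟨c.2.2⟩
  have h1 := Function.leftInverse_invFun hf
  have h2 := Function.leftInverse_invFun hk
  refine ⟨k ∘ Function.invFun f, f ∘ Function.invFun k, ?_, ?_, ?_, ?_⟩
  · simp [← hfo, h1 c.2.2, hko]
  · intro v hv
    obtain ⟨i, rfl⟩ := (hfR v).2 hv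
    simp only [Function.comp, h1 i, h2 i]
    exact ⟨(hkR _).1 ⟨i, rfl⟩, trivial⟩
  · intro v hv
    obtain ⟨i, rfl⟩ := (hkR v).2 hv
    simp only [Function.comp, h1 i, h2 i]
    exact ⟨(hfR _).1 ⟨i, rfl⟩, trivial⟩
  · intro u v hu hv
    obtain ⟨i, rfl⟩ := (hfR u).2 hu
    obtain ⟨j, rfl⟩ := (hfR v).2 hv
    simp only [Function.comp, h1 i, h1 j]
    rw [hkA, hfA]

theorem BallMaps.hasCode {V' : Type*} {G : SimpleGraph V} {G' : SimpleGraph V'} {o : V} {o' : V'}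
    {r : ℕ} {f : V → V'} {f' : V' → V} (hf : BallMaps r G o G' o' f f') {c : BallCode}
    (h : HasCode c G.Adj o (fun v => G.dist o v ≤ r)) :
    HasCode c G'.Adj o' (fun v => G'.dist o' v ≤ r) := by
  obtain ⟨k, hk, hko, hkA, hkR⟩ := h
  have hb : ∀ i, G.dist o (k i) ≤ r := fun i => (hkR _).1 ⟨i, rfl⟩
  refine ⟨f ∘ k, ?_, by simp [hko, hf.root], fun i j => ?_, fun v => ?_⟩
  · intro i j hij
    apply hk
    rw [← (hf.mem _ (hb i)).2, ← (hf.mem _ (hb j)).2]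
    exact congrArg f' hij
  · rw [← hkA, Function.comp, Function.comp, hf.adj _ _ (hb i) (hb j)]
  · constructor
    · rintro ⟨i, rfl⟩
      exact (hf.mem _ (hb i)).1
    · intro hv
      obtain ⟨i, hi⟩ := (hkR _).2 (hf.mem' v hv).1
      exact ⟨i, by simp [hi, (hf.mem' v hv).2]⟩

/-- `c` is a code of the `r`-ball of `Γ`. -/
def GraphSpace.Code (r : ℕ) (c : BallCode) (Γ : GraphSpace) : Prop :=
  ∃ g : RootedGraph, g.toClass = Γ ∧
    HasCode c g.graph.Adj g.root (fun v => g.graph.dist g.root v ≤ r)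

theorem code_iff_of_isClassOf {G : SimpleGraph V} {o : V} {Γ : GraphSpace} (h : Γ.IsClassOf G o)
    {r : ℕ} {c : BallCode} :
    Γ.Code r c ↔ HasCode c G.Adj o (fun v => G.dist o v ≤ r) := by
  obtain ⟨g, rfl, e, he⟩ := h
  constructor
  · rintro ⟨g', hg', hc⟩
    obtain ⟨i, hi⟩ := RootedGraph.toClass_eq_iff.1 hg'
    exact (BallMaps.of_iso g'.connected (i.trans e.symm) (by simp [hi, ← he]) r).hasCode hc
  · intro hc
    exact ⟨g, rfl, (BallMaps.of_iso ((SimpleGraph.Iso.connected_iff e).2 g.connected)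
      e he r).hasCode hc⟩

theorem exists_code (r : ℕ) (Γ : GraphSpace) : ∃ c, Γ.Code r c := by
  obtain ⟨g, rfl⟩ := exists_rep Γ
  obtain ⟨c, hc⟩ := exists_hasCode g.connected g.locallyFinite g.root r
  exact ⟨c, g, rfl, hc⟩

/-- Codes form a countable set. This gives a countable subbasis, and it reduces measurability of
maps into `GraphSpace` to the sets defined by `GraphSpace.Code`. -/
theorem setOf_sameBall {r : ℕ} {Γ : GraphSpace} {c : BallCode} (h : Γ.Code r c) :
    {Γ' | GraphSpace.SameBall r Γ Γ'} = {Γ' | GraphSpace.Code r c Γ'} := by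
  obtain ⟨g, rfl, hg⟩ := h
  ext Γ'
  obtain ⟨g', rfl⟩ := exists_rep Γ'
  constructor
  · intro h
    obtain ⟨f, f', hf⟩ := sameBall_iff.1 h
    exact ⟨g', rfl, hf.hasCode hg⟩
  · intro h
    have := (code_iff_of_isClassOf (Γ := g'.toClass) ⟨g', rfl, RelIso.refl _, rfl⟩).1 h
    exact sameBall_iff.2 (hg.ballMaps this)

theorem countable_basis :
    {U : Set GraphSpace | ∃ (r : ℕ) (Γ : GraphSpace), U = {Γ' | GraphSpace.SameBall r Γ Γ'}}.Countable := by
  have : Countable BallCode := inferInstance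
  refine (Set.countable_range fun p : ℕ × BallCode => {Γ' | GraphSpace.Code p.1 p.2 Γ'}).mono ?_
  rintro U ⟨r, Γ, rfl⟩
  obtain ⟨c, hc⟩ := exists_code r Γ
  exact ⟨(r, c), (setOf_sameBall hc).symm⟩

instance : SecondCountableTopology GraphSpace := ⟨⟨_, countable_basis, rfl⟩⟩

/-- Together with second countability this makes `GraphSpace` countably separated, as is required of
the target of a measurable surjection from a standard Borel space. -/
instance : T0Space GraphSpace := by
  refine ⟨fun Γ Γ' h => eq_of_sameBall fun r => ?_⟩
  have ho : IsOpen {Γ'' | GraphSpace.SameBall r Γ Γ''} :=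
    TopologicalSpace.isOpen_generateFrom_of_mem ⟨r, Γ, rfl⟩
  exact (h.mem_open_iff ho).1 (sameBall_refl r Γ)

theorem measurable_graphSpace {α : Type*} [MeasurableSpace α] {f : α → GraphSpace}
    (h : ∀ r c, MeasurableSet {a | (f a).Code r c}) : Measurable f := by
  have : borel GraphSpace = MeasurableSpace.generateFrom
      {U : Set GraphSpace | ∃ (r : ℕ) (Γ : GraphSpace), U = {Γ' | GraphSpace.SameBall r Γ Γ'}} :=
    borel_eq_generateFrom_of_subbasis rfl
  rw [BorelSpace.measurable_eq (α := GraphSpace), this]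
  refine measurable_generateFrom ?_
  rintro U ⟨r, Γ, rfl⟩
  obtain ⟨c, hc⟩ := exists_code r Γ
  rw [setOf_sameBall hc]
  exact h r c

/-- Reachability in at most `r` steps. -/
def ReachIn (A : V → V → Prop) (o : V) : ℕ → V → Prop
  | 0, v => v = o
  | r + 1, v => ReachIn A o r v ∨ ∃ u, ReachIn A o r u ∧ A u v

theorem exists_adj_dist {G : SimpleGraph V} (hG : G.Connected) {o v : V} {n : ℕ}
    (h : G.dist o v = n + 1) : ∃ u, G.Adj u v ∧ G.dist o u = n := by
  obtain ⟨p, hp⟩ := hG.exists_walk_length_eq_dist v o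
  rw [SimpleGraph.dist_comm, h] at hp
  cases p with
  | nil => simp at hp
  | @cons _ w _ hadj q =>
    simp only [SimpleGraph.Walk.length_cons, Nat.add_right_cancel_iff] at hp
    refine ⟨w, hadj.symm, ?_⟩
    have h1 : G.dist w o ≤ n := hp ▸ SimpleGraph.dist_le q
    have h2 : G.dist o v ≤ G.dist o w + G.dist w v := hG.dist_triangle
    rw [SimpleGraph.dist_eq_one_iff_adj.2 hadj.symm] at h2
    rw [SimpleGraph.dist_comm] at h1
    omega

theorem reachIn_iff {G : SimpleGraph V} (hG : G.Connected) (o : V) (r : ℕ) (v : V) :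
    ReachIn G.Adj o r v ↔ G.dist o v ≤ r := by
  induction r generalizing v with
  | zero => simp [ReachIn, hG.dist_eq_zero_iff, eq_comm]
  | succ r ih =>
    simp only [ReachIn, ih]
    constructor
    · rintro (h | ⟨u, hu, huv⟩)
      · omega
      · have h2 : G.dist o v ≤ G.dist o u + G.dist u v := hG.dist_triangle
        rw [SimpleGraph.dist_eq_one_iff_adj.2 huv] at h2
        omega
    · intro h
      rcases Nat.lt_or_ge r (G.dist o v) with h1 | h1
      · obtain ⟨u, hu, hd⟩ := exists_adj_dist hG (show G.dist o v = r + 1 by omega)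
        exact Or.inr ⟨u, hd.le, hu⟩
      · exact Or.inl h1

/-- Random graphs have vertex sets that depend on the parameter. They are embedded by `ι` into one
countable set of labels, where all quantifiers over vertices become countable and independent of the
parameter. -/
theorem reachIn_map {V' : Type*} {A : V → V → Prop} {A' : V' → V' → Prop} {ι : V → V'} {o : V}
    (hA : ∀ u v, A' u v ↔ ∃ a b, ι a = u ∧ ι b = v ∧ A a b) (hι : Function.Injective ι)
    (r : ℕ) (w : V') : ReachIn A' (ι o) r w ↔ ∃ v, ι v = w ∧ ReachIn A o r v := by
  induction r generalizing w with
  | zero => simp [ReachIn, eq_comm]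
  | succ r ih =>
    simp only [ReachIn, ih]
    constructor
    · rintro (⟨v, h, h'⟩ | ⟨u, ⟨v, rfl, h⟩, h'⟩)
      · exact ⟨v, h, Or.inl h'⟩
      · obtain ⟨a, b, ha, rfl, hab⟩ := (hA _ _).1 h'
        exact ⟨b, rfl, Or.inr ⟨a, by rwa [hι ha], hab⟩⟩
    · rintro ⟨v, rfl, h | ⟨u, h, h'⟩⟩
      · exact Or.inl ⟨v, rfl, h⟩
      · exact Or.inr ⟨ι u, ⟨u, rfl, h⟩, (hA _ _).2 ⟨u, v, rfl, rfl, h'⟩⟩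

end Codes

/-! ### Measurability of the class of a random rooted graph -/

section Family

variable {α : Type*} [MeasurableSpace α] {V : Type*} [Countable V]

theorem measurable_reachIn {A : α → V → V → Prop} {o : α → V}
    (hA : ∀ u v, Measurable fun a => A a u v) (ho : ∀ v, Measurable fun a => o a = v) (r : ℕ)
    (v : V) : Measurable fun a => ReachIn (A a) (o a) r v := by
  induction r generalizing v with
  | zero =>
    simp only [ReachIn]
    simpa [eq_comm] using ho v
  | succ r ih =>
    simp only [ReachIn]
    exact (ih v).or (Measurable.exists fun u => (ih u).and (hA u v))

theorem measurable_hasCode {A : α → V → V → Prop} {o : α → V} {R : α → V → Prop}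
    (hA : ∀ u v, Measurable fun a => A a u v) (ho : ∀ v, Measurable fun a => o a = v)
    (hR : ∀ v, Measurable fun a => R a v) (c : BallCode) :
    Measurable fun a => HasCode c (A a) (o a) (R a) := by
  refine Measurable.exists fun f => Measurable.and measurable_const (Measurable.and ?_
    (Measurable.and ?_ ?_))
  · simpa [eq_comm] using ho (f c.2.2)
  · exact Measurable.forall fun i => Measurable.forall fun j => (hA _ _).iff measurable_const
  · exact Measurable.forall fun v => measurable_const.iff (hR v)

theorem hasCode_map {W V : Type*} {ι : W → V} (hι : Function.Injective ι) {A : W → W → Prop} {o : W}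
    {R : W → Prop} {A' : V → V → Prop} {R' : V → Prop}
    (hA : ∀ u v, A' u v ↔ ∃ a b, ι a = u ∧ ι b = v ∧ A a b)
    (hR : ∀ w, R' w ↔ ∃ v, ι v = w ∧ R v) (c : BallCode) :
    HasCode c A' (ι o) R' ↔ HasCode c A o R := by
  have hA' : ∀ a b, A' (ι a) (ι b) ↔ A a b := fun a b => (hA _ _).trans
    ⟨fun ⟨x, y, hx, hy, h⟩ => by rwa [← hι hx, ← hι hy], fun h => ⟨a, b, rfl, rfl, h⟩⟩
  constructor
  · rintro ⟨f, hf, hfo, hfA, hfR⟩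
    have : ∀ i, ∃ v, ι v = f i := fun i => by
      obtain ⟨v, hv, -⟩ := (hR _).1 ((hfR (f i)).1 ⟨i, rfl⟩)
      exact ⟨v, hv⟩
    choose k hk using this
    refine ⟨k, fun i j h => hf (by rw [← hk, ← hk, h]), hι (by rw [hk, hfo]), fun i j => ?_,
      fun v => ?_⟩
    · rw [← hA', hk, hk, hfA]
    · constructor
      · rintro ⟨i, rfl⟩
        obtain ⟨v, hv, h⟩ := (hR _).1 ((hfR (f i)).1 ⟨i, rfl⟩)
        rw [← hk] at hv
        rwa [← hι hv]
      · intro h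
        obtain ⟨i, hi⟩ := (hfR (ι v)).2 ((hR _).2 ⟨v, rfl, h⟩)
        exact ⟨i, hι (by rw [hk, hi])⟩
  · rintro ⟨f, hf, hfo, hfA, hfR⟩
    refine ⟨ι ∘ f, hι.comp hf, by simp [hfo], fun i j => by rw [← hfA]; exact hA' _ _, fun w => ?_⟩
    rw [hR]
    constructor
    · rintro ⟨i, rfl⟩
      exact ⟨f i, rfl, (hfR _).1 ⟨i, rfl⟩⟩
    · rintro ⟨v, rfl, h⟩
      obtain ⟨i, rfl⟩ := (hfR v).2 h
      exact ⟨i, rfl⟩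

/-- The class of a random rooted graph depends measurably on the parameter. -/
theorem measurable_classOf {W : α → Type*} {G : ∀ a, SimpleGraph (W a)} {o : ∀ a, W a}
    {ι : ∀ a, W a → V} (hι : ∀ a, Function.Injective (ι a))
    (hG : ∀ a, IsInfiniteLocallyFiniteConnected (G a))
    (hA : ∀ u v, Measurable fun a => ∃ x y, ι a x = u ∧ ι a y = v ∧ (G a).Adj x y)
    (ho : ∀ v, Measurable fun a => ι a (o a) = v) :
    Measurable fun a => classOf (G a) (o a) := by
  refine measurable_graphSpace fun r c => ?_
  -- The condition is moved from the varying vertex set `W a` to the fixed set `V`, with distances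
  -- expressed by `ReachIn`.
  have h : ∀ a, (classOf (G a) (o a)).Code r c ↔
      HasCode c (fun u v => ∃ x y, ι a x = u ∧ ι a y = v ∧ (G a).Adj x y) (ι a (o a))
        (ReachIn (fun u v => ∃ x y, ι a x = u ∧ ι a y = v ∧ (G a).Adj x y) (ι a (o a)) r) := by
    intro a
    have : Countable (W a) := (hι a).countable
    rw [code_iff_of_isClassOf (classOf_isClassOf (hG a) (o a)),
      hasCode_map (hι a) (A := (G a).Adj) (R := fun v => (G a).dist (o a) v ≤ r)
        (fun _ _ => Iff.rfl)]
    intro w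
    rw [reachIn_map (A := (G a).Adj) (fun _ _ => Iff.rfl) (hι a)]
    simp only [reachIn_iff (hG a).2.1]
  simp only [h]
  exact measurableSet_setOfPred.2
    (measurable_hasCode hA ho (fun v => measurable_reachIn hA ho r v) c)

theorem aemeasurable_classOf {μ : Measure α} {W : α → Type*} {G : ∀ a, SimpleGraph (W a)}
    {o : ∀ a, W a}
    {ι : ∀ a, W a → V} (hι : ∀ a, Function.Injective (ι a))
    (hG : ∀ᵐ a ∂μ, IsInfiniteLocallyFiniteConnected (G a))
    (hA : ∀ u v, Measurable fun a => ∃ x y, ι a x = u ∧ ι a y = v ∧ (G a).Adj x y)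
    (ho : ∀ v, Measurable fun a => ι a (o a) = v) :
    AEMeasurable (fun a => classOf (G a) (o a)) μ := by
  obtain ⟨s, hs, hsm, hs0⟩ := exists_measurable_superset_of_null (ae_iff.1 hG)
  have h1 : Measurable fun a : ↥sᶜ => classOf (G a) (o a) := by
    refine measurable_classOf (ι := fun a : ↥sᶜ => ι a.1) (fun a => hι a) (fun a => ?_)
      (fun u v => (hA u v).comp measurable_subtype_coe)
      (fun v => (ho v).comp measurable_subtype_coe)
    by_contra h
    exact a.2 (hs h)
  have h2 := aemeasurable_restrict_of_measurable_subtype (μ := μ)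
    (f := fun a => classOf (G a) (o a)) hsm.compl h1
  rwa [Measure.restrict_eq_self_of_ae_mem] at h2
  exact measure_eq_zero_iff_ae_notMem.1 hs0

end Family

end HorosphericGW

namespace HorosphericGW
open ProbabilityTheory

/-! ### The standard Borel space of labelled rooted graphs -/

section Labelled

/-- The adjacency relation and the root of a labelled rooted graph. -/
def RootedGraph.enc (g : RootedGraph) : (ℕ → ℕ → Prop) × ℕ := (g.graph.Adj, g.root)

instance : MeasurableSpace RootedGraph := MeasurableSpace.comap RootedGraph.enc inferInstance

theorem RootedGraph.enc_injective : Function.Injective RootedGraph.enc := by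
  rintro ⟨G, o, h1, h2⟩ ⟨G', o', h1', h2'⟩ h
  simp only [RootedGraph.enc, Prod.mk.injEq] at h
  obtain ⟨h, rfl⟩ := h
  obtain rfl : G = G' := SimpleGraph.ext h
  rfl

theorem ReachIn.reachable {V : Type*} {G : SimpleGraph V} {o v : V} {r : ℕ}
    (h : ReachIn G.Adj o r v) : G.Reachable o v := by
  induction r generalizing v with
  | zero => rw [show v = o from h]
  | succ r ih =>
    rcases h with h | ⟨u, h, h'⟩
    · exact ih h
    · exact (ih h).trans h'.reachable

theorem RootedGraph.range_enc : Set.range RootedGraph.enc =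
    {p | (∀ u v, p.1 u v → p.1 v u) ∧ (∀ u, ¬ p.1 u u) ∧ (∀ u v, ∃ r, ReachIn p.1 u r v) ∧
      ∀ v, ∃ N, ∀ w, p.1 v w → w ≤ N} := by
  ext p
  constructor
  · rintro ⟨g, rfl⟩
    refine ⟨fun u v h => h.symm, fun u => g.graph.irrefl, fun u v => ⟨_,
      (reachIn_iff g.connected u _ v).2 le_rfl⟩, fun v => ?_⟩
    obtain ⟨N, hN⟩ := (g.locallyFinite v).bddAbove
    exact ⟨N, fun w hw => hN hw⟩
  · rintro ⟨h1, h2, h3, h4⟩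
    let G : SimpleGraph ℕ := ⟨p.1, ⟨h1⟩, ⟨h2⟩⟩
    have hG : G.Connected := by
      refine ⟨fun u v => ?_⟩
      obtain ⟨r, hr⟩ := h3 u v
      exact ReachIn.reachable (G := G) hr
    refine ⟨⟨G, p.2, hG, fun v => ?_⟩, rfl⟩
    obtain ⟨N, hN⟩ := h4 v
    exact (Set.finite_Iic N).subset hN

theorem measurable_fst_apply (u v : ℕ) :
    Measurable fun p : (ℕ → ℕ → Prop) × ℕ => p.1 u v :=
  (measurable_pi_apply v).comp ((measurable_pi_apply u).comp measurable_fst)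

/-- Symmetry, irreflexivity, connectedness and local finiteness are countable combinations of
adjacency conditions, so the encoded graphs form a Borel subset of a standard Borel space. -/
theorem RootedGraph.measurableEmbedding_enc : MeasurableEmbedding RootedGraph.enc := by
  refine MeasurableEmbedding.iff_comap_eq.2 ⟨enc_injective, rfl, ?_⟩
  rw [range_enc]
  refine measurableSet_setOfPred.2 (.and ?_ (.and ?_ (.and ?_ ?_)))
  · exact .forall fun u => .forall fun v => (measurable_fst_apply u v).imp (measurable_fst_apply v u)
  · exact .forall fun u => (measurable_fst_apply u u).not
  · exact .forall fun u => .forall fun v => .exists fun r =>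
      measurable_reachIn measurable_fst_apply (fun _ => measurable_const) r v
  · exact .forall fun v => .exists fun N => .forall fun w =>
      (measurable_fst_apply v w).imp measurable_const

theorem _root_.MeasurableEmbedding.standardBorelSpace {α β : Type*} [MeasurableSpace α]
    [MeasurableSpace β] [StandardBorelSpace β] {f : α → β} (hf : MeasurableEmbedding f) :
    StandardBorelSpace α := by
  have := hf.measurableSet_range.standardBorel
  obtain ⟨τ, h1, h2⟩ := (inferInstance : StandardBorelSpace (Set.range f)).polish
  let e := hf.equivRange
  let τ' : TopologicalSpace α := TopologicalSpace.induced e.toEquiv τ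
  have h3 : PolishSpace α := e.toEquiv.polishSpace_induced
  refine ⟨τ', ⟨?_⟩, h3⟩
  exact e.measurableEmbedding.comap_eq.symm.trans
    ((congrArg (MeasurableSpace.comap e) h1.measurable_eq).trans borel_comap.symm)

instance : StandardBorelSpace RootedGraph :=
  RootedGraph.measurableEmbedding_enc.standardBorelSpace

theorem measurable_adj (u v : ℕ) : Measurable fun g : RootedGraph => g.graph.Adj u v :=
  (measurable_fst_apply u v).comp (comap_measurable RootedGraph.enc)

theorem measurable_root : Measurable fun g : RootedGraph => g.root :=
  measurable_snd.comp (comap_measurable RootedGraph.enc)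

theorem measurable_clAt (v : ℕ) : Measurable fun g : RootedGraph => g.clAt v := by
  simp only [← classOf_graph]
  refine measurable_classOf (ι := fun _ => id) (fun _ => Function.injective_id) (fun g => g.nice)
    (fun u w => ?_) (fun w => measurable_const)
  simpa using measurable_adj u w

theorem measurable_clAt_apply {α : Type*} [MeasurableSpace α] {f : α → RootedGraph}
    {k : α → ℕ} (hf : Measurable f) (hk : Measurable k) :
    Measurable fun a => (f a).clAt (k a) := by
  have : Measurable fun p : RootedGraph × ℕ => p.1.clAt p.2 :=
    measurable_from_prod_countable_left fun n => measurable_clAt n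
  exact this.comp (hf.prodMk hk)

theorem measurable_toClass : Measurable RootedGraph.toClass :=
  measurable_clAt_apply measurable_id measurable_root

theorem toClass_surjective : Function.Surjective RootedGraph.toClass := exists_rep

instance : MeasurableSingletonClass GraphSpace :=
  MeasurableSpace.measurableSingletonClass_of_countablySeparated

/-- A function on the space of classes is measurable if its lift to labelled graphs is. -/
theorem measurable_of_toClass {β : Type*} [MeasurableSpace β] {f : GraphSpace → β}
    (h : Measurable fun g : RootedGraph => f g.toClass) : Measurable f :=
  -- A measurable surjection from a standard Borel space onto a countably separated one is a
  -- quotient map of measurable spaces. This spares any proof that `GraphSpace` itself is standard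
  -- Borel.
  (measurable_toClass.measurable_comp_iff_of_surjective toClass_surjective).1 h

theorem measurable_dist (u v : ℕ) : Measurable fun g : RootedGraph => g.graph.dist u v := by
  have h : ∀ r, Measurable fun g : RootedGraph => g.graph.dist u v ≤ r := fun r => by
    have := measurable_reachIn (A := fun g : RootedGraph => g.graph.Adj) (o := fun _ => u)
      (fun a b => measurable_adj a b) (fun _ => measurable_const) r v
    simpa only [reachIn_iff (RootedGraph.connected _)] using this
  exact measurable_of_Iic fun r => measurableSet_setOfPred.2 (h r)

end Labelled

/-! ### The neighbour kernel -/

section Nbr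

open Classical in
/-- The sum of the point masses at the classes which are obtained by moving the root to a
neighbour. -/
def nbr (Γ : GraphSpace) : Measure GraphSpace :=
  Measure.sum fun v : ℕ =>
    if Γ.out.graph.Adj Γ.out.root v then Measure.dirac (Γ.out.clAt v) else 0

open Classical in
theorem lintegral_nbr_aux (g : RootedGraph) (f : GraphSpace → ℝ≥0∞) :
    ∫⁻ y, f y ∂(Measure.sum fun v : ℕ =>
      if g.graph.Adj g.root v then Measure.dirac (g.clAt v) else 0) =
      ∑' v, if g.graph.Adj g.root v then f (g.clAt v) else 0 := by
  rw [lintegral_sum_measure]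
  refine tsum_congr fun v => ?_
  split_ifs
  · rw [lintegral_dirac]
  · rw [lintegral_zero_measure]

-- `nbr` is defined through a chosen representative; reindexing the sum by an isomorphism shows that
-- any representative may be used. The sum runs over neighbouring vertices with multiplicity, even
-- when their classes coincide, so the total mass is the degree of the root.
open Classical in
theorem lintegral_nbr (g : RootedGraph) (f : GraphSpace → ℝ≥0∞) :
    ∫⁻ y, f y ∂nbr g.toClass = ∑' v, if g.graph.Adj g.root v then f (g.clAt v) else 0 := by
  obtain ⟨e, he⟩ := RootedGraph.toClass_eq_iff.1 (Quotient.out_eq (s := rootedSetoid) g.toClass)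
  rw [nbr, lintegral_nbr_aux,
    ← e.toEquiv.tsum_eq (fun v => if g.graph.Adj g.root v then f (g.clAt v) else 0)]
  refine tsum_congr fun v => ?_
  have h1 : g.graph.Adj g.root (e v) ↔
      (Quotient.out g.toClass).graph.Adj (Quotient.out g.toClass).root v := by
    rw [← he]; exact e.map_rel_iff
  have h2 : (Quotient.out g.toClass).clAt v = g.clAt (e v) := RootedGraph.clAt_eq_iff.2 ⟨e, rfl⟩
  simp only [RelIso.coe_fn_toEquiv, h1, h2]

theorem nbr_apply (g : RootedGraph) {s : Set GraphSpace} (hs : MeasurableSet s) :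
    nbr g.toClass s = ∫⁻ y, s.indicator 1 y ∂nbr g.toClass :=
  (lintegral_indicator_one hs).symm

theorem nbr_univ_lt_top (Γ : GraphSpace) : nbr Γ Set.univ < ⊤ := by
  classical
  obtain ⟨g, rfl⟩ := exists_rep Γ
  rw [nbr_apply g .univ, lintegral_nbr]
  have hf := g.locallyFinite g.root
  rw [tsum_eq_sum (s := hf.toFinset)]
  · exact ENNReal.sum_lt_top.2 fun v _ => by split_ifs <;> simp
  · intro v hv
    rw [if_neg]
    simpa using hv

instance (Γ : GraphSpace) : IsFiniteMeasure (nbr Γ) := ⟨nbr_univ_lt_top Γ⟩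

theorem measurable_nbr : Measurable nbr := by
  classical
  refine Measure.measurable_of_measurable_coe _ fun s hs => measurable_of_toClass ?_
  simp only [nbr_apply _ hs, lintegral_nbr]
  refine Measurable.tsum fun v => ?_
  refine Measurable.ite ?_ ?_ measurable_const
  · exact measurableSet_setOfPred.2 ((measurable_from_prod_countable_right
      (f := fun p : ℕ × RootedGraph => p.2.graph.Adj p.1 v) fun n => measurable_adj n v).comp
      (measurable_root.prodMk measurable_id))
  · exact (measurable_one.indicator hs).comp (measurable_clAt v)

/-- The neighbour kernel. -/
def nbrKernel : Kernel GraphSpace GraphSpace := ⟨nbr, measurable_nbr⟩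

/-- The masses need not be uniformly bounded, so the kernel is cut into countably many finite
kernels according to the integer part of the mass. -/
theorem isSFiniteKernel_of_isFiniteMeasure {α β : Type*} [MeasurableSpace α] [MeasurableSpace β]
    (κ : Kernel α β) [∀ a, IsFiniteMeasure (κ a)] : IsSFiniteKernel κ := by
  classical
  have hA : ∀ n : ℕ, MeasurableSet {a | ⌊(κ a Set.univ).toReal⌋₊ = n} := fun n =>
    (Nat.measurable_floor.comp (κ.measurable_coe .univ).ennreal_toReal) (measurableSet_singleton n)
  have h : κ = Kernel.sum fun n => Kernel.piecewise (hA n) κ 0 := by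
    ext a s hs
    rw [Kernel.sum_apply' _ _ hs, tsum_eq_single ⌊(κ a Set.univ).toReal⌋₊]
    · simp [Kernel.piecewise_apply]
    · intro n hn
      simp [Kernel.piecewise_apply, hn.symm]
  have hfin : ∀ n, IsFiniteKernel (Kernel.piecewise (hA n) κ 0) := by
    refine fun n => ⟨⟨ENNReal.ofReal (n + 1), ENNReal.ofReal_lt_top, fun a => ?_⟩⟩
    rw [Kernel.piecewise_apply]
    split_ifs with ha
    · have ha' : ⌊(κ a Set.univ).toReal⌋₊ = n := ha
      rw [← ENNReal.ofReal_toReal (measure_ne_top (κ a) Set.univ)]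
      refine ENNReal.ofReal_le_ofReal ?_
      rw [← ha']
      exact (Nat.lt_floor_add_one _).le
    · simp
  rw [h]
  infer_instance

instance : IsSFiniteKernel nbrKernel :=
  have : ∀ a, IsFiniteMeasure (nbrKernel a) := fun a => inferInstanceAs (IsFiniteMeasure (nbr a))
  isSFiniteKernel_of_isFiniteMeasure _

@[simp] theorem nbrKernel_apply (Γ : GraphSpace) : nbrKernel Γ = nbr Γ := rfl

theorem measurable_lintegral_nbr {α : Type*} [MeasurableSpace α] {f : α → GraphSpace → ℝ≥0∞}
    {k : α → GraphSpace} (hf : Measurable (Function.uncurry f)) (hk : Measurable k) :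
    Measurable fun a => ∫⁻ y, f a y ∂nbr (k a) := by
  have h := Measurable.lintegral_kernel_prod_right' (κ := nbrKernel.comap k hk) (f := Function.uncurry f) hf
  simpa using h

theorem measurable_nbr_apply {A : Set GraphSpace} (hA : MeasurableSet A) :
    Measurable fun x => nbr x A :=
  nbrKernel.measurable_coe hA

/-- Invariance of a measure under the simple random moves of the root. -/
def Reversible (M : Measure GraphSpace) : Prop :=
  ∀ H : GraphSpace → GraphSpace → ℝ≥0∞, Measurable (Function.uncurry H) →
    ∫⁻ x, ∫⁻ y, H x y ∂nbr x ∂M = ∫⁻ x, ∫⁻ y, H y x ∂nbr x ∂M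

/-- Take `H x y` to be the indicator of `y ∈ A`: the mean mass moving into a null set equals the
mean mass moving out of it, which is zero. -/
theorem Reversible.measure_nbr_ne_zero {M : Measure GraphSpace} (hM : Reversible M)
    {A : Set GraphSpace} (hA : MeasurableSet A) (h : M A = 0) : M {x | nbr x A ≠ 0} = 0 := by
  have h1 := hM (fun _ y => A.indicator 1 y) ((measurable_one.indicator hA).comp measurable_snd)
  simp only [lintegral_indicator_one hA, lintegral_const] at h1
  have h2 : ∫⁻ x, A.indicator 1 x * nbr x Set.univ ∂M = 0 := by
    refine (lintegral_eq_zero_iff ((measurable_one.indicator hA).mul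
      (measurable_nbr_apply .univ))).2 ?_
    filter_upwards [measure_eq_zero_iff_ae_notMem.1 h] with x hx
    simp [hx]
  rw [h2, lintegral_eq_zero_iff (measurable_nbr_apply hA)] at h1
  exact ae_iff.1 h1

theorem nbr_ne_zero_of_adj {g : RootedGraph} {v : ℕ} (hv : g.graph.Adj g.root v)
    {A : Set GraphSpace} (hA : MeasurableSet A) (h : g.clAt v ∈ A) : nbr g.toClass A ≠ 0 := by
  classical
  rw [nbr_apply _ hA, lintegral_nbr]
  refine ne_of_gt (lt_of_lt_of_le ?_ (ENNReal.le_tsum v))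
  simp [hv, h]

/-- A full measurable set of a reversible measure may be replaced by its invariant part. -/
theorem Reversible.ae_forall_clAt {M : Measure GraphSpace} (hM : Reversible M)
    {A : Set GraphSpace} (hA : MeasurableSet A) (h : ∀ᵐ x ∂M, x ∈ A) :
    ∀ᵐ x ∂M, ∀ g : RootedGraph, g.toClass = x → ∀ u, g.clAt u ∈ A := by
  -- `B n` collects the classes from which `n` moves of the root can lead out of `A`. Each is null
  -- by induction, and connectedness makes their union contain every class with a bad rerooting.
  let B : ℕ → Set GraphSpace := fun n => Nat.rec Aᶜ (fun _ s => {x | nbr x s ≠ 0}) n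
  have hB : ∀ n, MeasurableSet (B n) ∧ M (B n) = 0 := by
    intro n
    induction n with
    | zero => exact ⟨hA.compl, h⟩
    | succ n ih =>
      exact ⟨((measurable_nbr_apply ih.1) (measurableSet_singleton 0)).compl,
        hM.measure_nbr_ne_zero ih.1 ih.2⟩
  have h1 : ∀ᵐ x ∂M, ∀ n, x ∉ B n :=
    ae_all_iff.2 fun n => measure_eq_zero_iff_ae_notMem.1 (hB n).2
  filter_upwards [h1] with x hx g hg u
  by_contra hu
  have key : ∀ (n : ℕ) (v : ℕ), g.graph.dist v u = n → g.clAt v ∈ B n := by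
    intro n
    induction n with
    | zero =>
      intro v hv
      rw [g.connected.dist_eq_zero_iff.1 hv]
      exact hu
    | succ n ih =>
      intro v hv
      obtain ⟨w, hw, hd⟩ := exists_adj_dist g.connected (show g.graph.dist u v = n + 1 by
        rw [SimpleGraph.dist_comm, hv])
      rw [SimpleGraph.dist_comm] at hd
      exact nbr_ne_zero_of_adj (g := g.reroot v) hw.symm (hB n).1 (ih w hd)
  subst hg
  exact hx _ (key _ g.root rfl)

end Nbr
end HorosphericGW

namespace HorosphericGW

/-! ### Geodesics in trees -/

section Trees

variable {V : Type*} {G : SimpleGraph V}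

theorem tree_dist_adj (hG : G.IsTree) (z : V) {x y : V} (h : G.Adj x y) :
    G.dist z x = G.dist z y + 1 ∨ G.dist z y = G.dist z x + 1 :=
  hG.dist_eq_dist_add_one_of_adj z h

/-- Each such neighbour is the penultimate vertex of a geodesic from `z` to `x`, and a tree has only
one path between two vertices. -/
theorem tree_closer_unique (hG : G.IsTree) {z x y y' : V} (h : G.Adj x y) (h' : G.Adj x y')
    (hd : G.dist z x = G.dist z y + 1) (hd' : G.dist z x = G.dist z y' + 1) : y = y' := by
  obtain ⟨p, hp⟩ := hG.connected.exists_walk_length_eq_dist z y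
  obtain ⟨p', hp'⟩ := hG.connected.exists_walk_length_eq_dist z y'
  have h1 : (p.concat h.symm).IsPath := SimpleGraph.Walk.isPath_of_length_eq_dist _ (by
    rw [SimpleGraph.Walk.length_concat, hp, hd])
  have h2 : (p'.concat h'.symm).IsPath := SimpleGraph.Walk.isPath_of_length_eq_dist _ (by
    rw [SimpleGraph.Walk.length_concat, hp', hd'])
  have h3 := hG.isAcyclic.path_unique ⟨_, h1⟩ ⟨_, h2⟩
  have h4 : p.concat h.symm = p'.concat h'.symm := congrArg Subtype.val h3
  have := congrArg SimpleGraph.Walk.penultimate h4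
  simpa using this

/-- Induction on the distance to `v`: the vertices preceding `v` on the two geodesics are both
closer to `o` than `v`, hence equal. -/
theorem tree_geodesic_unique (hG : G.IsTree) {o v w w' : V}
    (h : G.dist o w + G.dist w v = G.dist o v) (h' : G.dist o w' + G.dist w' v = G.dist o v)
    (hd : G.dist o w = G.dist o w') : w = w' := by
  obtain ⟨k, hk⟩ : ∃ k, G.dist w v = k := ⟨_, rfl⟩
  induction k generalizing v with
  | zero =>
    rw [hG.connected.dist_eq_zero_iff.1 hk]
    exact (hG.connected.dist_eq_zero_iff.1 (show G.dist w' v = 0 by omega)).symm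
  | succ k ih =>
    obtain ⟨x, hx, hxd⟩ := exists_adj_dist hG.connected hk
    obtain ⟨x', hx', hxd'⟩ := exists_adj_dist hG.connected (show G.dist w' v = k + 1 by omega)
    have t1 : G.dist o x ≤ G.dist o w + G.dist w x := hG.connected.dist_triangle
    have t2 : G.dist o x' ≤ G.dist o w' + G.dist w' x' := hG.connected.dist_triangle
    have e1 := tree_dist_adj hG o hx.symm
    have e2 := tree_dist_adj hG o hx'.symm
    obtain rfl := tree_closer_unique hG hx.symm hx'.symm (z := o) (by omega) (by omega)
    exact ih (by omega) (by omega) hxd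

/-- The geodesic segment. -/
theorem geodesicSegment_spec (hG : G.Connected) (o v : V) :
    (∀ i ≤ G.dist o v, G.dist o (geodesicSegment G o v i) = i ∧
      G.dist (geodesicSegment G o v i) v = G.dist o v - i) ∧
    (∀ i, G.dist o v ≤ i → geodesicSegment G o v i = v) ∧
    ∀ i < G.dist o v, G.Adj (geodesicSegment G o v i) (geodesicSegment G o v (i + 1)) := by
  have h := hG o v
  rw [geodesicSegment, dif_pos h]
  obtain hp := h.exists_walk_length_eq_dist.choose_spec
  set p := h.exists_walk_length_eq_dist.choose
  refine ⟨fun i hi => ?_, fun i hi => p.getVert_of_length_le (hp ▸ hi),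
    fun i hi => p.adj_getVert_succ (hp ▸ hi)⟩
  have h1 : G.dist o (p.getVert i) ≤ i := by
    refine (SimpleGraph.dist_le (p.take i)).trans ?_
    rw [SimpleGraph.Walk.take_length]
    exact min_le_left _ _
  have h2 : G.dist (p.getVert i) v ≤ G.dist o v - i := by
    refine (SimpleGraph.dist_le (p.drop i)).trans ?_
    rw [SimpleGraph.Walk.drop_length, hp]
  have h3 : G.dist o v ≤ G.dist o (p.getVert i) + G.dist (p.getVert i) v := hG.dist_triangle
  omega

theorem geodesicSegment_dist (hG : G.Connected) {o v : V} {i : ℕ} (hi : i ≤ G.dist o v) :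
    G.dist o (geodesicSegment G o v i) = i := ((geodesicSegment_spec hG o v).1 i hi).1

theorem geodesicSegment_dist_right (hG : G.Connected) {o v : V} {i : ℕ} (hi : i ≤ G.dist o v) :
    G.dist (geodesicSegment G o v i) v = G.dist o v - i := ((geodesicSegment_spec hG o v).1 i hi).2

theorem geodesicSegment_of_le (hG : G.Connected) {o v : V} {i : ℕ} (hi : G.dist o v ≤ i) :
    geodesicSegment G o v i = v := (geodesicSegment_spec hG o v).2.1 i hi

theorem geodesicSegment_eq (hG : G.IsTree) {o v w : V} {i : ℕ}
    (h : G.dist o w = i) (h' : i + G.dist w v = G.dist o v) : geodesicSegment G o v i = w := by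
  have hi : i ≤ G.dist o v := by omega
  have h1 := geodesicSegment_dist hG.connected hi
  have h2 := geodesicSegment_dist_right hG.connected hi
  exact tree_geodesic_unique hG (o := o) (v := v) (by omega) (by omega) (by omega)

theorem geodesicSegment_zero (hG : G.Connected) (o v : V) : geodesicSegment G o v 0 = o :=
  (hG.dist_eq_zero_iff.1 (geodesicSegment_dist hG (Nat.zero_le _))).symm

theorem geodesicSegment_dist_min (hG : G.Connected) (o v : V) (i : ℕ) :
    G.dist o (geodesicSegment G o v i) = min i (G.dist o v) := by
  rcases le_total i (G.dist o v) with h | h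
  · rw [geodesicSegment_dist hG h, min_eq_left h]
  · rw [geodesicSegment_of_le hG h, min_eq_right h]

theorem geodesicSegment_trans (hG : G.IsTree) {o v : V} {i n : ℕ} (hi : i ≤ n) :
    geodesicSegment G o (geodesicSegment G o v n) i = geodesicSegment G o v i := by
  rcases le_total (G.dist o v) n with h | h
  · rw [geodesicSegment_of_le hG.connected h]
  · have h1 := geodesicSegment_dist hG.connected h
    have h2 := geodesicSegment_dist_right hG.connected h
    have h3 := geodesicSegment_dist hG.connected (hi.trans h)
    have h4 := geodesicSegment_dist_right hG.connected (hi.trans h)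
    refine geodesicSegment_eq hG h3 ?_
    set w := geodesicSegment G o v n
    set x := geodesicSegment G o v i
    have h5 := geodesicSegment_dist hG.connected (show i ≤ G.dist o w by omega)
    have h6 := geodesicSegment_dist_right hG.connected (show i ≤ G.dist o w by omega)
    have t1 : G.dist (geodesicSegment G o w i) v ≤
      G.dist (geodesicSegment G o w i) w + G.dist w v := hG.connected.dist_triangle
    have t2 : G.dist o v ≤ G.dist o (geodesicSegment G o w i) +
      G.dist (geodesicSegment G o w i) v := hG.connected.dist_triangle
    have : geodesicSegment G o w i = x :=
      tree_geodesic_unique hG (o := o) (v := v) (by omega) (by omega) (by omega)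
    rw [← this]
    omega

/-- A geodesic sequence of neighbours issued from `o`. -/
theorem dist_of_dist_root (hG : G.Connected) {o : V} {a : ℕ → V} (N : ℕ)
    (ha : ∀ n < N, G.Adj (a n) (a (n + 1))) (hd : ∀ n ≤ N, G.dist o (a n) = n) {i j : ℕ}
    (h : i + j ≤ N) : G.dist (a i) (a (i + j)) = j := by
  have h1 : G.dist (a i) (a (i + j)) ≤ j := by
    induction j with
    | zero => simp
    | succ j ih =>
      have t : G.dist (a i) (a (i + (j + 1))) ≤
        G.dist (a i) (a (i + j)) + G.dist (a (i + j)) (a (i + j + 1)) := hG.dist_triangle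
      rw [SimpleGraph.dist_eq_one_iff_adj.2 (ha (i + j) (by omega))] at t
      have := ih (by omega)
      omega
  have t : G.dist o (a (i + j)) ≤ G.dist o (a i) + G.dist (a i) (a (i + j)) := hG.dist_triangle
  rw [hd i (by omega), hd _ h] at t
  omega

/-- The geodesic ray with given vertices. -/
def mkBoundary (hG : G.Connected) {o : V} (a : ℕ → V) (h0 : a 0 = o)
    (ha : ∀ n, G.Adj (a n) (a (n + 1))) (hd : ∀ n, G.dist o (a n) = n) : Boundary G o :=
  ⟨a, h0, fun i j => dist_of_dist_root hG (i + j) (fun n _ => ha n) (fun n _ => hd n) le_rfl⟩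

theorem Boundary.dist_root {o : V} (γ : Boundary G o) (n : ℕ) : G.dist o (γ.1 n) = n := by
  have := γ.2.2 0 n
  rwa [γ.2.1, Nat.zero_add] at this

theorem Boundary.adj {o : V} (γ : Boundary G o) (n : ℕ) : G.Adj (γ.1 n) (γ.1 (n + 1)) :=
  SimpleGraph.dist_eq_one_iff_adj.1 (γ.2.2 n 1)

/-- A non-backtracking path in a tree is a geodesic. -/
theorem dist_of_nonbacktracking (hG : G.IsTree) {o : V} {a : ℕ → V} (h0 : a 0 = o)
    (ha : ∀ n, G.Adj (a n) (a (n + 1))) (hb : ∀ n, a (n + 2) ≠ a n) (n : ℕ) :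
    G.dist o (a n) = n := by
  have key : ∀ n, G.dist o (a n) = n ∧ G.dist o (a (n + 1)) = n + 1 := by
    intro n
    induction n with
    | zero =>
      refine ⟨by simp [h0], ?_⟩
      rw [← h0]
      exact SimpleGraph.dist_eq_one_iff_adj.2 (ha 0)
    | succ n ih =>
      refine ⟨ih.2, ?_⟩
      rcases tree_dist_adj hG o (ha (n + 1)) with h | h
      · exact absurd (tree_closer_unique hG (ha (n + 1)) (ha n).symm h (by omega)) (hb n)
      · rw [h, ih.2]
  exact (key n).1

end Trees

/-! ### The compactification of a tree -/

section Compactification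

variable {V : Type*} {G : SimpleGraph V} {o : V}

/-- Apart from the initial value, the conditions involve three consecutive terms only, which will
make the image closed in the product. Such a sequence either stops for good at a vertex or never
stops and is a ray. -/
theorem range_trace (hG : G.IsTree) : Set.range (Compactification.trace (G := G) (o := o)) =
    {a | a 0 = o ∧ ∀ n, (a (n + 1) = a n → a (n + 2) = a (n + 1)) ∧
      (a (n + 1) ≠ a n → G.Adj (a n) (a (n + 1)) ∧ G.dist o (a (n + 1)) = n + 1)} := by
  ext a
  constructor
  · rintro ⟨v | γ, rfl⟩
    · obtain ⟨s1, s2, s3⟩ := geodesicSegment_spec hG.connected o v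
      refine ⟨geodesicSegment_zero hG.connected o v, fun n => ?_⟩
      simp only [Compactification.trace]
      rcases Nat.lt_or_ge n (G.dist o v) with h | h
      · have h1 := (s1 n h.le).1
        have h2 := (s1 (n + 1) h).1
        refine ⟨fun he => ?_, fun _ => ⟨s3 n h, h2⟩⟩
        rw [he] at h2
        omega
      · rw [s2 n h, s2 (n + 1) (by omega), s2 (n + 2) (by omega)]
        simp
    · refine ⟨γ.2.1, fun n => ⟨fun h => ?_, fun _ => ⟨γ.adj n, γ.dist_root _⟩⟩⟩
      exact absurd h (γ.adj n).ne'
  · rintro ⟨h0, h⟩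
    by_cases hs : ∃ n, a (n + 1) = a n
    · classical
      set n := Nat.find hs with hn
      have hlt : ∀ k < n, a (k + 1) ≠ a k := fun k hk => Nat.find_min hs hk
      have hd : ∀ k ≤ n, G.dist o (a k) = k := by
        intro k hk
        cases k with
        | zero => simp [h0]
        | succ k => exact ((h k).2 (hlt k hk)).2
      have hconst : ∀ k, a (n + k) = a n ∧ a (n + k + 1) = a (n + k) := by
        intro k
        induction k with
        | zero => exact ⟨rfl, Nat.find_spec hs⟩
        | succ k ih => exact ⟨ih.2.trans ih.1, (h (n + k)).1 ih.2⟩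
      refine ⟨.vertex (a n), funext fun i => ?_⟩
      simp only [Compactification.trace]
      rcases le_total i n with hi | hi
      · refine geodesicSegment_eq hG (hd i hi) ?_
        have := dist_of_dist_root hG.connected n (a := a) (fun k hk => ((h k).2 (hlt k hk)).1) hd
          (i := i) (j := n - i) (by omega)
        rw [show i + (n - i) = n by omega] at this
        rw [this, hd n le_rfl]
        omega
      · rw [geodesicSegment_of_le hG.connected (by rw [hd n le_rfl]; exact hi)]
        obtain ⟨k, rfl⟩ := Nat.exists_eq_add_of_le hi
        exact (hconst k).1.symm
    · push Not at hs
      refine ⟨.bdry (mkBoundary hG.connected a h0 (fun n => ((h n).2 (hs n)).1) fun n => ?_), rfl⟩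
      cases n with
      | zero => simp [h0]
      | succ n => exact ((h n).2 (hs n)).2

theorem trace_injective (hG : G.IsTree) :
    Function.Injective (Compactification.trace (G := G) (o := o)) := by
  rintro (v | γ) (v' | γ') h
  · have h1 := congrFun h (max (G.dist o v) (G.dist o v'))
    simp only [Compactification.trace] at h1
    rw [geodesicSegment_of_le hG.connected (le_max_left _ _),
      geodesicSegment_of_le hG.connected (le_max_right _ _)] at h1
    rw [h1]
  · have h1 := congrArg (G.dist o) (congrFun h (G.dist o v + 1))
    simp only [Compactification.trace] at h1
    rw [geodesicSegment_of_le hG.connected (Nat.le_succ _), γ'.dist_root] at h1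
    omega
  · have h1 := congrArg (G.dist o) (congrFun h (G.dist o v' + 1))
    simp only [Compactification.trace] at h1
    rw [geodesicSegment_of_le hG.connected (Nat.le_succ _), γ.dist_root] at h1
    omega
  · rw [Subtype.ext (h : γ.1 = γ'.1)]

theorem isInducing_trace : @Topology.IsInducing (Compactification G o) (ℕ → V) _
    (@Pi.topologicalSpace ℕ (fun _ => V) (fun _ => ⊥)) Compactification.trace :=
  let : TopologicalSpace V := ⊥
  ⟨rfl⟩

/-- The image under `Compactification.trace` is a closed subset of the product of the finite balls
of radius `n`, so Tychonoff's theorem applies. -/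
theorem compactSpace_compactification (hG : G.IsTree) (hf : ∀ v, (G.neighborSet v).Finite) :
    CompactSpace (Compactification G o) := by
  let : TopologicalSpace V := ⊥
  have : DiscreteTopology V := ⟨rfl⟩
  refine ⟨isInducing_trace.isCompact_iff.2 ?_⟩
  rw [Set.image_univ]
  refine IsCompact.of_isClosed_subset
    (isCompact_univ_pi (s := fun n => {v | G.dist o v ≤ n}) fun n => (ball_finite hG.connected hf o n).isCompact) ?_ ?_
  · rw [range_trace hG]
    have : {a : ℕ → V | a 0 = o ∧ ∀ n, (a (n + 1) = a n → a (n + 2) = a (n + 1)) ∧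
      (a (n + 1) ≠ a n → G.Adj (a n) (a (n + 1)) ∧ G.dist o (a (n + 1)) = n + 1)} =
      (fun a : ℕ → V => a 0) ⁻¹' {o} ∩ ⋂ n, (fun a : ℕ → V => (a n, a (n + 1), a (n + 2))) ⁻¹'
        {t | (t.2.1 = t.1 → t.2.2 = t.2.1) ∧
          (t.2.1 ≠ t.1 → G.Adj t.1 t.2.1 ∧ G.dist o t.2.1 = n + 1)} := by
      ext a; simp
    rw [this]
    refine ((isClosed_discrete _).preimage (continuous_apply 0)).inter (isClosed_iInter fun n => ?_)
    refine (isClosed_discrete _).preimage ?_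
    exact (continuous_apply n).prodMk ((continuous_apply (n + 1)).prodMk (continuous_apply (n + 2)))
  · rintro a ⟨ξ, rfl⟩ n -
    rcases ξ with v | γ
    · simp only [Compactification.trace, Set.mem_setOf_eq, geodesicSegment_dist_min hG.connected]
      exact min_le_left _ _
    · exact (γ.dist_root n).le

theorem t2Space_compactification (hG : G.IsTree) : T2Space (Compactification G o) := by
  let : TopologicalSpace V := ⊥
  have : DiscreteTopology V := ⟨rfl⟩
  exact Topology.IsEmbedding.t2Space (f := Compactification.trace (G := G) (o := o))
    ⟨isInducing_trace, trace_injective hG⟩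

/-- The set `D` of sequences is determined by the coordinates up to `n`. -/
def DepOn {V : Type*} (n : ℕ) (D : Set (ℕ → V)) : Prop :=
  ∀ a b : ℕ → V, (∀ i ≤ n, a i = b i) → (a ∈ D ↔ b ∈ D)

theorem DepOn.isClopen {n : ℕ} {D : Set (ℕ → V)} (h : DepOn n D) :
    @IsClopen (ℕ → V) (@Pi.topologicalSpace ℕ (fun _ => V) (fun _ => ⊥)) D := by
  let : TopologicalSpace V := ⊥
  have : DiscreteTopology V := ⟨rfl⟩
  have hc : Continuous fun (a : ℕ → V) (i : Fin (n + 1)) => a i :=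
    continuous_pi fun i => continuous_apply _
  have : D = (fun (a : ℕ → V) (i : Fin (n + 1)) => a i) ⁻¹'
      ((fun (a : ℕ → V) (i : Fin (n + 1)) => a i) '' D) := by
    refine Set.Subset.antisymm (Set.subset_preimage_image _ _) ?_
    rintro a ⟨b, hb, hab⟩
    refine (h b a fun i hi => ?_).1 hb
    exact congrFun hab ⟨i, by omega⟩
  rw [this]
  exact (isClopen_discrete _).preimage hc

/-- Sets that depend on finitely many coordinates contain the π-system of cylinders. They are also
clopen, so weak convergence determines their masses. -/
theorem seqMeasure_ext [Countable V] {X : Type*} [mX : MeasurableSpace X] {t : X → ℕ → V}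
    (ht : mX = MeasurableSpace.comap t (@MeasurableSpace.pi ℕ (fun _ => V) fun _ => ⊤))
    {μ ν : Measure X} [IsFiniteMeasure μ]
    (h : ∀ n D, DepOn n D → μ (t ⁻¹' D) = ν (t ⁻¹' D)) : μ = ν := by
  let : MeasurableSpace V := ⊤
  have hm : Measurable t := ht ▸ comap_measurable t
  have h1 : μ.map t = ν.map t := by
    refine ext_of_generate_finite (measurableCylinders fun _ : ℕ => V)
      generateFrom_measurableCylinders.symm isPiSystem_measurableCylinders ?_ ?_
    · rintro D hD
      obtain ⟨s, S, hS, rfl⟩ := (mem_measurableCylinders _).1 hD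
      rw [Measure.map_apply hm hS.cylinder, Measure.map_apply hm hS.cylinder]
      refine h (s.sup id) _ fun a b hab => ?_
      simp only [mem_cylinder]
      have : s.restrict a = s.restrict b :=
        funext fun i => hab i (Finset.le_sup (f := id) i.2)
      rw [this]
    · rw [Measure.map_apply hm .univ, Measure.map_apply hm .univ]
      exact h 0 Set.univ fun a b _ => by simp
  ext s hs
  have hs' := hs
  rw [ht] at hs'
  obtain ⟨B, hB, rfl⟩ := hs'
  rw [← Measure.map_apply hm hB, h1, Measure.map_apply hm hB]

/-- Countability of `V` is what makes the Borel structure of the product topology coincide with the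
product of the discrete σ-algebras. -/
theorem boundary_measurableSpace [Countable V] :
    (inferInstance : MeasurableSpace (Boundary G o)) = MeasurableSpace.comap
      (fun γ : Boundary G o => γ.1) (@MeasurableSpace.pi ℕ (fun _ => V) fun _ => ⊤) := by
  let : TopologicalSpace V := ⊥
  have : DiscreteTopology V := ⟨rfl⟩
  let : MeasurableSpace V := ⊤
  have : BorelSpace V := ⟨borel_eq_top_of_discrete.symm⟩
  rw [(inferInstance : BorelSpace (ℕ → V)).measurable_eq]
  exact borel_comap

instance : MeasurableSpace (Compactification G o) := borel _
instance : BorelSpace (Compactification G o) := ⟨rfl⟩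

theorem compactification_measurableSpace [Countable V] :
    (inferInstance : MeasurableSpace (Compactification G o)) = MeasurableSpace.comap
      (Compactification.trace (G := G) (o := o))
        (@MeasurableSpace.pi ℕ (fun _ => V) fun _ => ⊤) := by
  let : TopologicalSpace V := ⊥
  have : DiscreteTopology V := ⟨rfl⟩
  let : MeasurableSpace V := ⊤
  have : BorelSpace V := ⟨borel_eq_top_of_discrete.symm⟩
  rw [(inferInstance : BorelSpace (ℕ → V)).measurable_eq]
  exact borel_comap

theorem DepOn.measurableSet_trace {n : ℕ} {D : Set (ℕ → V)} (h : DepOn n D) :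
    IsClopen (Compactification.trace (G := G) (o := o) ⁻¹' D) := by
  let : TopologicalSpace V := ⊥
  exact h.isClopen.preimage isInducing_trace.continuous

theorem DepOn.isClopen_boundary {n : ℕ} {D : Set (ℕ → V)} (h : DepOn n D) :
    IsClopen ((fun γ : Boundary G o => γ.1) ⁻¹' D) := by
  let : TopologicalSpace V := ⊥
  exact h.isClopen.preimage (continuous_induced_dom (t := inferInstance))

end Compactification
end HorosphericGW

namespace HorosphericGW

/-! ### Branching measures on trees -/

section Branching

variable {V : Type*} {G : SimpleGraph V} {o : V} {m : ℝ}

/-- The number of points of the sphere of radius `k` with a prescribed geodesic from the root. -/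
def cnt (G : SimpleGraph V) (o : V) (k : ℕ) (D : Set (ℕ → V)) : ℕ :=
  Set.ncard {v | G.dist o v = k ∧ geodesicSegment G o v ∈ D}

/-- The normalized sizes of all cones converge. -/
def Conv (m : ℝ) (G : SimpleGraph V) (o : V) : Prop :=
  ∀ w, ∃ L : ℝ, w ≠ o → Tendsto (fun k : ℕ =>
    (Set.ncard {u | G.dist o u = k ∧ G.dist o w + G.dist w u = k} : ℝ) / m ^ k) atTop (𝓝 L)

theorem sphere_finite (hG : G.Connected) (hf : ∀ v, (G.neighborSet v).Finite) (o : V) (k : ℕ) :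
    {v | G.dist o v = k}.Finite :=
  (ball_finite hG hf o k).subset fun _ h => le_of_eq h

theorem finsum_sphere (hG : G.Connected) (hf : ∀ v, (G.neighborSet v).Finite) (o : V) (k : ℕ)
    (f : V → ℝ) : ∑ᶠ v ∈ {v : V | G.dist o v = k}, f v =
      ∑ v ∈ (sphere_finite hG hf o k).toFinset, f v :=
  finsum_mem_eq_finite_toFinset_sum f _

theorem cnt_eq_sum (hG : G.Connected) (hf : ∀ v, (G.neighborSet v).Finite) (o : V) (k : ℕ)
    (D : Set (ℕ → V)) : (cnt G o k D : ℝ) =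
      ∑ v ∈ (sphere_finite hG hf o k).toFinset, D.indicator 1 (geodesicSegment G o v) := by
  classical
  have h : {v | G.dist o v = k ∧ geodesicSegment G o v ∈ D} =
      ↑((sphere_finite hG hf o k).toFinset.filter fun v => geodesicSegment G o v ∈ D) := by
    ext v; simp
  rw [cnt, h, Set.ncard_coe_finset, Finset.card_filter]
  push_cast
  refine Finset.sum_congr rfl fun v _ => ?_
  by_cases hv : geodesicSegment G o v ∈ D <;> simp [hv]

/-- A set that depends on the coordinates up to `n` selects a finite set of vertices of the sphere
of radius `n`, and beyond that radius the count is the sum of the sizes of the disjoint cones over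
them. -/
theorem Conv.cnt (hG : G.IsTree) (hf : ∀ v, (G.neighborSet v).Finite) (h : Conv m G o) {n : ℕ}
    {D : Set (ℕ → V)} (hD : DepOn n D) :
    ∃ L : ℝ, Tendsto (fun k : ℕ => (cnt G o k D : ℝ) / m ^ k) atTop (𝓝 L) := by
  classical
  choose L hL using h
  -- `Conv` says nothing about the cone of the root itself, so the depth has to be positive.
  wlog hn : 1 ≤ n generalizing n
  · exact this (n := n + 1) (fun a b hab => hD a b fun i hi => hab i (by omega)) (by omega)
  set S := (sphere_finite hG.connected hf o n).toFinset with hS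
  set S' := S.filter fun w => geodesicSegment G o w ∈ D with hS'
  refine ⟨∑ w ∈ S', L w, ?_⟩
  refine (tendsto_finsetSum S' fun w hw => hL w ?_).congr' ?_
  · rintro rfl
    have := (Finset.mem_filter.1 hw).1
    rw [hS, Set.Finite.mem_toFinset, Set.mem_setOf_eq, SimpleGraph.dist_self] at this
    omega
  filter_upwards [eventually_ge_atTop n] with k hk
  rw [← Finset.sum_div]
  congr 1
  norm_cast
  have hseg : ∀ u, G.dist o u = k → (geodesicSegment G o u ∈ D ↔ geodesicSegment G o u n ∈ S') := by
    intro u hu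
    have h1 : geodesicSegment G o u ∈ D ↔
        geodesicSegment G o (geodesicSegment G o u n) ∈ D :=
      hD _ _ fun i hi => (geodesicSegment_trans hG hi).symm
    rw [h1, hS', Finset.mem_filter, hS, Set.Finite.mem_toFinset]
    refine ⟨fun h => ⟨?_, h⟩, fun h => h.2⟩
    exact geodesicSegment_dist hG.connected (by omega)
  have hset : {v | G.dist o v = k ∧ geodesicSegment G o v ∈ D} =
      ⋃ w ∈ S', {u | G.dist o u = k ∧ G.dist o w + G.dist w u = k} := by
    ext u
    simp only [Set.mem_setOf_eq, Set.mem_iUnion, exists_prop]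
    constructor
    · rintro ⟨hu, hD⟩
      refine ⟨_, (hseg u hu).1 hD, hu, ?_⟩
      have h1 := geodesicSegment_dist hG.connected (show n ≤ G.dist o u by omega)
      have h2 := geodesicSegment_dist_right hG.connected (show n ≤ G.dist o u by omega)
      omega
    · rintro ⟨w, hw, hu, hd⟩
      refine ⟨hu, (hseg u hu).2 ?_⟩
      have hwn : G.dist o w = n := by
        have := (Finset.mem_filter.1 hw).1
        rwa [hS, Set.Finite.mem_toFinset] at this
      rwa [geodesicSegment_eq hG hwn (by omega)]
  have hfin : ∀ w, {u | G.dist o u = k ∧ G.dist o w + G.dist w u = k}.Finite := fun w =>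
    (sphere_finite hG.connected hf o k).subset fun _ h => h.1
  have hbi : (⋃ w ∈ S', {u | G.dist o u = k ∧ G.dist o w + G.dist w u = k}) =
      ↑(S'.biUnion fun w => (hfin w).toFinset) := by
    ext u; simp
  rw [HorosphericGW.cnt, hset, hbi, Set.ncard_coe_finset, Finset.card_biUnion]
  · exact Finset.sum_congr rfl fun w _ => Set.ncard_eq_toFinset_card _ (hfin w)
  · intro w hw w' hw' hne
    rw [Function.onFun, Finset.disjoint_left]
    intro u hu hu'
    simp only [Set.Finite.mem_toFinset, Set.mem_setOf_eq] at hu hu'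
    have e1 : G.dist o w = n := by
      have := (Finset.mem_filter.1 hw).1
      rwa [hS, Set.Finite.mem_toFinset] at this
    have e2 : G.dist o w' = n := by
      have := (Finset.mem_filter.1 hw').1
      rwa [hS, Set.Finite.mem_toFinset] at this
    exact hne (tree_geodesic_unique hG (o := o) (v := u) (by omega) (by omega) (by omega))

open CompactlySupported in
/-- A weak limit of the normalized counting measures on spheres along an ultrafilter. -/
theorem exists_ultrafilter_limit (hG : G.IsTree) (hf : ∀ v, (G.neighborSet v).Finite)
    (hm : 0 < m) (h : Conv m G o) (U : Ultrafilter ℕ) :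
    ∃ ν : Measure (Compactification G o), IsFiniteMeasure ν ∧
      ∀ f : Compactification G o → ℝ, Continuous f →
        Tendsto (fun n : ℕ => (∑ᶠ v ∈ {v : V | G.dist o v = n}, f (.vertex v)) / m ^ n) U
          (𝓝 (∫ ξ, f ξ ∂ν)) := by
  have := compactSpace_compactification (o := o) hG hf
  have := t2Space_compactification (o := o) hG
  simp only [finsum_sphere hG.connected hf]
  set A : (Compactification G o → ℝ) → ℕ → ℝ := fun f n =>
    (∑ v ∈ (sphere_finite hG.connected hf o n).toFinset, f (.vertex v)) / m ^ n with hA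
  obtain ⟨L, hL⟩ := h.cnt hG hf (n := 0) (D := Set.univ) fun _ _ _ => by simp
  obtain ⟨B, hB⟩ := hL.bddAbove_range
  have hB' : ∀ n : ℕ, ((sphere_finite hG.connected hf o n).toFinset.card : ℝ) / m ^ n ≤ B := by
    intro n
    have := hB ⟨n, rfl⟩
    simpa [cnt_eq_sum hG.connected hf] using this
  -- The total masses converge and are bounded by `B`, so the averages of `f` stay in a compact
  -- interval and have a limit along the ultrafilter.
  have hlim : ∀ f : C_c(Compactification G o, ℝ), ∃ x, Tendsto (A f) U (𝓝 x) := by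
    intro f
    obtain ⟨C, hC⟩ := (isCompact_range f.continuous).isBounded.exists_norm_le
    have hb : ∀ n, A f n ∈ Set.Icc (-(C * B)) (C * B) := by
      intro n
      have hC0 : 0 ≤ C := (norm_nonneg _).trans (hC _ ⟨.vertex o, rfl⟩)
      rw [Set.mem_Icc, ← abs_le, hA, abs_div, abs_of_pos (pow_pos hm n)]
      calc _ ≤ (∑ v ∈ (sphere_finite hG.connected hf o n).toFinset, C) / m ^ n := by
            gcongr
            refine (Finset.abs_sum_le_sum_abs _ _).trans (Finset.sum_le_sum fun v _ => ?_)
            exact hC _ ⟨_, rfl⟩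
        _ = C * (((sphere_finite hG.connected hf o n).toFinset.card : ℝ) / m ^ n) := by
            rw [Finset.sum_const, nsmul_eq_mul]; ring
        _ ≤ C * B := by gcongr; exact hB' n
    obtain ⟨x, -, hx⟩ := isCompact_Icc.ultrafilter_le_nhds (U.map (A f)) (by
      rw [Ultrafilter.coe_map, le_principal_iff]
      exact Filter.mem_map.2 (Filter.univ_mem' hb))
    exact ⟨x, hx⟩
  choose Λ hΛ using hlim
  let Λ' : C_c(Compactification G o, ℝ) →ₗ[ℝ] ℝ :=
    { toFun := Λ
      map_add' := fun f g => by
        refine tendsto_nhds_unique (hΛ (f + g)) (((hΛ f).add (hΛ g)).congr fun n => ?_)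
        simp only [hA, CompactlySupportedContinuousMap.coe_add, Pi.add_apply,
          Finset.sum_add_distrib, add_div]
      map_smul' := fun c f => by
        refine tendsto_nhds_unique (hΛ (c • f)) (((hΛ f).const_mul c).congr fun n => ?_)
        simp only [hA, CompactlySupportedContinuousMap.coe_smul, Pi.smul_apply, smul_eq_mul,
          ← Finset.mul_sum, mul_div_assoc] }
  -- The limits form a positive linear functional, to which the Riesz representation theorem
  -- applies.
  let P : C_c(Compactification G o, ℝ) →ₚ[ℝ] ℝ := PositiveLinearMap.mk₀ Λ' fun f hf0 => by
    refine ge_of_tendsto' (hΛ f) fun n => ?_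
    exact div_nonneg (Finset.sum_nonneg fun v _ => hf0 _) (pow_pos hm n).le
  refine ⟨RealRMK.rieszMeasure P, ?_, fun f hfc => ?_⟩
  · exact ⟨isCompact_univ.measure_lt_top⟩
  · let F : C_c(Compactification G o, ℝ) := ⟨⟨f, hfc⟩, .of_compactSpace _⟩
    have : ∫ ξ, f ξ ∂(RealRMK.rieszMeasure P) = Λ F := RealRMK.integral_rieszMeasure P F
    rw [this]
    exact hΛ F

theorem continuous_indicator_trace {n : ℕ} {D : Set (ℕ → V)} (hD : DepOn n D) :
    Continuous fun ξ : Compactification G o => D.indicator (1 : (ℕ → V) → ℝ) ξ.trace := by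
  have h := hD.measurableSet_trace (G := G) (o := o)
  have : (fun ξ : Compactification G o => D.indicator (1 : (ℕ → V) → ℝ) ξ.trace) =
      (Compactification.trace ⁻¹' D).indicator fun _ => 1 := by
    ext ξ; rfl
  rw [this]
  exact continuous_const.indicator fun a ha => by
    rw [h.frontier_eq] at ha; exact ha.elim

theorem limit_cnt (hG : G.Connected) (hf : ∀ v, (G.neighborSet v).Finite)
    {ν : Measure (Compactification G o)} {l : Filter ℕ}
    (h : ∀ f : Compactification G o → ℝ, Continuous f →
        Tendsto (fun n : ℕ => (∑ᶠ v ∈ {v : V | G.dist o v = n}, f (.vertex v)) / m ^ n) l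
          (𝓝 (∫ ξ, f ξ ∂ν))) {n : ℕ} {D : Set (ℕ → V)} (hD : DepOn n D) :
    Tendsto (fun k : ℕ => (cnt G o k D : ℝ) / m ^ k) l
      (𝓝 (ν.real (Compactification.trace ⁻¹' D))) := by
  have h1 := h _ (continuous_indicator_trace hD)
  simp only [finsum_sphere hG hf] at h1
  have h2 : ∫ ξ : Compactification G o, D.indicator (1 : (ℕ → V) → ℝ) ξ.trace ∂ν =
      ν.real (Compactification.trace ⁻¹' D) := by
    rw [← integral_indicator_one hD.measurableSet_trace.isOpen.measurableSet]
    congr 1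
  rw [h2] at h1
  refine h1.congr fun k => ?_
  rw [cnt_eq_sum hG hf]
  rfl

/-- The branching measure exists on a tree in which the normalized sizes of cones converge. -/
theorem exists_isBranchingMeasure [Countable V] (hG : G.IsTree)
    (hf : ∀ v, (G.neighborSet v).Finite)
    (hm : 0 < m) (h : Conv m G o) : ∃ ν, IsBranchingMeasure G o m ν := by
  choose ν hν hlim using fun U : Ultrafilter ℕ => exists_ultrafilter_limit hG hf hm h U
  -- The masses of cylinders are limits along `atTop`, the same for every ultrafilter. Hence all
  -- ultrafilter limits agree, and the weak convergence holds along `atTop`.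
  have huniq : ∀ U U' : Ultrafilter ℕ, (U : Filter ℕ) ≤ atTop → (U' : Filter ℕ) ≤ atTop →
      ν U = ν U' := by
    intro U U' hU hU'
    refine seqMeasure_ext compactification_measurableSpace fun n D hD => ?_
    obtain ⟨L, hL⟩ := h.cnt hG hf hD
    have h1 := tendsto_nhds_unique (limit_cnt hG.connected hf (hlim U) hD) (hL.mono_left hU)
    have h2 := tendsto_nhds_unique (limit_cnt hG.connected hf (hlim U') hD) (hL.mono_left hU')
    rw [← ofReal_measureReal, ← ofReal_measureReal, h1, h2]
  set U₀ := hyperfilter ℕ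
  have hU₀ : (U₀ : Filter ℕ) ≤ atTop := by
    rw [← Nat.cofinite_eq_atTop]; exact hyperfilter_le_cofinite
  set μ := ν U₀
  have hμ : IsFiniteMeasure μ := hν U₀
  have hall : ∀ f : Compactification G o → ℝ, Continuous f →
        Tendsto (fun n : ℕ => (∑ᶠ v ∈ {v : V | G.dist o v = n}, f (.vertex v)) / m ^ n) atTop
          (𝓝 (∫ ξ, f ξ ∂μ)) := by
    intro f hfc
    rw [tendsto_iff_ultrafilter]
    intro U hU
    have := hlim U f hfc
    rwa [huniq U U₀ hU hU₀] at this
  have := t2Space_compactification (o := o) hG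
  -- The trace of `v` is still at `v` at time `G.dist o v + 1`, which is impossible for the trace of
  -- a vertex of a larger sphere. The limit therefore gives mass zero to this clopen condition.
  have hvert : ∀ v : V, μ {.vertex v} = 0 := by
    intro v
    have hD : DepOn (G.dist o v + 1) {a : ℕ → V | a (G.dist o v + 1) = v} := fun a b hab => by
      simp [hab _ le_rfl]
    have h1 := limit_cnt hG.connected hf hall hD
    have h2 : ∀ᶠ k in atTop, (cnt G o k {a : ℕ → V | a (G.dist o v + 1) = v} : ℝ) / m ^ k = 0 := by
      filter_upwards [eventually_ge_atTop (G.dist o v + 1)] with k hk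
      have : {u | G.dist o u = k ∧
          geodesicSegment G o u ∈ {a : ℕ → V | a (G.dist o v + 1) = v}} = ∅ := by
        refine Set.eq_empty_of_forall_notMem ?_
        rintro u ⟨hu, hu'⟩
        have h3 := geodesicSegment_dist hG.connected (show G.dist o v + 1 ≤ G.dist o u by omega)
        rw [Set.mem_setOf_eq] at hu'
        rw [hu'] at h3
        omega
      rw [cnt, this]
      simp
    have h3 := tendsto_nhds_unique h1 (tendsto_const_nhds.congr' (h2.mono fun _ h => h.symm))
    have h4 : μ (Compactification.trace ⁻¹' {a : ℕ → V | a (G.dist o v + 1) = v}) = 0 := by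
      rw [← ofReal_measureReal, h3]; simp
    refine measure_mono_null ?_ h4
    rintro _ rfl
    exact geodesicSegment_of_le hG.connected (Nat.le_succ _)
  have hrange : (Set.range (Compactification.bdry (G := G) (o := o))) =
      (⋃ v, {.vertex v})ᶜ := by
    ext ξ
    cases ξ <;> simp
  have hmr : MeasurableSet (Set.range (Compactification.bdry (G := G) (o := o))) := by
    rw [hrange]
    exact (MeasurableSet.iUnion fun v => measurableSet_singleton _).compl
  have hnull : ∀ᵐ ξ ∂μ, ξ ∈ Set.range (Compactification.bdry (G := G) (o := o)) := by
    rw [hrange]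
    exact measure_eq_zero_iff_ae_notMem.1 (measure_iUnion_null hvert)
  have hemb : MeasurableEmbedding (Compactification.bdry (G := G) (o := o)) := by
    refine MeasurableEmbedding.iff_comap_eq.2 ⟨fun γ γ' h => by injection h, ?_, hmr⟩
    exact (congrArg (MeasurableSpace.comap _) compactification_measurableSpace).trans
      (MeasurableSpace.comap_comp.trans boundary_measurableSpace.symm)
  -- The countably many vertices being null, the limit measure lives on the boundary and is pulled
  -- back to it.
  refine ⟨μ.comap .bdry, ⟨?_⟩, fun f hfc => ?_⟩
  · rw [hemb.comap_apply]
    exact measure_lt_top _ _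
  · have : ∫ γ, f (.bdry γ) ∂(μ.comap .bdry) = ∫ ξ, f ξ ∂μ := by
      rw [← hemb.integral_map, hemb.map_comap, Measure.restrict_eq_self_of_ae_mem hnull]
    rw [this]
    exact hall f hfc

/-- The mass of a cylinder with respect to the branching measure. -/
theorem IsBranchingMeasure.tendsto_cnt (hG : G.IsTree) (hf : ∀ v, (G.neighborSet v).Finite)
    {ν : Measure (Boundary G o)} (h : IsBranchingMeasure G o m ν) {n : ℕ} {D : Set (ℕ → V)}
    (hD : DepOn n D) : Tendsto (fun k : ℕ => (HorosphericGW.cnt G o k D : ℝ) / m ^ k) atTop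
      (𝓝 (ν.real {γ | γ.1 ∈ D})) := by
  have h1 := h.2 _ (continuous_indicator_trace hD)
  simp only [finsum_sphere hG.connected hf] at h1
  have h2 : ∫ γ : Boundary G o, D.indicator (1 : (ℕ → V) → ℝ)
      (Compactification.bdry γ).trace ∂ν = ν.real {γ | γ.1 ∈ D} :=
    integral_indicator_one hD.isClopen_boundary.isOpen.measurableSet
  rw [h2] at h1
  refine h1.congr fun k => ?_
  rw [cnt_eq_sum hG.connected hf]
  rfl

end Branching
end HorosphericGW

namespace HorosphericGW

/-! ### Walk counts -/

section WalkCounts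

variable {V V' : Type*}

open Classical in
/-- The number of walks of length `n` issued from `v` for the relation `A`. -/
def wcount (A : V → V → Prop) : ℕ → V → ℝ≥0∞
  | 0, _ => 1
  | n + 1, v => ∑' w, if A v w then wcount A n w else 0

theorem wcount_map {A : V → V → Prop} {A' : V' → V' → Prop} {ι : V → V'}
    (hι : Function.Injective ι) (h : ∀ v w', A' (ι v) w' ↔ ∃ w, ι w = w' ∧ A v w) (n : ℕ) (v : V) :
    wcount A' n (ι v) = wcount A n v := by
  classical
  induction n generalizing v with
  | zero => rfl
  | succ n ih =>
    rw [wcount, wcount, ← hι.tsum_eq]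
    · refine tsum_congr fun w => ?_
      have : A' (ι v) (ι w) ↔ A v w :=
        (h v (ι w)).trans ⟨fun ⟨w', h1, h2⟩ => hι h1 ▸ h2, fun h => ⟨w, rfl, h⟩⟩
      rw [ih]
      simp only [this]
    · intro w' hw'
      by_cases hA : A' (ι v) w'
      · obtain ⟨w, rfl, -⟩ := (h v w').1 hA
        exact ⟨w, rfl⟩
      · simp [hA] at hw'

theorem wcount_iso {G : SimpleGraph V} {G' : SimpleGraph V'} (e : G ≃g G') (n : ℕ) (v : V) :
    wcount G'.Adj n (e v) = wcount G.Adj n v :=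
  wcount_map e.injective (fun v w' => ⟨fun h => ⟨e.symm w', e.apply_symm_apply _, by
    rwa [← e.map_rel_iff, e.apply_symm_apply]⟩, fun ⟨w, h, h'⟩ => h ▸ e.map_rel_iff.2 h'⟩) n v

theorem wcount_lt_top {A : V → V → Prop} (hA : ∀ v, {w | A v w}.Finite) (n : ℕ) (v : V) :
    wcount A n v < ⊤ := by
  classical
  induction n generalizing v with
  | zero => exact ENNReal.one_lt_top
  | succ n ih =>
    rw [wcount, tsum_eq_sum (s := (hA v).toFinset)]
    · exact ENNReal.sum_lt_top.2 fun w _ => by split_ifs <;> simp [ih]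
    · intro w hw
      rw [if_neg]
      simpa using hw

/-- Distinct vertices have different numbers of walks of some length. -/
def WalkDistinct (G : SimpleGraph V) : Prop :=
  ∀ o v, (∀ n, wcount G.Adj n v = wcount G.Adj n o) → v = o

/-- Walk counts are invariant under automorphisms. Unlike rigidity, which quantifies over
uncountably many bijections, this sufficient condition is a countable one and is visibly measurable.
-/
theorem WalkDistinct.isRigidGraph {G : SimpleGraph V} (h : WalkDistinct G) : IsRigidGraph G :=
  fun e => RelIso.ext fun v => h _ _ fun n => wcount_iso e n v

theorem WalkDistinct.congr {G : SimpleGraph V} {G' : SimpleGraph V'} (e : G ≃g G')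
    (h : WalkDistinct G) : WalkDistinct G' := by
  intro o v hv
  have := h (e.symm o) (e.symm v) fun n => by
    rw [wcount_iso e.symm, wcount_iso e.symm]; exact hv n
  exact e.symm.injective this

theorem measurable_wcount {α : Type*} [MeasurableSpace α] [Countable V] {A : α → V → V → Prop}
    (hA : ∀ u v, Measurable fun a => A a u v) (n : ℕ) (v : V) :
    Measurable fun a => wcount (A a) n v := by
  classical
  induction n generalizing v with
  | zero => exact measurable_const
  | succ n ih =>
    exact Measurable.tsum fun w =>
      Measurable.ite (measurableSet_setOfPred.2 (hA v w)) (ih w) measurable_const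

theorem WalkDistinct.clAt_injective {g : RootedGraph} (h : WalkDistinct g.graph) :
    Function.Injective g.clAt := by
  intro u v huv
  obtain ⟨e, he⟩ := RootedGraph.clAt_eq_iff.1 huv
  exact h _ _ fun n => by rw [← he, wcount_iso]

theorem rel_clAt_iff {g : RootedGraph} {u : ℕ} {Γ : GraphSpace} :
    GraphSpace.Rel (g.clAt u) Γ ↔ ∃ v, g.clAt v = Γ := by
  constructor
  · rintro ⟨h, k, h1, rfl, ⟨e⟩⟩
    obtain ⟨e', -⟩ := RootedGraph.toClass_eq_iff.1 (show h.toClass = (g.reroot u).toClass from h1)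
    exact ⟨e' (e.symm k.root), RootedGraph.clAt_eq_iff.2 ⟨e'.symm.trans e,
      (congrArg e (e'.symm_apply_apply _)).trans (e.apply_symm_apply _)⟩⟩
  · rintro ⟨v, rfl⟩
    exact ⟨g.reroot u, g.reroot v, rfl, rfl, ⟨RelIso.refl _⟩⟩

theorem edge_clAt_iff {g : RootedGraph} {u : ℕ} {Γ : GraphSpace} :
    GraphSpace.Edge (g.clAt u) Γ ↔ ∃ v, g.graph.Adj u v ∧ g.clAt v = Γ := by
  constructor
  · rintro ⟨h, v, hv, h1, rfl⟩
    obtain ⟨e, he⟩ := RootedGraph.toClass_eq_iff.1 (show h.toClass = (g.reroot u).toClass from h1)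
    refine ⟨e v, ?_, RootedGraph.clAt_eq_iff.2 ⟨e.symm, e.symm_apply_apply v⟩⟩
    have : e h.root = u := he
    rw [← this]
    exact e.map_rel_iff.2 hv
  · rintro ⟨v, hv, rfl⟩
    exact ⟨g.reroot u, v, hv, rfl, rfl⟩

/-- A graph with distinguishable vertices is isomorphic to its leafwise graph. -/
def leafIso {g : RootedGraph} (h : WalkDistinct g.graph) (o : ℕ) :
    g.graph ≃g (g.clAt o).leafGraph where
  toEquiv := Equiv.ofBijective (fun v => ⟨g.clAt v, rel_clAt_iff.2 ⟨v, rfl⟩⟩)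
    ⟨fun u v huv => h.clAt_injective (congrArg Subtype.val huv), fun ⟨Γ, hΓ⟩ => by
      obtain ⟨v, rfl⟩ := rel_clAt_iff.1 hΓ
      exact ⟨v, rfl⟩⟩
  map_rel_iff' := by
    intro u v
    change (_ ≠ _ ∧ GraphSpace.Edge (g.clAt u) (g.clAt v)) ↔ _
    rw [edge_clAt_iff]
    constructor
    · rintro ⟨-, w, hw, h1⟩
      rwa [← h.clAt_injective h1]
    · intro huv
      exact ⟨fun h1 => huv.ne (h.clAt_injective (congrArg Subtype.val h1)), v, huv, rfl⟩

theorem leafIso_root {g : RootedGraph} (h : WalkDistinct g.graph) (o : ℕ) :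
    leafIso h o o = (g.clAt o).leafRoot := Subtype.ext rfl

end WalkCounts

/-! ### Trees -/

section Trees

variable {V V' : Type*} {G : SimpleGraph V}

/-- A graph in which the neighbours of smaller rank are unique has no cycles. -/
theorem isAcyclic_of_rank (l : V → ℕ) (h1 : ∀ x y, G.Adj x y → l x ≠ l y)
    (h2 : ∀ x y y', G.Adj x y → G.Adj x y' → l y < l x → l y' < l x → y = y') :
    G.IsAcyclic := by
  classical
  intro v c hc
  -- At a vertex of maximal rank on the cycle both neighbours along the cycle have smaller rank, so
  -- they would coincide.
  obtain ⟨u, hu, hmax⟩ := c.support.toFinset.exists_max_image l ⟨v, by simp⟩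
  rw [List.mem_toFinset] at hu
  have hc' := hc.rotate hu
  set c' := c.rotate u hu
  have hsup : ∀ x ∈ c'.support, l x ≤ l u := fun x hx => hmax x (by
    rw [List.mem_toFinset]
    exact by simpa [c'] using hx)
  have a1 := c'.adj_snd hc'.not_nil
  have a2 := (c'.adj_penultimate hc'.not_nil).symm
  refine hc'.snd_ne_penultimate (h2 u _ _ a1 a2 ?_ ?_)
  · exact lt_of_le_of_ne (hsup _ (c'.getVert_mem_support _)) (h1 _ _ a1).symm
  · exact lt_of_le_of_ne (hsup _ (c'.getVert_mem_support _)) (h1 _ _ a2).symm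

/-- If `a, w` is the last edge of the geodesic `[o, w]` and the first edge of `[a, u]`, then
`[o, u]` is the concatenation of `[o, w]` and `[w, u]`. -/
theorem tree_dist_concat (hG : G.IsTree) {o a w u : V} (haw : G.Adj a w)
    (hw : G.dist o w = G.dist o a + 1) (hu : G.dist a u = G.dist w u + 1) :
    G.dist o u = G.dist o w + G.dist w u := by
  obtain ⟨k, hk⟩ : ∃ k, G.dist w u = k := ⟨_, rfl⟩
  induction k using Nat.strong_induction_on generalizing u with
  | _ k ih =>
    rcases k with _ | k
    · rw [← hG.connected.dist_eq_zero_iff.1 hk]; simp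
    obtain ⟨u', hu', hd⟩ := exists_adj_dist hG.connected hk
    have hd' : G.dist a u' = k + 1 := by
      have := tree_dist_adj hG a hu'
      have := tree_dist_adj hG u' haw
      rw [G.dist_comm (u := u') (v := a), G.dist_comm (u := u') (v := w)] at this
      omega
    have e1 := ih k (by omega) (u := u') (by omega) hd
    -- If `u'` were farther from `o` than `u`, then `u` and the vertex before `u'` (namely `a` when
    -- `u' = w`) would both be the unique neighbour of `u'` closer to `o`. The distances to `w`
    -- exclude this.
    rcases tree_dist_adj hG o hu' with h | h
    · exfalso
      rcases k with _ | k
      · obtain rfl := hG.connected.dist_eq_zero_iff.1 hd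
        obtain rfl := tree_closer_unique hG (z := o) hu' haw.symm h hw
        simp at hu
      · obtain ⟨u'', hu'', hd''⟩ := exists_adj_dist hG.connected hd
        have hd3 : G.dist a u'' = k + 1 := by
          have := tree_dist_adj hG a hu''
          have := tree_dist_adj hG u'' haw
          rw [G.dist_comm (u := u'') (v := a), G.dist_comm (u := u'') (v := w)] at this
          omega
        have e2 := ih k (by omega) (u := u'') (by omega) hd''
        have := tree_closer_unique hG (z := o) hu' hu''.symm h (by omega)
        rw [this] at hk
        omega
    · omega

/-- The properties of trees, seen from a root, which hold almost surely. -/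
structure RootGood (m : ℝ) (G : SimpleGraph V) (o : V) : Prop where
  dist_ne : ∀ x y, G.Adj x y → G.dist o x ≠ G.dist o y
  closer_unique : ∀ x y y', G.Adj x y → G.Adj x y' → G.dist o y < G.dist o x →
    G.dist o y' < G.dist o x → y = y'
  two_le : ∃ u v, u ≠ v ∧ G.Adj o u ∧ G.Adj o v
  conv : ∀ b, G.Adj o b → ∃ L : ℝ, Tendsto (fun k : ℕ =>
    (Set.ncard {u | G.dist b u = k ∧ G.dist o u = k + 1} : ℝ) / m ^ k) atTop (𝓝 L)
  distinct : ∀ v, (∀ n, wcount G.Adj n v = wcount G.Adj n o) → v = o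

/-- The properties of trees which hold almost surely. -/
def Good (m : ℝ) (G : SimpleGraph V) : Prop := ∀ o, RootGood m G o

variable {m : ℝ}

theorem RootGood.congr (hG : G.Connected) {G' : SimpleGraph V'} (e : G ≃g G') {o : V}
    (h : RootGood m G o) : RootGood m G' (e o) := by
  have hd : ∀ a b, G'.dist (e a) b = G.dist a (e.symm b) := fun a b => by
    rw [← dist_iso hG e, e.apply_symm_apply]
  have ha : ∀ {a b}, G'.Adj a b → G.Adj (e.symm a) (e.symm b) := fun h => e.symm.map_rel_iff.2 h
  constructor
  · intro x y hxy
    rw [hd, hd]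
    exact h.dist_ne _ _ (ha hxy)
  · intro x y y' hy hy'
    rw [hd, hd, hd]
    intro h1 h2
    exact e.symm.injective (h.closer_unique _ _ _ (ha hy) (ha hy') h1 h2)
  · obtain ⟨u, v, huv, hu, hv⟩ := h.two_le
    exact ⟨e u, e v, e.injective.ne huv, e.map_rel_iff.2 hu, e.map_rel_iff.2 hv⟩
  · intro b hb
    obtain ⟨L, hL⟩ := h.conv (e.symm b) (by simpa using ha hb)
    refine ⟨L, hL.congr fun k => ?_⟩
    rw [← Set.ncard_image_of_injective _ e.injective]
    congr 3
    ext u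
    constructor
    · rintro ⟨v, ⟨h1, h2⟩, rfl⟩
      refine ⟨?_, by rw [hd, e.symm_apply_apply]; exact h2⟩
      rw [← e.apply_symm_apply b, hd, e.symm_apply_apply]; exact h1
    · rintro ⟨h1, h2⟩
      refine ⟨e.symm u, ⟨?_, by rw [← hd]; exact h2⟩, e.apply_symm_apply u⟩
      rw [← hd, e.apply_symm_apply]; exact h1
  · intro v hv
    have := h.distinct (e.symm v) fun n => by rw [wcount_iso e.symm, hv, wcount_iso e]
    rw [← this, e.apply_symm_apply]

theorem Good.congr (hG : G.Connected) {G' : SimpleGraph V'} (e : G ≃g G') (h : Good m G) :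
    Good m G' := fun o => by
  have := (h (e.symm o)).congr hG e
  rwa [e.apply_symm_apply] at this

theorem RootGood.isTree (hG : G.Connected) {o : V} (h : RootGood m G o) : G.IsTree :=
  ⟨hG, isAcyclic_of_rank _ h.dist_ne h.closer_unique⟩

theorem Good.isTree (hG : G.Connected) (h : Good m G) : G.IsTree :=
  (h hG.nonempty.some).isTree hG

theorem Good.walkDistinct (h : Good m G) : WalkDistinct G := fun o => (h o).distinct

/-- The cone of `w` seen from `o` is the cone beyond the last edge `a, w` of the geodesic from `o`
to `w`, which is controlled by the condition `conv` at `a`. Counting radii from `o` instead of `w`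
divides the limit by a power of `m`. -/
theorem Good.conv (hG : G.Connected) (h : Good m G) (o : V) : Conv m G o := by
  intro w
  by_cases hwo : w = o
  · exact ⟨0, fun h => (h hwo).elim⟩
  have hT := h.isTree hG
  have h0 : G.dist o w ≠ 0 := fun h => hwo (hG.dist_eq_zero_iff.1 h).symm
  obtain ⟨j, hj⟩ := Nat.exists_eq_succ_of_ne_zero h0
  obtain ⟨a, ha, had⟩ := exists_adj_dist hG hj
  obtain ⟨L, hL⟩ := (h a).conv w (by first | exact ha | exact ha.symm)
  refine ⟨L / m ^ (j + 1), fun _ => (tendsto_add_atTop_iff_nat (j + 1)).1 ?_⟩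
  refine (hL.div_const _).congr fun k => ?_
  rw [pow_add m k (j + 1), ← div_div]
  refine congrArg (fun s : Set V => (s.ncard : ℝ) / m ^ k / m ^ (j + 1)) (Set.ext fun u => ?_)
  simp only [Set.mem_setOf_eq]
  have haw : G.Adj a w := by first | exact ha | exact ha.symm
  constructor
  · rintro ⟨h1, h2⟩
    have := tree_dist_concat hT (o := o) haw (by omega) (show G.dist a u = G.dist w u + 1 by omega)
    omega
  · rintro ⟨h1, h2⟩
    have h3 : G.dist w u = k := by omega
    have h4 := hG.dist_triangle (u := o) (v := a) (w := u)
    have h5 := tree_dist_adj hT u haw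
    rw [G.dist_comm (u := u) (v := a), G.dist_comm (u := u) (v := w)] at h5
    omega

/-- The cone beyond the edge `a, b`. -/
theorem cone_iff (hT : G.IsTree) {a b u : V} (hab : G.Adj a b) (k : ℕ) :
    (G.dist a u = k + 1 ∧ geodesicSegment G a u 1 = b) ↔
      (G.dist b u = k ∧ G.dist a u = k + 1) := by
  have h1 : G.dist a b = 1 := SimpleGraph.dist_eq_one_iff_adj.2 hab
  constructor
  · rintro ⟨h, rfl⟩
    have := geodesicSegment_dist_right hT.connected (o := a) (v := u) (i := 1) (by omega)
    omega
  · rintro ⟨h, h'⟩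
    exact ⟨h', geodesicSegment_eq hT h1 (by omega)⟩

theorem cone_iff' (hT : G.IsTree) {a b u : V} (hab : G.Adj a b) {k : ℕ} (hk : 1 ≤ k) :
    (G.dist b u = k ∧ geodesicSegment G b u 1 ≠ a) ↔
      (G.dist b u = k ∧ G.dist a u = k + 1) := by
  have h1 : G.dist b a = 1 := SimpleGraph.dist_eq_one_iff_adj.2 hab.symm
  refine and_congr_right fun h => ?_
  have h2 := tree_dist_adj hT u hab
  rw [G.dist_comm (u := u) (v := a), G.dist_comm (u := u) (v := b)] at h2
  constructor
  · intro h'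
    rcases h2 with h2 | h2
    · omega
    · exact (h' (geodesicSegment_eq hT h1 (by omega))).elim
  · rintro h' rfl
    have := geodesicSegment_dist_right hT.connected (o := b) (v := u) (i := 1) (by omega)
    omega

theorem geodesicSegment_cone (hT : G.IsTree) {a b u : V} (hab : G.Adj a b)
    (h : G.dist a u = G.dist b u + 1) (i : ℕ) :
    geodesicSegment G a u (i + 1) = geodesicSegment G b u i := by
  rcases le_total i (G.dist b u) with hi | hi
  · have h1 := geodesicSegment_dist hT.connected hi
    have h2 := geodesicSegment_dist_right hT.connected hi
    refine geodesicSegment_eq hT ?_ (by omega)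
    have h3 := hT.connected.dist_triangle (u := a) (v := b) (w := geodesicSegment G b u i)
    have h4 := hT.connected.dist_triangle (u := a) (v := geodesicSegment G b u i) (w := u)
    have h5 : G.dist a b = 1 := SimpleGraph.dist_eq_one_iff_adj.2 hab
    omega
  · rw [geodesicSegment_of_le hT.connected hi, geodesicSegment_of_le hT.connected (by omega)]

end Trees

/-! ### The space of good trees -/

section GoodClasses

variable {m : ℝ}

/-- The classes of good trees. -/
def GoodClass (m : ℝ) : Set GraphSpace := {Γ | ∃ g : RootedGraph, g.toClass = Γ ∧ Good m g.graph}

/-- The classes of trees which look good from the root. -/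
def RootGoodClass (m : ℝ) : Set GraphSpace :=
  {Γ | ∃ g : RootedGraph, g.toClass = Γ ∧ RootGood m g.graph g.root}

theorem clAt_mem_goodClass {g : RootedGraph} {v : ℕ} :
    g.clAt v ∈ GoodClass m ↔ Good m g.graph := by
  refine ⟨fun ⟨h, h1, h2⟩ => ?_, fun h => ⟨g.reroot v, rfl, h⟩⟩
  obtain ⟨e, -⟩ := RootedGraph.toClass_eq_iff.1 (show h.toClass = (g.reroot v).toClass from h1)
  exact h2.congr h.connected e

theorem toClass_mem_goodClass {g : RootedGraph} :
    g.toClass ∈ GoodClass m ↔ Good m g.graph := clAt_mem_goodClass (v := g.root)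

theorem clAt_mem_rootGoodClass {g : RootedGraph} {v : ℕ} :
    g.clAt v ∈ RootGoodClass m ↔ RootGood m g.graph v := by
  refine ⟨fun ⟨h, h1, h2⟩ => ?_, fun h => ⟨g.reroot v, rfl, h⟩⟩
  obtain ⟨e, he⟩ := RootedGraph.toClass_eq_iff.1 (show h.toClass = (g.reroot v).toClass from h1)
  have := h2.congr h.connected e
  rwa [he] at this

theorem ncard_eq_tsum {V : Type*} {s : Set V} (hs : s.Finite) :
    (s.ncard : ℝ) = (∑' u, s.indicator (1 : V → ℝ≥0∞) u).toReal := by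
  classical
  rw [tsum_eq_sum (s := hs.toFinset) (fun u hu => by
    rw [Set.indicator_of_notMem]; simpa using hu)]
  rw [Finset.sum_congr rfl (g := fun _ => 1) (fun u hu => by
    rw [Set.indicator_of_mem (by simpa using hu)]; rfl)]
  rw [Finset.sum_const, nsmul_eq_mul, mul_one, Set.ncard_eq_toFinset_card _ hs]
  simp

theorem measurable_ncard {α V : Type*} [MeasurableSpace α] [Countable V] {s : α → Set V}
    (hf : ∀ a, (s a).Finite) (hs : ∀ v, Measurable fun a => v ∈ s a) :
    Measurable fun a => ((s a).ncard : ℝ) := by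
  classical
  simp only [ncard_eq_tsum (hf _)]
  refine Measurable.ennreal_toReal (Measurable.tsum fun v => ?_)
  simp only [Set.indicator_apply, Pi.one_apply]
  exact Measurable.ite (measurableSet_setOfPred.2 (hs v)) measurable_const measurable_const

theorem measurable_dist_eq (u v k : ℕ) : Measurable fun g : RootedGraph => g.graph.dist u v = k :=
  measurableSet_setOfPred.1 (measurable_dist u v (measurableSet_singleton k))

theorem measurable_rootGood (o : ℕ) : Measurable fun g : RootedGraph => RootGood m g.graph o := by
  have h : ∀ g : RootedGraph, RootGood m g.graph o ↔
      (∀ x y, g.graph.Adj x y → g.graph.dist o x ≠ g.graph.dist o y) ∧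
      (∀ x y y', g.graph.Adj x y → g.graph.Adj x y' → g.graph.dist o y < g.graph.dist o x →
        g.graph.dist o y' < g.graph.dist o x → y = y') ∧
      (∃ u v, u ≠ v ∧ g.graph.Adj o u ∧ g.graph.Adj o v) ∧
      (∀ b, g.graph.Adj o b → ∃ L : ℝ, Tendsto (fun k : ℕ =>
        (Set.ncard {u | g.graph.dist b u = k ∧ g.graph.dist o u = k + 1} : ℝ) / m ^ k)
          atTop (𝓝 L)) ∧
      (∀ v, (∀ n, wcount g.graph.Adj n v = wcount g.graph.Adj n o) → v = o) := fun g =>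
    ⟨fun h => ⟨h.1, h.2, h.3, h.4, h.5⟩, fun h => ⟨h.1, h.2.1, h.2.2.1, h.2.2.2.1, h.2.2.2.2⟩⟩
  simp only [h]
  have hlt : ∀ x y, Measurable fun g : RootedGraph => g.graph.dist o x < g.graph.dist o y :=
    fun x y => measurableSet_setOfPred.1 (measurableSet_lt (measurable_dist o x) (measurable_dist o y))
  refine .and ?_ (.and ?_ (.and ?_ (.and ?_ ?_)))
  · exact .forall fun x => .forall fun y => (measurable_adj x y).imp
      (measurableSet_setOfPred.1 (measurableSet_eq_fun (measurable_dist o x) (measurable_dist o y))).not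
  · exact .forall fun x => .forall fun y => .forall fun y' => (measurable_adj x y).imp
      ((measurable_adj x y').imp ((hlt y x).imp ((hlt y' x).imp measurable_const)))
  · exact .exists fun u => .exists fun v => .and measurable_const
      (.and (measurable_adj o u) (measurable_adj o v))
  · refine .forall fun b => (measurable_adj o b).imp ?_
    -- The existential over the real limit is not countable; the set on which a sequence of
    -- measurable functions converges is measurable by completeness.
    refine measurableSet_setOfPred.1 (measurableSet_exists_tendsto fun k => ?_)
    refine Measurable.div_const (measurable_ncard (fun g => ?_) fun v => ?_) _
    · exact (sphere_finite g.connected g.locallyFinite b k).subset fun _ h => h.1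
    · exact .and (measurable_dist_eq b v k) (measurable_dist_eq o v (k + 1))
  · refine .forall fun v => Measurable.imp (.forall fun n => ?_) measurable_const
    exact measurableSet_setOfPred.1 (measurableSet_eq_fun
      (measurable_wcount measurable_adj n v) (measurable_wcount measurable_adj n o))

theorem measurableSet_goodClass : MeasurableSet (GoodClass m) := by
  refine measurableSet_setOfPred.2 (measurable_of_toClass ?_)
  change Measurable fun g : RootedGraph => g.toClass ∈ GoodClass m
  simp only [toClass_mem_goodClass]
  exact .forall measurable_rootGood

theorem measurableSet_rootGoodClass : MeasurableSet (RootGoodClass m) := by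
  refine measurableSet_setOfPred.2 (measurable_of_toClass ?_)
  change Measurable fun g : RootedGraph => g.clAt g.root ∈ RootGoodClass m
  simp only [clAt_mem_rootGoodClass]
  have h : Measurable fun p : RootedGraph × ℕ => RootGood m p.1.graph p.2 :=
    measurable_from_prod_countable_left fun n => measurable_rootGood n
  exact h.comp (measurable_id.prodMk measurable_root)

/-- This is why `RootGood` is formulated relative to a root: only the root has to be examined in the
random tree, and reversibility supplies the other vertices. -/
theorem Reversible.ae_goodClass {M : Measure GraphSpace} (hM : Reversible M)
    (h : ∀ᵐ x ∂M, x ∈ RootGoodClass m) : ∀ᵐ x ∂M, x ∈ GoodClass m := by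
  filter_upwards [hM.ae_forall_clAt measurableSet_rootGoodClass h] with x hx
  obtain ⟨g, rfl⟩ := exists_rep x
  exact toClass_mem_goodClass.2 fun o => clAt_mem_rootGoodClass.1 (hx g rfl o)

end GoodClasses
end HorosphericGW

namespace HorosphericGW

/-! ### Sequences of classes -/

section Sequences

/-- The sequence starting with `x` and continued by `s`. -/
def scons {α : Type*} (x : α) (s : ℕ → α) : ℕ → α
  | 0 => x
  | n + 1 => s n

/-- The shifted sequence. -/
def stail {α : Type*} (s : ℕ → α) : ℕ → α := fun n => s (n + 1)

theorem measurable_scons {α : Type*} [MeasurableSpace α] :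
    Measurable fun p : α × (ℕ → α) => scons p.1 p.2 := by
  refine measurable_pi_iff.2 fun n => ?_
  cases n with
  | zero => exact measurable_fst
  | succ n => exact (measurable_pi_apply n).comp measurable_snd

theorem measurable_stail {α : Type*} [MeasurableSpace α] :
    Measurable (stail : (ℕ → α) → ℕ → α) :=
  measurable_pi_iff.2 fun n => measurable_pi_apply (n + 1)

theorem exists_depOn_of_mem_measurableCylinders {α : Type*} [MeasurableSpace α] {D : Set (ℕ → α)}
    (hD : D ∈ measurableCylinders fun _ : ℕ => α) : MeasurableSet D ∧ ∃ n, DepOn n D := by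
  obtain ⟨s, S, hS, rfl⟩ := (mem_measurableCylinders _).1 hD
  refine ⟨hS.cylinder, s.sup id, fun a b hab => ?_⟩
  simp only [mem_cylinder]
  have : s.restrict a = s.restrict b :=
    funext fun i => hab i (Finset.le_sup (f := id) i.2)
  rw [this]

theorem measure_ext_of_depOn {α : Type*} [MeasurableSpace α] {μ ν : Measure (ℕ → α)}
    [IsFiniteMeasure μ] (h : ∀ n D, MeasurableSet D → DepOn n D → μ D = ν D) : μ = ν := by
  refine ext_of_generate_finite (measurableCylinders fun _ : ℕ => α)
    generateFrom_measurableCylinders.symm isPiSystem_measurableCylinders (fun D hD => ?_)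
    (h 0 _ .univ fun a b _ => by simp)
  obtain ⟨h1, n, h2⟩ := exists_depOn_of_mem_measurableCylinders hD
  exact h n D h1 h2

end Sequences

/-- Countably many measurable sets separate the points, which exhibits the diagonal as a countable
intersection. -/
instance : MeasurableEq GraphSpace := by
  obtain ⟨f, hf, hinj⟩  := MeasurableSpace.measurable_injection_nat_bool_of_countablySeparated GraphSpace
  refine ⟨?_⟩
  have : Set.diagonal GraphSpace = ⋂ n, {p : GraphSpace × GraphSpace | f p.1 n = f p.2 n} := by
    ext p
    simp only [Set.mem_diagonal_iff, Set.mem_iInter, Set.mem_setOf_eq, ← funext_iff, hinj.eq_iff]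
  rw [this]
  exact .iInter fun n => measurableSet_eq_fun
    ((measurable_pi_apply n).comp (hf.comp measurable_fst))
    ((measurable_pi_apply n).comp (hf.comp measurable_snd))

theorem measurableSet_seq_eq (i : ℕ) (x : GraphSpace) :
    MeasurableSet {s : ℕ → GraphSpace | s i = x} :=
  (measurable_pi_apply i : Measurable fun s : ℕ → GraphSpace => s i) (measurableSet_singleton x)

/-! ### Branching measures of classes -/

section ClassBranching

variable {V V' : Type*} {m : ℝ}

theorem geodesicSegment_iso {G : SimpleGraph V} {G' : SimpleGraph V'} (hG : G.IsTree) (e : G ≃g G')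
    (o v : V) (i : ℕ) : geodesicSegment G' (e o) (e v) i = e (geodesicSegment G o v i) := by
  have hd := dist_iso hG.connected e
  have hG' : G'.IsTree := (SimpleGraph.Iso.isTree_iff e).1 hG
  rcases le_total i (G.dist o v) with hi | hi
  · refine geodesicSegment_eq hG' ?_ ?_
    · rw [hd, geodesicSegment_dist hG.connected hi]
    · rw [hd, hd, geodesicSegment_dist_right hG.connected hi]; omega
  · rw [geodesicSegment_of_le hG.connected hi,
      geodesicSegment_of_le hG'.connected (by rw [hd]; exact hi)]

theorem cnt_iso {G : SimpleGraph V} {G' : SimpleGraph V'} (hG : G.IsTree) (e : G ≃g G')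
    (o : V) (k : ℕ) (D : Set (ℕ → V')) :
    cnt G' (e o) k D = cnt G o k {a | (fun n => e (a n)) ∈ D} := by
  rw [cnt, cnt, ← Set.ncard_image_of_injective _ e.injective]
  congr 1
  ext u
  constructor
  · rintro ⟨h1, h2⟩
    obtain ⟨v, rfl⟩ := e.surjective u
    refine ⟨v, ⟨by rw [← dist_iso hG.connected e]; exact h1, ?_⟩, rfl⟩
    simp only [Set.mem_setOf_eq, ← geodesicSegment_iso hG e]
    exact h2
  · rintro ⟨v, ⟨h1, h2⟩, rfl⟩
    refine ⟨by rw [dist_iso hG.connected e]; exact h1, ?_⟩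
    simp only [Set.mem_setOf_eq, ← geodesicSegment_iso hG e] at h2
    exact h2

instance (Γ : GraphSpace) : Countable Γ.Leaf := by
  obtain ⟨g, rfl⟩ := exists_rep Γ
  refine Function.Surjective.countable
    (f := fun v : ℕ => (⟨g.clAt v, rel_clAt_iff.2 ⟨v, rfl⟩⟩ : (g.clAt g.root).Leaf)) ?_
  rintro ⟨Γ', h⟩
  obtain ⟨v, rfl⟩ := rel_clAt_iff.1 h
  exact ⟨v, rfl⟩

theorem goodClass_isTree {x : GraphSpace} (hx : x ∈ GoodClass m) : x.IsTree := by
  rintro g rfl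
  exact (toClass_mem_goodClass.1 hx).isTree g.connected

theorem goodClass_isRigid {x : GraphSpace} (hx : x ∈ GoodClass m) : x.IsRigid := by
  rintro g rfl
  exact (toClass_mem_goodClass.1 hx).walkDistinct.isRigidGraph

/-- A good class as a rigid tree. -/
def goodTree {x : GraphSpace} (hx : x ∈ GoodClass m) : RigidTree :=
  ⟨x, goodClass_isTree hx, goodClass_isRigid hx⟩

/-- The classes along a ray of a leafwise tree. -/
def leafRay (x : RigidTree) (γ : LeafBoundary x) : ℕ → GraphSpace := fun n => (γ.1 n).1

theorem measurable_leafRay (x : RigidTree) : Measurable (leafRay x) := by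
  refine measurable_pi_iff.2 fun n => ?_
  let : MeasurableSpace x.1.Leaf := ⊤
  have h1 : Measurable fun γ : LeafBoundary x => γ.1 n := by
    refine (measurable_pi_apply n).comp ?_
    exact Measurable.mono (comap_measurable fun γ : LeafBoundary x => γ.1)
      (le_of_eq boundary_measurableSpace.symm) le_rfl
  exact (measurable_from_top (f := fun a : x.1.Leaf => a.1)).comp h1

theorem good_leafGraph {g : RootedGraph} (h : Good m g.graph) (v : ℕ) :
    Good m (g.clAt v).leafGraph := h.congr g.connected (leafIso h.walkDistinct v)

theorem leafGraph_nice {g : RootedGraph} (h : WalkDistinct g.graph) (v : ℕ) :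
    IsInfiniteLocallyFiniteConnected (g.clAt v).leafGraph := g.nice.congr (leafIso h v)

theorem isBranchingMeasure_branchingMeasure (hm : 0 < m) (x : RigidTree)
    (hx : x.1 ∈ GoodClass m) :
    IsBranchingMeasure (leafTree x) x.1.leafRoot m (branchingMeasure m x) := by
  obtain ⟨x, h1, h2⟩ := x
  obtain ⟨g, rfl⟩ := exists_rep x
  have hg := toClass_mem_goodClass.1 hx
  have hn := leafGraph_nice hg.walkDistinct g.root
  have hG : Good m g.toClass.leafGraph := good_leafGraph hg g.root
  have h : ∃ ν, IsBranchingMeasure g.toClass.leafGraph g.toClass.leafRoot m ν :=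
    exists_isBranchingMeasure (hG.isTree hn.2.1) hn.2.2 hm (hG.conv hn.2.1 _)
  rw [branchingMeasure, dif_pos h]
  exact h.choose_spec

open Classical in
/-- The branching measure of a good class, as a measure on sequences of classes. -/
def bray (m : ℝ) (x : GraphSpace) : Measure (ℕ → GraphSpace) :=
  if h : 0 < m ∧ x ∈ GoodClass m then (branchingMeasure m (goodTree h.2)).map (leafRay _) else 0

theorem bray_of_good (hm : 0 < m) {x : GraphSpace} (hx : x ∈ GoodClass m) :
    bray m x = (branchingMeasure m (goodTree hx)).map (leafRay _) := by
  rw [bray, dif_pos ⟨hm, hx⟩]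

theorem bray_of_not_good {x : GraphSpace} (hx : x ∉ GoodClass m) : bray m x = 0 := by
  rw [bray, dif_neg fun h => hx h.2]

instance (x : GraphSpace) : IsFiniteMeasure (bray m x) := by
  rw [bray]
  split_ifs with h
  · have := (isBranchingMeasure_branchingMeasure h.1 (goodTree h.2) h.2).1
    infer_instance
  · infer_instance

/-- The mass of a cylinder for the branching measure of a good class. -/
theorem tendsto_cnt_bray (hm : 0 < m) {g : RootedGraph} (hg : Good m g.graph) (v : ℕ)
    {D : Set (ℕ → GraphSpace)} (hD : MeasurableSet D) {n : ℕ} (hn : DepOn n D) :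
    Tendsto (fun k : ℕ => (cnt g.graph v k {a | (fun i => g.clAt (a i)) ∈ D} : ℝ) / m ^ k) atTop
      (𝓝 ((bray m (g.clAt v)).real D)) := by
  have hx : g.clAt v ∈ GoodClass m := clAt_mem_goodClass.2 hg
  have hl := leafGraph_nice hg.walkDistinct v
  have hG := good_leafGraph hg v
  have hν := isBranchingMeasure_branchingMeasure hm (goodTree hx) hx
  have hT := hG.isTree hl.2.1
  have h1 := hν.tendsto_cnt hT hl.2.2 (n := n)
    (D := {a | (fun i => (a i).1) ∈ D}) fun a b hab => hn _ _ fun i hi => by rw [hab i hi]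
  rw [bray_of_good hm hx, map_measureReal_apply (measurable_leafRay _) hD]
  refine Tendsto.congr (fun k => ?_) h1
  congr 2
  change HorosphericGW.cnt (g.clAt v).leafGraph (g.clAt v).leafRoot k _ = _
  rw [← leafIso_root hg.walkDistinct, cnt_iso (hg.isTree g.connected)]
  rfl

/-- The geodesic is defined by choice; in terms of distances it becomes accessible to measurability
arguments. -/
theorem geodesicSegment_eq_iff {G : SimpleGraph V} (hG : G.IsTree) (o v w : V) (i : ℕ) :
    geodesicSegment G o v i = w ↔
      G.dist o w = min i (G.dist o v) ∧ G.dist o w + G.dist w v = G.dist o v := by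
  rcases le_total i (G.dist o v) with hi | hi
  · rw [min_eq_left hi]
    constructor
    · rintro rfl
      rw [geodesicSegment_dist hG.connected hi, geodesicSegment_dist_right hG.connected hi]
      omega
    · rintro ⟨h1, h2⟩
      exact geodesicSegment_eq hG h1 (by omega)
  · rw [min_eq_right hi, geodesicSegment_of_le hG.connected hi]
    constructor
    · rintro rfl; simp
    · rintro ⟨h1, h2⟩
      exact (hG.connected.dist_eq_zero_iff.1 (by omega : G.dist w v = 0)).symm

/-- The mass is a limit of normalized cardinalities, and each of these is measurable because the
beginning of a geodesic is described by finitely many equations between distances. -/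
theorem measurable_bray_apply (o : ℕ) {D : Set (ℕ → GraphSpace)} (hD : MeasurableSet D) {n : ℕ}
    (hn : DepOn n D) : Measurable fun g : RootedGraph => bray m (g.clAt o) D := by
  classical
  by_cases hm : 0 < m
  swap
  · have : ∀ x, bray m x = 0 := fun x => by rw [bray, dif_neg fun h => hm h.1]
    simp only [this]
    exact measurable_const
  -- `w` lists the first `n + 1` points of the geodesic to `v`, stopped at `v`; this is the origin
  -- of the minimum. Truncating the index at `n` is harmless because `D` depends only on the
  -- coordinates up to `n`.
  let S : RootedGraph → ℕ → Set ℕ := fun g k => {v | g.graph.dist o v = k ∧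
    ∃ w : Fin (n + 1) → ℕ, (∀ i : Fin (n + 1), g.graph.dist o (w i) = min (i : ℕ) (g.graph.dist o v) ∧
      g.graph.dist o (w i) + g.graph.dist (w i) v = g.graph.dist o v) ∧
      (fun j : ℕ => g.clAt (w (Fin.ofNat (n + 1) (min j n)))) ∈ D}
  have hS : ∀ g k, Good m g.graph →
      cnt g.graph o k {a | (fun i => g.clAt (a i)) ∈ D} = (S g k).ncard := by
    intro g k hg
    have hT := hg.isTree g.connected
    rw [cnt]
    congr 1
    ext v
    refine and_congr_right fun _ => ?_
    have key : ∀ w : Fin (n + 1) → ℕ, (∀ i : Fin (n + 1), geodesicSegment g.graph o v i = w i) →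
        ((fun j : ℕ => g.clAt (w (Fin.ofNat (n + 1) (min j n)))) ∈ D ↔
          (fun i => g.clAt (geodesicSegment g.graph o v i)) ∈ D) := fun w hw =>
      hn _ _ fun i hi => by
        rw [← hw]
        congr 2
        simp only [Fin.val_ofNat, min_eq_left hi]
        exact Nat.mod_eq_of_lt (by omega)
    constructor
    · intro h
      refine ⟨fun i => geodesicSegment g.graph o v i, fun i => ?_, (key _ fun i => rfl).2 h⟩
      exact (geodesicSegment_eq_iff hT o v _ i).1 rfl
    · rintro ⟨w, hw, h⟩
      exact (key w fun i => (geodesicSegment_eq_iff hT o v _ i).2 (hw i)).1 h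
  -- A lower limit is defined and measurable for every graph, and it agrees with the limit where the
  -- latter exists.
  have h : (fun g : RootedGraph => bray m (g.clAt o) D) = fun g =>
      if Good m g.graph then
        liminf (fun k : ℕ => ENNReal.ofReal (((S g k).ncard : ℝ) / m ^ k)) atTop else 0 := by
    ext g
    split_ifs with hg
    · have h1 := tendsto_cnt_bray hm hg o hD hn
      simp only [hS g _ hg] at h1
      have h2 := (ENNReal.continuous_ofReal.tendsto _).comp h1
      rw [ofReal_measureReal] at h2
      exact h2.liminf_eq.symm
    · rw [bray_of_not_good fun h => hg (clAt_mem_goodClass.1 h)]; rfl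
  rw [h]
  refine Measurable.ite ?_ (Measurable.liminf fun k => ?_) measurable_const
  · exact measurableSet_setOfPred.2 (.forall measurable_rootGood)
  · refine (Measurable.div_const (measurable_ncard (fun g => ?_) fun v => ?_) _).ennreal_ofReal
    · exact (sphere_finite g.connected g.locallyFinite o k).subset fun _ h => h.1
    · refine .and (measurable_dist_eq o v k) (.exists fun w => .and (.forall fun i => .and ?_ ?_) ?_)
      · exact measurableSet_setOfPred.1 (measurableSet_eq_fun (measurable_dist _ _)
          (measurable_const.min (measurable_dist _ _)))
      · exact measurableSet_setOfPred.1 (measurableSet_eq_fun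
          ((measurable_dist _ _).add (measurable_dist _ _)) (measurable_dist _ _))
      · exact measurableSet_setOfPred.1
          ((measurable_pi_iff.2 fun j => measurable_clAt _) hD)

theorem measurable_bray : Measurable (bray m) := by
  have h : ∀ n D, MeasurableSet D → DepOn n D → Measurable fun x => bray m x D := by
    intro n D hD hn
    refine measurable_of_toClass ?_
    have h : Measurable fun p : RootedGraph × ℕ => bray m (p.1.clAt p.2) D :=
      measurable_from_prod_countable_left fun o => measurable_bray_apply o hD hn
    exact h.comp (measurable_id.prodMk measurable_root)
  refine Measurable.measure_of_isPiSystem generateFrom_measurableCylinders.symm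
    isPiSystem_measurableCylinders (fun D hD => ?_) (h 0 _ .univ fun a b _ => by simp)
  obtain ⟨h1, n, h2⟩ := exists_depOn_of_mem_measurableCylinders hD
  exact h n D h1 h2

/-- The part of the branching measure carried by the cone beyond an edge. -/
theorem bray_restrict (hm : 0 < m) {g : RootedGraph} (hg : Good m g.graph) {a b : ℕ}
    (hab : g.graph.Adj a b) :
    (bray m (g.clAt a)).restrict {s | s 1 = g.clAt b} = (ENNReal.ofReal m)⁻¹ •
      ((bray m (g.clAt b)).restrict {s | s 1 ≠ g.clAt a}).map (scons (g.clAt a)) := by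
  have hT := hg.isTree g.connected
  have hinj := hg.walkDistinct.clAt_injective
  have hE : ∀ x : GraphSpace, MeasurableSet {s : ℕ → GraphSpace | s 1 = x} :=
    measurableSet_seq_eq 1
  have hsc : Measurable (scons (g.clAt a)) :=
    measurable_scons.comp (measurable_const.prodMk measurable_id)
  refine measure_ext_of_depOn fun n D hD hn => ?_
  rw [Measure.restrict_apply hD, Measure.smul_apply, Measure.map_apply hsc hD,
    Measure.restrict_apply (hsc hD)]
  have h1 := tendsto_cnt_bray hm hg a (hD.inter (hE (g.clAt b))) (n := n + 1) fun s t hst =>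
    and_congr (hn s t fun i hi => hst i (by omega)) (by
      simp only [Set.mem_setOf_eq, hst 1 (by omega)])
  have h2 := tendsto_cnt_bray hm hg b ((hsc hD).inter (hE (g.clAt a)).compl) (n := n + 1)
    fun s t hst => and_congr (hn _ _ fun i hi => by
      cases i with
      | zero => rfl
      | succ i => exact hst i (by omega)) (by
      simp only [Set.mem_compl_iff, Set.mem_setOf_eq, hst 1 (by omega)])
  rw [← ofReal_measureReal, ← ofReal_measureReal]
  have hreal : (bray m (g.clAt a)).real (D ∩ {s | s 1 = g.clAt b}) =
      m⁻¹ * (bray m (g.clAt b)).real (scons (g.clAt a) ⁻¹' D ∩ {s | s 1 = g.clAt a}ᶜ) := by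
    refine tendsto_nhds_unique ((tendsto_add_atTop_iff_nat 1).2 h1)
      ((h2.const_mul m⁻¹).congr' ?_)
    filter_upwards [eventually_ge_atTop 1] with k hk
    rw [pow_succ, div_mul_eq_div_div_swap, div_eq_inv_mul, div_eq_inv_mul, div_eq_inv_mul _ m]
    -- Beyond the edge, the points at distance `k + 1` from `a` are exactly those at distance `k`
    -- from `b`. Only the normalization changes, by one factor of `m`.
    have hc : cnt g.graph b k {u | (fun i => g.clAt (u i)) ∈
        scons (g.clAt a) ⁻¹' D ∩ {s | s 1 = g.clAt a}ᶜ} =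
        cnt g.graph a (k + 1) {u | (fun i => g.clAt (u i)) ∈ D ∩ {s | s 1 = g.clAt b}} := by
      rw [cnt, cnt]
      congr 1
      ext u
      simp only [Set.mem_setOf_eq, Set.mem_inter_iff, Set.mem_preimage, Set.mem_compl_iff,
        hinj.eq_iff]
      have e1 := cone_iff (u := u) hT hab k
      have e2 := cone_iff' (u := u) hT hab hk
      have e3 : (g.graph.dist b u = k ∧ g.graph.dist a u = k + 1) → scons (g.clAt a)
          (fun i => g.clAt (geodesicSegment g.graph b u i)) =
          fun i => g.clAt (geodesicSegment g.graph a u i) := by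
        rintro ⟨h3, h4⟩
        ext i
        cases i with
        | zero => rw [geodesicSegment_zero g.connected]; rfl
        | succ i => rw [geodesicSegment_cone hT hab (by omega)]; rfl
      constructor
      · rintro ⟨h3, h4, h5⟩
        have h6 := e2.1 ⟨h3, h5⟩
        rw [e3 h6] at h4
        exact ⟨h6.2, h4, (e1.2 h6).2⟩
      · rintro ⟨h3, h4, h5⟩
        have h6 := e1.1 ⟨h3, h5⟩
        rw [← e3 h6] at h4
        exact ⟨h6.1, h4, (e2.2 h6).2⟩
    rw [hc]
    ring
  rw [hreal, ENNReal.ofReal_mul (by positivity), ENNReal.ofReal_inv_of_pos hm]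
  rfl

theorem measurableSet_nbr_singleton : MeasurableSet {p : GraphSpace × GraphSpace | nbr p.1 {p.2} ≠ 0} := by
  have h : Measurable fun p : GraphSpace × GraphSpace =>
      ∫⁻ y, ({q : GraphSpace × GraphSpace | q.1 = q.2}).indicator 1 (p.2, y) ∂nbr p.1 :=
    measurable_lintegral_nbr ((measurable_one.indicator
      (measurableSet_eq_fun measurable_fst measurable_snd)).comp
        ((measurable_snd.comp measurable_fst).prodMk measurable_snd)) measurable_fst
  have h' : (fun p : GraphSpace × GraphSpace => nbr p.1 {p.2}) = fun p =>
      ∫⁻ y, ({q : GraphSpace × GraphSpace | q.1 = q.2}).indicator 1 (p.2, y) ∂nbr p.1 := by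
    ext p
    refine (lintegral_indicator_one (measurableSet_singleton p.2)).symm.trans
      (lintegral_congr fun y => ?_)
    by_cases h : p.2 = y
    · rw [Set.indicator_of_mem (show y ∈ ({p.2} : Set GraphSpace) from h.symm),
        Set.indicator_of_mem (show (p.2, y) ∈ {q : GraphSpace × GraphSpace | q.1 = q.2} from h)]
      rfl
    · rw [Set.indicator_of_notMem (show y ∉ ({p.2} : Set GraphSpace) from fun h' => h (Eq.symm h')), Set.indicator_of_notMem
        (show (p.2, y) ∉ {q : GraphSpace × GraphSpace | q.1 = q.2} from h)]
  rw [← h'] at h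
  exact h (measurableSet_singleton 0).compl

theorem nbr_singleton_ne_zero_iff {g : RootedGraph} {v : ℕ} {y : GraphSpace} :
    nbr (g.clAt v) {y} ≠ 0 ↔ ∃ w, g.graph.Adj v w ∧ g.clAt w = y := by
  classical
  have h := nbr_apply (g.reroot v) (measurableSet_singleton y)
  rw [lintegral_nbr] at h
  rw [show g.clAt v = (g.reroot v).toClass from rfl, h, Ne, ENNReal.tsum_eq_zero, not_forall]
  refine exists_congr fun w => ?_
  change ¬ (if g.graph.Adj v w then Set.indicator {y} 1 (g.clAt w) else 0) = (0 : ℝ≥0∞) ↔ _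
  by_cases h1 : g.graph.Adj v w <;> by_cases h2 : g.clAt w = y <;> simp [h1, h2]

/-- The sequences of classes which are rays of good trees. -/
def RaySet (m : ℝ) : Set (ℕ → GraphSpace) :=
  {s | s 0 ∈ GoodClass m ∧ ∀ i, nbr (s i) {s (i + 1)} ≠ 0 ∧ s (i + 2) ≠ s i}

theorem measurableSet_raySet : MeasurableSet (RaySet m) := by
  have h : ∀ i, Measurable fun s : ℕ → GraphSpace => s i := fun i => measurable_pi_apply i
  rw [show RaySet m = (fun s : ℕ → GraphSpace => s 0) ⁻¹' GoodClass m ∩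
    ⋂ i, ((fun s => (s i, s (i + 1))) ⁻¹' {p | nbr p.1 {p.2} ≠ 0} ∩ {s | s (i + 2) = s i}ᶜ) by
      ext; simp [RaySet]]
  refine (h 0 measurableSet_goodClass).inter ?_
  exact .iInter fun i => (((h i).prodMk (h (i + 1))) measurableSet_nbr_singleton).inter
    (measurableSet_eq_fun (h _) (h _)).compl

/-- Vertices of a good tree have different classes, so a sequence of neighbouring classes lifts
uniquely to a path, and a path without backtracking in a tree is a geodesic. -/
theorem mem_raySet_iff {g : RootedGraph} (hg : Good m g.graph) {v : ℕ} {s : ℕ → GraphSpace}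
    (hs : s 0 = g.clAt v) :
    s ∈ RaySet m ↔ ∃ γ : Boundary g.graph v, s = fun i => g.clAt (γ.1 i) := by
  have hinj := hg.walkDistinct.clAt_injective
  have hT := hg.isTree g.connected
  constructor
  · rintro ⟨-, h⟩
    have hrep : ∀ i, ∃ w, g.clAt w = s i := by
      intro i
      induction i with
      | zero => exact ⟨v, hs.symm⟩
      | succ i ih =>
        obtain ⟨w, hw⟩ := ih
        have := (h i).1
        rw [← hw, nbr_singleton_ne_zero_iff] at this
        obtain ⟨w', -, hw'⟩ := this
        exact ⟨w', hw'⟩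
    choose a ha using hrep
    have ha0 : a 0 = v := hinj ((ha 0).trans hs)
    have hadj : ∀ i, g.graph.Adj (a i) (a (i + 1)) := by
      intro i
      have := (h i).1
      rw [← ha i, nbr_singleton_ne_zero_iff] at this
      obtain ⟨w, hw, hw'⟩ := this
      rwa [← hinj ((ha (i + 1)).trans hw'.symm)] at hw
    refine ⟨mkBoundary g.connected a ha0 hadj (dist_of_nonbacktracking hT ha0 hadj ?_), ?_⟩
    · intro i hi
      exact (h i).2 (by rw [← ha, ← ha, hi])
    · ext i; exact (ha i).symm
  · rintro ⟨γ, rfl⟩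
    refine ⟨clAt_mem_goodClass.2 hg, fun i => ⟨?_, fun h => ?_⟩⟩
    · exact nbr_singleton_ne_zero_iff.2 ⟨_, γ.adj i, rfl⟩
    · have h1 := γ.2.2 i 2
      rw [hinj h] at h1
      simp at h1

theorem bray_ae (x : GraphSpace) : ∀ᵐ s ∂bray m x, s ∈ RaySet m ∧ s 0 = x := by
  by_cases h : 0 < m ∧ x ∈ GoodClass m
  · rw [bray_of_good h.1 h.2]
    have hmeas : MeasurableSet {s : ℕ → GraphSpace | s ∈ RaySet m ∧ s 0 = x} :=
      measurableSet_raySet.inter (measurableSet_seq_eq 0 x)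
    rw [ae_map_iff (measurable_leafRay _).aemeasurable hmeas]
    refine ae_of_all _ fun γ => ?_
    obtain ⟨g, hx, hg⟩ := h.2
    have h0 : leafRay (goodTree h.2) γ 0 = x := congrArg Subtype.val γ.2.1
    refine ⟨⟨by rw [h0]; exact h.2, fun i => ⟨?_, fun h1 => ?_⟩⟩, h0⟩
    · obtain ⟨g', v, hv, h1, h2⟩ := (γ.adj i).2
      change nbr (γ.1 i).1 {(γ.1 (i + 1)).1} ≠ 0
      rw [← h1, ← h2]
      exact nbr_ne_zero_of_adj hv (measurableSet_singleton _) rfl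
    · have h3 := γ.2.2 i 2
      rw [show γ.1 (i + 2) = γ.1 i from Subtype.ext h1] at h3
      simp at h3
  · rw [bray, dif_neg h, ae_zero]
    exact Filter.eventually_bot

end ClassBranching
end HorosphericGW

namespace HorosphericGW

/-! ### The branching measure along the first edge and the shift identity -/

open ProbabilityTheory in
/-- The branching measures as a kernel. -/
def brayKernel (m : ℝ) : Kernel GraphSpace (ℕ → GraphSpace) := ⟨bray m, measurable_bray⟩

instance (m : ℝ) : ProbabilityTheory.IsSFiniteKernel (brayKernel m) :=
  have : ∀ a, IsFiniteMeasure (brayKernel m a) := fun a => inferInstanceAs (IsFiniteMeasure (bray m a))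
  isSFiniteKernel_of_isFiniteMeasure _

theorem measurable_lintegral_bray {m : ℝ} {α : Type*} [MeasurableSpace α]
    {f : α → (ℕ → GraphSpace) → ℝ≥0∞} {k : α → GraphSpace} (hf : Measurable (Function.uncurry f))
    (hk : Measurable k) : Measurable fun a => ∫⁻ s, f a s ∂bray m (k a) :=
  Measurable.lintegral_kernel_prod_right' (κ := (brayKernel m).comap k hk)
    (f := Function.uncurry f) hf

theorem measurable_avoid {F : (ℕ → GraphSpace) → ℝ≥0∞} (hF : Measurable F) :
    Measurable fun p : GraphSpace × (ℕ → GraphSpace) =>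
      open Classical in if p.2 1 = p.1 then 0 else F (scons p.1 p.2) := by
  classical
  refine Measurable.ite ?_ measurable_const (hF.comp measurable_scons)
  exact measurableSet_eq_fun ((measurable_pi_apply 1).comp measurable_snd) measurable_fst

open Classical in
/-- Integration with respect to the branching measure, split according to the first edge. -/
theorem lintegral_bray_eq {m : ℝ} (hm : 0 < m) {x : GraphSpace} (hx : x ∈ GoodClass m)
    {F : (ℕ → GraphSpace) → ℝ≥0∞} (hF : Measurable F) :
    ∫⁻ s, F s ∂bray m x = (ENNReal.ofReal m)⁻¹ *
      ∫⁻ y, ∫⁻ s, (if s 1 = x then 0 else F (scons x s)) ∂bray m y ∂nbr x := by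
  obtain ⟨g, rfl, hg⟩ := hx
  have hinj := hg.walkDistinct.clAt_injective
  have hE := measurableSet_seq_eq 1
  have hsc : Measurable (scons (g.clAt g.root)) :=
    measurable_scons.comp (measurable_const.prodMk measurable_id)
  -- Exactly one neighbour of the root is the first vertex of a given ray, so the integrand splits
  -- into cones, to which `bray_restrict` applies one by one.
  have h1 : ∫⁻ s, F s ∂bray m g.toClass = ∫⁻ s, ∑' v, (if g.graph.Adj g.root v then
      ({s : ℕ → GraphSpace | s 1 = g.clAt v}).indicator F s else 0) ∂bray m g.toClass := by
    refine lintegral_congr_ae ?_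
    filter_upwards [bray_ae g.toClass] with s ⟨hs, hs0⟩
    obtain ⟨γ, rfl⟩ := (mem_raySet_iff hg (v := g.root) hs0).1 hs
    have hadj := γ.adj 0
    rw [γ.2.1] at hadj
    rw [tsum_eq_single (γ.1 1)]
    · rw [if_pos hadj, Set.indicator_of_mem (by simp)]
    · intro v hv
      rw [Set.indicator_of_notMem, ite_self]
      exact fun h => hv (hinj h).symm
  rw [h1, lintegral_tsum fun v => by
    split_ifs
    · exact (hF.indicator (hE _)).aemeasurable
    · exact aemeasurable_const, lintegral_nbr, ← ENNReal.tsum_mul_left]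
  refine tsum_congr fun v => ?_
  split_ifs with hv
  · rw [lintegral_indicator (hE _), ← RootedGraph.clAt_root, bray_restrict hm hg hv,
      lintegral_smul_measure, lintegral_map hF hsc, smul_eq_mul]
    congr 1
    rw [← lintegral_indicator (show MeasurableSet {s : ℕ → GraphSpace | s 1 ≠ g.clAt g.root} from
      (hE _).compl)]
    refine lintegral_congr fun s => ?_
    by_cases hs : s 1 = g.clAt g.root
    · rw [Set.indicator_of_notMem
        (show s ∉ {s : ℕ → GraphSpace | s 1 ≠ g.clAt g.root} from fun h => h hs), if_pos hs]
    · rw [Set.indicator_of_mem (show s ∈ {s : ℕ → GraphSpace | s 1 ≠ g.clAt g.root} from hs),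
        if_neg hs]
  · simp

open Classical in
/-- The extension of a reversible measure by the branching measures is quasi-invariant with respect
to the shift. -/
theorem Reversible.lintegral_bind_bray {m : ℝ} (hm : 0 < m) {μ : Measure GraphSpace}
    (hμ : Reversible μ) (hgood : ∀ᵐ x ∂μ, x ∈ GoodClass m)
    {F : (ℕ → GraphSpace) → ℝ≥0∞} (hF : Measurable F) :
    ∫⁻ s, F s ∂μ.bind (bray m) = (ENNReal.ofReal m)⁻¹ *
      ∫⁻ s, ∫⁻ y, (if s 1 = y then 0 else F (scons y s)) ∂nbr (s 0) ∂μ.bind (bray m) := by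
  have hav := measurable_avoid hF
  have hm1 : Measurable fun s : ℕ → GraphSpace =>
      ∫⁻ y, (if s 1 = y then 0 else F (scons y s)) ∂nbr (s 0) :=
    measurable_lintegral_nbr (f := fun (s : ℕ → GraphSpace) y =>
      if s 1 = y then 0 else F (scons y s)) (hav.comp measurable_swap) (measurable_pi_apply 0)
  have hm2 : Measurable (Function.uncurry fun x y : GraphSpace =>
      ∫⁻ s, (if s 1 = x then 0 else F (scons x s)) ∂bray m y) :=
    measurable_lintegral_bray (f := fun (p : GraphSpace × GraphSpace) s =>
      if s 1 = p.1 then 0 else F (scons p.1 s))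
      (hav.comp ((measurable_fst.comp measurable_fst).prodMk measurable_snd)) measurable_snd
  -- The integral over rays is split along the first edge, reversibility exchanges the endpoints of
  -- that edge, and Tonelli's theorem moves the sum over neighbours inside the integral over rays.
  rw [Measure.lintegral_bind measurable_bray.aemeasurable hF.aemeasurable,
    Measure.lintegral_bind measurable_bray.aemeasurable hm1.aemeasurable,
    lintegral_congr_ae (hgood.mono fun x hx => lintegral_bray_eq hm hx hF),
    lintegral_const_mul' _ _ (by simp [hm]), hμ _ hm2]
  congr 1
  refine lintegral_congr fun x => ?_
  refine (lintegral_lintegral_swap (μ := nbr x) (ν := bray m x)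
    (f := fun y s => if s 1 = y then 0 else F (scons y s)) hav.aemeasurable).trans ?_
  refine lintegral_congr_ae ?_
  filter_upwards [bray_ae x] with s hs
  rw [hs.2]

/-! ### Invariance of reversible measures -/

section WalkOp

/-- Summation over the endpoints of the walks of length `n`. -/
def walkOp : ℕ → (GraphSpace → ℝ≥0∞) → GraphSpace → ℝ≥0∞
  | 0, f, x => f x
  | n + 1, f, x => ∫⁻ y, walkOp n f y ∂nbr x

theorem walkOp_succ' (n : ℕ) (f : GraphSpace → ℝ≥0∞) :
    walkOp n (fun x => ∫⁻ y, f y ∂nbr x) = walkOp (n + 1) f := by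
  induction n with
  | zero => rfl
  | succ n ih => ext x; rw [walkOp, ih]; rfl

theorem measurable_walkOp {α : Type*} [MeasurableSpace α] {H : α → GraphSpace → ℝ≥0∞}
    (hH : Measurable (Function.uncurry H)) (n : ℕ) :
    Measurable (Function.uncurry fun a x => walkOp n (H a) x) := by
  induction n with
  | zero => exact hH
  | succ n ih =>
    exact measurable_lintegral_nbr (f := fun (p : α × GraphSpace) y => walkOp n (H p.1) y)
      (ih.comp ((measurable_fst.comp measurable_fst).prodMk measurable_snd)) measurable_snd

theorem walkOp_lintegral {α : Type*} [MeasurableSpace α] {ρ : Measure α} [IsFiniteMeasure ρ]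
    {H : α → GraphSpace → ℝ≥0∞} (hH : Measurable (Function.uncurry H)) (n : ℕ) (x : GraphSpace) :
    walkOp n (fun z => ∫⁻ a, H a z ∂ρ) x = ∫⁻ a, walkOp n (H a) x ∂ρ := by
  induction n generalizing x with
  | zero => rfl
  | succ n ih =>
    simp only [walkOp, ih]
    exact lintegral_lintegral_swap ((measurable_walkOp hH n).comp measurable_swap).aemeasurable

/-- Reversibility reverses one step; the remaining `n` steps are reversed by the induction
hypothesis, applied to `H` summed over one move of the root. -/
theorem Reversible.lintegral_walkOp {M : Measure GraphSpace} (hM : Reversible M)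
    {H : GraphSpace → GraphSpace → ℝ≥0∞} (hH : Measurable (Function.uncurry H)) (n : ℕ) :
    ∫⁻ x, walkOp n (H x) x ∂M = ∫⁻ x, walkOp n (fun z => H z x) x ∂M := by
  induction n generalizing H with
  | zero => rfl
  | succ n ih =>
    have h1 := hM (fun x y => walkOp n (H x) y) (measurable_walkOp hH n)
    have h2 : Measurable (Function.uncurry fun x z => ∫⁻ y, H y z ∂nbr x) :=
      measurable_lintegral_nbr (f := fun (p : GraphSpace × GraphSpace) y => H y p.2)
        (hH.comp (measurable_snd.prodMk (measurable_snd.comp measurable_fst))) measurable_fst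
    have h3 := ih h2
    simp only [walkOp_lintegral hH] at h3
    have h4 : ∀ x, walkOp n (fun z => ∫⁻ y, H y x ∂nbr z) x =
        walkOp (n + 1) (fun z => H z x) x := fun x => by rw [walkOp_succ']
    simp only [h4] at h3
    rw [← h3]
    exact h1

open Classical in
/-- The number of walks of length `n` between two vertices. -/
def walkNum {V : Type*} (G : SimpleGraph V) : ℕ → V → V → ℝ≥0∞
  | 0, u, v => if u = v then 1 else 0
  | n + 1, u, v => ∑' w, (if G.Adj u w then 1 else 0) * walkNum G n w v

variable {V : Type*} {G : SimpleGraph V}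

open Classical in
theorem walkNum_succ' (n : ℕ) (u v : V) :
    walkNum G (n + 1) u v = ∑' w, walkNum G n u w * (if G.Adj w v then 1 else 0) := by
  induction n generalizing u with
  | zero =>
    rw [walkNum, tsum_eq_single v, tsum_eq_single u]
    · simp [walkNum]
    · intro w hw; simp [walkNum, hw.symm]
    · intro w hw; simp [walkNum, hw]
  | succ n ih =>
    rw [walkNum]
    simp only [ih]
    simp only [walkNum, ← ENNReal.tsum_mul_left, ← ENNReal.tsum_mul_right]
    rw [ENNReal.tsum_comm]
    simp only [mul_assoc]

theorem walkNum_comm (n : ℕ) (u v : V) : walkNum G n u v = walkNum G n v u := by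
  induction n generalizing u v with
  | zero =>
    by_cases h : u = v
    · rw [h]
    · simp [walkNum, h, Ne.symm h]
  | succ n ih =>
    rw [walkNum_succ', walkNum]
    refine tsum_congr fun w => ?_
    rw [ih, mul_comm, G.adj_comm]

theorem walkNum_lt_top (hf : ∀ v, (G.neighborSet v).Finite) (n : ℕ) (u v : V) :
    walkNum G n u v < ⊤ := by
  classical
  induction n generalizing u with
  | zero => rw [walkNum]; split_ifs <;> simp
  | succ n ih =>
    rw [walkNum, tsum_eq_sum (s := (hf u).toFinset)]
    · exact ENNReal.sum_lt_top.2 fun w _ => ENNReal.mul_lt_top (by split_ifs <;> simp) (ih w)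
    · intro w hw
      rw [if_neg, zero_mul]
      simpa using hw

theorem walkNum_length_ne_zero {u v : V} (p : G.Walk u v) : walkNum G p.length u v ≠ 0 := by
  induction p with
  | nil => simp [walkNum]
  | @cons u w v h p ih =>
    rw [SimpleGraph.Walk.length_cons, walkNum, Ne, ENNReal.tsum_eq_zero, not_forall]
    exact ⟨w, by simp [h, ih]⟩

theorem walkOp_clAt (g : RootedGraph) (n : ℕ) (f : GraphSpace → ℝ≥0∞) (u : ℕ) :
    walkOp n f (g.clAt u) = ∑' v, walkNum g.graph n u v * f (g.clAt v) := by
  classical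
  induction n generalizing u with
  | zero =>
    rw [tsum_eq_single u]
    · simp [walkNum, walkOp]
    · intro v hv; simp [walkNum, hv.symm]
  | succ n ih =>
    rw [walkOp, show g.clAt u = (g.reroot u).toClass from rfl, lintegral_nbr]
    change (∑' w, if g.graph.Adj u w then walkOp n f (g.clAt w) else 0) = _
    simp only [walkNum, ih, ← ENNReal.tsum_mul_right]
    rw [ENNReal.tsum_comm]
    refine tsum_congr fun w => ?_
    split_ifs with h <;> simp

open Classical in
/-- The weight which singles out the walks of minimal length. -/
def firstWeight (c : ℕ → ℝ≥0∞) (n : ℕ) : ℝ≥0∞ :=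
  if (∀ k < n, c k = 0) ∧ c n ≠ 0 then (c n)⁻¹ else 0

/-- Only the least `n` with `c n ≠ 0` contributes. With `c` counting walks between two vertices,
each pair receives total weight one, shared equally by its shortest walks. -/
theorem tsum_firstWeight {c : ℕ → ℝ≥0∞} (h : ∃ n, c n ≠ 0) (hc : ∀ n, c n ≠ ⊤) :
    ∑' n, c n * firstWeight c n = 1 := by
  classical
  rw [tsum_eq_single (Nat.find h)]
  · rw [firstWeight, if_pos ⟨fun k hk => not_not.1 (Nat.find_min h hk), Nat.find_spec h⟩]
    exact ENNReal.mul_inv_cancel (Nat.find_spec h) (hc _)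
  · intro n hn
    rw [firstWeight, if_neg, mul_zero]
    rintro ⟨h1, h2⟩
    rcases lt_trichotomy n (Nat.find h) with h3 | h3 | h3
    · exact Nat.find_min h h3 h2
    · exact hn h3
    · exact Nat.find_spec h (h1 _ h3)

/-- The classes of graphs with distinguishable vertices. -/
def DistinctClass : Set GraphSpace :=
  {Γ | ∃ g : RootedGraph, g.toClass = Γ ∧ WalkDistinct g.graph}

theorem clAt_mem_distinctClass {g : RootedGraph} {v : ℕ} :
    g.clAt v ∈ DistinctClass ↔ WalkDistinct g.graph := by
  refine ⟨fun ⟨h, h1, h2⟩ => ?_, fun h => ⟨g.reroot v, rfl, h⟩⟩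
  obtain ⟨e, -⟩ := RootedGraph.toClass_eq_iff.1 (show h.toClass = (g.reroot v).toClass from h1)
  exact h2.congr e

theorem measurableSet_distinctClass : MeasurableSet DistinctClass := by
  refine measurableSet_setOfPred.2 (measurable_of_toClass ?_)
  change Measurable fun g : RootedGraph => g.clAt g.root ∈ DistinctClass
  simp only [clAt_mem_distinctClass]
  refine .forall fun o => .forall fun v => Measurable.imp (.forall fun n => ?_) measurable_const
  exact measurableSet_setOfPred.1 (measurableSet_eq_fun
    (measurable_wcount measurable_adj n v) (measurable_wcount measurable_adj n o))

theorem rel_mem_distinctClass {x y : GraphSpace} (h : GraphSpace.Rel x y) :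
    x ∈ DistinctClass ↔ y ∈ DistinctClass := by
  obtain ⟨g, rfl⟩ := exists_rep x
  obtain ⟨v, rfl⟩ := rel_clAt_iff.1 h
  rw [← g.clAt_root, clAt_mem_distinctClass, clAt_mem_distinctClass]

theorem distinctClass_isRigid {x : GraphSpace} (hx : x ∈ DistinctClass) : x.IsRigid := by
  rintro g rfl
  rw [← g.clAt_root, clAt_mem_distinctClass] at hx
  exact hx.isRigidGraph

/-- A reversible measure carried by graphs with distinguishable vertices is preserved by partial
transformations. -/
theorem Reversible.measure_eq {M : Measure GraphSpace} (hM : Reversible M)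
    (hD : ∀ᵐ x ∂M, x ∈ DistinctClass) {S R : Set GraphSpace} (hS : MeasurableSet S)
    (hR : MeasurableSet R) {ψ : GraphSpace → GraphSpace} (hψ : Measurable ψ)
    (hb : Set.BijOn ψ S R) (hrel : ∀ x ∈ S, GraphSpace.Rel x (ψ x)) : M S = M R := by
  classical
  -- On distinguishable graphs this is the number of walks of length `n` from `x` to `y`, in a form
  -- that is measurable in the two classes.
  let c : GraphSpace → GraphSpace → ℕ → ℝ≥0∞ := fun x y n =>
    walkOp n (fun z => if y = z then 1 else 0) x
  have hc : ∀ n, Measurable fun p : GraphSpace × GraphSpace => c p.1 p.2 n := fun n =>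
    (measurable_walkOp (H := fun y z : GraphSpace => if y = z then (1 : ℝ≥0∞) else 0)
      (Measurable.ite (measurableSet_eq_fun measurable_fst measurable_snd)
        measurable_const measurable_const) n).comp measurable_swap
  -- Mass transport: each `x ∈ S` sends unit mass to `ψ x` along the shortest walks. The mass sent
  -- is the indicator of `S`, the mass received is the indicator of `R` because `ψ` is bijective,
  -- and reversibility equates the two means for each length `n`.
  let H : ℕ → GraphSpace → GraphSpace → ℝ≥0∞ := fun n x y =>
    if x ∈ S ∧ ψ x = y then firstWeight (c x y) n else 0
  have hH : ∀ n, Measurable (Function.uncurry (H n)) := fun n => by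
    refine Measurable.ite ?_ ?_ measurable_const
    · exact (measurable_fst hS).inter (measurableSet_eq_fun (hψ.comp measurable_fst) measurable_snd)
    · refine Measurable.ite ?_ (hc n).inv measurable_const
      refine measurableSet_setOfPred.2 (.and (.forall fun k => measurable_const.imp ?_) ?_)
      · exact measurableSet_setOfPred.1 ((hc k) (measurableSet_singleton 0))
      · exact measurableSet_setOfPred.1 ((hc n) (measurableSet_singleton 0)).compl
  have hcl : ∀ (g : RootedGraph), WalkDistinct g.graph → ∀ u v n,
      c (g.clAt u) (g.clAt v) n = walkNum g.graph n u v := fun g hg u v n => by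
    simp only [c, walkOp_clAt, hg.clAt_injective.eq_iff]
    rw [tsum_eq_single v]
    · simp
    · intro w hw; simp [hw.symm]
  have hsum : ∀ (g : RootedGraph), WalkDistinct g.graph → ∀ u v,
      ∑' n, walkNum g.graph n u v * firstWeight (c (g.clAt u) (g.clAt v)) n = 1 :=
    fun g hg u v => by
      have h1 : c (g.clAt u) (g.clAt v) = fun n => walkNum g.graph n u v := funext (hcl g hg u v)
      rw [h1]
      obtain ⟨p⟩ := g.connected u v
      exact tsum_firstWeight ⟨_, walkNum_length_ne_zero p⟩
        fun n => (walkNum_lt_top g.locallyFinite n u v).ne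
  have h1 : ∀ x ∈ DistinctClass, ∑' n, walkOp n (H n x) x = S.indicator 1 x := by
    rintro x hx
    obtain ⟨g, rfl⟩ := exists_rep x
    rw [← g.clAt_root, clAt_mem_distinctClass] at hx
    rw [← g.clAt_root]
    simp only [walkOp_clAt]
    rw [ENNReal.tsum_comm]
    by_cases hxS : g.clAt g.root ∈ S
    · obtain ⟨v, hv⟩ := rel_clAt_iff.1 (hrel _ hxS)
      rw [Set.indicator_of_mem hxS, tsum_eq_single v]
      · rw [Pi.one_apply]
        simp only [H, hxS, ← hv, true_and, if_true]
        exact hsum g hx _ _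
      · intro w hw
        have : ψ (g.clAt g.root) ≠ g.clAt w := fun h =>
          hw (hx.clAt_injective (hv.trans h).symm)
        simp [H, this, -RootedGraph.clAt_root]
    · rw [Set.indicator_of_notMem hxS]
      simp only [H, hxS, false_and, if_false, mul_zero, tsum_zero]
  -- The mass received is computed along walks issued from the receiving vertex; the symmetry
  -- `walkNum_comm` turns them into walks from the sender.
  have h2 : ∀ x ∈ DistinctClass, ∑' n, walkOp n (fun z => H n z x) x = R.indicator 1 x := by
    rintro x hx
    obtain ⟨g, rfl⟩ := exists_rep x
    rw [← g.clAt_root, clAt_mem_distinctClass] at hx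
    rw [← g.clAt_root]
    simp only [walkOp_clAt]
    rw [ENNReal.tsum_comm]
    by_cases hxR : g.clAt g.root ∈ R
    · obtain ⟨y, hy, hyx⟩ := hb.surjOn hxR
      obtain ⟨g', rfl⟩ := exists_rep y
      obtain ⟨u, hu⟩ : ∃ u, g.clAt u = g'.toClass := by
        have := hrel _ hy
        rw [hyx, ← g'.clAt_root, rel_clAt_iff] at this
        obtain ⟨v, hv⟩ := this
        obtain ⟨e, he⟩ := RootedGraph.clAt_eq_iff.1 hv
        exact ⟨e g'.root, RootedGraph.clAt_eq_iff.2 ⟨e.symm, e.symm_apply_apply _⟩⟩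
      rw [← hu] at hy hyx
      rw [Set.indicator_of_mem hxR, tsum_eq_single u]
      · simp only [H, hy, hyx, true_and, if_true]
        simp only [walkNum_comm _ g.root u]
        exact hsum g hx _ _
      · intro w hw
        have : ¬ (g.clAt w ∈ S ∧ ψ (g.clAt w) = g.clAt g.root) := fun h =>
          hw (hx.clAt_injective (hb.injOn h.1 hy (h.2.trans hyx.symm)))
        simp [H, this, -RootedGraph.clAt_root]
    · rw [Set.indicator_of_notMem hxR]
      have : ∀ w, ¬ (g.clAt w ∈ S ∧ ψ (g.clAt w) = g.clAt g.root) := fun w h =>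
        hxR (h.2 ▸ hb.mapsTo h.1)
      simp only [H, this, if_false, mul_zero, tsum_zero]
  have m1 : ∀ n, Measurable fun x => walkOp n (H n x) x := fun n =>
    (measurable_walkOp (hH n) n).comp (measurable_id.prodMk measurable_id)
  have m2 : ∀ n, Measurable fun x => walkOp n (fun z => H n z x) x := fun n =>
    (measurable_walkOp (H := fun x z => H n z x) ((hH n).comp measurable_swap) n).comp
      (measurable_id.prodMk measurable_id)
  rw [← lintegral_indicator_one hS, ← lintegral_indicator_one hR,
    ← lintegral_congr_ae (hD.mono h1), ← lintegral_congr_ae (hD.mono h2),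
    lintegral_tsum fun n => (m1 n).aemeasurable, lintegral_tsum fun n => (m2 n).aemeasurable]
  exact tsum_congr fun n => hM.lintegral_walkOp (hH n) n

/-- A reversible measure carried by graphs with distinguishable vertices is invariant. -/
theorem Reversible.isRelInvariant {M : Measure GraphSpace} (hM : Reversible M)
    (hD : ∀ᵐ x ∂M, x ∈ DistinctClass) {N : Measure RigidGraph} (hN : N.map Subtype.val = M) :
    IsRelInvariant N := by
  classical
  intro A B φ hA hB hφ hbij hrel
  ext C hC
  rw [Measure.map_apply hφ hC, Measure.restrict_apply (hφ hC), Measure.restrict_apply hC]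
  have hval : Measurable (Subtype.val : RigidGraph → GraphSpace) := measurable_subtype_coe
  -- The rigid classes are not known to form a Borel set. A measurable set of rigid classes is the
  -- trace of a Borel set, and cutting that down to the Borel set `DistinctClass` of full measure
  -- loses nothing.
  have key : ∀ S : Set RigidGraph, MeasurableSet S → ∃ S₀ : Set GraphSpace, MeasurableSet S₀ ∧
      S₀ ⊆ DistinctClass ∧ N S = M S₀ ∧ ∀ x : RigidGraph, x.1 ∈ S₀ ↔ x ∈ S ∧ x.1 ∈ DistinctClass := by
    rintro _ ⟨S₀, hS₀, rfl⟩
    refine ⟨S₀ ∩ DistinctClass, hS₀.inter measurableSet_distinctClass, Set.inter_subset_right, ?_,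
      fun x => Iff.rfl⟩
    rw [← Measure.map_apply hval hS₀, hN]
    exact (measure_inter_conull' (by exact measure_mono_null (Set.diff_subset_compl _ _) hD)).symm
  obtain ⟨S, hS, hSD, hNS, hSmem⟩ := key _ ((hφ hC).inter hA)
  obtain ⟨R, hR, hRD, hNR, hRmem⟩ := key _ (hC.inter hB)
  rw [hNS, hNR]
  -- The value off `DistinctClass` is immaterial, since `S` is contained in it.
  let ψ : GraphSpace → GraphSpace := fun x =>
    if h : x ∈ DistinctClass then (φ ⟨x, distinctClass_isRigid h⟩).1 else x
  have hψ : Measurable ψ := by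
    refine Measurable.dite (s := DistinctClass) (f := fun x => (φ ⟨x.1, distinctClass_isRigid x.2⟩).1)
      (g := fun x => x.1) ?_ measurable_subtype_coe measurableSet_distinctClass
    exact hval.comp (hφ.comp (measurable_subtype_coe.subtype_mk))
  have hψφ : ∀ x (h : x ∈ DistinctClass), ψ x = (φ ⟨x, distinctClass_isRigid h⟩).1 :=
    fun x h => dif_pos h
  refine hM.measure_eq hD hS hR hψ ⟨?_, ?_, ?_⟩ ?_
  · intro x hx
    have h1 := (hSmem ⟨x, distinctClass_isRigid (hSD hx)⟩).1 hx
    rw [hψφ x h1.2, hRmem]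
    exact ⟨⟨h1.1.1, hbij.mapsTo h1.1.2⟩, (rel_mem_distinctClass (hrel _ h1.1.2)).1 h1.2⟩
  · intro x hx y hy hxy
    have h1 := (hSmem ⟨x, distinctClass_isRigid (hSD hx)⟩).1 hx
    have h2 := (hSmem ⟨y, distinctClass_isRigid (hSD hy)⟩).1 hy
    rw [hψφ x h1.2, hψφ y h2.2] at hxy
    exact congrArg Subtype.val (hbij.injOn h1.1.2 h2.1.2 (Subtype.ext hxy))
  · intro y hy
    have h1 := (hRmem ⟨y, distinctClass_isRigid (hRD hy)⟩).1 hy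
    obtain ⟨x, hx, hxy⟩ := hbij.surjOn h1.1.2
    have hxD : x.1 ∈ DistinctClass := by
      rw [rel_mem_distinctClass (hrel x hx), hxy]; exact h1.2
    refine ⟨x.1, (hSmem x).2 ⟨⟨?_, hx⟩, hxD⟩, ?_⟩
    · rw [Set.mem_preimage, hxy]; exact h1.1.1
    · rw [hψφ x.1 hxD]
      exact congrArg Subtype.val hxy
  · intro x hx
    have h1 := (hSmem ⟨x, distinctClass_isRigid (hSD hx)⟩).1 hx
    rw [hψφ x h1.2]
    exact hrel _ h1.1.2

end WalkOp
end HorosphericGW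

namespace HorosphericGW

/-! ### Horofunctions on trees -/

section Horofunctions

variable {V V' : Type*} {G : SimpleGraph V} {o : V}

theorem busemann_eq_of_eventually {γ : Boundary G o} {x : V} {k : ℤ}
    (h : ∀ᶠ n : ℕ in atTop, (G.dist x (γ.1 n) : ℤ) = n + k) : busemann G γ o x = k := by
  refine Tendsto.limUnder_eq (tendsto_const_nhds.congr' ?_)
  filter_upwards [h] with n hn
  rw [hn, γ.dist_root]
  omega

/-- The integer `d(x, γ n) - n` does not increase with `n` and is at least `-d(o, x)`, so it is
eventually constant, and the limit in the Busemann cocycle is attained. -/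
theorem exists_eventually_dist (hG : G.Connected) (γ : Boundary G o) (x : V) :
    ∃ N : ℕ, ∀ n ≥ N, (G.dist x (γ.1 n) : ℤ) = n + busemann G γ o x := by
  have hmono : ∀ n, G.dist x (γ.1 (n + 1)) ≤ G.dist x (γ.1 n) + 1 := fun n => by
    have h1 := hG.dist_triangle (u := x) (v := γ.1 n) (w := γ.1 (n + 1))
    rw [γ.2.2 n 1] at h1
    exact h1
  have hbd : ∀ n, n ≤ G.dist x (γ.1 n) + G.dist o x := fun n => by
    have h1 := hG.dist_triangle (u := o) (v := x) (w := γ.1 n)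
    rw [γ.dist_root] at h1
    omega
  let f : ℕ → ℕ := fun n => G.dist x (γ.1 n) + G.dist o x - n
  obtain ⟨N, hN⟩ : ∃ N, ∀ n ≥ N, f n = f N := by
    have hanti : Antitone f := antitone_nat_of_succ_le fun n => by
      have := hmono n; have := hbd n; have := hbd (n + 1)
      simp only [f]; omega
    obtain ⟨N, hN⟩ := Nat.sInf_mem (Set.range_nonempty f)
    exact ⟨N, fun n hn => le_antisymm (hanti hn) (hN ▸ Nat.sInf_le ⟨n, rfl⟩)⟩
  have hk : ∀ n ≥ N, (G.dist x (γ.1 n) : ℤ) = n + ((f N : ℤ) - G.dist o x) := fun n hn => by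
    have h1 := hN n hn
    have h2 := hbd n
    simp only [f] at h1 ⊢
    have h3 := hbd N
    omega
  refine ⟨N, fun n hn => ?_⟩
  rw [busemann_eq_of_eventually ((eventually_ge_atTop N).mono hk), hk n hn]

theorem busemann_eq_iff (hG : G.Connected) {γ : Boundary G o} {x : V} {k : ℤ} :
    busemann G γ o x = k ↔ ∃ N : ℕ, ∀ n ≥ N, (G.dist x (γ.1 n) : ℤ) = n + k := by
  constructor
  · rintro rfl
    exact exists_eventually_dist hG γ x
  · rintro ⟨N, hN⟩
    exact busemann_eq_of_eventually ((eventually_ge_atTop N).mono hN)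

theorem busemann_ray (hG : G.Connected) (γ : Boundary G o) (i : ℕ) :
    busemann G γ o (γ.1 i) = -i := by
  refine (busemann_eq_iff hG).2 ⟨i, fun n hn => ?_⟩
  obtain ⟨j, rfl⟩ := Nat.exists_eq_add_of_le hn
  rw [γ.2.2]
  push_cast
  ring

theorem busemann_adj (hG : G.IsTree) (γ : Boundary G o) {x y : V} (h : G.Adj x y) :
    busemann G γ o y = busemann G γ o x + 1 ∨ busemann G γ o x = busemann G γ o y + 1 := by
  obtain ⟨N, hN⟩ := exists_eventually_dist hG.connected γ x
  obtain ⟨N', hN'⟩ := exists_eventually_dist hG.connected γ y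
  have h1 := hN (max N N') (le_max_left _ _)
  have h2 := hN' (max N N') (le_max_right _ _)
  have h3 := tree_dist_adj hG (γ.1 (max N N')) h
  rw [G.dist_comm (v := x), G.dist_comm (v := y)] at h3
  omega

/-- Existence: the first vertex on the geodesic from `x` to a far point of the ray stays closer than
`x` to all later points. Uniqueness: two candidates would both be closer than `x` to some far point
of the ray. -/
theorem exists_parent (hG : G.IsTree) (γ : Boundary G o) (x : V) :
    ∃! y, G.Adj x y ∧ busemann G γ o x = busemann G γ o y + 1 := by
  obtain ⟨N, hN⟩ := exists_eventually_dist hG.connected γ x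
  obtain ⟨n, hn, hpos⟩ : ∃ n ≥ N, 0 < G.dist x (γ.1 n) := by
    have h1 := hN (N + (busemann G γ o x).natAbs + 1) (by omega)
    exact ⟨N + (busemann G γ o x).natAbs + 1, by omega, by omega⟩
  obtain ⟨d, hd⟩ := Nat.exists_eq_succ_of_ne_zero hpos.ne'
  rw [G.dist_comm] at hd
  obtain ⟨y, hxy, hyd⟩ := exists_adj_dist hG.connected hd
  have hxy' : G.Adj x y := by first | exact hxy | exact hxy.symm
  have hy : ∀ j, G.dist x (γ.1 (n + j)) = G.dist y (γ.1 (n + j)) + 1 := by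
    intro j
    induction j with
    | zero =>
      change G.dist x (γ.1 n) = G.dist y (γ.1 n) + 1
      rw [G.dist_comm, hd, G.dist_comm, hyd]
    | succ j ih =>
      have h1 := hN (n + j) (by omega)
      have h2 := hN (n + (j + 1)) (by omega)
      have h3 := hG.connected.dist_triangle (u := y) (v := γ.1 (n + j)) (w := γ.1 (n + j + 1))
      rw [γ.2.2 (n + j) 1] at h3
      have h4 := tree_dist_adj hG (γ.1 (n + (j + 1))) hxy'
      rw [G.dist_comm (v := x), G.dist_comm (v := y)] at h4
      rw [← add_assoc] at h2 h4 ⊢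
      push_cast at h2
      omega
  refine ⟨y, ⟨hxy', ?_⟩, ?_⟩
  · have : busemann G γ o y = busemann G γ o x - 1 := by
      refine (busemann_eq_iff hG.connected).2 ⟨n, fun k hk => ?_⟩
      obtain ⟨j, rfl⟩ := Nat.exists_eq_add_of_le hk
      have h1 := hy j
      have h2 := hN (n + j) (by omega)
      omega
    omega
  · rintro z ⟨hz, hzh⟩
    obtain ⟨N', hN'⟩ := exists_eventually_dist hG.connected γ z
    obtain ⟨j, hj⟩ : ∃ j, N' ≤ n + j := ⟨N', by omega⟩
    have h1 := hN' (n + j) hj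
    have h2 := hN (n + j) (by omega)
    have h3 := hy j
    refine tree_closer_unique hG (z := γ.1 (n + j)) hz hxy' ?_ ?_
    · rw [G.dist_comm, G.dist_comm (v := z)]; omega
    · rw [G.dist_comm, G.dist_comm (v := y)]; omega

open Classical in
/-- The next vertex on the ray towards a boundary point. -/
def parent (G : SimpleGraph V) {o : V} (γ : Boundary G o) (x : V) : V :=
  if h : ∃ y, G.Adj x y ∧ busemann G γ o x = busemann G γ o y + 1 then h.choose else x

theorem parent_spec (hG : G.IsTree) (γ : Boundary G o) (x : V) :
    G.Adj x (parent G γ x) ∧ busemann G γ o x = busemann G γ o (parent G γ x) + 1 := by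
  rw [parent, dif_pos (exists_parent hG γ x).exists]
  exact (exists_parent hG γ x).exists.choose_spec

theorem eq_parent (hG : G.IsTree) (γ : Boundary G o) {x y : V} (h : G.Adj x y)
    (hy : busemann G γ o x = busemann G γ o y + 1) : parent G γ x = y :=
  (exists_parent hG γ x).unique (parent_spec hG γ x) ⟨h, hy⟩

theorem adj_iff_parent (hG : G.IsTree) (γ : Boundary G o) {x y : V} :
    G.Adj x y ↔ parent G γ x = y ∨ parent G γ y = x := by
  constructor
  · intro h
    rcases busemann_adj hG γ h with h1 | h1
    · exact Or.inr (eq_parent hG γ h.symm h1)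
    · exact Or.inl (eq_parent hG γ h h1)
  · rintro (rfl | rfl)
    · exact (parent_spec hG γ x).1
    · exact (parent_spec hG γ y).1.symm

theorem parent_ray (hG : G.IsTree) (γ : Boundary G o) (i : ℕ) :
    parent G γ (γ.1 i) = γ.1 (i + 1) :=
  eq_parent hG γ (γ.adj i) (by
    rw [busemann_ray hG.connected, busemann_ray hG.connected]; push_cast; ring)

theorem parent_iterate_ray (hG : G.IsTree) (γ : Boundary G o) (i k : ℕ) :
    (parent G γ)^[k] (γ.1 i) = γ.1 (i + k) := by
  induction k generalizing i with
  | zero => rfl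
  | succ k ih => rw [Function.iterate_succ_apply, parent_ray hG, ih]; exact congrArg γ.1 (by omega)

theorem busemann_parent_iterate (hG : G.IsTree) (γ : Boundary G o) (x : V) (k : ℕ) :
    busemann G γ o ((parent G γ)^[k] x) = busemann G γ o x - k := by
  induction k generalizing x with
  | zero => simp
  | succ k ih =>
    rw [Function.iterate_succ_apply, ih]
    have := (parent_spec hG γ x).2
    push_cast
    omega

/-- Every vertex eventually joins the distinguished ray. -/
theorem exists_parent_iterate (hG : G.IsTree) (γ : Boundary G o) (x : V) :
    ∃ k n, (parent G γ)^[k] x = γ.1 n := by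
  -- The threshold `n` does not have to grow when `x` is replaced by its parent, so the distance to
  -- the fixed point `γ n` drops by one at each step and reaches zero.
  have step : ∀ x n, (∀ k ≥ n, (G.dist x (γ.1 k) : ℤ) = k + busemann G γ o x) →
      0 < G.dist x (γ.1 n) →
      (∀ k ≥ n, (G.dist (parent G γ x) (γ.1 k) : ℤ) = k + busemann G γ o (parent G γ x)) ∧
      G.dist x (γ.1 n) = G.dist (parent G γ x) (γ.1 n) + 1 := by
    intro x n hx hpos
    obtain ⟨N, hN⟩ := exists_eventually_dist hG.connected γ (parent G γ x)
    have hp := parent_spec hG γ x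
    have hk : ∀ k ≥ n, (G.dist (parent G γ x) (γ.1 k) : ℤ) =
        k + busemann G γ o (parent G γ x) := by
      intro k hk
      have h1 := hx k hk
      have h2 := tree_dist_adj hG (γ.1 k) hp.1
      rw [G.dist_comm (v := x), G.dist_comm (v := parent G γ x)] at h2
      rcases h2 with h2 | h2
      · omega
      · exfalso
        have h3 := hN (max N k) (le_max_left _ _)
        have h4 := hx (max N k) (hk.trans (le_max_right _ _))
        have h5 : ∀ j, G.dist x (γ.1 k) + j = G.dist x (γ.1 (k + j)) := fun j => by
          have := hx (k + j) (by omega)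
          push_cast at this
          omega
        have hcl : ∃ u, G.Adj x u ∧ G.dist x (γ.1 k) = G.dist u (γ.1 k) + 1 := by
          have hpos' : G.dist x (γ.1 k) ≠ 0 := by
            have := hx n le_rfl
            omega
          obtain ⟨d, hd⟩ := Nat.exists_eq_succ_of_ne_zero hpos'
          rw [G.dist_comm] at hd
          obtain ⟨u, hu, hud⟩ := exists_adj_dist hG.connected hd
          refine ⟨u, by first | exact hu | exact hu.symm, ?_⟩
          rw [G.dist_comm, hd, G.dist_comm, hud]
        obtain ⟨u, hu, hud⟩ := hcl
        obtain ⟨j, hj⟩ := Nat.exists_eq_add_of_le (le_max_right N k)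
        rw [hj] at h3 h4
        have h6 := hG.connected.dist_triangle (u := u) (v := γ.1 k) (w := γ.1 (k + j))
        rw [γ.2.2 k j] at h6
        have h7 := h5 j
        have h8 := tree_dist_adj hG (γ.1 (k + j)) hu
        rw [G.dist_comm (v := x), G.dist_comm (v := u)] at h8
        have h9 : u = parent G γ x := by
          refine tree_closer_unique hG (z := γ.1 (k + j)) hu hp.1 ?_ ?_
          · rw [G.dist_comm, G.dist_comm (v := u)]; omega
          · rw [G.dist_comm, G.dist_comm (v := parent G γ x)]; omega
        rw [h9] at hud
        omega
    refine ⟨hk, ?_⟩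
    have h1 := hx n le_rfl
    have h2 := hk n le_rfl
    omega
  obtain ⟨N, hN⟩ := exists_eventually_dist hG.connected γ x
  obtain ⟨d, hd⟩ : ∃ d, G.dist x (γ.1 N) = d := ⟨_, rfl⟩
  induction d generalizing x with
  | zero => exact ⟨0, N, hG.connected.dist_eq_zero_iff.1 hd⟩
  | succ d ih =>
    obtain ⟨h1, h2⟩ := step x N hN (by omega)
    obtain ⟨k, n, hk⟩ := ih (parent G γ x) h1 (by omega)
    exact ⟨k + 1, n, hk⟩

theorem exists_child (hG : G.IsTree) (γ : Boundary G o)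
    (hdeg : ∀ x, ∃ u v, u ≠ v ∧ G.Adj x u ∧ G.Adj x v) (x : V) : ∃ y, parent G γ y = x := by
  obtain ⟨u, v, huv, hu, hv⟩ := hdeg x
  rw [adj_iff_parent hG γ] at hu hv
  rcases hu with hu | hu
  · rcases hv with hv | hv
    · exact (huv (hu.symm.trans hv)).elim
    · exact ⟨v, hv⟩
  · exact ⟨u, hu⟩

theorem exists_descendant (hG : G.IsTree) (γ : Boundary G o)
    (hdeg : ∀ x, ∃ u v, u ≠ v ∧ G.Adj x u ∧ G.Adj x v) (x : V) (k : ℕ) :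
    ∃ y, (parent G γ)^[k] y = x := by
  induction k generalizing x with
  | zero => exact ⟨x, rfl⟩
  | succ k ih =>
    obtain ⟨y, hy⟩ := exists_child hG γ hdeg x
    obtain ⟨z, hz⟩ := ih y
    exact ⟨z, by rw [Function.iterate_succ_apply', hz, hy]⟩

theorem busemann_root_adj (hG : G.IsTree) (γ : Boundary G o) {x : V} (hx : G.Adj o x) :
    (x = γ.1 1 ∧ busemann G γ o x = -1) ∨ (x ≠ γ.1 1 ∧ busemann G γ o x = 1) := by
  have h0 := busemann_adj hG γ hx
  rw [busemann_self] at h0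
  have h1 := parent_ray hG γ 0
  rw [γ.2.1] at h1
  rcases h0 with h0 | h0
  · refine Or.inr ⟨?_, by omega⟩
    rintro rfl
    rw [busemann_ray hG.connected] at h0
    simp at h0
  · refine Or.inl ⟨?_, by omega⟩
    rw [← h1, eq_parent hG γ hx (by rw [busemann_self]; omega)]

end Horofunctions

/-! ### Horospheric products -/

section HorosphericProducts

variable {V V' : Type*} {G : SimpleGraph V} {G' : SimpleGraph V'} {o : V} {o' : V'}
  {γ : Boundary G o} {γ' : Boundary G' o'}

/-- One coordinate moves towards its end while the other moves away from its end, which keeps the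
sum of the horofunctions equal to zero. -/
theorem horospheric_climb (hG : G.IsTree) (hG' : G'.IsTree) (k : ℕ) (x : V) (z : V')
    (h : busemann G γ o x + busemann G' γ' o' ((parent G' γ')^[k] z) = 0) :
    ∃ h', (horosphericProduct G γ G' γ').Reachable ⟨(x, (parent G' γ')^[k] z), h⟩
      ⟨((parent G γ)^[k] x, z), h'⟩ := by
  induction k generalizing z with
  | zero => exact ⟨h, .refl _⟩
  | succ k ih =>
    obtain ⟨h1, h2⟩ := ih (parent G' γ' z) h
    have h3 := parent_spec hG' γ' z
    have h4 := parent_spec hG γ ((parent G γ)^[k] x)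
    have h5 : busemann G γ o ((parent G γ)^[k] x) + busemann G' γ' o' (parent G' γ' z) = 0 := h1
    refine ⟨?_, h2.trans (SimpleGraph.Adj.reachable ⟨?_, h3.1.symm⟩)⟩
    · change busemann G γ o ((parent G γ)^[k + 1] x) + busemann G' γ' o' z = 0
      rw [Function.iterate_succ_apply']
      omega
    · change G.Adj ((parent G γ)^[k] x) ((parent G γ)^[k + 1] x)
      rw [Function.iterate_succ_apply']
      exact h4.1

theorem horospheric_climb' (hG : G.IsTree) (hG' : G'.IsTree) (k : ℕ) (z : V) (x : V')
    (h : busemann G γ o ((parent G γ)^[k] z) + busemann G' γ' o' x = 0) :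
    ∃ h', (horosphericProduct G γ G' γ').Reachable ⟨((parent G γ)^[k] z, x), h⟩
      ⟨(z, (parent G' γ')^[k] x), h'⟩ := by
  induction k generalizing z with
  | zero => exact ⟨h, .refl _⟩
  | succ k ih =>
    obtain ⟨h1, h2⟩ := ih (parent G γ z) h
    have h3 := parent_spec hG γ z
    have h4 := parent_spec hG' γ' ((parent G' γ')^[k] x)
    have h5 : busemann G γ o (parent G γ z) + busemann G' γ' o' ((parent G' γ')^[k] x) = 0 := h1
    refine ⟨?_, h2.trans (SimpleGraph.Adj.reachable ⟨h3.1.symm, ?_⟩)⟩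
    · change busemann G γ o z + busemann G' γ' o' ((parent G' γ')^[k + 1] x) = 0
      rw [Function.iterate_succ_apply']
      omega
    · change G'.Adj ((parent G' γ')^[k] x) ((parent G' γ')^[k + 1] x)
      rw [Function.iterate_succ_apply']
      exact h4.1

/-- Three zigzags suffice: climb in `G` to the ray `γ`, then climb in `G'` to the ray `γ'` while
descending in `G` below `o`, and climb in `G` back to `o` while descending in `G'` along the ray to
`o'`. Descending is always possible because every vertex has a child. -/
theorem horospheric_reachable_root (hG : G.IsTree) (hG' : G'.IsTree)
    (hdeg : ∀ x, ∃ u v, u ≠ v ∧ G.Adj x u ∧ G.Adj x v)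
    (hdeg' : ∀ x, ∃ u v, u ≠ v ∧ G'.Adj x u ∧ G'.Adj x v) (w : HorosphericVertex G γ G' γ') :
    (horosphericProduct G γ G' γ').Reachable w (horosphericRoot G γ G' γ') := by
  obtain ⟨⟨x, x'⟩, hw⟩ := w
  obtain ⟨k, n, hk⟩ := exists_parent_iterate hG γ x
  obtain ⟨z', rfl⟩ := exists_descendant hG' γ' hdeg' x' k
  obtain ⟨h1, r1⟩ := horospheric_climb hG hG' k x z' hw
  -- With `K ≥ n`, a descendant `y` of `o` at depth `K - n` has `γ n` as its `K`-th ancestor, so the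
  -- descent from `γ n` can be steered through `o`.
  obtain ⟨K, l, hK, hKn⟩ : ∃ K l, (parent G' γ')^[K] z' = γ'.1 l ∧ n ≤ K := by
    obtain ⟨K, l, hK⟩ := exists_parent_iterate hG' γ' z'
    exact ⟨n + K, l + n, by rw [Function.iterate_add_apply, hK, parent_iterate_ray hG'], by omega⟩
  obtain ⟨y, hy⟩ := exists_descendant hG γ hdeg o (K - n)
  have hyK : (parent G γ)^[K] y = (parent G γ)^[k] x := by
    rw [show K = n + (K - n) by omega, Function.iterate_add_apply, hy, hk]
    have := parent_iterate_ray hG γ 0 n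
    rwa [γ.2.1, Nat.zero_add] at this
  have h1' : busemann G γ o ((parent G γ)^[K] y) + busemann G' γ' o' z' = 0 := by rw [hyK]; exact h1
  obtain ⟨h2, r2⟩ := horospheric_climb' hG hG' K y z' h1'
  have h2' : busemann G γ o y + busemann G' γ' o' ((parent G' γ')^[K] z') = 0 := h2
  have hl : l = K - n := by
    have e1 := busemann_parent_iterate hG γ y (K - n)
    rw [hy, busemann_self] at e1
    rw [hK, busemann_ray hG'.connected] at h2'
    omega
  have hz : (parent G' γ')^[K] z' = (parent G' γ')^[K - n] o' := by
    have := parent_iterate_ray hG' γ' 0 (K - n)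
    rw [γ'.2.1, Nat.zero_add] at this
    rw [hK, this, hl]
  have h3 : busemann G γ o y + busemann G' γ' o' ((parent G' γ')^[K - n] o') = 0 := by
    rw [← hz]; exact h2'
  obtain ⟨h4, r3⟩ := horospheric_climb hG hG' (K - n) y o' h3
  have e1 : (⟨((parent G γ)^[k] x, z'), h1⟩ : HorosphericVertex G γ G' γ') =
      ⟨((parent G γ)^[K] y, z'), h1'⟩ := Subtype.ext (Prod.ext hyK.symm rfl)
  have e2 : (⟨(y, (parent G' γ')^[K] z'), h2⟩ : HorosphericVertex G γ G' γ') =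
      ⟨(y, (parent G' γ')^[K - n] o'), h3⟩ := Subtype.ext (Prod.ext rfl hz)
  have e3 : (⟨((parent G γ)^[K - n] y, o'), h4⟩ : HorosphericVertex G γ G' γ') =
      horosphericRoot G γ G' γ' := Subtype.ext (Prod.ext hy rfl)
  rw [e1] at r1
  rw [e2] at r2
  rw [e3] at r3
  exact r1.trans (r2.trans r3)

theorem horosphericProduct_nice (hG : G.IsTree) (hG' : G'.IsTree)
    (hf : ∀ v, (G.neighborSet v).Finite) (hf' : ∀ v, (G'.neighborSet v).Finite)
    (hdeg : ∀ x, ∃ u v, u ≠ v ∧ G.Adj x u ∧ G.Adj x v)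
    (hdeg' : ∀ x, ∃ u v, u ≠ v ∧ G'.Adj x u ∧ G'.Adj x v) :
    IsInfiniteLocallyFiniteConnected (horosphericProduct G γ G' γ') := by
  refine ⟨?_, ?_, fun w => ?_⟩
  -- The points `(γ n, z n)`, with `z n` a descendant of `o'` at depth `n`, are infinitely many
  -- vertices of the product.
  · choose z hz using fun n => exists_descendant hG' γ' hdeg' o' n
    refine Infinite.of_injective (fun n : ℕ => (⟨(γ.1 n, z n), ?_⟩ : HorosphericVertex G γ G' γ')) ?_
    · have h1 := busemann_parent_iterate hG' γ' (z n) n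
      rw [hz, busemann_self] at h1
      change busemann G γ o (γ.1 n) + busemann G' γ' o' (z n) = 0
      rw [busemann_ray hG.connected]
      omega
    · intro i j hij
      have h1 : γ.1 i = γ.1 j := congrArg (fun w => w.1.1) hij
      rw [← γ.dist_root i, h1, γ.dist_root]
  · have : Nonempty (HorosphericVertex G γ G' γ') := ⟨horosphericRoot G γ G' γ'⟩
    exact ⟨fun a b => (horospheric_reachable_root hG hG' hdeg hdeg' a).trans
      (horospheric_reachable_root hG hG' hdeg hdeg' b).symm⟩
  · refine Set.Finite.of_finite_image (f := Subtype.val) (((hf w.1.1).prod (hf' w.1.2)).subset ?_)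
      Subtype.val_injective.injOn
    rintro _ ⟨u, hu, rfl⟩
    exact ⟨hu.1, hu.2⟩

variable {V₂ V₂' : Type*} {G₂ : SimpleGraph V₂} {G₂' : SimpleGraph V₂'} {o₂ : V₂} {o₂' : V₂'}
  {γ₂ : Boundary G₂ o₂} {γ₂' : Boundary G₂' o₂'}

/-- Isomorphisms which shift the horofunctions by opposite constants induce an isomorphism of
horospheric products. -/
def horosphericIso (e : G ≃g G₂) (e' : G' ≃g G₂') (c : ℤ)
    (h : ∀ x, busemann G₂ γ₂ o₂ (e x) = busemann G γ o x + c)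
    (h' : ∀ x, busemann G₂' γ₂' o₂' (e' x) = busemann G' γ' o' x - c) :
    horosphericProduct G γ G' γ' ≃g horosphericProduct G₂ γ₂ G₂' γ₂' where
  toFun w := ⟨(e w.1.1, e' w.1.2), by
    have : busemann G γ o w.1.1 + busemann G' γ' o' w.1.2 = 0 := w.2
    rw [h, h']; omega⟩
  invFun w := ⟨(e.symm w.1.1, e'.symm w.1.2), by
    have h1 : busemann G₂ γ₂ o₂ w.1.1 + busemann G₂' γ₂' o₂' w.1.2 = 0 := w.2
    have h2 := h (e.symm w.1.1)
    have h3 := h' (e'.symm w.1.2)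
    rw [e.apply_symm_apply] at h2
    rw [e'.apply_symm_apply] at h3
    change busemann G γ o (e.symm w.1.1) + busemann G' γ' o' (e'.symm w.1.2) = 0
    omega⟩
  left_inv w := Subtype.ext (Prod.ext (e.symm_apply_apply _) (e'.symm_apply_apply _))
  right_inv w := Subtype.ext (Prod.ext (e.apply_symm_apply _) (e'.apply_symm_apply _))
  map_rel_iff' := by
    intro v w
    exact and_congr e.map_rel_iff e'.map_rel_iff

/-- The horofunctions of rays which agree up to a shift differ by a constant. -/
theorem busemann_iso (hG : G.Connected) (e : G ≃g G₂) {i j : ℕ}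
    (h : ∀ n, γ₂.1 (n + i) = e (γ.1 (n + j))) (x : V) :
    busemann G₂ γ₂ o₂ (e x) = busemann G γ o x + ((j : ℤ) - i) := by
  obtain ⟨N, hN⟩ := exists_eventually_dist hG γ x
  refine busemann_eq_of_eventually ?_
  filter_upwards [eventually_ge_atTop (N + i)] with n hn
  obtain ⟨k, rfl⟩ := Nat.exists_eq_add_of_le hn
  rw [show N + i + k = (N + k) + i by omega, h, dist_iso hG, hN _ (by omega)]
  push_cast
  ring

/-- The neighbours of the root of a horospheric product. -/
theorem horospheric_root_iff (hG : G.IsTree) (hG' : G'.IsTree) {x : V} {x' : V'}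
    (hx : G.Adj o x) (hx' : G'.Adj o' x') :
    busemann G γ o x + busemann G' γ' o' x' = 0 ↔
      (x = γ.1 1 ∧ x' ≠ γ'.1 1) ∨ (x ≠ γ.1 1 ∧ x' = γ'.1 1) := by
  rcases busemann_root_adj hG γ hx with ⟨h1, h2⟩ | ⟨h1, h2⟩ <;>
    rcases busemann_root_adj hG' γ' hx' with ⟨h3, h4⟩ | ⟨h3, h4⟩ <;> rw [h2, h4] <;> simp [h1, h3]

end HorosphericProducts
end HorosphericGW

namespace HorosphericGW

/-! ### Classes of horospheric products -/

section HorosphericClasses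

variable {V V' : Type*} {m : ℝ}

instance {G : SimpleGraph V} {G' : SimpleGraph V'} {o : V} {o' : V'} (γ : Boundary G o)
    (γ' : Boundary G' o') [Countable V] [Countable V'] : Countable (HorosphericVertex G γ G' γ') :=
  inferInstanceAs (Countable {w : V × V' // busemann G γ o w.1 + busemann G' γ' o' w.2 = 0})

/-- The ray with its first vertex removed. -/
def Boundary.tail {G : SimpleGraph V} {o : V} (γ : Boundary G o) : Boundary G (γ.1 1) :=
  ⟨stail γ.1, rfl, fun i j => by
    have := γ.2.2 (i + 1) j
    rwa [show i + 1 + j = i + j + 1 by omega] at this⟩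

/-- The ray extended by a vertex. -/
def Boundary.cons {G : SimpleGraph V} (hG : G.IsTree) {o : V} (γ : Boundary G o) {y : V}
    (hy : G.Adj o y) (hy' : y ≠ γ.1 1) : Boundary G y :=
  have hadj : ∀ n, G.Adj (scons y γ.1 n) (scons y γ.1 (n + 1)) := fun n => by
    cases n with
    | zero =>
      change G.Adj y (γ.1 0)
      rw [γ.2.1]; exact hy.symm
    | succ n => exact γ.adj n
  mkBoundary hG.connected (scons y γ.1) rfl hadj (dist_of_nonbacktracking hG rfl hadj fun n => by
    cases n with
    | zero => exact hy'.symm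
    | succ n =>
      intro h
      have h1 := γ.2.2 n 2
      rw [show γ.1 (n + 2) = γ.1 n from h] at h1
      simp at h1)

open Classical in
theorem lintegral_nbr_classOf [Countable V] {G : SimpleGraph V}
    (hG : IsInfiniteLocallyFiniteConnected G) (o : V) (f : GraphSpace → ℝ≥0∞) :
    ∫⁻ y, f y ∂nbr (classOf G o) = ∑' v, if G.Adj o v then f (classOf G v) else 0 := by
  obtain ⟨g, e, he⟩ := exists_rootedGraph_iso hG o
  rw [classOf_eq_clAt e, he, RootedGraph.clAt_root, lintegral_nbr, ← e.toEquiv.tsum_eq]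
  refine tsum_congr fun v => ?_
  rw [classOf_eq_clAt e]
  have : g.graph.Adj g.root (e v) ↔ G.Adj o v := by rw [← he]; exact e.map_rel_iff
  change (if g.graph.Adj g.root (e v) then f (g.clAt (e v)) else 0) = _
  simp only [this]

/-- Labelled good trees with a ray issued from the root. -/
def LabelledRay (m : ℝ) : Type :=
  {p : RootedGraph × (ℕ → ℕ) // Good m p.1.graph ∧ p.2 0 = p.1.root ∧
    ∀ i j, p.1.graph.dist (p.2 i) (p.2 (i + j)) = j}

namespace LabelledRay

/-- The ray as a boundary point. -/
def bdry (p : LabelledRay m) : Boundary p.1.1.graph p.1.1.root := ⟨p.1.2, p.2.2⟩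

/-- The classes along the ray. -/
def seq (p : LabelledRay m) : ℕ → GraphSpace := fun n => p.1.1.clAt (p.1.2 n)

theorem isTree (p : LabelledRay m) : p.1.1.graph.IsTree := p.2.1.isTree p.1.1.connected

/-- An isomorphism that matches the roots automatically matches the rays, because in a good tree a
vertex is determined by its class. -/
theorem exists_iso [Countable V] (p : LabelledRay m) {G : SimpleGraph V}
    (hG : IsInfiniteLocallyFiniteConnected G) {o : V} (γ : Boundary G o)
    (h : p.seq = fun n => classOf G (γ.1 n)) :
    ∃ e : G ≃g p.1.1.graph, ∀ n, p.1.2 n = e (γ.1 n) := by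
  have h0 : p.1.1.clAt (p.1.2 0) = classOf G (γ.1 0) := congrFun h 0
  rw [← classOf_graph] at h0
  obtain ⟨e, -⟩ := (classOf_eq_iff p.1.1.nice hG).1 h0
  have hn : ∀ n, p.1.1.clAt (p.1.2 n) = p.1.1.clAt (e.symm (γ.1 n)) := fun n => by
    rw [← classOf_eq_clAt e.symm]; exact congrFun h n
  exact ⟨e.symm, fun n => p.2.1.walkDistinct.clAt_injective (hn n)⟩

theorem exists_seq_eq [Countable V] {G : SimpleGraph V} (hG : IsInfiniteLocallyFiniteConnected G)
    (hgood : Good m G) {o : V} (γ : Boundary G o) :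
    ∃ p : LabelledRay m, p.seq = fun n => classOf G (γ.1 n) := by
  obtain ⟨g, e, he⟩ := exists_rootedGraph_iso hG o
  refine ⟨⟨(g, fun n => e (γ.1 n)), hgood.congr hG.2.1 e, ?_, fun i j => ?_⟩, ?_⟩
  · exact (congrArg e γ.2.1).trans he
  · exact (dist_iso hG.2.1 e _ _).trans (γ.2.2 i j)
  · ext n
    exact (classOf_eq_clAt e _).symm

theorem seq_mem (p : LabelledRay m) : p.seq ∈ RaySet m :=
  (mem_raySet_iff p.2.1 (v := p.1.1.root) (s := p.seq) (congrArg p.1.1.clAt p.2.2.1)).2 ⟨p.bdry, rfl⟩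

theorem exists_of_mem {s : ℕ → GraphSpace} (hs : s ∈ RaySet m) :
    ∃ p : LabelledRay m, p.seq = s := by
  obtain ⟨g, h0, hg⟩ := hs.1
  obtain ⟨γ, rfl⟩ := (mem_raySet_iff hg (v := g.root) h0.symm).1 hs
  exact ⟨⟨(g, γ.1), hg, γ.2⟩, rfl⟩

end LabelledRay

/-- The class of the horospheric product of labelled trees with distinguished rays. -/
def labelledProduct (p : LabelledRay m × LabelledRay m) : GraphSpace :=
  classOf (horosphericProduct _ p.1.bdry _ p.2.bdry) (horosphericRoot _ p.1.bdry _ p.2.bdry)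

open Classical in
/-- The class of the horospheric product as a function of the classes along the distinguished
rays. -/
def hpClass (m : ℝ) (s s' : ℕ → GraphSpace) : GraphSpace :=
  if h : ∃ p : LabelledRay m × LabelledRay m, p.1.seq = s ∧ p.2.seq = s' then
    labelledProduct h.choose else rootedRay.toClass

theorem hp_nice {G : SimpleGraph V} {G' : SimpleGraph V'} {o : V} {o' : V'} (γ : Boundary G o)
    (γ' : Boundary G' o') (hG : IsInfiniteLocallyFiniteConnected G)
    (hG' : IsInfiniteLocallyFiniteConnected G') (hg : Good m G) (hg' : Good m G') :
    IsInfiniteLocallyFiniteConnected (horosphericProduct G γ G' γ') :=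
  horosphericProduct_nice (hg.isTree hG.2.1) (hg'.isTree hG'.2.1) hG.2.2 hG'.2.2
    (fun x => (hg x).two_le) (fun x => (hg' x).two_le)

/-- `hpClass` is defined with chosen labellings. Isomorphisms that match the rays preserve the
horofunctions exactly and so induce an isomorphism of the products. -/
theorem hpClass_eq [Countable V] [Countable V'] {G : SimpleGraph V} {G' : SimpleGraph V'}
    (hG : IsInfiniteLocallyFiniteConnected G) (hG' : IsInfiniteLocallyFiniteConnected G')
    (hg : Good m G) (hg' : Good m G') {o : V} {o' : V'} (γ : Boundary G o) (γ' : Boundary G' o') :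
    hpClass m (fun n => classOf G (γ.1 n)) (fun n => classOf G' (γ'.1 n)) =
      classOf (horosphericProduct G γ G' γ') (horosphericRoot G γ G' γ') := by
  have h : ∃ p : LabelledRay m × LabelledRay m, p.1.seq = (fun n => classOf G (γ.1 n)) ∧
      p.2.seq = fun n => classOf G' (γ'.1 n) := by
    obtain ⟨p, hp⟩ := LabelledRay.exists_seq_eq hG hg γ
    obtain ⟨p', hp'⟩ := LabelledRay.exists_seq_eq hG' hg' γ'
    exact ⟨(p, p'), hp, hp'⟩
  rw [hpClass, dif_pos h]
  obtain ⟨h1, h2⟩ := h.choose_spec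
  obtain ⟨e, he⟩ := h.choose.1.exists_iso hG γ h1
  obtain ⟨e', he'⟩ := h.choose.2.exists_iso hG' γ' h2
  have b1 := busemann_iso (γ := γ) (γ₂ := h.choose.1.bdry) (i := 0) (j := 0) hG.2.1 e he
  have b2 := busemann_iso (γ := γ') (γ₂ := h.choose.2.bdry) (i := 0) (j := 0) hG'.2.1 e' he'
  refine (classOf_congr (hp_nice γ γ' hG hG' hg hg')
    (horosphericIso e e' 0 (fun x => by simpa using b1 x) (fun x => by simpa using b2 x)) ?_).symm
  refine Subtype.ext (Prod.ext ?_ ?_)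
  · change e o = h.choose.1.1.1.root
    rw [← h.choose.1.2.2.1, he, γ.2.1]
  · change e' o' = h.choose.2.1.1.root
    rw [← h.choose.2.2.2.1, he', γ'.2.1]

theorem hpClass_seq (p p' : LabelledRay m) : hpClass m p.seq p'.seq = labelledProduct (p, p') := by
  have := hpClass_eq p.1.1.nice p'.1.1.nice p.2.1 p'.2.1 p.bdry p'.bdry
  simp only [classOf_graph] at this
  exact this

instance : MeasurableSpace (LabelledRay m) := inferInstanceAs (MeasurableSpace (Subtype _))

theorem measurable_dist_comp {α : Type*} [MeasurableSpace α] {g : α → RootedGraph} {a b : α → ℕ}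
    (hg : Measurable g) (ha : Measurable a) (hb : Measurable b) :
    Measurable fun x => (g x).graph.dist (a x) (b x) := by
  have h : Measurable fun p : RootedGraph × (ℕ × ℕ) => p.1.graph.dist p.2.1 p.2.2 :=
    measurable_from_prod_countable_left fun n => measurable_dist n.1 n.2
  exact h.comp (hg.prodMk (ha.prodMk hb))

instance : StandardBorelSpace (LabelledRay m) := by
  have h : MeasurableSet {p : RootedGraph × (ℕ → ℕ) | Good m p.1.graph ∧ p.2 0 = p.1.root ∧
      ∀ i j, p.1.graph.dist (p.2 i) (p.2 (i + j)) = j} := by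
    refine measurableSet_setOfPred.2 (.and ?_ (.and ?_ (.forall fun i => .forall fun j => ?_)))
    · have h1 : Measurable fun g : RootedGraph => Good m g.graph := .forall measurable_rootGood
      exact h1.comp measurable_fst
    · exact measurableSet_setOfPred.1 (measurableSet_eq_fun
        ((measurable_pi_apply 0).comp measurable_snd) (measurable_root.comp measurable_fst))
    · exact measurableSet_setOfPred.1 ((measurable_dist_comp measurable_fst
        ((measurable_pi_apply i).comp measurable_snd)
        ((measurable_pi_apply (i + j)).comp measurable_snd)) (measurableSet_singleton j))
  exact h.standardBorel

theorem LabelledRay.measurable_seq : Measurable (LabelledRay.seq : LabelledRay m → _) :=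
  measurable_pi_iff.2 fun n => measurable_clAt_apply (measurable_fst.comp measurable_subtype_coe)
    ((measurable_pi_apply n).comp (measurable_snd.comp measurable_subtype_coe))

theorem LabelledRay.measurable_busemann (x : ℕ) (k : ℤ) : Measurable fun p : LabelledRay m =>
    busemann p.1.1.graph p.bdry p.1.1.root x = k := by
  rw [show (fun p : LabelledRay m => busemann p.1.1.graph p.bdry p.1.1.root x = k) = fun p =>
    ∃ N : ℕ, ∀ n ≥ N, (p.1.1.graph.dist x (p.bdry.1 n) : ℤ) = n + k from
      funext fun p => propext (busemann_eq_iff p.1.1.connected)]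
  refine .exists fun N => .forall fun n => measurable_const.imp ?_
  have h1 : Measurable fun p : LabelledRay m => p.1.1.graph.dist x (p.bdry.1 n) :=
    measurable_dist_comp (measurable_fst.comp measurable_subtype_coe) measurable_const
      ((measurable_pi_apply n).comp (measurable_snd.comp measurable_subtype_coe))
  have h2 : Measurable fun p : LabelledRay m => (p.1.1.graph.dist x (p.bdry.1 n) : ℤ) :=
    (measurable_from_top (f := fun n : ℕ => (n : ℤ))).comp h1
  exact measurableSet_setOfPred.1 (h2 (measurableSet_singleton _))

theorem measurable_horosphericVertex (w : ℕ × ℕ) : Measurable fun p : LabelledRay m × LabelledRay m =>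
    busemann p.1.1.1.graph p.1.bdry p.1.1.1.root w.1 +
      busemann p.2.1.1.graph p.2.bdry p.2.1.1.root w.2 = 0 := by
  have : ∀ p : LabelledRay m × LabelledRay m,
      busemann p.1.1.1.graph p.1.bdry p.1.1.1.root w.1 +
        busemann p.2.1.1.graph p.2.bdry p.2.1.1.root w.2 = 0 ↔
      ∃ k : ℤ, busemann p.1.1.1.graph p.1.bdry p.1.1.1.root w.1 = k ∧
        busemann p.2.1.1.graph p.2.bdry p.2.1.1.root w.2 = -k := fun p => by
    constructor
    · intro h; exact ⟨_, rfl, by omega⟩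
    · rintro ⟨k, h1, h2⟩; omega
  simp only [this]
  exact .exists fun k => .and ((LabelledRay.measurable_busemann _ _).comp measurable_fst)
    ((LabelledRay.measurable_busemann _ _).comp measurable_snd)

theorem measurable_horospheric_adj (u v : ℕ × ℕ) : Measurable fun p : LabelledRay m × LabelledRay m =>
    ∃ x y : HorosphericVertex p.1.1.1.graph p.1.bdry p.2.1.1.graph p.2.bdry, x.1 = u ∧ y.1 = v ∧
      (horosphericProduct p.1.1.1.graph p.1.bdry p.2.1.1.graph p.2.bdry).Adj x y := by
  have : ∀ p : LabelledRay m × LabelledRay m,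
      (∃ x y : HorosphericVertex p.1.1.1.graph p.1.bdry p.2.1.1.graph p.2.bdry, x.1 = u ∧ y.1 = v ∧
        (horosphericProduct p.1.1.1.graph p.1.bdry p.2.1.1.graph p.2.bdry).Adj x y) ↔
      (busemann p.1.1.1.graph p.1.bdry p.1.1.1.root u.1 +
        busemann p.2.1.1.graph p.2.bdry p.2.1.1.root u.2 = 0) ∧
      (busemann p.1.1.1.graph p.1.bdry p.1.1.1.root v.1 +
        busemann p.2.1.1.graph p.2.bdry p.2.1.1.root v.2 = 0) ∧
      p.1.1.1.graph.Adj u.1 v.1 ∧ p.2.1.1.graph.Adj u.2 v.2 := fun p => by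
    constructor
    · rintro ⟨x, y, rfl, rfl, h⟩
      exact ⟨x.2, y.2, h⟩
    · rintro ⟨h1, h2, h3⟩
      exact ⟨⟨u, h1⟩, ⟨v, h2⟩, rfl, rfl, h3⟩
  simp only [this]
  refine .and (measurable_horosphericVertex u) (.and (measurable_horosphericVertex v) (.and ?_ ?_))
  · exact (measurable_adj _ _).comp
      (measurable_fst.comp (measurable_subtype_coe.comp measurable_fst))
  · exact (measurable_adj _ _).comp
      (measurable_fst.comp (measurable_subtype_coe.comp measurable_snd))

theorem measurable_horosphericRoot (v : ℕ × ℕ) : Measurable fun p : LabelledRay m × LabelledRay m =>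
    (horosphericRoot p.1.1.1.graph p.1.bdry p.2.1.1.graph p.2.bdry).1 = v := by
  have : ∀ p : LabelledRay m × LabelledRay m,
      (horosphericRoot p.1.1.1.graph p.1.bdry p.2.1.1.graph p.2.bdry).1 = v ↔
        p.1.1.1.root = v.1 ∧ p.2.1.1.root = v.2 := fun p => Prod.ext_iff
  simp only [this]
  refine .and ?_ ?_
  · exact measurableSet_setOfPred.1 ((measurable_root.comp (measurable_fst.comp
      (measurable_subtype_coe.comp measurable_fst))) (measurableSet_singleton v.1))
  · exact measurableSet_setOfPred.1 ((measurable_root.comp (measurable_fst.comp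
      (measurable_subtype_coe.comp measurable_snd))) (measurableSet_singleton v.2))

theorem measurable_labelledProduct : Measurable (labelledProduct (m := m)) :=
  measurable_classOf (W := fun p : LabelledRay m × LabelledRay m =>
    HorosphericVertex p.1.1.1.graph p.1.bdry p.2.1.1.graph p.2.bdry)
    (ι := fun _ => Subtype.val) (fun _ => Subtype.val_injective)
    (fun p => hp_nice _ _ p.1.1.1.nice p.2.1.1.nice p.1.2.1 p.2.2.1) measurable_horospheric_adj
    measurable_horosphericRoot

theorem surjective_rays : Function.Surjective (fun p : LabelledRay m × LabelledRay m =>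
    ((⟨p.1.seq, p.1.seq_mem⟩, ⟨p.2.seq, p.2.seq_mem⟩) : RaySet m × RaySet m)) := by
  rintro ⟨⟨s, hs⟩, ⟨s', hs'⟩⟩
  obtain ⟨p, rfl⟩ := LabelledRay.exists_of_mem hs
  obtain ⟨p', rfl⟩ := LabelledRay.exists_of_mem hs'
  exact ⟨(p, p'), rfl⟩

theorem measurable_rays : Measurable (fun p : LabelledRay m × LabelledRay m =>
    ((⟨p.1.seq, p.1.seq_mem⟩, ⟨p.2.seq, p.2.seq_mem⟩) : RaySet m × RaySet m)) :=
  ((LabelledRay.measurable_seq.comp measurable_fst).subtype_mk).prodMk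
    ((LabelledRay.measurable_seq.comp measurable_snd).subtype_mk)

/-- Pairs of labelled rays form a standard Borel space mapping onto `RaySet m × RaySet m`, so it
suffices that the class of the product of labelled trees is measurable. Off the rays the value is
constant. -/
theorem measurable_hpClass : Measurable fun p : (ℕ → GraphSpace) × (ℕ → GraphSpace) =>
    hpClass m p.1 p.2 := by
  classical
  have h1 : Measurable fun p : RaySet m × RaySet m => hpClass m p.1 p.2 := by
    refine (measurable_rays.measurable_comp_iff_of_surjective surjective_rays).1 ?_
    have : (fun p : RaySet m × RaySet m => hpClass m p.1.1 p.2.1) ∘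
        (fun p : LabelledRay m × LabelledRay m =>
          ((⟨p.1.seq, p.1.seq_mem⟩, ⟨p.2.seq, p.2.seq_mem⟩) : RaySet m × RaySet m)) =
        labelledProduct := funext fun p => hpClass_seq p.1 p.2
    rw [this]
    exact measurable_labelledProduct
  have h2 : (fun p : (ℕ → GraphSpace) × (ℕ → GraphSpace) => hpClass m p.1 p.2) = fun p =>
      if h : p ∈ RaySet m ×ˢ RaySet m then hpClass m p.1 p.2 else rootedRay.toClass := by
    ext p
    split_ifs with h
    · rfl
    · rw [hpClass, dif_neg]
      rintro ⟨q, h1, h2⟩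
      exact h ⟨h1 ▸ q.1.seq_mem, h2 ▸ q.2.seq_mem⟩
  rw [h2]
  refine Measurable.dite (s := RaySet m ×ˢ RaySet m) (f := fun q => hpClass m q.1.1 q.1.2)
    (g := fun _ => rootedRay.toClass) ?_ measurable_const
    (measurableSet_raySet.prod measurableSet_raySet)
  have e : Measurable fun q : (RaySet m ×ˢ RaySet m : Set ((ℕ → GraphSpace) × (ℕ → GraphSpace))) =>
      ((⟨q.1.1, q.2.1⟩, ⟨q.1.2, q.2.2⟩) : RaySet m × RaySet m) :=
    (measurable_fst.comp measurable_subtype_coe).subtype_mk.prodMk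
      (measurable_snd.comp measurable_subtype_coe).subtype_mk
  exact h1.comp e

theorem raySet_scons {p : LabelledRay m} {y : ℕ} (hy : p.1.1.graph.Adj p.1.1.root y)
    (hy' : y ≠ p.1.2 1) : scons (p.1.1.clAt y) p.seq =
      fun n => p.1.1.clAt ((p.bdry.cons p.isTree hy hy').1 n) := by
  ext n; cases n <;> rfl

open Classical in
/-- Integration over the neighbours of the root of a horospheric product. -/
theorem lintegral_nbr_hpClass {s s' : ℕ → GraphSpace} (hs : s ∈ RaySet m) (hs' : s' ∈ RaySet m)
    (H : GraphSpace → ℝ≥0∞) :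
    ∫⁻ z, H z ∂nbr (hpClass m s s') =
      ∫⁻ y, (if s' 1 = y then 0 else H (hpClass m (stail s) (scons y s'))) ∂nbr (s' 0) +
      ∫⁻ y, (if s 1 = y then 0 else H (hpClass m (scons y s) (stail s'))) ∂nbr (s 0) := by
  obtain ⟨p, rfl⟩ := LabelledRay.exists_of_mem hs
  obtain ⟨p', rfl⟩ := LabelledRay.exists_of_mem hs'
  have hT := p.isTree
  have hT' := p'.isTree
  have hnice := hp_nice p.bdry p'.bdry p.1.1.nice p'.1.1.nice p.2.1 p'.2.1
  have hinj := p.2.1.walkDistinct.clAt_injective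
  have hinj' := p'.2.1.walkDistinct.clAt_injective
  set g := p.1.1 with hg
  set g' := p'.1.1 with hg'
  set γ := p.bdry with hγ
  set γ' := p'.bdry with hγ'
  rw [hpClass_seq, labelledProduct, lintegral_nbr_classOf hnice]
  have hp0 : p.seq 0 = g.toClass := congrArg g.clAt p.2.2.1
  have hp0' : p'.seq 0 = g'.toClass := congrArg g'.clAt p'.2.2.1
  rw [hp0, hp0', lintegral_nbr, lintegral_nbr]
  set A : ℕ → ℝ≥0∞ := fun v => if g'.graph.Adj g'.root v then
    if p'.seq 1 = g'.clAt v then 0 else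
      H (hpClass m (stail p.seq) (scons (g'.clAt v) p'.seq)) else 0 with hA
  set B : ℕ → ℝ≥0∞ := fun v => if g.graph.Adj g.root v then
    if p.seq 1 = g.clAt v then 0 else
      H (hpClass m (scons (g.clAt v) p.seq) (stail p'.seq)) else 0 with hB
  change (∑' w : HorosphericVertex g.graph γ g'.graph γ',
    if (horosphericProduct g.graph γ g'.graph γ').Adj (horosphericRoot g.graph γ g'.graph γ') w then
      H (classOf (horosphericProduct g.graph γ g'.graph γ') w) else 0) = ∑' v, A v + ∑' v, B v
  -- Extension by zero from the vertices of the product to all pairs, so that the sum can be taken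
  -- over the two coordinates separately.
  let F : ℕ × ℕ → ℝ≥0∞ := fun w =>
    if h : busemann g.graph γ g.root w.1 + busemann g'.graph γ' g'.root w.2 = 0 then
      (if g.graph.Adj g.root w.1 ∧ g'.graph.Adj g'.root w.2 then
        H (classOf (horosphericProduct g.graph γ g'.graph γ') ⟨w, h⟩) else 0) else 0
  have h1 : (∑' w : HorosphericVertex g.graph γ g'.graph γ',
      if (horosphericProduct g.graph γ g'.graph γ').Adj (horosphericRoot g.graph γ g'.graph γ') w
      then H (classOf (horosphericProduct g.graph γ g'.graph γ') w) else 0) = ∑' w, F w := by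
    rw [← Function.Injective.tsum_eq (f := F) (g := fun w : HorosphericVertex g.graph γ g'.graph γ' =>
      w.1) Subtype.val_injective]
    · refine tsum_congr fun w => ?_
      have hw : busemann g.graph γ g.root w.1.1 + busemann g'.graph γ' g'.root w.1.2 = 0 := w.2
      simp only [F]
      rw [dif_pos hw]
      exact if_congr Iff.rfl rfl rfl
    · intro w hw
      by_cases h : busemann g.graph γ g.root w.1 + busemann g'.graph γ' g'.root w.2 = 0
      · exact ⟨⟨w, h⟩, rfl⟩
      · simp only [F, Function.mem_support, dif_neg h, ne_eq, not_true_eq_false] at hw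
  -- A neighbour of the root moves one step along the ray in exactly one tree and off the ray in the
  -- other. Seen from the new root, one ray has lost its first vertex and the other is prolonged by
  -- one; the horofunctions shift by opposite constants, so the product graph is unchanged.
  have h2 : ∀ x x', F (x, x') = (if x = γ.1 1 then A x' else 0) + if x' = γ'.1 1 then B x else 0 := by
    intro x x'
    have eA : ∀ x', (p'.seq 1 = g'.clAt x' ↔ x' = γ'.1 1) := fun x' =>
      ⟨fun h => (hinj' h).symm, fun h => by rw [h]; rfl⟩
    have eB : ∀ x, (p.seq 1 = g.clAt x ↔ x = γ.1 1) := fun x =>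
      ⟨fun h => (hinj h).symm, fun h => by rw [h]; rfl⟩
    have a1 : g.graph.Adj g.root (γ.1 1) := by have := γ.adj 0; rwa [γ.2.1] at this
    have a1' : g'.graph.Adj g'.root (γ'.1 1) := by have := γ'.adj 0; rwa [γ'.2.1] at this
    by_cases hx : g.graph.Adj g.root x
    · by_cases hx' : g'.graph.Adj g'.root x'
      · have hiff := horospheric_root_iff (γ := γ) (γ' := γ') hT hT' hx hx'
        by_cases c1 : x = γ.1 1 <;> by_cases c2 : x' = γ'.1 1
        · have : ¬ (busemann g.graph γ g.root x + busemann g'.graph γ' g'.root x' = 0) := by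
            rw [hiff]; tauto
          rw [show F (x, x') = 0 from dif_neg this, if_pos c1, if_pos c2]
          simp only [hA, hB]
          rw [if_pos hx, if_pos hx', if_pos ((eA _).2 c2), if_pos ((eB _).2 c1), add_zero]
        · have hmem : busemann g.graph γ g.root x + busemann g'.graph γ' g'.root x' = 0 := by
            rw [hiff]; tauto
          rw [show F (x, x') = _ from (dif_pos hmem).trans (if_pos ⟨hx, hx'⟩), if_pos c1, if_neg c2,
            add_zero]
          simp only [hA]
          rw [if_pos hx', if_neg (mt (eA _).1 c2)]
          refine congrArg H ?_
          rw [raySet_scons (p := p') hx' c2]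
          have e1 := hpClass_eq g.nice g'.nice p.2.1 p'.2.1 γ.tail (γ'.cons hT' hx' c2)
          simp only [classOf_graph] at e1
          refine Eq.trans ?_ e1.symm
          refine classOf_congr hnice (horosphericIso (RelIso.refl _) (RelIso.refl _) 1
            (fun z => ?_) (fun z => ?_)) ?_
          · have := busemann_iso (γ := γ) (γ₂ := γ.tail) (i := 0) (j := 1) g.connected
              (RelIso.refl _) (fun n => rfl) z
            simpa using this
          · have := busemann_iso (γ := γ') (γ₂ := γ'.cons hT' hx' c2) (i := 1) (j := 0)
              g'.connected (RelIso.refl _) (fun n => rfl) z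
            simpa [sub_eq_add_neg] using this
          · exact Subtype.ext (Prod.ext c1 rfl)
        · have hmem : busemann g.graph γ g.root x + busemann g'.graph γ' g'.root x' = 0 := by
            rw [hiff]; tauto
          rw [show F (x, x') = _ from (dif_pos hmem).trans (if_pos ⟨hx, hx'⟩), if_neg c1, if_pos c2,
            zero_add]
          simp only [hB]
          rw [if_pos hx, if_neg (mt (eB _).1 c1)]
          refine congrArg H ?_
          rw [raySet_scons (p := p) hx c1]
          have e1 := hpClass_eq g.nice g'.nice p.2.1 p'.2.1 (γ.cons hT hx c1) γ'.tail
          simp only [classOf_graph] at e1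
          refine Eq.trans ?_ e1.symm
          refine classOf_congr hnice (horosphericIso (RelIso.refl _) (RelIso.refl _) (-1)
            (fun z => ?_) (fun z => ?_)) ?_
          · have := busemann_iso (γ := γ) (γ₂ := γ.cons hT hx c1) (i := 1) (j := 0) g.connected
              (RelIso.refl _) (fun n => rfl) z
            simpa using this
          · have := busemann_iso (γ := γ') (γ₂ := γ'.tail) (i := 0) (j := 1)
              g'.connected (RelIso.refl _) (fun n => rfl) z
            simpa using this
          · exact Subtype.ext (Prod.ext rfl c2)
        · have : ¬ (busemann g.graph γ g.root x + busemann g'.graph γ' g'.root x' = 0) := by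
            rw [hiff]; tauto
          simp only [F, dif_neg this, c1, c2, if_false, add_zero]
      · have e1 : x' ≠ γ'.1 1 := fun h => hx' (h ▸ a1')
        simp only [F, hA, hx', and_false, if_false, e1, ite_self, dite_eq_ite, add_zero]
    · have e1 : x ≠ γ.1 1 := fun h => hx (h ▸ a1)
      simp only [F, hB, hx, false_and, if_false, e1, ite_self, dite_eq_ite, add_zero]
  rw [h1, ENNReal.tsum_prod']
  simp only [h2]
  rw [ENNReal.tsum_comm]
  simp only [ENNReal.tsum_add, tsum_ite_eq]
  congr 1
  rw [ENNReal.tsum_comm]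
  simp only [tsum_ite_eq]

/-- Invariance, up to a factor, with respect to the shift of sequences. -/
def ShiftInvariant (m : ℝ) (P : Measure (ℕ → GraphSpace)) : Prop :=
  open Classical in ∀ F : (ℕ → GraphSpace) → ℝ≥0∞, Measurable F →
    ∫⁻ s, ∫⁻ y, (if s 1 = y then 0 else F (scons y s)) ∂nbr (s 0) ∂P =
      ENNReal.ofReal m * ∫⁻ s, F s ∂P

/-- The image of a product of shift invariant measures under the horospheric product is
reversible. -/
theorem reversible_hpClass {P Q : Measure (ℕ → GraphSpace)} [SFinite P] [SFinite Q]
    (hP : ShiftInvariant m P) (hQ : ShiftInvariant m Q)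
    (hP' : ∀ᵐ s ∂P, s ∈ RaySet m) (hQ' : ∀ᵐ s ∂Q, s ∈ RaySet m) :
    Reversible ((P.prod Q).map fun p => hpClass m p.1 p.2) := by
  classical
  have hhp : Measurable fun p : (ℕ → GraphSpace) × (ℕ → GraphSpace) => hpClass m p.1 p.2 :=
    measurable_hpClass
  have hhp' : ∀ {α : Type} [MeasurableSpace α] {a b : α → ℕ → GraphSpace}, Measurable a →
      Measurable b → Measurable fun x => hpClass m (a x) (b x) := fun ha hb =>
    hhp.comp (ha.prodMk hb)
  have hae : ∀ᵐ p ∂P.prod Q, p.1 ∈ RaySet m ∧ p.2 ∈ RaySet m :=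
    (Measure.quasiMeasurePreserving_fst.ae hP').and (Measure.quasiMeasurePreserving_snd.ae hQ')
  have hs0 : ∀ i, Measurable fun s : ℕ → GraphSpace => s i := fun i => measurable_pi_apply i
  -- Shift invariance in the tree whose ray is prolonged replaces the sum over prolongations by the
  -- factor `m`. The two resulting terms are exchanged when `H` is transposed; this uses that the
  -- factor is the same for `P` and `Q`.
  have key : ∀ H : GraphSpace → GraphSpace → ℝ≥0∞, Measurable (Function.uncurry H) →
      ∫⁻ x, ∫⁻ y, H x y ∂nbr x ∂((P.prod Q).map fun p => hpClass m p.1 p.2) =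
      ENNReal.ofReal m * ∫⁻ p, H (hpClass m p.1 (stail p.2)) (hpClass m (stail p.1) p.2) ∂P.prod Q +
      ENNReal.ofReal m *
        ∫⁻ p, H (hpClass m (stail p.1) p.2) (hpClass m p.1 (stail p.2)) ∂P.prod Q := by
    intro H hH
    have hH' : ∀ {α : Type} [MeasurableSpace α] {a b : α → GraphSpace}, Measurable a →
        Measurable b → Measurable fun x => H (a x) (b x) := fun ha hb => hH.comp (ha.prodMk hb)
    have mA : Measurable fun p : (ℕ → GraphSpace) × (ℕ → GraphSpace) =>
        H (hpClass m p.1 (stail p.2)) (hpClass m (stail p.1) p.2) :=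
      hH' (hhp' measurable_fst (measurable_stail.comp measurable_snd))
        (hhp' (measurable_stail.comp measurable_fst) measurable_snd)
    have mB : Measurable fun p : (ℕ → GraphSpace) × (ℕ → GraphSpace) =>
        H (hpClass m (stail p.1) p.2) (hpClass m p.1 (stail p.2)) :=
      hH' (hhp' (measurable_stail.comp measurable_fst) measurable_snd)
        (hhp' measurable_fst (measurable_stail.comp measurable_snd))
    have m1 : Measurable fun p : (ℕ → GraphSpace) × (ℕ → GraphSpace) =>
        ∫⁻ y, (if p.2 1 = y then 0 else
          H (hpClass m p.1 p.2) (hpClass m (stail p.1) (scons y p.2))) ∂nbr (p.2 0) := by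
      refine measurable_lintegral_nbr ?_ ((hs0 0).comp measurable_snd)
      refine Measurable.ite (measurableSet_eq_fun ((hs0 1).comp (measurable_snd.comp measurable_fst))
        measurable_snd) measurable_const (hH' (hhp.comp measurable_fst) (hhp' ?_ ?_))
      · exact measurable_stail.comp (measurable_fst.comp measurable_fst)
      · exact measurable_scons.comp (measurable_snd.prodMk (measurable_snd.comp measurable_fst))
    have m2 : Measurable fun p : (ℕ → GraphSpace) × (ℕ → GraphSpace) =>
        ∫⁻ y, (if p.1 1 = y then 0 else
          H (hpClass m p.1 p.2) (hpClass m (scons y p.1) (stail p.2))) ∂nbr (p.1 0) := by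
      refine measurable_lintegral_nbr ?_ ((hs0 0).comp measurable_fst)
      refine Measurable.ite (measurableSet_eq_fun ((hs0 1).comp (measurable_fst.comp measurable_fst))
        measurable_snd) measurable_const (hH' (hhp.comp measurable_fst) (hhp' ?_ ?_))
      · exact measurable_scons.comp (measurable_snd.prodMk (measurable_fst.comp measurable_fst))
      · exact measurable_stail.comp (measurable_snd.comp measurable_fst)
    have mH : Measurable fun x => ∫⁻ y, H x y ∂nbr x := measurable_lintegral_nbr hH measurable_id
    rw [lintegral_map mH hhp,
      lintegral_congr_ae (hae.mono fun p hp => lintegral_nbr_hpClass hp.1 hp.2 _),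
      lintegral_add_left m1]
    congr 1
    · rw [lintegral_prod _ m1.aemeasurable, lintegral_prod _ mA.aemeasurable,
        ← lintegral_const_mul _ mA.lintegral_prod_right']
      refine lintegral_congr fun s => ?_
      exact hQ (fun t => H (hpClass m s (stail t)) (hpClass m (stail s) t))
        (mA.comp (measurable_const.prodMk measurable_id))
    · rw [lintegral_prod_symm _ m2.aemeasurable, lintegral_prod_symm _ mB.aemeasurable,
        ← lintegral_const_mul _ mB.lintegral_prod_left']
      refine lintegral_congr fun s => ?_
      exact hP (fun t => H (hpClass m (stail t) s) (hpClass m t (stail s)))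
        (mB.comp (measurable_id.prodMk measurable_const))
  intro H hH
  rw [key H hH, key (fun x y => H y x) (hH.comp measurable_swap), add_comm]

end HorosphericClasses
end HorosphericGW

namespace HorosphericGW

/-! ### Resampling one coordinate of a product measure -/

section Resampling

variable {ι : Type*} [DecidableEq ι] {X : ι → Type*} [∀ i, MeasurableSpace (X i)]
  (μ : ∀ i, Measure (X i)) [∀ i, IsProbabilityMeasure (μ i)]

theorem infinitePi_map_update (z : ι) :
    ((Measure.infinitePi μ).prod (μ z)).map (fun p => Function.update p.1 z p.2) =
      Measure.infinitePi μ := by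
  refine Measure.eq_infinitePi _ fun s t ht => ?_
  have hm : Measurable fun p : (∀ i, X i) × X z => Function.update p.1 z p.2 :=
    measurable_update'
  rw [Measure.map_apply hm (MeasurableSet.pi s.countable_toSet fun i _ => ht i)]
  by_cases hz : z ∈ s
  · have : (fun p : (∀ i, X i) × X z => Function.update p.1 z p.2) ⁻¹' Set.pi s t =
        (Set.pi (s.erase z) t) ×ˢ t z := by
      ext p
      simp only [Set.mem_preimage, Set.mem_pi, Finset.mem_coe, Set.mem_prod, Finset.mem_erase]
      constructor
      · intro h
        refine ⟨fun i hi => ?_, by simpa using h z hz⟩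
        simpa [Function.update_of_ne hi.1] using h i hi.2
      · rintro ⟨h1, h2⟩ i hi
        by_cases hiz : i = z
        · subst hiz; simpa using h2
        · rw [Function.update_of_ne hiz]; exact h1 i ⟨hiz, hi⟩
    rw [this, Measure.prod_prod, Measure.infinitePi_pi _ fun i _ => ht i, mul_comm,
      Finset.mul_prod_erase s (fun i => μ i (t i)) hz]
  · have : (fun p : (∀ i, X i) × X z => Function.update p.1 z p.2) ⁻¹' Set.pi s t =
        (Set.pi s t) ×ˢ Set.univ := by
      ext p
      simp only [Set.mem_preimage, Set.mem_pi, Finset.mem_coe, Set.mem_prod, Set.mem_univ, and_true]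
      refine forall₂_congr fun i hi => ?_
      rw [Function.update_of_ne fun h : i = z => hz (h ▸ hi)]
    rw [this, Measure.prod_prod, Measure.infinitePi_pi _ fun i _ => ht i, measure_univ, mul_one]

theorem lintegral_infinitePi_update (z : ι) {F : (∀ i, X i) → ℝ≥0∞} (hF : Measurable F) :
    ∫⁻ x, F x ∂Measure.infinitePi μ =
      ∫⁻ x, ∫⁻ b, F (Function.update x z b) ∂μ z ∂Measure.infinitePi μ := by
  have hm : Measurable fun p : (∀ i, X i) × X z => Function.update p.1 z p.2 :=
    measurable_update'
  conv_lhs => rw [← infinitePi_map_update μ z]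
  rw [lintegral_map hF hm]
  exact lintegral_prod _ (hF.comp hm).aemeasurable

/-- Events which in turn constrain fresh coordinates cannot all occur. -/
theorem infinitePi_iInter_eq_zero {z : ℕ → ι} {E : ℕ → Set (∀ i, X i)}
    (hE : ∀ L, MeasurableSet (E L)) {θ : ℝ≥0∞} (hθ : θ < 1)
    (h1 : ∀ l L, l < L → ∀ x b, Function.update x (z L) b ∈ E l ↔ x ∈ E l)
    (h2 : ∀ L x, μ (z L) {b | Function.update x (z L) b ∈ E L} ≤ θ) :
    Measure.infinitePi μ (⋂ L, E L) = 0 := by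
  have hbd : ∀ L, Measure.infinitePi μ (⋂ l ∈ Finset.range L, E l) ≤ θ ^ L := by
    intro L
    induction L with
    | zero => simpa using prob_le_one (μ := Measure.infinitePi μ)
    | succ L ih =>
      have hF : MeasurableSet (⋂ l ∈ Finset.range L, E l) :=
        .biInter (Finset.countable_toSet _) fun l _ => hE l
      have heq : (⋂ l ∈ Finset.range (L + 1), E l) = (⋂ l ∈ Finset.range L, E l) ∩ E L := by
        ext x
        simp only [Set.mem_iInter, Finset.mem_range, Set.mem_inter_iff]
        constructor
        · exact fun h => ⟨fun l hl => h l (by omega), h L (by omega)⟩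
        · rintro ⟨h, h'⟩ l hl
          rcases Nat.lt_succ_iff_lt_or_eq.1 hl with hl | rfl
          exacts [h l hl, h']
      -- The coordinate `z L` is resampled: the earlier events do not see it, and given the other
      -- coordinates it satisfies `E L` with probability at most `θ`.
      rw [heq, ← lintegral_indicator_one (hF.inter (hE L)),
        lintegral_infinitePi_update μ (z L) (measurable_one.indicator (hF.inter (hE L)))]
      have hb : ∀ x : ∀ i, X i, ∫⁻ b, ((⋂ l ∈ Finset.range L, E l) ∩ E L).indicator
          (1 : (∀ i, X i) → ℝ≥0∞) (Function.update x (z L) b) ∂μ (z L) ≤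
          (⋂ l ∈ Finset.range L, E l).indicator (fun _ => θ) x := by
        intro x
        by_cases hx : x ∈ ⋂ l ∈ Finset.range L, E l
        · rw [Set.indicator_of_mem hx]
          refine le_trans ?_ (h2 L x)
          have hm : MeasurableSet {b | Function.update x (z L) b ∈ E L} :=
            (measurable_update x) (hE L)
          rw [← lintegral_indicator_one hm]
          refine lintegral_mono fun b => ?_
          by_cases hb : Function.update x (z L) b ∈ E L
          · rw [Set.indicator_of_mem (show b ∈ {b | Function.update x (z L) b ∈ E L} from hb)]
            exact Set.indicator_le_self' (fun _ _ => zero_le) _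
          · rw [Set.indicator_of_notMem fun h => hb h.2]
            exact zero_le
        · rw [Set.indicator_of_notMem hx, nonpos_iff_eq_zero]
          refine (lintegral_congr fun b => Set.indicator_of_notMem (fun hb => hx ?_) _).trans
            lintegral_zero
          simp only [Set.mem_iInter, Finset.mem_range, Set.mem_inter_iff] at hb ⊢
          exact fun l hl => (h1 l L hl x b).1 (hb.1 l hl)
      refine (lintegral_mono hb).trans ?_
      rw [lintegral_indicator_const hF, pow_succ, mul_comm]
      gcongr
  refine le_antisymm (ge_of_tendsto' (ENNReal.tendsto_pow_atTop_nhds_zero_of_lt_one hθ)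
    fun L => (measure_mono ?_).trans (hbd L)) zero_le
  exact fun x hx => Set.mem_iInter₂.2 fun l _ => Set.mem_iInter.1 hx l

theorem measurable_sumElim {κ κ' : Type*} {Y : Type*} [MeasurableSpace Y] :
    Measurable fun p : (κ → Y) × (κ' → Y) => Sum.elim p.1 p.2 := by
  refine measurable_pi_iff.2 ?_
  rintro (i | i)
  · exact (measurable_pi_apply i).comp measurable_fst
  · exact (measurable_pi_apply i).comp measurable_snd

theorem infinitePi_prod_map_sum {κ κ' : Type*} {Y : Type*} [MeasurableSpace Y]
    (μ : κ → Measure Y) (μ' : κ' → Measure Y) [∀ i, IsProbabilityMeasure (μ i)]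
    [∀ i, IsProbabilityMeasure (μ' i)] :
    ((Measure.infinitePi μ).prod (Measure.infinitePi μ')).map (fun p => Sum.elim p.1 p.2) =
      Measure.infinitePi (Sum.elim μ μ') := by
  classical
  have : ∀ i, IsProbabilityMeasure (Sum.elim μ μ' i) := by
    rintro (i | i)
    exacts [inferInstanceAs (IsProbabilityMeasure (μ i)), inferInstanceAs (IsProbabilityMeasure (μ' i))]
  refine Measure.eq_infinitePi _ fun s t ht => ?_
  have hm : Measurable fun p : (κ → Y) × (κ' → Y) => Sum.elim p.1 p.2 := measurable_sumElim
  rw [Measure.map_apply hm (MeasurableSet.pi s.countable_toSet fun i _ => ht i)]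
  have : (fun p : (κ → Y) × (κ' → Y) => Sum.elim p.1 p.2) ⁻¹' Set.pi s t =
      (Set.pi s.toLeft fun i => t (Sum.inl i)) ×ˢ (Set.pi s.toRight fun i => t (Sum.inr i)) := by
    ext p
    simp [Set.mem_pi, Sum.forall]
  rw [this, Measure.prod_prod, Measure.infinitePi_pi _ fun i _ => ht _,
    Measure.infinitePi_pi _ fun i _ => ht _]
  conv_rhs => rw [← Finset.toLeft_disjSum_toRight (u := s), Finset.prod_disjSum]
  rfl

end Resampling

/-! ### Offspring numbers -/

section Offspring

variable {p : PMF ℕ}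

/-- Independent offspring numbers with distribution `p`. -/
def offspringLaw (p : PMF ℕ) : Measure (List ℕ → ℕ) :=
  Measure.infinitePi fun _ => p.toMeasure

instance : IsProbabilityMeasure (offspringLaw p) := by
  unfold offspringLaw; infer_instance

theorem pmf_ae_ne_zero (hp0 : p 0 = 0) : ∀ᵐ k ∂p.toMeasure, 1 ≤ k := by
  rw [ae_iff, show {k : ℕ | ¬ 1 ≤ k} = {0} by ext k; simp,
    PMF.toMeasure_apply_singleton _ _ (measurableSet_singleton _), hp0]

theorem ae_one_le (hp0 : p 0 = 0) : ∀ᵐ X ∂offspringLaw p, ∀ u, 1 ≤ X u := by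
  refine ae_all_iff.2 fun u => ?_
  have h := pmf_ae_ne_zero hp0
  rw [← Measure.infinitePi_map_eval (fun _ : List ℕ => p.toMeasure) u] at h
  exact ae_of_ae_map (measurable_pi_apply u).aemeasurable h

/-- For two atoms `a` and `b`, every `k` differs from at least one of them, whence `p k ≤ 1 - p a`
or `p k ≤ 1 - p b`. -/
theorem exists_pmf_bound (hp : p.support.Nontrivial) : ∃ θ < 1, ∀ k, p k ≤ θ := by
  obtain ⟨a, ha, b, hb, hab⟩ := hp
  rw [PMF.mem_support_iff] at ha hb
  have h2 : ∀ i j, i ≠ j → p i + p j ≤ 1 := fun i j hij => by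
    rw [← p.tsum_coe]
    have := ENNReal.sum_le_tsum (f := p) {i, j}
    rwa [Finset.sum_pair hij] at this
  refine ⟨max (1 - p a) (1 - p b), max_lt ?_ ?_, fun k => ?_⟩
  · exact ENNReal.sub_lt_self ENNReal.one_ne_top one_ne_zero ha
  · exact ENNReal.sub_lt_self ENNReal.one_ne_top one_ne_zero hb
  · by_cases hk : k = a
    · refine le_max_of_le_right (ENNReal.le_sub_of_add_le_right (p.apply_ne_top b) (h2 k b ?_))
      rwa [hk]
    · exact le_max_of_le_left (ENNReal.le_sub_of_add_le_right (p.apply_ne_top a) (h2 k a hk))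

theorem pmf_mean {m : ℝ} (hpm : HasSum (fun k : ℕ => (k : ℝ) * (p k).toReal) m) :
    ∫⁻ k, (k : ℝ≥0∞) ∂p.toMeasure = ENNReal.ofReal m := by
  rw [lintegral_countable']
  rw [← hpm.tsum_eq, ENNReal.ofReal_tsum_of_nonneg (fun k => by positivity) hpm.summable]
  refine tsum_congr fun k => ?_
  rw [PMF.toMeasure_apply_singleton _ _ (measurableSet_singleton _),
    ENNReal.ofReal_mul (by positivity), ENNReal.ofReal_toReal (p.apply_ne_top k)]
  simp

theorem one_le_mean {m : ℝ} (hp0 : p 0 = 0)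
    (hpm : HasSum (fun k : ℕ => (k : ℝ) * (p k).toReal) m) : 1 ≤ m := by
  have h1 : (1 : ℝ≥0∞) ≤ ENNReal.ofReal m := by
    rw [← pmf_mean hpm]
    calc (1 : ℝ≥0∞) = ∫⁻ _, 1 ∂p.toMeasure := by simp
      _ ≤ _ := lintegral_mono_ae ((pmf_ae_ne_zero hp0).mono fun k hk => by exact_mod_cast hk)
  simpa using h1

theorem isIndividual_cons {N : List ℕ → ℕ} {u : List ℕ} {i : ℕ} :
    IsIndividual N (i :: u) ↔ IsIndividual N u ∧ i < N u :=
  ⟨fun h => by cases h with | child _ _ h1 h2 => exact ⟨h1, h2⟩, fun h => .child _ _ h.1 h.2⟩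

theorem measurable_isIndividual (u : List ℕ) :
    Measurable fun N : List ℕ → ℕ => IsIndividual N u := by
  induction u with
  | nil =>
    simp only [IsIndividual.root]
    exact measurable_const
  | cons i u ih =>
    simp only [isIndividual_cons]
    exact ih.and (measurableSet_setOfPred.1 ((measurable_pi_apply u) (measurableSet_Ioi (a := i))))

/-- The number of individuals in the `k`-th generation. -/
def generationSize (N : List ℕ → ℕ) (k : ℕ) : ℕ := {u | IsIndividual N u ∧ u.length = k}.ncard

theorem generation_finite (N : List ℕ → ℕ) (k : ℕ) :
    {u | IsIndividual N u ∧ u.length = k}.Finite := by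
  induction k with
  | zero => exact (Set.finite_singleton []).subset fun u hu => List.length_eq_zero_iff.1 hu.2
  | succ k ih =>
    refine (ih.biUnion fun u _ => (Set.finite_lt_nat (N u)).image (· :: u)).subset ?_
    rintro (_ | ⟨i, u⟩) ⟨h1, h2⟩
    · simp at h2
    · rw [isIndividual_cons] at h1
      simp only [Set.mem_iUnion]
      exact ⟨u, ⟨h1.1, by simpa using h2⟩, i, h1.2, rfl⟩

open Classical in
theorem generationSize_eq_tsum (N : List ℕ → ℕ) (k : ℕ) : (generationSize N k : ℝ≥0∞) =
    ∑' u : List ℕ, if IsIndividual N u ∧ u.length = k then 1 else 0 := by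
  have h := generation_finite N k
  rw [generationSize, Set.ncard_eq_toFinset_card _ h, tsum_eq_sum (s := h.toFinset)]
  · rw [Finset.sum_congr rfl (g := fun _ => 1) (fun u hu => if_pos (by simpa using hu))]
    simp
  · intro u hu
    rw [if_neg]
    simpa using hu

open Classical in
theorem generationSize_succ (N : List ℕ → ℕ) (k : ℕ) : (generationSize N (k + 1) : ℝ≥0∞) =
    ∑' u : List ℕ, if IsIndividual N u ∧ u.length = k then (N u : ℝ≥0∞) else 0 := by
  have h : ∀ u : List ℕ, (if IsIndividual N u ∧ u.length = k then (N u : ℝ≥0∞) else 0) =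
      ∑' i : ℕ, if IsIndividual N (i :: u) ∧ (i :: u).length = k + 1 then 1 else 0 := by
    intro u
    by_cases hu : IsIndividual N u ∧ u.length = k
    · rw [if_pos hu, tsum_eq_sum (s := Finset.range (N u))]
      · rw [Finset.sum_congr rfl (g := fun _ => 1) (fun i hi => if_pos
          ⟨isIndividual_cons.2 ⟨hu.1, Finset.mem_range.1 hi⟩, by simp [hu.2]⟩)]
        simp
      · intro i hi
        rw [if_neg]
        rintro ⟨h1, -⟩
        exact hi (Finset.mem_range.2 (isIndividual_cons.1 h1).2)
    · rw [if_neg hu, eq_comm, ENNReal.tsum_eq_zero]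
      intro i
      rw [if_neg]
      rintro ⟨h1, h2⟩
      exact hu ⟨(isIndividual_cons.1 h1).1, by simpa using h2⟩
  simp only [h]
  rw [generationSize_eq_tsum, ← ENNReal.tsum_prod (f := fun (u : List ℕ) (i : ℕ) =>
    if IsIndividual N (i :: u) ∧ (i :: u).length = k + 1 then (1 : ℝ≥0∞) else 0)]
  have hinj : Function.Injective fun q : List ℕ × ℕ => q.2 :: q.1 := by
    rintro ⟨u, i⟩ ⟨v, j⟩ h
    simp only [List.cons.injEq] at h
    simp [h]
  symm
  refine hinj.tsum_eq (f := fun u : List ℕ =>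
    if IsIndividual N u ∧ u.length = k + 1 then (1 : ℝ≥0∞) else 0) ?_
  rintro (_ | ⟨i, u⟩) h
  · simp at h
  · exact ⟨(u, i), rfl⟩

theorem measurable_generationSize (k : ℕ) :
    Measurable fun N : List ℕ → ℕ => (generationSize N k : ℝ) :=
  measurable_ncard (fun N => generation_finite N k) fun u =>
    (measurable_isIndividual u).and measurable_const

/-- The events which do not depend on the offspring numbers from the `k`-th generation on. -/
def generationFiltration : Filtration ℕ (inferInstance : MeasurableSpace (List ℕ → ℕ)) where
  seq k :=
    { MeasurableSet' := fun A => MeasurableSet A ∧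
        ∀ u : List ℕ, k ≤ u.length → ∀ N b, Function.update N u b ∈ A ↔ N ∈ A
      measurableSet_empty := ⟨.empty, by simp⟩
      measurableSet_compl := fun A hA => ⟨hA.1.compl, fun u hu N b => not_congr (hA.2 u hu N b)⟩
      measurableSet_iUnion := fun A hA => ⟨.iUnion fun n => (hA n).1, fun u hu N b => by
        simp only [Set.mem_iUnion]
        exact exists_congr fun n => (hA n).2 u hu N b⟩ }
  mono' i j hij A hA := ⟨hA.1, fun u hu => hA.2 u (hij.trans hu)⟩
  le' i A hA := hA.1

theorem isIndividual_update {N : List ℕ → ℕ} {u v : List ℕ} (h : v.length ≤ u.length) (b : ℕ) :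
    IsIndividual (Function.update N u b) v ↔ IsIndividual N v := by
  induction v with
  | nil => simp [IsIndividual.root]
  | cons i v ih =>
    rw [isIndividual_cons, isIndividual_cons, ih (by simp at h; omega), Function.update_of_ne]
    rintro rfl
    simp at h

theorem generationSize_update {N : List ℕ → ℕ} {u : List ℕ} {k : ℕ} (h : k ≤ u.length) (b : ℕ) :
    generationSize (Function.update N u b) k = generationSize N k := by
  rw [generationSize, generationSize]
  congr 1
  ext v
  refine and_congr_left fun hv => isIndividual_update (by omega) b

-- This is the martingale property. Resampling the offspring number of a word of length `k` affects
-- neither `A` nor whether the word is an individual, so its mean `m` factors out.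
open Classical in
theorem setLIntegral_generationSize_succ {m : ℝ}
    (hpm : HasSum (fun k : ℕ => (k : ℝ) * (p k).toReal) m) {k : ℕ} {A : Set (List ℕ → ℕ)}
    (hA : MeasurableSet[generationFiltration k] A) :
    ∫⁻ N in A, (generationSize N (k + 1) : ℝ≥0∞) ∂offspringLaw p =
      ENNReal.ofReal m * ∫⁻ N in A, (generationSize N k : ℝ≥0∞) ∂offspringLaw p := by
  have hAm : MeasurableSet A := hA.1
  have hm1 : ∀ u : List ℕ, Measurable fun N : List ℕ → ℕ =>
      if IsIndividual N u ∧ u.length = k then (1 : ℝ≥0∞) else 0 := fun u =>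
    Measurable.ite (measurableSet_setOfPred.2 ((measurable_isIndividual u).and measurable_const))
      measurable_const measurable_const
  have hm2 : ∀ u : List ℕ, Measurable fun N : List ℕ → ℕ =>
      if IsIndividual N u ∧ u.length = k then (N u : ℝ≥0∞) else 0 := fun u =>
    Measurable.ite (measurableSet_setOfPred.2 ((measurable_isIndividual u).and measurable_const))
      ((measurable_from_top (f := fun n : ℕ => (n : ℝ≥0∞))).comp (measurable_pi_apply u))
      measurable_const
  simp only [generationSize_succ, generationSize_eq_tsum]
  rw [lintegral_tsum fun u => (hm2 u).aemeasurable, lintegral_tsum fun u => (hm1 u).aemeasurable,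
    ← ENNReal.tsum_mul_left]
  refine tsum_congr fun u => ?_
  rw [← lintegral_indicator hAm, ← lintegral_indicator hAm, offspringLaw,
    lintegral_infinitePi_update _ u ((hm2 u).indicator hAm), ← lintegral_const_mul _
      ((hm1 u).indicator hAm)]
  refine lintegral_congr fun N => ?_
  by_cases hu : IsIndividual N u ∧ u.length = k
  · by_cases hN : N ∈ A
    · rw [Set.indicator_of_mem hN, if_pos hu, mul_one, ← pmf_mean hpm]
      refine lintegral_congr fun b => ?_
      rw [Set.indicator_of_mem ((hA.2 u hu.2.ge N b).2 hN),
        if_pos ⟨(isIndividual_update le_rfl b).2 hu.1, hu.2⟩, Function.update_self]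
    · rw [Set.indicator_of_notMem hN, mul_zero, ← lintegral_zero (μ := p.toMeasure)]
      refine lintegral_congr fun b => ?_
      rw [Set.indicator_of_notMem fun h => hN ((hA.2 u hu.2.ge N b).1 h)]
  · have h0 : ∀ N : List ℕ → ℕ, ¬ (IsIndividual N u ∧ u.length = k) →
        A.indicator (fun N => if IsIndividual N u ∧ u.length = k then (N u : ℝ≥0∞) else 0) N = 0 :=
      fun N h => by simp only [Set.indicator_apply, if_neg h, ite_self]
    rw [lintegral_congr fun b => h0 _ fun h => hu
      ⟨(isIndividual_update le_rfl b).1 h.1, h.2⟩]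
    simp [Set.indicator_apply, if_neg hu]

theorem lintegral_generationSize {m : ℝ}
    (hpm : HasSum (fun k : ℕ => (k : ℝ) * (p k).toReal) m) (k : ℕ) :
    ∫⁻ N, (generationSize N k : ℝ≥0∞) ∂offspringLaw p = ENNReal.ofReal m ^ k := by
  induction k with
  | zero =>
    have : ∀ N, generationSize N 0 = 1 := fun N => by
      rw [generationSize, Set.ncard_eq_one]
      refine ⟨[], ?_⟩
      ext u
      simp only [List.length_eq_zero_iff, Set.mem_setOf_eq, Set.mem_singleton_iff]
      exact ⟨fun h => h.2, fun h => ⟨h ▸ .root, h⟩⟩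
    simp [this]
  | succ k ih =>
    have := setLIntegral_generationSize_succ (p := p) hpm (k := k) (A := Set.univ) .univ
    rw [setLIntegral_univ, setLIntegral_univ, ih] at this
    rw [this, pow_succ, mul_comm]

theorem lintegral_generationSize_div {m : ℝ} (hm : 0 < m)
    (hpm : HasSum (fun k : ℕ => (k : ℝ) * (p k).toReal) m) (k : ℕ) :
    ∫⁻ N, ENNReal.ofReal ((generationSize N k : ℝ) / m ^ k) ∂offspringLaw p = 1 := by
  have : ∀ N : List ℕ → ℕ, ENNReal.ofReal ((generationSize N k : ℝ) / m ^ k) =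
      (generationSize N k : ℝ≥0∞) * (ENNReal.ofReal m ^ k)⁻¹ := fun N => by
    rw [ENNReal.ofReal_div_of_pos (by positivity), ENNReal.ofReal_pow hm.le, ENNReal.ofReal_natCast]
    rfl
  simp only [this]
  rw [lintegral_mul_const', lintegral_generationSize hpm, ENNReal.mul_inv_cancel]
  · simp [hm]
  · simp
  · simp [hm]

/-- The normalized generation sizes converge almost surely. -/
theorem ae_tendsto_generationSize {m : ℝ} (hm : 0 < m)
    (hpm : HasSum (fun k : ℕ => (k : ℝ) * (p k).toReal) m) :
    ∀ᵐ N ∂offspringLaw p, ∃ L : ℝ,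
      Tendsto (fun k : ℕ => (generationSize N k : ℝ) / m ^ k) atTop (𝓝 L) := by
  have hmeas : ∀ k, Measurable fun N : List ℕ → ℕ => (generationSize N k : ℝ) / m ^ k :=
    fun k => (measurable_generationSize k).div_const _
  have hnn : ∀ k (N : List ℕ → ℕ), 0 ≤ (generationSize N k : ℝ) / m ^ k := fun k N => by positivity
  have hint : ∀ k, Integrable (fun N => (generationSize N k : ℝ) / m ^ k) (offspringLaw p) := by
    intro k
    refine ⟨(hmeas k).aestronglyMeasurable, ?_⟩
    rw [hasFiniteIntegral_iff_ofReal (ae_of_all _ (hnn k)), lintegral_generationSize_div hm hpm]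
    exact ENNReal.one_lt_top
  have hset : ∀ k (A : Set (List ℕ → ℕ)),
      ∫ N in A, (generationSize N k : ℝ) / m ^ k ∂offspringLaw p =
        ((∫⁻ N in A, (generationSize N k : ℝ≥0∞) ∂offspringLaw p) *
          (ENNReal.ofReal m ^ k)⁻¹).toReal := by
    intro k A
    rw [integral_eq_lintegral_of_nonneg_ae (ae_of_all _ (hnn k)) (hmeas k).aestronglyMeasurable,
      ← lintegral_mul_const' _ _ (by simp [hm])]
    congr 1
    refine lintegral_congr fun N => ?_
    rw [ENNReal.ofReal_div_of_pos (by positivity), ENNReal.ofReal_pow hm.le, ENNReal.ofReal_natCast]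
    rfl
  have hmart : Martingale (fun k N => (generationSize N k : ℝ) / m ^ k) generationFiltration
      (offspringLaw p) := by
    refine martingale_of_setIntegral_eq_succ (fun k => ?_) hint fun k A hA => ?_
    · refine Measurable.stronglyMeasurable fun S hS => ⟨hmeas k hS, fun u hu N b => ?_⟩
      simp only [Set.mem_preimage, generationSize_update hu]
    · rw [hset, hset, setLIntegral_generationSize_succ hpm hA, pow_succ,
        ENNReal.mul_inv (by simp) (by simp), mul_comm (ENNReal.ofReal m), mul_assoc, mul_comm
          (ENNReal.ofReal m ^ k)⁻¹, ← mul_assoc (ENNReal.ofReal m), ENNReal.mul_inv_cancel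
          (by simp [hm]) (by simp), one_mul]
  -- The martingale is nonnegative with mean one, hence bounded in L¹.
  refine hmart.submartingale.exists_ae_tendsto_of_bdd (R := 1) fun k => ?_
  rw [eLpNorm_one_eq_lintegral_enorm, ENNReal.coe_one, ← lintegral_generationSize_div hm hpm k]
  exact lintegral_mono fun N => by rw [Real.enorm_of_nonneg (hnn k N)]

end Offspring
end HorosphericGW

namespace HorosphericGW

/-! ### Genealogical trees and grafts -/

section Grafts

variable {V : Type*}

/-- Descending by `h2` produces a walk of length `l v` to `o`, and by `h1` no walk can be shorter.
All distances in genealogical trees and grafts are obtained from such a rank. -/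
theorem dist_eq_of_rank {G : SimpleGraph V} {o : V} (l : V → ℕ) (h0 : l o = 0)
    (h1 : ∀ x y, G.Adj x y → l y ≤ l x + 1)
    (h2 : ∀ x, x ≠ o → ∃ y, G.Adj x y ∧ l x = l y + 1) :
    G.Connected ∧ ∀ v, G.dist o v = l v := by
  have hr : ∀ n v, l v = n → ∃ w : G.Walk o v, w.length = n := by
    intro n
    induction n with
    | zero =>
      intro v hv
      by_cases h : v = o
      · subst h; exact ⟨.nil, rfl⟩
      · obtain ⟨y, -, hy⟩ := h2 v h
        omega
    | succ n ih =>
      intro v hv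
      obtain ⟨y, hy, hl⟩ := h2 v (by rintro rfl; omega)
      obtain ⟨w, hw⟩ := ih y (by omega)
      exact ⟨w.concat hy.symm, by rw [SimpleGraph.Walk.length_concat, hw]⟩
  have hl : ∀ {u v} (w : G.Walk u v), l v ≤ l u + w.length := by
    intro u v w
    induction w with
    | nil => simp
    | cons h w ih =>
      have := h1 _ _ h
      rw [SimpleGraph.Walk.length_cons]
      omega
  have hreach : ∀ v, G.Reachable o v := fun v => (hr _ v rfl).choose.reachable
  have : Nonempty V := ⟨o⟩
  refine ⟨⟨fun u v => (hreach u).symm.trans (hreach v)⟩, fun v => le_antisymm ?_ ?_⟩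
  · obtain ⟨w, hw⟩ := hr _ v rfl
    exact hw ▸ SimpleGraph.dist_le w
  · obtain ⟨w, hw⟩ := (hreach v).exists_walk_length_eq_dist
    have := hl w
    omega

/-- The progenitor of a genealogical tree. -/
def progenitor (N : List ℕ → ℕ) : {u : List ℕ // IsIndividual N u} := ⟨[], .root⟩

theorem exists_genealogical_parent {N : List ℕ → ℕ} {x : {u : List ℕ // IsIndividual N u}}
    (hx : x.1 ≠ []) : ∃ y, (genealogicalTree N).Adj x y ∧ x.1.length = y.1.length + 1 := by
  obtain ⟨_ | ⟨i, u⟩, h⟩ := x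
  · exact (hx rfl).elim
  · exact ⟨⟨u, (isIndividual_cons.1 h).1⟩, Or.inr ⟨i, rfl⟩, rfl⟩

theorem genealogical_length {N : List ℕ → ℕ} {x y : {u : List ℕ // IsIndividual N u}}
    (h : (genealogicalTree N).Adj x y) :
    y.1.length = x.1.length + 1 ∨ x.1.length = y.1.length + 1 := by
  rcases h with ⟨i, h⟩ | ⟨i, h⟩ <;> simp [h]

theorem genealogicalTree_dist (N : List ℕ → ℕ) : (genealogicalTree N).Connected ∧
    ∀ u, (genealogicalTree N).dist (progenitor N) u = u.1.length :=
  dist_eq_of_rank _ rfl (fun _ _ h => by have := genealogical_length h; omega)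
    fun _ hx => exists_genealogical_parent fun h => hx (Subtype.ext h)

theorem genealogicalTree_finite (N : List ℕ → ℕ) (u) :
    ((genealogicalTree N).neighborSet u).Finite := by
  refine Set.Finite.of_finite_image (f := Subtype.val) ?_ Subtype.val_injective.injOn
  refine (((Set.finite_lt_nat (N u.1)).image (· :: u.1)).union
    (Set.finite_singleton u.1.tail)).subset ?_
  rintro _ ⟨v, h, rfl⟩
  rcases h with ⟨i, h⟩ | ⟨i, h⟩
  · refine Or.inl ⟨i, ?_, h.symm⟩
    have := v.2
    rw [h, isIndividual_cons] at this
    exact this.2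
  · exact Or.inr (by simp [h])

theorem infinite_individuals {N : List ℕ → ℕ} (hN : ∀ u, 1 ≤ N u) :
    Infinite {u : List ℕ // IsIndividual N u} := by
  have h : ∀ n, IsIndividual N (List.replicate n 0) := fun n => by
    induction n with
    | zero => exact .root
    | succ n ih => exact isIndividual_cons.2 ⟨ih, hN _⟩
  refine Infinite.of_injective (fun n => ⟨_, h n⟩ : ℕ → {u : List ℕ // IsIndividual N u})
    fun a b hab => ?_
  simpa using congrArg (fun u : {u : List ℕ // IsIndividual N u} => u.1.length) hab

theorem genealogicalTree_nice {N : List ℕ → ℕ} (hN : ∀ u, 1 ≤ N u) :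
    IsInfiniteLocallyFiniteConnected (genealogicalTree N) :=
  ⟨infinite_individuals hN, (genealogicalTree_dist N).1, genealogicalTree_finite N⟩

/-- The adjacency relation of a graft. -/
def GraftAdj (N : List ℕ → ℕ) (H : SimpleGraph V) (r : V) :
    {u : List ℕ // IsIndividual N u} ⊕ V → {u : List ℕ // IsIndividual N u} ⊕ V → Prop
  | .inl u, .inl v => (genealogicalTree N).Adj u v
  | .inl u, .inr y => u.1 = [] ∧ y = r
  | .inr y, .inl u => u.1 = [] ∧ y = r
  | .inr x, .inr y => H.Adj x y

/-- The genealogical tree joined to the graph `H` by an edge between the progenitor and `r`. -/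
def graft (N : List ℕ → ℕ) (H : SimpleGraph V) (r : V) :
    SimpleGraph ({u : List ℕ // IsIndividual N u} ⊕ V) where
  Adj := GraftAdj N H r
  symm := ⟨by
    rintro (u | x) (v | y) h
    exacts [SimpleGraph.Adj.symm (G := genealogicalTree N) h, h, h, SimpleGraph.Adj.symm (G := H) h]⟩
  loopless := ⟨by
    rintro (u | x) h
    exacts [(genealogicalTree N).irrefl h, H.irrefl h]⟩

variable {N : List ℕ → ℕ} {H : SimpleGraph V} {r : V}

theorem graft_dist_left (hH : H.Connected) : (graft N H r).Connected ∧
    ∀ x, (graft N H r).dist (.inl (progenitor N)) x =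
      Sum.elim (fun u => u.1.length) (fun y => H.dist r y + 1) x := by
  refine dist_eq_of_rank _ rfl ?_ ?_
  · rintro (u | x) (v | y) h
    · have := genealogical_length (show (genealogicalTree N).Adj u v from h)
      simp only [Sum.elim_inl]; omega
    · obtain ⟨h1, rfl⟩ := h
      simp
    · obtain ⟨h1, rfl⟩ := h
      simp [h1]
    · have h1 : H.Adj x y := h
      have h2 := hH.dist_triangle (u := r) (v := x) (w := y)
      rw [SimpleGraph.dist_eq_one_iff_adj.2 h1] at h2
      simp only [Sum.elim_inr]; omega
  · rintro (u | x) hx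
    · obtain ⟨y, h1, h2⟩ := exists_genealogical_parent (x := u) fun h => hx (by
        congr 1; exact Subtype.ext h)
      exact ⟨.inl y, h1, h2⟩
    · by_cases h : x = r
      · subst h
        exact ⟨.inl (progenitor N), ⟨rfl, rfl⟩, by simp [progenitor]⟩
      · have h0 : H.dist r x ≠ 0 := fun h' => h (hH.dist_eq_zero_iff.1 h').symm
        obtain ⟨k, hk⟩ := Nat.exists_eq_succ_of_ne_zero h0
        obtain ⟨y, h1, h2⟩ := exists_adj_dist hH hk
        exact ⟨.inr y, h1.symm, by simp [hk, h2]⟩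

theorem graft_dist_right (hH : H.Connected) (z : V) (x) : (graft N H r).dist (.inr z) x =
      Sum.elim (fun u => u.1.length + H.dist z r + 1) (fun y => H.dist z y) x := by
  refine (dist_eq_of_rank (G := graft N H r) (o := .inr z) (Sum.elim
    (fun u => u.1.length + H.dist z r + 1) (fun y => H.dist z y)) SimpleGraph.dist_self ?_ ?_).2 x
  · rintro (u | x) (v | y) h
    · have := genealogical_length (show (genealogicalTree N).Adj u v from h)
      simp only [Sum.elim_inl]; omega
    · obtain ⟨h1, rfl⟩ := h
      simp only [Sum.elim_inl, Sum.elim_inr]; omega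
    · obtain ⟨h1, rfl⟩ := h
      simp [h1]
    · have h1 : H.Adj x y := h
      have h2 := hH.dist_triangle (u := z) (v := x) (w := y)
      rw [SimpleGraph.dist_eq_one_iff_adj.2 h1] at h2
      simp only [Sum.elim_inr]; omega
  · rintro (u | x) hx
    · by_cases h : u.1 = []
      · exact ⟨.inr r, ⟨h, rfl⟩, by simp [h]⟩
      · obtain ⟨y, h1, h2⟩ := exists_genealogical_parent h
        exact ⟨.inl y, h1, by simp only [Sum.elim_inl]; omega⟩
    · have h : x ≠ z := by rintro rfl; exact hx rfl
      have h0 : H.dist z x ≠ 0 := fun h' => h (hH.dist_eq_zero_iff.1 h').symm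
      obtain ⟨k, hk⟩ := Nat.exists_eq_succ_of_ne_zero h0
      obtain ⟨y, h1, h2⟩ := exists_adj_dist hH hk
      exact ⟨.inr y, h1.symm, by simp [hk, h2]⟩

theorem graft_nice (hN : ∀ u, 1 ≤ N u) (hH : H.Connected) (hf : ∀ v, (H.neighborSet v).Finite) :
    IsInfiniteLocallyFiniteConnected (graft N H r) := by
  have := infinite_individuals hN
  refine ⟨inferInstance, (graft_dist_left hH).1, ?_⟩
  rintro (u | x)
  · refine (((genealogicalTree_finite N u).image Sum.inl).union
      (Set.finite_singleton (Sum.inr r))).subset ?_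
    rintro (v | y) h
    · exact Or.inl ⟨v, h, rfl⟩
    · exact Or.inr (congrArg Sum.inr h.2)
  · refine (((hf x).image Sum.inr).union (Set.finite_singleton (Sum.inl (progenitor N)))).subset ?_
    rintro (v | y) h
    · exact Or.inr (congrArg Sum.inl (Subtype.ext h.1))
    · exact Or.inl ⟨y, h, rfl⟩

/-- Interchanging the two parts of the graft of two genealogical trees. -/
def graftSwap (X Y : List ℕ → ℕ) : graft X (genealogicalTree Y) (progenitor Y) ≃g
    graft Y (genealogicalTree X) (progenitor X) where
  toEquiv := Equiv.sumComm _ _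
  map_rel_iff' := by
    rintro (u | x) (v | y)
    · exact Iff.rfl
    · exact ⟨fun ⟨h1, h2⟩ => ⟨congrArg Subtype.val h2, Subtype.ext h1⟩,
        fun ⟨h1, h2⟩ => ⟨congrArg Subtype.val h2, Subtype.ext h1⟩⟩
    · exact ⟨fun ⟨h1, h2⟩ => ⟨congrArg Subtype.val h2, Subtype.ext h1⟩,
        fun ⟨h1, h2⟩ => ⟨congrArg Subtype.val h2, Subtype.ext h1⟩⟩
    · exact Iff.rfl

/-- The words which do not pass through the child `i` of the progenitor, the other children being
renumbered. -/
def skipWord (i : ℕ) : List ℕ → List ℕ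
  | [] => []
  -- The oldest ancestor is the last letter of a word, so only that letter is renumbered, to leave
  -- room for the child `i` of the progenitor.
  | j :: u => (if u = [] ∧ i ≤ j then j + 1 else j) :: skipWord i u

theorem skipWord_injective (i : ℕ) : Function.Injective (skipWord i) := by
  intro u v h
  induction u generalizing v with
  | nil => cases v with
    | nil => rfl
    | cons k v => simp [skipWord] at h
  | cons j u ih => cases v with
    | nil => simp [skipWord] at h
    | cons k v =>
      simp only [skipWord, List.cons.injEq] at h
      obtain rfl := ih h.2
      have h1 := h.1
      congr 1
      by_cases hu : u = []
      · simp only [hu, true_and] at h1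
        split_ifs at h1 <;> omega
      · simpa [hu] using h1

theorem skipWord_ne (i : ℕ) (u v : List ℕ) : skipWord i u ≠ v ++ [i] := by
  induction u generalizing v with
  | nil => simp [skipWord]
  | cons j u ih => cases v with
    | nil =>
      simp only [skipWord, List.nil_append, Ne, List.cons.injEq, not_and]
      intro h1 h2
      cases u with
      | nil => simp only [true_and] at h1; split_ifs at h1 <;> omega
      | cons k u => simp [skipWord] at h2
    | cons k v =>
      simp only [skipWord, List.cons_append, Ne, List.cons.injEq, not_and]
      exact fun _ => ih v

/-- The decomposition of the set of words according to whether they pass through the child `i` of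
the progenitor. -/
def wordEquiv (i : ℕ) : List ℕ ⊕ List ℕ ≃ List ℕ :=
  Equiv.ofBijective (Sum.elim (skipWord i) (· ++ [i])) <| by
    constructor
    · rintro (u | u) (v | v) h
      · exact congrArg Sum.inl (skipWord_injective i h)
      · exact (skipWord_ne i u v h).elim
      · exact (skipWord_ne i v u h.symm).elim
      · exact congrArg Sum.inr (List.append_cancel_right h)
    · intro u
      induction u with
      | nil => exact ⟨.inl [], rfl⟩
      | cons j u ih =>
        obtain ⟨v | v, rfl⟩ := ih
        · rcases v with _ | ⟨k, v⟩
          · by_cases hj : j = i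
            · exact ⟨.inr [], by simp [hj, skipWord]⟩
            · refine ⟨.inl [if j < i then j else j - 1], ?_⟩
              simp only [Sum.elim_inl, skipWord, true_and, List.cons.injEq, and_true]
              split_ifs <;> omega
          · exact ⟨.inl (j :: k :: v), by simp [skipWord]⟩
        · exact ⟨.inr (j :: v), rfl⟩

theorem wordEquiv_inl (i : ℕ) (u : List ℕ) : wordEquiv i (.inl u) = skipWord i u := rfl
theorem wordEquiv_inr (i : ℕ) (u : List ℕ) : wordEquiv i (.inr u) = u ++ [i] := rfl

/-- The offspring numbers of the tree obtained by inserting the tree with offspring numbers `Y` as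
the `i`-th child of the progenitor of the tree with offspring numbers `X`. -/
def insertChild (i : ℕ) (X Y : List ℕ → ℕ) (u : List ℕ) : ℕ :=
  Sum.elim X Y ((wordEquiv i).symm u) + if u = [] then 1 else 0

variable {i : ℕ} {X Y : List ℕ → ℕ}

theorem insertChild_skipWord (u : List ℕ) :
    insertChild i X Y (skipWord i u) = X u + if u = [] then 1 else 0 := by
  rw [insertChild, ← wordEquiv_inl, Equiv.symm_apply_apply, wordEquiv_inl]
  cases u <;> simp [skipWord]

theorem insertChild_append (u : List ℕ) : insertChild i X Y (u ++ [i]) = Y u := by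
  rw [insertChild, ← wordEquiv_inr, Equiv.symm_apply_apply, wordEquiv_inr]
  simp

theorem insertChild_nil : insertChild i X Y [] = X [] + 1 :=
  insertChild_skipWord (u := [])

theorem isIndividual_skipWord (hi : i ≤ X []) (u : List ℕ) :
    IsIndividual (insertChild i X Y) (skipWord i u) ↔ IsIndividual X u := by
  induction u with
  | nil => simp [skipWord, IsIndividual.root]
  | cons j u ih =>
    rw [skipWord, isIndividual_cons, isIndividual_cons, ih, insertChild_skipWord]
    refine and_congr_right fun _ => ?_
    by_cases hu : u = []
    · subst hu
      simp only [true_and, if_true]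
      split_ifs <;> omega
    · simp [hu]

theorem isIndividual_append (hi : i ≤ X []) (u : List ℕ) :
    IsIndividual (insertChild i X Y) (u ++ [i]) ↔ IsIndividual Y u := by
  induction u with
  | nil =>
    simp only [List.nil_append, isIndividual_cons, IsIndividual.root, insertChild_nil, true_and, iff_true]
    omega
  | cons j u ih => rw [List.cons_append, isIndividual_cons, isIndividual_cons, ih, insertChild_append]

/-- Any child of the progenitor splits a genealogical tree into two. -/
def graftIso (hi : i ≤ X []) : graft X (genealogicalTree Y) (progenitor Y) ≃g
    genealogicalTree (insertChild i X Y) where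
  toEquiv := Equiv.ofBijective (Sum.elim
      (fun u => ⟨skipWord i u.1, (isIndividual_skipWord hi _).2 u.2⟩)
      (fun u => ⟨u.1 ++ [i], (isIndividual_append hi _).2 u.2⟩)) <| by
    constructor
    · rintro (u | u) (v | v) h <;> have h' := congrArg Subtype.val h
      · exact congrArg Sum.inl (Subtype.ext (skipWord_injective i h'))
      · exact (skipWord_ne i u.1 v.1 h').elim
      · exact (skipWord_ne i v.1 u.1 h'.symm).elim
      · exact congrArg Sum.inr (Subtype.ext (List.append_cancel_right h'))
    · rintro ⟨u, hu⟩
      obtain ⟨w | w, rfl⟩ := (wordEquiv i).surjective u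
      · exact ⟨.inl ⟨w, (isIndividual_skipWord hi w).1 hu⟩, rfl⟩
      · exact ⟨.inr ⟨w, (isIndividual_append hi w).1 hu⟩, rfl⟩
  map_rel_iff' := by
    have h1 : ∀ u v : List ℕ, (∃ j, skipWord i v = j :: skipWord i u) ↔ ∃ j, v = j :: u := by
      intro u v
      constructor
      · rintro ⟨j, h⟩
        cases v with
        | nil => simp [skipWord] at h
        | cons k v =>
          simp only [skipWord, List.cons.injEq] at h
          exact ⟨k, by rw [skipWord_injective i h.2]⟩
      · rintro ⟨j, rfl⟩
        exact ⟨_, rfl⟩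
    have h2 : ∀ u v : List ℕ, (∃ j, v ++ [i] = j :: (u ++ [i])) ↔ ∃ j, v = j :: u := by
      intro u v
      simp only [← List.cons_append, List.append_cancel_right_eq]
    have h3 : ∀ u y : List ℕ, ((∃ j, y ++ [i] = j :: skipWord i u) ∨
        ∃ j, skipWord i u = j :: (y ++ [i])) ↔ u = [] ∧ y = [] := by
      intro u y
      constructor
      · rintro (⟨j, h⟩ | ⟨j, h⟩)
        · cases y with
          | nil =>
            simp only [List.nil_append, List.cons.injEq] at h
            cases u with
            | nil => simp
            | cons k u => simp [skipWord] at h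
          | cons k y =>
            simp only [List.cons_append, List.cons.injEq] at h
            exact (skipWord_ne i u y h.2.symm).elim
        · exact (skipWord_ne i u (j :: y) h).elim
      · rintro ⟨rfl, rfl⟩
        exact Or.inl ⟨i, rfl⟩
    rintro (u | u) (v | v)
    · exact or_congr (h1 _ _) (h1 _ _)
    · exact (h3 u.1 v.1).trans (and_congr_right fun _ => ⟨fun h => Subtype.ext h, fun h => congrArg Subtype.val h⟩)
    · exact or_comm.trans ((h3 v.1 u.1).trans
        (and_congr_right fun _ => ⟨fun h => Subtype.ext h, fun h => congrArg Subtype.val h⟩))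
    · exact or_congr (h2 _ _) (h2 _ _)

theorem graftIso_inl (hi : i ≤ X []) :
    graftIso (Y := Y) hi (.inl (progenitor X)) = progenitor _ := rfl

theorem graftIso_inr (hi : i ≤ X []) (u) :
    (graftIso (X := X) (Y := Y) hi (.inr u)).1 = u.1 ++ [i] := rfl

/-! ### The augmented process -/

variable {p : PMF ℕ}

/-- The law of the offspring numbers of the augmented process. -/
def augmentedOffspringLaw (p : PMF ℕ) : Measure (List ℕ → ℕ) :=
  Measure.infinitePi fun u => (augmentedOffspring p u).toMeasure

theorem measurable_insertChild (i : ℕ) :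
    Measurable fun q : (List ℕ → ℕ) × (List ℕ → ℕ) => insertChild i q.1 q.2 := by
  refine measurable_pi_iff.2 fun u => ?_
  unfold insertChild
  refine Measurable.add_const ?_ _
  rcases (wordEquiv i).symm u with v | v
  · exact (measurable_pi_apply v).comp measurable_fst
  · exact (measurable_pi_apply v).comp measurable_snd

/-- The extra child of the progenitor may be given any index `i`: the subtree below it and the
remaining tree are independent with the ordinary law. The augmentation serves to make the two ends
of this edge play the same role. -/
theorem map_insertChild (p : PMF ℕ) (i : ℕ) :
    ((offspringLaw p).prod (offspringLaw p)).map (fun q => insertChild i q.1 q.2) =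
      augmentedOffspringLaw p := by
  have h1 := infinitePi_prod_map_sum (fun _ : List ℕ => p.toMeasure) (fun _ : List ℕ => p.toMeasure)
  have h2 := Measure.infinitePi_map_piCongrLeft (μ := fun _ : List ℕ => p.toMeasure) (wordEquiv i)
  have h3 := Measure.infinitePi_map_pi (fun _ : List ℕ => p.toMeasure)
    (f := fun (u : List ℕ) k => k + if u = [] then 1 else 0) fun u => measurable_from_top
  have h4 : (fun u : List ℕ => p.toMeasure.map fun k => k + if u = [] then 1 else 0) =
      fun u => (augmentedOffspring p u).toMeasure := by
    ext1 u
    by_cases hu : u = []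
    · simp only [augmentedOffspring, hu, if_true]
      exact PMF.toMeasure_map _ p measurable_from_top
    · simp only [augmentedOffspring, hu, if_false, add_zero]
      exact Measure.map_id
  have h5 : (Sum.elim (fun _ : List ℕ => p.toMeasure) fun _ : List ℕ => p.toMeasure) =
      fun _ => p.toMeasure := by ext1 (u | u) <;> rfl
  rw [h5] at h1
  rw [augmentedOffspringLaw]
  simp only [← h4]
  rw [← h3, ← h2, ← h1, Measure.map_map (MeasurableEquiv.measurable _) measurable_sumElim,
    Measure.map_map]
  · congr 1
    ext q u
    obtain ⟨w, rfl⟩ := (wordEquiv i).surjective u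
    simp only [Function.comp_apply, MeasurableEquiv.coe_piCongrLeft, Equiv.piCongrLeft_apply_apply,
      insertChild, Equiv.symm_apply_apply]
  · exact measurable_pi_iff.2 fun u => (measurable_pi_apply u).add_const _
  · exact (MeasurableEquiv.measurable _).comp measurable_sumElim

end Grafts
end HorosphericGW

namespace HorosphericGW

/-! ### Walks which explore a random tree -/

section Exploration

variable {S R : Type*}

/-- The steps from `List ℕ × S` which do not lead to offspring. -/
def BackStep (C : S → S → Prop) (up : S → R → Prop) (a : List ℕ × S) :
    (List ℕ × S) ⊕ R → Prop
  | .inl b => ∃ i, a.1 = i :: b.1 ∧ C a.2 b.2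
  | .inr r => a.1 = [] ∧ up a.2 r

/-- The steps of a walk which explores the tree with offspring numbers `X`: a step to a child is
coupled with the map `D`, a step to the parent is coupled with the relation `C`, and the progenitor
has access to the space `R`, which carries the relation `A`. -/
def ExploreStep (D : S → S) (C : S → S → Prop) (up : S → R → Prop) (down : R → S → Prop)
    (A : R → R → Prop) (X : List ℕ → ℕ) : (List ℕ × S) ⊕ R → (List ℕ × S) ⊕ R → Prop
  | .inl a, w => (∃ i < X a.1, w = .inl (i :: a.1, D a.2)) ∨ BackStep C up a w
  | .inr r, .inl b => b.1 = [] ∧ down r b.2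
  | .inr r, .inr r' => A r r'

/-- The distance of a position from the space `R`. -/
def exploreRank : (List ℕ × S) ⊕ R → ℕ := Sum.elim (fun a => a.1.length + 1) fun _ => 0

variable {D : S → S} {C : S → S → Prop} {up : S → R → Prop} {down : R → S → Prop}
  {A : R → R → Prop} {X X' : List ℕ → ℕ}

theorem BackStep.rank {a : List ℕ × S} {w : (List ℕ × S) ⊕ R} (h : BackStep C up a w) :
    exploreRank w ≤ a.1.length := by
  rcases w with b | r
  · obtain ⟨i, h, -⟩ := h
    simp [exploreRank, h]
  · simp [exploreRank]

theorem ExploreStep.rank {w w' : (List ℕ × S) ⊕ R} (h : ExploreStep D C up down A X w w') :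
    exploreRank w' ≤ exploreRank w + 1 := by
  rcases w with a | r
  · rcases h with ⟨i, -, rfl⟩ | h
    · simp [exploreRank]
    · have := h.rank
      simp only [exploreRank, Sum.elim_inl] at this ⊢
      omega
  · rcases w' with b | r'
    · simp [exploreRank, h.1]
    · simp [exploreRank]

theorem exploreStep_finite (hC : ∀ s, {t | C s t}.Finite) (hup : ∀ s, {r | up s r}.Finite)
    (hdown : ∀ r, {s | down r s}.Finite) (hA : ∀ r, {r' | A r r'}.Finite)
    (w : (List ℕ × S) ⊕ R) : {w' | ExploreStep D C up down A X w w'}.Finite := by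
  rcases w with ⟨u, s⟩ | r
  · refine (((Set.finite_lt_nat (X u)).image fun i => Sum.inl (i :: u, D s)).union
      (((hC s).image fun t => Sum.inl (u.tail, t)).union ((hup s).image Sum.inr))).subset ?_
    rintro w (⟨i, hi, rfl⟩ | h)
    · exact Or.inl ⟨i, hi, rfl⟩
    · rcases w with ⟨v, t⟩ | r
      · obtain ⟨i, h1, h2⟩ := h
        exact Or.inr (Or.inl ⟨t, h2, by simp only at h1; simp [h1]⟩)
      · exact Or.inr (Or.inr ⟨r, h.2, rfl⟩)
  · refine (((hdown r).image fun t => Sum.inl ([], t)).union ((hA r).image Sum.inr)).subset ?_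
    rintro (⟨v, t⟩ | r') h
    · exact Or.inl ⟨t, h.2, by have : v = [] := h.1; simp [this]⟩
    · exact Or.inr ⟨r', h, rfl⟩

/-- A walk reads offspring numbers only at the positions it leaves, and under the bound on the rank
all of these belong to generations before `L`. -/
theorem explore_wcount_congr {L : ℕ} (h : ∀ u : List ℕ, u.length < L → X u = X' u) (n : ℕ)
    (w : (List ℕ × S) ⊕ R) (hw : exploreRank w + n ≤ L + 1) :
    wcount (ExploreStep D C up down A X) n w = wcount (ExploreStep D C up down A X') n w := by
  classical
  induction n generalizing w with
  | zero => rfl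
  | succ n ih =>
    rw [wcount, wcount]
    refine tsum_congr fun w' => ?_
    have h1 : ExploreStep D C up down A X w w' ↔ ExploreStep D C up down A X' w w' := by
      rcases w with a | r
      · have := h a.1 (by simp only [exploreRank, Sum.elim_inl] at hw; omega)
        simp only [ExploreStep, this]
      · rcases w' with b | r' <;> exact Iff.rfl
    by_cases h2 : ExploreStep D C up down A X w w'
    · rw [if_pos h2, if_pos (h1.1 h2), ih w' (by have := h2.rank; omega)]
    · rw [if_neg h2, if_neg fun h => h2 (h1.2 h)]

open Classical in
theorem explore_wcount_succ (n : ℕ) (a : List ℕ × S) :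
    wcount (ExploreStep D C up down A X) (n + 1) (.inl a) =
      (∑' i : ℕ, if i < X a.1 then
        wcount (ExploreStep D C up down A X) n (.inl (i :: a.1, D a.2)) else 0) +
      ∑' w, if BackStep C up a w then wcount (ExploreStep D C up down A X) n w else 0 := by
  have h : ∀ w, (if ExploreStep D C up down A X (.inl a) w then
        wcount (ExploreStep D C up down A X) n w else 0) =
      (if ∃ i < X a.1, w = .inl (i :: a.1, D a.2) then
        wcount (ExploreStep D C up down A X) n w else 0) +
      if BackStep C up a w then wcount (ExploreStep D C up down A X) n w else 0 := by
    intro w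
    by_cases h1 : ∃ i < X a.1, w = .inl (i :: a.1, D a.2)
    · have h2 : ¬ BackStep C up a w := fun h2 => by
        have := h2.rank
        obtain ⟨i, -, rfl⟩ := h1
        simp [exploreRank] at this
      rw [if_pos h1, if_neg h2, add_zero, if_pos (show ExploreStep D C up down A X (.inl a) w from Or.inl h1)]
    · rw [if_neg h1, zero_add]
      exact if_congr (show ExploreStep D C up down A X (.inl a) w ↔ _ from or_iff_right h1) rfl rfl
  rw [wcount, tsum_congr h, ENNReal.tsum_add]
  congr 1
  have hinj : Function.Injective fun i : ℕ => (Sum.inl (i :: a.1, D a.2) : (List ℕ × S) ⊕ R) :=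
    fun i j hij => by simpa using hij
  rw [← hinj.tsum_eq]
  · refine tsum_congr fun i => if_congr ?_ rfl rfl
    constructor
    · rintro ⟨j, hj, h⟩
      rwa [hinj h]
    · exact fun h => ⟨i, h, rfl⟩
  · intro w hw
    by_contra h1
    refine hw (if_neg ?_)
    rintro ⟨i, -, rfl⟩
    exact h1 ⟨i, rfl⟩

/-- The effect on the number of walks of a change of the offspring number of one individual which
can just be reached. -/
theorem explore_wcount_change {L : ℕ} (h : ∀ u, u ≠ List.replicate L 0 → X u = X' u)
    (hX : ∀ u, 1 ≤ X u) (n : ℕ) (a : List ℕ × S) (ha : a.1.length + n = L) :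
    wcount (ExploreStep D C up down A X) (n + 1) (.inl a) +
        (if a.1 = List.replicate a.1.length 0 then (X' (List.replicate L 0) : ℝ≥0∞) else 0) =
      wcount (ExploreStep D C up down A X') (n + 1) (.inl a) +
        (if a.1 = List.replicate a.1.length 0 then (X (List.replicate L 0) : ℝ≥0∞) else 0) := by
  classical
  have hlt : ∀ u : List ℕ, u.length < L → X u = X' u := fun u hu => h u fun h' => by
    rw [h', List.length_replicate] at hu
    omega
  -- After a step back, the remaining steps are too few to leave an individual of generation `L`, so
  -- the change is not noticed.
  have hback : ∀ n (a : List ℕ × S), a.1.length + n = L →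
      (∑' w, if BackStep C up a w then wcount (ExploreStep D C up down A X) n w else 0) =
      ∑' w, if BackStep C up a w then wcount (ExploreStep D C up down A X') n w else 0 := by
    intro n a ha
    refine tsum_congr fun w => ?_
    by_cases hw : BackStep C up a w
    · rw [if_pos hw, if_pos hw, explore_wcount_congr hlt n w (by have := hw.rank; omega)]
    · rw [if_neg hw, if_neg hw]
  have hnat : ∀ k : ℕ, (∑' i : ℕ, if i < k then (1 : ℝ≥0∞) else 0) = k := fun k => by
    rw [tsum_eq_sum (s := Finset.range k) (fun i hi => if_neg (by simpa using hi)),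
      Finset.sum_congr rfl (g := fun _ => 1) (fun i hi => if_pos (by simpa using hi))]
    simp
  induction n generalizing a with
  | zero =>
    rw [explore_wcount_succ, explore_wcount_succ, hback 0 a ha]
    simp only [wcount, hnat]
    split_ifs with h1
    · have : List.replicate L 0 = a.1 := by rw [h1]; simp; omega
      rw [this]
      ring
    · rw [h a.1 fun h' => h1 (by rw [h']; simp)]
  | succ n ih =>
    rw [explore_wcount_succ, explore_wcount_succ, hback (n + 1) a ha, ← hlt a.1 (by omega)]
    -- Only the child `0` can lie on the way to the word `0…0` of length `L`; the other children
    -- contribute equally on both sides. The identity is written with crosswise sums because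
    -- differences are unavailable in `ℝ≥0∞`.
    have hsplit : ∀ f : ℕ → ℝ≥0∞, (∑' i, if i < X a.1 then f i else 0) =
        f 0 + ∑' i, if i + 1 < X a.1 then f (i + 1) else 0 := fun f => by
      rw [tsum_eq_zero_add' ENNReal.summable, if_pos (show 0 < X a.1 from hX a.1)]
    rw [hsplit, hsplit]
    have h0 := ih (0 :: a.1, D a.2) (by simp; omega)
    have hs : ∀ i, wcount (ExploreStep D C up down A X) (n + 1) (.inl ((i + 1) :: a.1, D a.2)) =
        wcount (ExploreStep D C up down A X') (n + 1) (.inl ((i + 1) :: a.1, D a.2)) := fun i => by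
      have := ih ((i + 1) :: a.1, D a.2) (by simp; omega)
      simpa [List.replicate_succ] using this
    simp only [hs]
    simp only [List.length_cons, List.replicate_succ, List.cons.injEq, true_and] at h0
    rw [add_right_comm, add_right_comm _ _ (ite _ _ _), h0]
    ring

variable [Countable S] [Countable R] {p : PMF ℕ}

/-- The progenitor can almost surely be distinguished from all points of `R`. -/
theorem ae_exists_wcount_ne (hp0 : p 0 = 0) (hp : p.support.Nontrivial)
    (hC : ∀ s, {t | C s t}.Finite) (hup : ∀ s, {r | up s r}.Finite)
    (hdown : ∀ r, {s | down r s}.Finite) (hA : ∀ r, {r' | A r r'}.Finite) (s : S) :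
    ∀ᵐ X ∂offspringLaw p, ∀ r : R, ¬ ∀ n,
      wcount (ExploreStep D C up down A X) n (.inr r) =
        wcount (ExploreStep D C up down A X) n (.inl ([], s)) := by
  classical
  refine ae_all_iff.2 fun r => ?_
  obtain ⟨θ, hθ, hpθ⟩ := exists_pmf_bound hp
  -- Truncation from below makes `1 ≤ X u` hold everywhere instead of almost everywhere, as is
  -- needed after a coordinate has been resampled.
  let pos : (List ℕ → ℕ) → List ℕ → ℕ := fun X u => max (X u) 1
  let W : (List ℕ → ℕ) → ℕ → (List ℕ × S) ⊕ R → ℝ≥0∞ := fun X =>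
    wcount (ExploreStep D C up down A (pos X))
  have hW : ∀ n w, Measurable fun X => W X n w := by
    refine measurable_wcount fun w w' => ?_
    rcases w with a | r
    · refine .or (.exists fun i => .and ?_ measurable_const) measurable_const
      have : Measurable fun X : List ℕ → ℕ => max (X a.1) 1 :=
        (measurable_pi_apply a.1).max measurable_const
      exact measurableSet_setOfPred.1 (this (measurableSet_Ioi (a := i)))
    · rcases w' with b | r' <;> exact measurable_const
  -- The count from the progenitor grows by one with each additional child of `0…0` in generation
  -- `L`, while the count from `r`, which lies one step farther away, does not depend on it. Given
  -- the other offspring numbers, equality therefore fixes this one.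
  let E : ℕ → Set (List ℕ → ℕ) := fun L => {X | W X (L + 1) (.inr r) = W X (L + 1) (.inl ([], s))}
  have hzero : offspringLaw p (⋂ L, E L) = 0 := by
    refine infinitePi_iInter_eq_zero (z := fun L => List.replicate L 0) (E := E) _
      (fun L => measurableSet_eq_fun (hW _ _) (hW _ _)) hθ (fun l L hl X b => ?_) (fun L X => ?_)
    · have hag : ∀ u : List ℕ, u.length < L →
          pos (Function.update X (List.replicate L 0) b) u = pos X u := fun u hu => by
        simp only [pos]
        rw [Function.update_of_ne]
        rintro rfl
        simp at hu
      change W _ _ _ = W _ _ _ ↔ W _ _ _ = W _ _ _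
      simp only [W]
      rw [explore_wcount_congr hag (l + 1) _ (by simp [exploreRank]; omega),
        explore_wcount_congr hag (l + 1) _ (by simp [exploreRank]; omega)]
    · have huniq : ∀ b b', Function.update X (List.replicate L 0) b ∈ E L →
          Function.update X (List.replicate L 0) b' ∈ E L → max b 1 = max b' 1 := by
        intro b b' hb hb'
        have hag : ∀ u : List ℕ, u ≠ List.replicate L 0 →
            pos (Function.update X (List.replicate L 0) b) u =
              pos (Function.update X (List.replicate L 0) b') u := fun u hu => by
          simp only [pos]
          rw [Function.update_of_ne hu, Function.update_of_ne hu]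
        have h1 := explore_wcount_change (D := D) (C := C) (up := up) (down := down) (A := A)
          hag (fun u => le_max_right _ _) L ([], s) (by simp)
        have h2 := explore_wcount_congr (D := D) (C := C) (up := up) (down := down) (A := A)
          (L := L) (fun u hu => hag u fun h' => by simp [h'] at hu) (L + 1) (.inr r)
          (by simp [exploreRank])
        have hb1 : W _ _ _ = W _ _ _ := hb
        have hb2 : W _ _ _ = W _ _ _ := hb'
        simp only [W] at hb1 hb2
        rw [← hb1, ← hb2, h2] at h1
        simp only [List.length_nil, List.replicate_zero, if_true, pos, Function.update_self] at h1
        have h3 := (ENNReal.add_right_inj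
          (wcount_lt_top (exploreStep_finite hC hup hdown hA) _ _).ne).1 h1
        exact_mod_cast h3.symm
      by_cases hne : ∃ b, Function.update X (List.replicate L 0) b ∈ E L
      · obtain ⟨b, hb⟩ := hne
        -- The value `0`, which the truncation confuses with `1`, has probability zero.
        have hsub : {b' | Function.update X (List.replicate L 0) b' ∈ E L} ⊆ {max b 1} ∪ {0} := by
          intro b' hb'
          have := huniq b' b hb' hb
          rcases Nat.eq_zero_or_pos b' with h | h
          · exact Or.inr h
          · left
            rw [max_eq_left (show 1 ≤ b' from h)] at this
            exact this
        refine (measure_mono hsub).trans ((measure_union_le _ _).trans ?_)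
        rw [PMF.toMeasure_apply_singleton _ _ (measurableSet_singleton _),
          PMF.toMeasure_apply_singleton _ _ (measurableSet_singleton _), hp0, add_zero]
        exact hpθ _
      · push Not at hne
        simp [hne]
  filter_upwards [ae_one_le hp0, measure_eq_zero_iff_ae_notMem.1 hzero] with X hX hX'
  intro h
  refine hX' (Set.mem_iInter.2 fun L => ?_)
  have hpos : pos X = X := funext fun u => max_eq_left (hX u)
  change W _ _ _ = W _ _ _
  simp only [W, hpos]
  exact h (L + 1)

end Exploration

/-! ### Distinguishing the vertices of grafts and of their horospheric products -/

section GraftExploration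

variable {V V' : Type*} [Countable V] [Countable V'] {H : SimpleGraph V} {r : V} {p : PMF ℕ}

/-- Walks in the graft are exploration walks with trivial coupled space `Unit` and with `R` the
vertex set of the fixed graph `H`. -/
theorem ae_graft_distinct (hp0 : p 0 = 0) (hp : p.support.Nontrivial)
    (hf : ∀ v, (H.neighborSet v).Finite) : ∀ᵐ X ∂offspringLaw p, ∀ y : V, ¬ ∀ n,
      wcount (graft X H r).Adj n (.inr y) = wcount (graft X H r).Adj n (.inl (progenitor X)) := by
  have h := ae_exists_wcount_ne (S := Unit) (R := V) (D := id) (C := fun _ _ => True)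
    (up := fun _ y => y = r) (down := fun y _ => y = r) (A := H.Adj) hp0 hp
    (fun _ => Set.toFinite _) (fun _ => Set.finite_singleton r) (fun _ => Set.toFinite _) hf ()
  filter_upwards [h] with X hX y hy
  refine hX y fun n => ?_
  let ι : {u : List ℕ // IsIndividual X u} ⊕ V → (List ℕ × Unit) ⊕ V :=
    Sum.map (fun u => (u.1, ())) id
  have hι : Function.Injective ι :=
    Sum.map_injective.2 ⟨fun u v h => Subtype.ext (congrArg Prod.fst h), Function.injective_id⟩
  have hstep : ∀ v w', ExploreStep id (fun _ _ => True) (fun _ y => y = r) (fun y _ => y = r)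
      H.Adj X (ι v) w' ↔ ∃ w, ι w = w' ∧ (graft X H r).Adj v w := by
    rintro (u | y) w'
    · constructor
      · rintro (⟨i, hi, rfl⟩ | h)
        · exact ⟨.inl ⟨i :: u.1, isIndividual_cons.2 ⟨u.2, hi⟩⟩, rfl, Or.inl ⟨i, rfl⟩⟩
        · rcases w' with ⟨v, t⟩ | y
          · obtain ⟨i, h1, -⟩ := h
            change u.1 = i :: v at h1
            exact ⟨.inl ⟨v, (isIndividual_cons.1 (h1 ▸ u.2)).1⟩, rfl, Or.inr ⟨i, h1⟩⟩
          · exact ⟨.inr y, rfl, h⟩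
      · rintro ⟨v | y, rfl, h⟩
        · rcases h with ⟨i, h⟩ | ⟨i, h⟩
          · have := v.2
            rw [h, isIndividual_cons] at this
            exact Or.inl ⟨i, this.2, congrArg (fun x => Sum.inl (x, ())) h⟩
          · exact Or.inr ⟨i, h, trivial⟩
        · exact Or.inr h
    · constructor
      · rcases w' with ⟨v, t⟩ | y'
        · rintro ⟨h1, h2⟩
          exact ⟨.inl (progenitor X), congrArg (fun x => Sum.inl (x, ())) (Eq.symm h1), rfl, h2⟩
        · exact fun h => ⟨.inr y', rfl, h⟩
      · rintro ⟨v | y', rfl, h⟩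
        · exact h
        · exact h
  exact (wcount_map hι hstep n (.inr y)).trans
    ((hy n).trans (wcount_map hι hstep n (.inl (progenitor X))).symm)

/-- The ray of a graft which passes through the grafted edge and continues in `H`. -/
def graftRay (X : List ℕ → ℕ) (hH : H.Connected) (γ : Boundary H r) :
    Boundary (graft X H r) (.inl (progenitor X)) :=
  mkBoundary (graft_dist_left hH).1 (scons (.inl (progenitor X)) fun n => .inr (γ.1 n)) rfl
    (fun n => by
      cases n with
      | zero => exact ⟨rfl, γ.2.1⟩
      | succ n => exact γ.adj n)
    (fun n => by
      rw [(graft_dist_left hH).2]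
      cases n with
      | zero => rfl
      | succ n => exact congrArg (· + 1) (γ.dist_root n))

/-- The ray leaves the random tree at its first step, so every individual descends from the
progenitor with respect to the end, and its horofunction is its generation. On `H` the reference
point has moved by one. -/
theorem busemann_graftRay (hH : H.Connected) (γ : Boundary H r) {X : List ℕ → ℕ} (x) :
    busemann (graft X H r) (graftRay X hH γ) (.inl (progenitor X)) x =
      Sum.elim (fun u => (u.1.length : ℤ)) (fun y => busemann H γ r y - 1) x := by
  refine busemann_eq_of_eventually ?_
  obtain ⟨M, hM⟩ : ∃ M : ℕ, ∀ n ≥ M, ((graft X H r).dist x (.inr (γ.1 n)) : ℤ) = n + 1 +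
      Sum.elim (fun u => (u.1.length : ℤ)) (fun y => busemann H γ r y - 1) x := by
    rcases x with u | y
    · refine ⟨0, fun n _ => ?_⟩
      rw [SimpleGraph.dist_comm, graft_dist_right hH, Sum.elim_inl, Sum.elim_inl,
        SimpleGraph.dist_comm, γ.dist_root]
      push_cast
      ring
    · obtain ⟨M, hM⟩ := exists_eventually_dist hH γ y
      refine ⟨M, fun n hn => ?_⟩
      rw [graft_dist_right hH, Sum.elim_inr, Sum.elim_inr, hM n hn]
      ring
  filter_upwards [eventually_ge_atTop (M + 1)] with n hn
  obtain ⟨k, rfl⟩ := Nat.exists_eq_add_of_le' (show 1 ≤ n by omega)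
  have := hM k (by omega)
  push_cast
  exact this

/-- Some vertex `(x, x')` of the horospheric product, where `x` is not a descendant of the root with
respect to `γ`, cannot be distinguished from the root by counting walks. -/
def Twin {G : SimpleGraph V} {o : V} (γ : Boundary G o) {G' : SimpleGraph V'} {o' : V'}
    (γ' : Boundary G' o') : Prop :=
  ∃ w : HorosphericVertex G γ G' γ', busemann G γ o w.1.1 ≠ G.dist o w.1.1 ∧ ∀ n,
    wcount (horosphericProduct G γ G' γ').Adj n w =
      wcount (horosphericProduct G γ G' γ').Adj n (horosphericRoot G γ G' γ')

/-- Walks in the horospheric product are exploration walks with `S = V'`: a step to a child in the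
random tree forces the second coordinate to its parent, a step back allows any child of it. The
space `R` holds the pairs whose first coordinate lies in `H`, and a twin must be of this kind
because on individuals the horofunction equals the distance to the root. -/
theorem ae_not_twin (hp0 : p 0 = 0) (hp : p.support.Nontrivial)
    (hf : ∀ v, (H.neighborSet v).Finite) (hH : H.Connected) (γ : Boundary H r)
    {G' : SimpleGraph V'} (hf' : ∀ v, (G'.neighborSet v).Finite) (hT : G'.IsTree) {o' : V'}
    (γ' : Boundary G' o') : ∀ᵐ X ∂offspringLaw p, ¬ Twin (graftRay X hH γ) γ' := by
  have hchild : ∀ s, {t | parent G' γ' t = s}.Finite := fun s => (hf' s).subset fun t ht => by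
    rw [← show parent G' γ' t = s from ht]
    exact (parent_spec hT γ' t).1.symm
  have h := ae_exists_wcount_ne (S := V') (R := V × V') (D := parent G' γ')
    (C := fun s t => parent G' γ' t = s) (up := fun s q => q.1 = r ∧ parent G' γ' q.2 = s)
    (down := fun q s => q.1 = r ∧ s = parent G' γ' q.2)
    (A := fun q q' => H.Adj q.1 q'.1 ∧ G'.Adj q.2 q'.2 ∧
      busemann H γ r q'.1 - 1 + busemann G' γ' o' q'.2 = 0) hp0 hp hchild
    (fun s => ((Set.finite_singleton r).prod (hchild s)).subset fun q h => h)
    (fun q => (Set.finite_singleton (parent G' γ' q.2)).subset fun t h => h.2)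
    (fun q => ((hf q.1).prod (hf' q.2)).subset fun q h => ⟨h.1, h.2.1⟩) o'
  filter_upwards [h] with X hX
  rintro ⟨⟨⟨u | y, s'⟩, hw⟩, hne, hcount⟩
  · refine hne ?_
    change busemann _ (graftRay X hH γ) _ (.inl u) = ((graft X H r).dist _ (.inl u) : ℤ)
    rw [busemann_graftRay, (graft_dist_left hH).2]
    rfl
  refine hX (y, s') fun n => ?_
  let HV := HorosphericVertex (graft X H r) (graftRay X hH γ) G' γ'
  let pos : ({u : List ℕ // IsIndividual X u} ⊕ V) × V' → (List ℕ × V') ⊕ (V × V') := fun w =>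
    Sum.elim (fun u => .inl (u.1, w.2)) (fun y => .inr (y, w.2)) w.1
  have hpos : Function.Injective pos := by
    rintro ⟨u | y, s⟩ ⟨v | z, t⟩ h
    · simp only [pos, Sum.elim_inl, Sum.inl.injEq, Prod.mk.injEq] at h
      rw [Subtype.ext h.1, h.2]
    · simp [pos] at h
    · simp [pos] at h
    · simp only [pos, Sum.elim_inr, Sum.inr.injEq, Prod.mk.injEq] at h
      rw [h.1, h.2]
  have hι : Function.Injective fun w : HV => pos w.1 := hpos.comp Subtype.val_injective
  have hmem : ∀ w : HV, Sum.elim (fun u => (u.1.length : ℤ)) (fun y => busemann H γ r y - 1) w.1.1 +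
      busemann G' γ' o' w.1.2 = 0 := fun w => by
    rw [← busemann_graftRay hH γ]; exact w.2
  have hmk : ∀ (x : {u : List ℕ // IsIndividual X u} ⊕ V) (t : V'),
      Sum.elim (fun u => (u.1.length : ℤ)) (fun y => busemann H γ r y - 1) x +
      busemann G' γ' o' t = 0 → ∃ w : HV, w.1 = (x, t) := fun x t h => by
    rw [← busemann_graftRay hH γ] at h
    exact ⟨⟨(x, t), h⟩, rfl⟩
  have hpar := fun s => (parent_spec hT γ' s).2
  have hadj := fun s => (parent_spec hT γ' s).1
  have hr : busemann H γ r r = 0 := busemann_self _ _ _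
  have hstep : ∀ (v : HV) w', ExploreStep (parent G' γ')
      (fun s t => parent G' γ' t = s) (fun s q => q.1 = r ∧ parent G' γ' q.2 = s)
      (fun q s => q.1 = r ∧ s = parent G' γ' q.2)
      (fun q q' => H.Adj q.1 q'.1 ∧ G'.Adj q.2 q'.2 ∧
        busemann H γ r q'.1 - 1 + busemann G' γ' o' q'.2 = 0) X (pos v.1) w' ↔
      ∃ w : HV, pos w.1 = w' ∧ (horosphericProduct _ (graftRay X hH γ) _ γ').Adj v w := by
    intro v w'
    obtain ⟨⟨u | y, s⟩, hv⟩ := v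
    · have hv' := hmem ⟨(.inl u, s), hv⟩
      simp only [Sum.elim_inl] at hv'
      constructor
      · rintro (⟨i, hi, rfl⟩ | h)
        · have := hpar s
          obtain ⟨w, hw⟩ := hmk (.inl ⟨i :: u.1, isIndividual_cons.2 ⟨u.2, hi⟩⟩) (parent G' γ' s)
            (by simp only [Sum.elim_inl, List.length_cons]; push_cast; omega)
          refine ⟨w, by rw [hw]; rfl, ?_⟩
          change (graft X H r).Adj (.inl u) w.1.1 ∧ G'.Adj s w.1.2
          rw [hw]
          exact ⟨Or.inl ⟨i, rfl⟩, hadj s⟩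
        · rcases w' with ⟨x, t⟩ | ⟨y, t⟩
          · obtain ⟨i, h1, h2⟩ := h
            change u.1 = i :: x at h1
            change parent G' γ' t = s at h2
            have := hpar t
            rw [h2] at this
            obtain ⟨w, hw⟩ := hmk (.inl ⟨x, (isIndividual_cons.1 (h1 ▸ u.2)).1⟩) t
              (by rw [h1] at hv'; simp only [Sum.elim_inl, List.length_cons] at hv' ⊢; push_cast at hv'; omega)
            refine ⟨w, by rw [hw]; rfl, ?_⟩
            change (graft X H r).Adj (.inl u) w.1.1 ∧ G'.Adj s w.1.2
            rw [hw]
            exact ⟨Or.inr ⟨i, h1⟩, h2 ▸ (hadj t).symm⟩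
          · obtain ⟨h1, h2, h3⟩ := h
            change u.1 = [] at h1
            change y = r at h2
            change parent G' γ' t = s at h3
            have := hpar t
            rw [h3] at this
            rw [h1] at hv'
            obtain ⟨w, hw⟩ := hmk (.inr y) t
              (by simp only [Sum.elim_inr, h2, hr]; simp at hv'; omega)
            refine ⟨w, by rw [hw]; rfl, ?_⟩
            change (graft X H r).Adj (.inl u) w.1.1 ∧ G'.Adj s w.1.2
            rw [hw]
            exact ⟨⟨h1, h2⟩, h3 ▸ (hadj t).symm⟩
      · rintro ⟨⟨⟨x | y, t⟩, hx⟩, rfl, h⟩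
        · have hx' := hmem ⟨(.inl x, t), hx⟩
          simp only [Sum.elim_inl] at hx'
          obtain ⟨h1, h2⟩ := h
          change G'.Adj s t at h2
          rcases h1 with ⟨i, h1⟩ | ⟨i, h1⟩ <;> change _ = i :: _ at h1
          · refine Or.inl ⟨i, ?_, ?_⟩
            · have := x.2
              rw [h1, isIndividual_cons] at this
              exact this.2
            · have : parent G' γ' s = t := eq_parent hT γ' h2 (by
                rw [h1] at hx'; simp only [List.length_cons] at hx'; push_cast at hx'; omega)
              change Sum.inl (x.1, t) = Sum.inl (i :: u.1, parent G' γ' s)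
              rw [h1, this]
          · refine Or.inr ⟨i, h1, eq_parent hT γ' h2.symm ?_⟩
            rw [h1] at hv'; simp only [List.length_cons] at hv'; push_cast at hv'
            change busemann G' γ' o' t = busemann G' γ' o' s + 1
            omega
        · have hx' := hmem ⟨(.inr y, t), hx⟩
          simp only [Sum.elim_inr] at hx'
          obtain ⟨⟨h1, h2⟩, h3⟩ := h
          change G'.Adj s t at h3
          refine Or.inr ⟨h1, h2, eq_parent hT γ' h3.symm ?_⟩
          rw [h2, hr] at hx'
          rw [h1] at hv'
          simp at hv'
          change busemann G' γ' o' t = busemann G' γ' o' s + 1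
          omega
    · have hv' := hmem ⟨(.inr y, s), hv⟩
      simp only [Sum.elim_inr] at hv'
      constructor
      · rcases w' with ⟨x, t⟩ | ⟨z, t⟩
        · rintro ⟨h1, h2, h3⟩
          change x = [] at h1
          change y = r at h2
          change t = parent G' γ' s at h3
          have := hpar s
          obtain ⟨w, hw⟩ := hmk (.inl (progenitor X)) t (by
            rw [h2, hr] at hv'
            simp only [Sum.elim_inl, progenitor, h3, List.length_nil]; push_cast; omega)
          refine ⟨w, by rw [hw, h1]; rfl, ?_⟩
          change (graft X H r).Adj (.inr y) w.1.1 ∧ G'.Adj s w.1.2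
          rw [hw, h3]
          exact ⟨⟨rfl, h2⟩, hadj s⟩
        · rintro ⟨h1, h2, h3⟩
          obtain ⟨w, hw⟩ := hmk (.inr z) t h3
          refine ⟨w, by rw [hw]; rfl, ?_⟩
          change (graft X H r).Adj (.inr y) w.1.1 ∧ G'.Adj s w.1.2
          rw [hw]
          exact ⟨h1, h2⟩
      · rintro ⟨⟨⟨x | z, t⟩, hx⟩, rfl, h⟩
        · have hx' := hmem ⟨(.inl x, t), hx⟩
          simp only [Sum.elim_inl] at hx'
          obtain ⟨⟨h1, h2⟩, h3⟩ := h
          change G'.Adj s t at h3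
          refine ⟨h1, h2, (eq_parent hT γ' h3 ?_).symm⟩
          change x.1 = [] at h1
          change y = r at h2
          rw [h1] at hx'
          rw [h2, hr] at hv'
          simp at hx'
          change busemann G' γ' o' s = busemann G' γ' o' t + 1
          omega
        · exact ⟨h.1, h.2, hmem ⟨(.inr z, t), hx⟩⟩
  exact (wcount_map hι hstep n ⟨(.inr y, s'), hw⟩).trans
    ((hcount n).trans (wcount_map hι hstep n (horosphericRoot _ _ _ _)).symm)

end GraftExploration
end HorosphericGW

namespace HorosphericGW

/-! ### Augmented Galton–Watson trees -/

section AugmentedTrees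

variable {p : PMF ℕ} {m : ℝ}

/-- The word of a vertex of the graft of two genealogical trees. -/
def graftWord (X Y : List ℕ → ℕ) :
    {u : List ℕ // IsIndividual X u} ⊕ {u : List ℕ // IsIndividual Y u} → List ℕ ⊕ List ℕ :=
  Sum.map Subtype.val Subtype.val

theorem graftWord_injective (X Y : List ℕ → ℕ) : Function.Injective (graftWord X Y) :=
  Sum.map_injective.2 ⟨Subtype.val_injective, Subtype.val_injective⟩

/-- The graft of two genealogical trees. -/
abbrev treeGraft (X Y : List ℕ → ℕ) := graft X (genealogicalTree Y) (progenitor Y)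

theorem treeGraft_nice {X Y : List ℕ → ℕ} (hX : ∀ u, 1 ≤ X u) :
    IsInfiniteLocallyFiniteConnected (treeGraft X Y) :=
  graft_nice hX (genealogicalTree_dist Y).1 (genealogicalTree_finite Y)

theorem measurable_treeGraft_adj (u v : List ℕ ⊕ List ℕ) :
    Measurable fun q : (List ℕ → ℕ) × (List ℕ → ℕ) =>
      ∃ x y, graftWord q.1 q.2 x = u ∧ graftWord q.1 q.2 y = v ∧ (treeGraft q.1 q.2).Adj x y := by
  have h1 : ∀ u, Measurable fun q : (List ℕ → ℕ) × (List ℕ → ℕ) => IsIndividual q.1 u :=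
    fun u => (measurable_isIndividual u).comp measurable_fst
  have h2 : ∀ u, Measurable fun q : (List ℕ → ℕ) × (List ℕ → ℕ) => IsIndividual q.2 u :=
    fun u => (measurable_isIndividual u).comp measurable_snd
  have key : ∀ q : (List ℕ → ℕ) × (List ℕ → ℕ), (∃ x y, graftWord q.1 q.2 x = u ∧
      graftWord q.1 q.2 y = v ∧ (treeGraft q.1 q.2).Adj x y) ↔
      (Sum.elim (IsIndividual q.1) (IsIndividual q.2) u ∧
        Sum.elim (IsIndividual q.1) (IsIndividual q.2) v) ∧ (match u, v with
        | .inl u, .inl v => (∃ i, v = i :: u) ∨ (∃ i, u = i :: v)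
        | .inl u, .inr v => u = [] ∧ v = []
        | .inr v, .inl u => u = [] ∧ v = []
        | .inr u, .inr v => (∃ i, v = i :: u) ∨ (∃ i, u = i :: v)) := by
    intro q
    constructor
    · rintro ⟨x | x, y | y, rfl, rfl, h⟩
      · exact ⟨⟨x.2, y.2⟩, h⟩
      · exact ⟨⟨x.2, y.2⟩, h.1, congrArg Subtype.val h.2⟩
      · exact ⟨⟨x.2, y.2⟩, h.1, congrArg Subtype.val h.2⟩
      · exact ⟨⟨x.2, y.2⟩, h⟩
    · rcases u with u | u <;> rcases v with v | v <;> rintro ⟨⟨hu, hv⟩, h⟩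
      · exact ⟨.inl ⟨u, hu⟩, .inl ⟨v, hv⟩, rfl, rfl, h⟩
      · exact ⟨.inl ⟨u, hu⟩, .inr ⟨v, hv⟩, rfl, rfl, h.1, Subtype.ext h.2⟩
      · exact ⟨.inr ⟨u, hu⟩, .inl ⟨v, hv⟩, rfl, rfl, h.1, Subtype.ext h.2⟩
      · exact ⟨.inr ⟨u, hu⟩, .inr ⟨v, hv⟩, rfl, rfl, h⟩
  simp only [key]
  refine .and (.and ?_ ?_) measurable_const
  · rcases u with u | u
    exacts [h1 u, h2 u]
  · rcases v with u | u
    exacts [h1 u, h2 u]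

theorem ae_prod_one_le (hp0 : p 0 = 0) :
    ∀ᵐ q ∂(offspringLaw p).prod (offspringLaw p), (∀ u, 1 ≤ q.1 u) ∧ ∀ u, 1 ≤ q.2 u :=
  (Measure.quasiMeasurePreserving_fst.ae (ae_one_le hp0)).and
    (Measure.quasiMeasurePreserving_snd.ae (ae_one_le hp0))

theorem aemeasurable_graftClass_left (hp0 : p 0 = 0) :
    AEMeasurable (fun q : (List ℕ → ℕ) × (List ℕ → ℕ) => classOf (treeGraft q.1 q.2)
      (.inl (progenitor q.1))) ((offspringLaw p).prod (offspringLaw p)) :=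
  aemeasurable_classOf (ι := fun q => graftWord q.1 q.2) (fun q => graftWord_injective q.1 q.2)
    ((ae_prod_one_le hp0).mono fun q hq => treeGraft_nice hq.1) measurable_treeGraft_adj
    fun v => (measurable_const : Measurable fun _ => (Sum.inl [] : List ℕ ⊕ List ℕ) = v)

theorem aemeasurable_graftClass_right (hp0 : p 0 = 0) :
    AEMeasurable (fun q : (List ℕ → ℕ) × (List ℕ → ℕ) => classOf (treeGraft q.1 q.2)
      (.inr (progenitor q.2))) ((offspringLaw p).prod (offspringLaw p)) :=
  aemeasurable_classOf (ι := fun q => graftWord q.1 q.2) (fun q => graftWord_injective q.1 q.2)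
    ((ae_prod_one_le hp0).mono fun q hq => treeGraft_nice hq.1) measurable_treeGraft_adj
    fun v => (measurable_const : Measurable fun _ => (Sum.inr [] : List ℕ ⊕ List ℕ) = v)

/-- The decomposition of the offspring numbers which is inverse to `insertChild`. -/
def splitChild (i : ℕ) (N : List ℕ → ℕ) : (List ℕ → ℕ) × (List ℕ → ℕ) :=
  (fun u => N (skipWord i u) - if u = [] then 1 else 0, fun u => N (u ++ [i]))

theorem measurable_splitChild (i : ℕ) : Measurable (splitChild i) :=
  (measurable_pi_iff.2 fun u => (measurable_from_top
    (f := fun n : ℕ => n - if u = [] then 1 else 0)).comp (measurable_pi_apply _)).prodMk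
    (measurable_pi_iff.2 fun _ => measurable_pi_apply _)

theorem splitChild_insertChild (i : ℕ) (q : (List ℕ → ℕ) × (List ℕ → ℕ)) :
    splitChild i (insertChild i q.1 q.2) = q := by
  refine Prod.ext (funext fun u => ?_) (funext fun u => insertChild_append u)
  simp only [splitChild, insertChild_skipWord]
  omega

theorem insertChild_splitChild (i : ℕ) {N : List ℕ → ℕ} (hN : 1 ≤ N []) :
    insertChild i (splitChild i N).1 (splitChild i N).2 = N := by
  ext u
  obtain ⟨w | w, rfl⟩ := (wordEquiv i).surjective u
  · rw [wordEquiv_inl, insertChild_skipWord]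
    by_cases hw : w = []
    · subst hw
      simp only [splitChild, skipWord, if_true]
      omega
    · simp [splitChild, hw]
  · exact insertChild_append w

theorem map_splitChild (p : PMF ℕ) (i : ℕ) : (augmentedOffspringLaw p).map (splitChild i) =
    (offspringLaw p).prod (offspringLaw p) := by
  rw [← map_insertChild p i, Measure.map_map (measurable_splitChild i) (measurable_insertChild i)]
  convert Measure.map_id
  ext1 q
  exact splitChild_insertChild i q

theorem ae_augmented {Q : (List ℕ → ℕ) × (List ℕ → ℕ) → Prop}
    (h : ∀ᵐ q ∂(offspringLaw p).prod (offspringLaw p), Q q) (i : ℕ) :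
    ∀ᵐ N ∂augmentedOffspringLaw p, Q (splitChild i N) := by
  rw [← map_splitChild p i] at h
  exact ae_of_ae_map (measurable_splitChild i).aemeasurable h

theorem ae_augmented_one_le (hp0 : p 0 = 0) :
    ∀ᵐ N ∂augmentedOffspringLaw p, (∀ u, 1 ≤ N u) ∧ 2 ≤ N [] := by
  rw [← map_insertChild p 0]
  have hm : MeasurableSet {N : List ℕ → ℕ | (∀ u, 1 ≤ N u) ∧ 2 ≤ N []} := by
    refine measurableSet_setOfPred.2 (.and (.forall fun u => ?_) ?_)
    · exact measurableSet_setOfPred.1 ((measurable_pi_apply u) (measurableSet_Ici (a := 1)))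
    · exact measurableSet_setOfPred.1
        ((measurable_pi_apply ([] : List ℕ)) (measurableSet_Ici (a := 2)))
  refine (ae_map_iff (measurable_insertChild 0).aemeasurable hm).2 ?_
  filter_upwards [ae_prod_one_le hp0] with q hq
  refine ⟨fun u => ?_, ?_⟩
  · obtain ⟨w | w, rfl⟩ := (wordEquiv 0).surjective u
    · rw [wordEquiv_inl, insertChild_skipWord]
      exact (hq.1 w).trans (Nat.le_add_right _ _)
    · rw [wordEquiv_inr, insertChild_append]
      exact hq.2 w
  · rw [insertChild_nil]
    have := hq.1 []
    omega

/-- The `i`-th child of the progenitor, or the progenitor itself if there is no such child. -/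
def rootChild (i : ℕ) (N : List ℕ → ℕ) : {u : List ℕ // IsIndividual N u} :=
  if h : i < N [] then ⟨[i], .child _ _ .root h⟩ else progenitor N

theorem aemeasurable_treeClass (hp0 : p 0 = 0) {o : ∀ N, {u : List ℕ // IsIndividual N u}}
    (ho : ∀ v, Measurable fun N => (o N).1 = v) :
    AEMeasurable (fun N => classOf (genealogicalTree N) (o N)) (augmentedOffspringLaw p) := by
  refine aemeasurable_classOf (ι := fun _ => Subtype.val) (fun _ => Subtype.val_injective)
    ((ae_augmented_one_le hp0).mono fun N hN => genealogicalTree_nice hN.1) (fun u v => ?_) ho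
  have : ∀ N : List ℕ → ℕ, (∃ x y : {u : List ℕ // IsIndividual N u}, x.1 = u ∧ y.1 = v ∧
      (genealogicalTree N).Adj x y) ↔ (IsIndividual N u ∧ IsIndividual N v) ∧
        ((∃ i, v = i :: u) ∨ (∃ i, u = i :: v)) := fun N => by
    constructor
    · rintro ⟨x, y, rfl, rfl, h⟩
      exact ⟨⟨x.2, y.2⟩, h⟩
    · rintro ⟨⟨hu, hv⟩, h⟩
      exact ⟨⟨u, hu⟩, ⟨v, hv⟩, rfl, rfl, h⟩
  simp only [this]
  exact .and (.and (measurable_isIndividual u) (measurable_isIndividual v)) measurable_const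

theorem aemeasurable_treeClass_root (hp0 : p 0 = 0) :
    AEMeasurable (fun N => classOf (genealogicalTree N) (progenitor N))
      (augmentedOffspringLaw p) := aemeasurable_treeClass hp0 fun v =>
    (measurable_const : Measurable fun _ => ([] : List ℕ) = v)

theorem aemeasurable_treeClass_child (hp0 : p 0 = 0) (i : ℕ) :
    AEMeasurable (fun N => classOf (genealogicalTree N) (rootChild i N))
      (augmentedOffspringLaw p) := by
  refine aemeasurable_treeClass hp0 fun v => ?_
  have : ∀ N : List ℕ → ℕ, (rootChild i N).1 = v ↔ (i < N [] ∧ [i] = v) ∨ (¬ i < N [] ∧ [] = v) := by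
    intro N
    rw [rootChild]
    split_ifs with h <;> simp [h, progenitor]
  have hi : Measurable fun N : List ℕ → ℕ => i < N [] :=
    measurableSet_setOfPred.1 ((measurable_pi_apply ([] : List ℕ)) (measurableSet_Ioi (a := i)))
  simp only [this]
  exact (hi.and measurable_const).or (hi.not.and measurable_const)

theorem augmentedLaw_eq (p : PMF ℕ) : augmentedLaw p = (augmentedOffspringLaw p).map
    fun N => classOf (genealogicalTree N) (progenitor N) := rfl

instance (p : PMF ℕ) : IsProbabilityMeasure (augmentedOffspringLaw p) := by
  unfold augmentedOffspringLaw; infer_instance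

/-- The augmented Galton–Watson law divided by the degree of the root. -/
def reversibleLaw (p : PMF ℕ) : Measure GraphSpace :=
  (augmentedLaw p).withDensity fun x => (nbr x Set.univ)⁻¹

open Classical in
theorem lintegral_nbr_genealogicalTree {N : List ℕ → ℕ} (hN : ∀ u, 1 ≤ N u)
    (f : GraphSpace → ℝ≥0∞) :
    ∫⁻ y, f y ∂nbr (classOf (genealogicalTree N) (progenitor N)) =
      ∑' i : ℕ, if i < N [] then f (classOf (genealogicalTree N) (rootChild i N)) else 0 := by
  rw [lintegral_nbr_classOf (genealogicalTree_nice hN),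
    tsum_eq_sum (s := (Finset.range (N [])).image fun i => rootChild i N),
    tsum_eq_sum (s := Finset.range (N [])), Finset.sum_image]
  · refine Finset.sum_congr rfl fun i hi => ?_
    have hi : i < N [] := by simpa using hi
    rw [if_pos hi, if_pos]
    rw [rootChild, dif_pos hi]
    exact Or.inl ⟨i, rfl⟩
  · intro i hi j hj hij
    have hi : i < N [] := by simpa using hi
    have hj : j < N [] := by simpa using hj
    simpa [rootChild, hi, hj] using hij
  · intro i hi
    rw [if_neg (by simpa using hi)]
  · intro v hv
    rw [if_neg]
    rintro (⟨i, h⟩ | ⟨i, h⟩)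
    · have h1 := v.2
      change v.1 = [i] at h
      rw [h, isIndividual_cons] at h1
      refine hv (Finset.mem_image.2 ⟨i, Finset.mem_range.2 h1.2, ?_⟩)
      rw [rootChild, dif_pos h1.2]
      exact Subtype.ext h.symm
    · exact List.cons_ne_nil _ _ h.symm

theorem classOf_insertChild {i : ℕ} {X Y : List ℕ → ℕ} (hX : ∀ u, 1 ≤ X u) (hi : i ≤ X []) :
    classOf (genealogicalTree (insertChild i X Y)) (progenitor _) =
        classOf (treeGraft X Y) (.inl (progenitor X)) ∧
      classOf (genealogicalTree (insertChild i X Y)) (rootChild i _) =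
        classOf (treeGraft X Y) (.inr (progenitor Y)) := by
  constructor
  · exact (classOf_congr (treeGraft_nice hX) (graftIso hi) (graftIso_inl hi)).symm
  · refine (classOf_congr (treeGraft_nice hX) (graftIso hi) ?_).symm
    have : i < insertChild i X Y [] := by rw [insertChild_nil]; omega
    rw [rootChild, dif_pos this]
    exact Subtype.ext (graftIso_inr hi _)

/-- Moving the root of the degree-biased augmented tree to a random neighbour. -/
theorem lintegral_reversibleLaw (hp0 : p 0 = 0) {h : GraphSpace → GraphSpace → ℝ≥0∞}
    (hh : Measurable (Function.uncurry h)) :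
    ∫⁻ x, ∫⁻ y, h x y ∂nbr x ∂reversibleLaw p =
      ∫⁻ q, h (classOf (treeGraft q.1 q.2) (.inl (progenitor q.1)))
        (classOf (treeGraft q.1 q.2) (.inr (progenitor q.2)))
        ∂(offspringLaw p).prod (offspringLaw p) := by
  classical
  have hI : Measurable fun x => ∫⁻ y, h x y ∂nbr x := measurable_lintegral_nbr hh measurable_id
  have hD : Measurable fun x : GraphSpace => (nbr x Set.univ)⁻¹ := (measurable_nbr_apply .univ).inv
  have hr := aemeasurable_treeClass_root hp0 (p := p)
  have hi : ∀ i, Measurable fun N : List ℕ → ℕ => i < N [] := fun i =>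
    measurableSet_setOfPred.1 ((measurable_pi_apply ([] : List ℕ)) (measurableSet_Ioi (a := i)))
  have hc : Measurable fun N : List ℕ → ℕ => ((N [] : ℕ) : ℝ≥0∞)⁻¹ :=
    (measurable_from_top (f := fun n : ℕ => (n : ℝ≥0∞)⁻¹)).comp (measurable_pi_apply _)
  let T : ℕ → (List ℕ → ℕ) → ℝ≥0∞ := fun i N => if i < N [] then ((N [] : ℕ) : ℝ≥0∞)⁻¹ *
    h (classOf (genealogicalTree N) (progenitor N)) (classOf (genealogicalTree N) (rootChild i N))
    else 0
  have hT : ∀ i, AEMeasurable (T i) (augmentedOffspringLaw p) := fun i => by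
    have h1 := hh.comp_aemeasurable (hr.prodMk (aemeasurable_treeClass_child hp0 i))
    have h2 := (hc.aemeasurable (μ := augmentedOffspringLaw p)).mul h1
    have : T i = {N : List ℕ → ℕ | i < N []}.indicator ((fun N : List ℕ → ℕ =>
        ((N [] : ℕ) : ℝ≥0∞)⁻¹) * Function.uncurry h ∘ fun N =>
          (classOf (genealogicalTree N) (progenitor N),
            classOf (genealogicalTree N) (rootChild i N))) := by
      ext N
      by_cases hN : i < N []
      · rw [Set.indicator_of_mem (show N ∈ {N : List ℕ → ℕ | i < N []} from hN)]
        exact if_pos hN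
      · rw [Set.indicator_of_notMem (show N ∉ {N : List ℕ → ℕ | i < N []} from hN)]
        exact if_neg hN
    rw [this]
    exact h2.indicator (measurableSet_setOfPred.2 (hi i))
  rw [reversibleLaw, lintegral_withDensity_eq_lintegral_mul _ hD hI, augmentedLaw_eq,
    lintegral_map' (hD.mul hI).aemeasurable hr]
  have h1 : ∀ᵐ N ∂augmentedOffspringLaw p, ((fun x : GraphSpace => (nbr x Set.univ)⁻¹) *
      fun x => ∫⁻ y, h x y ∂nbr x) (classOf (genealogicalTree N) (progenitor N)) = ∑' i, T i N := by
    filter_upwards [ae_augmented_one_le hp0] with N hN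
    have huniv : nbr (classOf (genealogicalTree N) (progenitor N)) Set.univ = (N [] : ℕ) := by
      rw [← lintegral_one, lintegral_nbr_genealogicalTree hN.1,
        tsum_eq_sum (s := Finset.range (N [])) (fun i hi => if_neg (by simpa using hi)),
        Finset.sum_congr rfl (g := fun _ => 1) (fun i hi => if_pos (by simpa using hi))]
      simp
    rw [Pi.mul_apply, huniv, lintegral_nbr_genealogicalTree hN.1, ← ENNReal.tsum_mul_left]
    refine tsum_congr fun i => ?_
    simp only [T, mul_ite, mul_zero]
  rw [lintegral_congr_ae h1, lintegral_tsum hT]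
  have hgr := hh.comp_aemeasurable ((aemeasurable_graftClass_left hp0 (p := p)).prodMk
    (aemeasurable_graftClass_right hp0))
  -- Inserting `q.2` as the child `i` of `q.1` turns `T i` into `K i`, which depends on `i` only
  -- through the condition `i ≤ q.1 []`. The sum over these `q.1 [] + 1` indices cancels the inverse
  -- of the degree.
  let K : ℕ → (List ℕ → ℕ) × (List ℕ → ℕ) → ℝ≥0∞ := fun i q =>
    if i < q.1 [] + 1 then ((q.1 [] + 1 : ℕ) : ℝ≥0∞)⁻¹ *
      h (classOf (treeGraft q.1 q.2) (.inl (progenitor q.1)))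
        (classOf (treeGraft q.1 q.2) (.inr (progenitor q.2))) else 0
  have h2 : ∀ i, ∫⁻ N, T i N ∂augmentedOffspringLaw p =
      ∫⁻ q, K i q ∂(offspringLaw p).prod (offspringLaw p) := fun i => by
    have hT' := hT i
    rw [← map_insertChild p i] at hT' ⊢
    rw [lintegral_map' hT' (measurable_insertChild i).aemeasurable]
    refine lintegral_congr_ae ?_
    filter_upwards [ae_prod_one_le hp0] with q hq
    simp only [T, K, insertChild_nil]
    split_ifs with hi
    · have := classOf_insertChild (Y := q.2) hq.1 (Nat.lt_succ_iff.1 hi)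
      rw [this.1, this.2]
    · rfl
  have hK : ∀ i, AEMeasurable (K i) ((offspringLaw p).prod (offspringLaw p)) := fun i => by
    have h3 : Measurable fun q : (List ℕ → ℕ) × (List ℕ → ℕ) => ((q.1 [] + 1 : ℕ) : ℝ≥0∞)⁻¹ :=
      (measurable_from_top (f := fun n : ℕ => ((n + 1 : ℕ) : ℝ≥0∞)⁻¹)).comp
        ((measurable_pi_apply ([] : List ℕ)).comp measurable_fst)
    have h4 : MeasurableSet {q : (List ℕ → ℕ) × (List ℕ → ℕ) | i < q.1 [] + 1} :=
      ((measurable_from_top (f := fun n : ℕ => n + 1)).comp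
        ((measurable_pi_apply ([] : List ℕ)).comp measurable_fst)) (measurableSet_Ioi (a := i))
    have : K i = {q : (List ℕ → ℕ) × (List ℕ → ℕ) | i < q.1 [] + 1}.indicator
        ((fun q : (List ℕ → ℕ) × (List ℕ → ℕ) => ((q.1 [] + 1 : ℕ) : ℝ≥0∞)⁻¹) *
        Function.uncurry h ∘ fun q : (List ℕ → ℕ) × (List ℕ → ℕ) =>
          (classOf (treeGraft q.1 q.2) (.inl (progenitor q.1)),
            classOf (treeGraft q.1 q.2) (.inr (progenitor q.2)))) := by
      ext q
      by_cases hq : i < q.1 [] + 1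
      · rw [Set.indicator_of_mem
          (show q ∈ {q : (List ℕ → ℕ) × (List ℕ → ℕ) | i < q.1 [] + 1} from hq)]
        exact if_pos hq
      · rw [Set.indicator_of_notMem
          (show q ∉ {q : (List ℕ → ℕ) × (List ℕ → ℕ) | i < q.1 [] + 1} from hq)]
        exact if_neg hq
    rw [this]
    exact (h3.aemeasurable.mul hgr).indicator h4
  simp only [h2]
  rw [← lintegral_tsum hK]
  refine lintegral_congr fun q => ?_
  simp only [K]
  rw [tsum_eq_sum (s := Finset.range (q.1 [] + 1)) (fun i hi => if_neg (by simpa using hi)),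
    Finset.sum_congr rfl (fun i hi => if_pos (by simpa using hi)), Finset.sum_const,
    Finset.card_range, nsmul_eq_mul, ← mul_assoc, ENNReal.mul_inv_cancel (by simp) (by simp),
    one_mul]

theorem graftSwap_class {X Y : List ℕ → ℕ} (hX : ∀ u, 1 ≤ X u) :
    classOf (treeGraft X Y) (.inl (progenitor X)) = classOf (treeGraft Y X) (.inr (progenitor X)) ∧
      classOf (treeGraft X Y) (.inr (progenitor Y)) =
        classOf (treeGraft Y X) (.inl (progenitor Y)) :=
  ⟨classOf_congr (treeGraft_nice hX) (graftSwap X Y) rfl,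
    classOf_congr (treeGraft_nice hX) (graftSwap X Y) rfl⟩

/-- By `lintegral_reversibleLaw`, the root and a neighbour become the two ends of the edge joining
two independent trees with the same law, and the trees may be interchanged. -/
theorem reversible_reversibleLaw (hp0 : p 0 = 0) : Reversible (reversibleLaw p) := by
  intro h hh
  have hh' : Measurable (Function.uncurry fun x y => h y x) := hh.comp measurable_swap
  rw [lintegral_reversibleLaw hp0 hh, lintegral_reversibleLaw hp0 hh']
  have hm := hh.comp_aemeasurable ((aemeasurable_graftClass_left hp0 (p := p)).prodMk
    (aemeasurable_graftClass_right hp0))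
  refine (lintegral_prod_swap _).symm.trans (lintegral_congr_ae ?_)
  filter_upwards [ae_prod_one_le hp0] with q hq
  have := graftSwap_class (X := q.2) (Y := q.1) hq.2
  simp only [Prod.fst_swap, Prod.snd_swap]
  rw [this.1, this.2]

end AugmentedTrees
end HorosphericGW

namespace HorosphericGW

/-! ### Augmented Galton–Watson trees are almost surely good -/

section AugmentedGoodness

variable {p : PMF ℕ} {m : ℝ}

/-- Transfers walk counts of a graph with random vertex set to a relation on a fixed countable set,
where `measurable_wcount` applies. -/
theorem wcount_range {V W : Type*} {G : SimpleGraph W} {ι : W → V} (hι : Function.Injective ι)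
    (n : ℕ) (v : W) :
    wcount (fun u v => ∃ x y, ι x = u ∧ ι y = v ∧ G.Adj x y) n (ι v) = wcount G.Adj n v :=
  wcount_map hι (fun v w' => ⟨fun ⟨x, y, h1, h2, h3⟩ => ⟨y, h2, hι h1 ▸ h3⟩,
    fun ⟨y, h2, h3⟩ => ⟨v, y, rfl, h2, h3⟩⟩) n v

/-- With the second tree fixed it plays the role of `H` in `ae_graft_distinct`; Fubini's theorem
then needs the event to be measurable in the pair. -/
theorem ae_treeGraft_distinct (hp0 : p 0 = 0) (hp : p.support.Nontrivial) :
    ∀ᵐ q ∂(offspringLaw p).prod (offspringLaw p), ∀ y, ¬ ∀ n,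
      wcount (treeGraft q.1 q.2).Adj n (.inr y) =
        wcount (treeGraft q.1 q.2).Adj n (.inl (progenitor q.1)) := by
  let A : (List ℕ → ℕ) × (List ℕ → ℕ) → List ℕ ⊕ List ℕ → List ℕ ⊕ List ℕ → Prop := fun q u v =>
    ∃ x y, graftWord q.1 q.2 x = u ∧ graftWord q.1 q.2 y = v ∧ (treeGraft q.1 q.2).Adj x y
  have key : ∀ q : (List ℕ → ℕ) × (List ℕ → ℕ), (∀ y, ¬ ∀ n,
      wcount (treeGraft q.1 q.2).Adj n (.inr y) =
        wcount (treeGraft q.1 q.2).Adj n (.inl (progenitor q.1))) ↔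
      ∀ u, IsIndividual q.2 u → ¬ ∀ n, wcount (A q) n (.inr u) = wcount (A q) n (.inl []) := by
    intro q
    rw [Subtype.forall]
    refine forall₂_congr fun u hu => not_congr (forall_congr' fun n => ?_)
    rw [← wcount_range (graftWord_injective q.1 q.2) n (.inr _),
      ← wcount_range (graftWord_injective q.1 q.2) n (.inl _)]
    rfl
  have hm : MeasurableSet {q : (List ℕ → ℕ) × (List ℕ → ℕ) | ∀ y, ¬ ∀ n,
      wcount (treeGraft q.1 q.2).Adj n (.inr y) =
        wcount (treeGraft q.1 q.2).Adj n (.inl (progenitor q.1))} := by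
    refine measurableSet_setOfPred.2 ?_
    simp only [key]
    refine .forall fun u => .imp ((measurable_isIndividual u).comp measurable_snd)
      (.not (.forall fun n => ?_))
    exact measurableSet_setOfPred.1 (measurableSet_eq_fun
      (measurable_wcount measurable_treeGraft_adj n _)
      (measurable_wcount measurable_treeGraft_adj n _))
  rw [← Measure.prod_swap, ae_map_iff measurable_swap.aemeasurable hm]
  refine (Measure.ae_prod_iff_ae_ae (hm.preimage measurable_swap)).2 (ae_of_all _ fun Y => ?_)
  exact (ae_graft_distinct hp0 hp (r := progenitor Y) (genealogicalTree_finite Y)).mono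
    fun X hX => hX

theorem sphere_ncard {X Y : List ℕ → ℕ} {i : ℕ} (hi : i ≤ X []) (k : ℕ) :
    Set.ncard {u | (genealogicalTree (insertChild i X Y)).dist (rootChild i _) u = k ∧
      (genealogicalTree (insertChild i X Y)).dist (progenitor _) u = k + 1} =
      generationSize Y k := by
  have hconn := (graft_dist_left (N := X) (r := progenitor Y) (genealogicalTree_dist Y).1).1
  have hrc : graftIso (Y := Y) hi (.inr (progenitor Y)) = rootChild i _ := by
    have : i < insertChild i X Y [] := by rw [insertChild_nil]; omega
    rw [rootChild, dif_pos this]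
    exact Subtype.ext (graftIso_inr hi _)
  have h1 : {u | (genealogicalTree (insertChild i X Y)).dist (rootChild i _) u = k ∧
      (genealogicalTree (insertChild i X Y)).dist (progenitor _) u = k + 1} =
      (fun y => graftIso hi (.inr y)) '' {y | y.1.length = k} := by
    ext u
    obtain ⟨x, rfl⟩ := (graftIso (X := X) (Y := Y) hi).surjective u
    simp only [Set.mem_setOf_eq, ← hrc, ← graftIso_inl hi, dist_iso hconn]
    rw [graft_dist_right (genealogicalTree_dist Y).1, (graft_dist_left (genealogicalTree_dist Y).1).2]
    rcases x with u | y
    · simp only [Sum.elim_inl, Set.mem_image, EmbeddingLike.apply_eq_iff_eq, reduceCtorEq, and_false,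
        exists_false, iff_false]
      omega
    · simp [(genealogicalTree_dist Y).2]
  have h2 : {u | IsIndividual Y u ∧ u.length = k} =
      Subtype.val '' {y : {u // IsIndividual Y u} | y.1.length = k} := by
    ext u
    constructor
    · exact fun h => ⟨⟨u, h.1⟩, h.2, rfl⟩
    · rintro ⟨y, h, rfl⟩
      exact ⟨y.2, h⟩
  rw [h1, generationSize, h2, Set.ncard_image_of_injective _ Subtype.val_injective,
    Set.ncard_image_of_injective]
  exact (graftIso hi).injective.comp Sum.inr_injective

theorem genealogical_parent_unique {N : List ℕ → ℕ} {x y y' : {u : List ℕ // IsIndividual N u}}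
    (hy : (genealogicalTree N).Adj x y) (hy' : (genealogicalTree N).Adj x y')
    (h : y.1.length < x.1.length) (h' : y'.1.length < x.1.length) : y = y' := by
  have key : ∀ y, (genealogicalTree N).Adj x y → y.1.length < x.1.length → y.1 = x.1.tail := by
    rintro y (⟨i, h⟩ | ⟨i, h⟩) hlt
    · rw [h] at hlt; simp at hlt
    · rw [h]; rfl
  exact Subtype.ext ((key y hy h).trans (key y' hy' h').symm)

theorem genealogicalTree_isTree (N : List ℕ → ℕ) : (genealogicalTree N).IsTree :=
  ⟨(genealogicalTree_dist N).1, isAcyclic_of_rank (fun u => u.1.length)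
    (fun _ _ h => by have := genealogical_length h; omega)
    fun _ _ _ hy hy' h h' => genealogical_parent_unique hy hy' h h'⟩

/-- A vertex other than the progenitor lies below some child `i`. Splitting the tree at this child
puts the vertex into the grafted part, where it is distinguished from the progenitor, and the cone
beyond the child is counted by the generation sizes of that part. -/
theorem rootGood_genealogicalTree {N : List ℕ → ℕ} (hN : 2 ≤ N [])
    (h : ∀ i < N [], (∀ y, ¬ ∀ n,
      wcount (treeGraft (splitChild i N).1 (splitChild i N).2).Adj n (.inr y) =
        wcount (treeGraft (splitChild i N).1 (splitChild i N).2).Adj n (.inl (progenitor _))) ∧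
      ∃ L : ℝ, Tendsto (fun k : ℕ => (generationSize (splitChild i N).2 k : ℝ) / m ^ k)
        atTop (𝓝 L)) : RootGood m (genealogicalTree N) (progenitor N) := by
  have hsplit : ∀ i < N [], ∃ X Y, N = insertChild i X Y ∧ i ≤ X [] ∧ (∀ y, ¬ ∀ n,
      wcount (treeGraft X Y).Adj n (.inr y) = wcount (treeGraft X Y).Adj n (.inl (progenitor _))) ∧
      ∃ L : ℝ, Tendsto (fun k : ℕ => (generationSize Y k : ℝ) / m ^ k) atTop (𝓝 L) := by
    intro i hi
    refine ⟨_, _, (insertChild_splitChild i (by omega)).symm, ?_, h i hi⟩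
    simp only [splitChild, skipWord, if_true]
    omega
  have hd := (genealogicalTree_dist N).2
  refine ⟨fun x y hxy => ?_, fun x y y' hy hy' h1 h2 => ?_, ?_, fun b hb => ?_, fun v hv => ?_⟩
  · rw [hd, hd]
    have := genealogical_length hxy
    omega
  · rw [hd, hd] at h1 h2
    exact genealogical_parent_unique hy hy' h1 h2
  · refine ⟨⟨[0], .child _ _ .root (by omega)⟩, ⟨[1], .child _ _ .root (by omega)⟩, ?_,
      Or.inl ⟨0, rfl⟩, Or.inl ⟨1, rfl⟩⟩
    intro h
    simpa using congrArg Subtype.val h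
  · obtain ⟨i, hi⟩ : ∃ i, b.1 = [i] := by
      rcases hb with ⟨i, h⟩ | ⟨i, h⟩
      · exact ⟨i, h⟩
      · exact (List.cons_ne_nil _ _ h.symm).elim
    have hiN : i < N [] := by
      have := b.2
      rw [hi, isIndividual_cons] at this
      exact this.2
    have hb' : b = rootChild i N := by
      rw [rootChild, dif_pos hiN]; exact Subtype.ext hi
    obtain ⟨X, Y, rfl, hiX, -, L, hL⟩ := hsplit i hiN
    refine ⟨L, ?_⟩
    rw [hb']
    simpa only [sphere_ncard hiX] using hL
  · by_contra hne
    have hlast : ∃ w i, v.1 = w ++ [i] := by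
      rcases List.eq_nil_or_concat' v.1 with h | ⟨w, i, h⟩
      · exact (hne (Subtype.ext h)).elim
      · exact ⟨w, i, h⟩
    obtain ⟨w, i, hw⟩ := hlast
    have hiN : ∀ w, IsIndividual N (w ++ [i]) → i < N [] := fun w => by
      induction w with
      | nil => exact fun h => (isIndividual_cons.1 h).2
      | cons j w ih => exact fun h => ih (isIndividual_cons.1 h).1
    obtain ⟨X, Y, rfl, hiX, hdist, -⟩ := hsplit i (hiN w (hw ▸ v.2))
    have hwY : IsIndividual Y w := (isIndividual_append hiX w).1 (hw ▸ v.2)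
    refine hdist ⟨w, hwY⟩ fun n => ?_
    rw [← wcount_iso (graftIso hiX), ← wcount_iso (graftIso hiX), graftIso_inl, ← hv n]
    congr 1
    exact Subtype.ext hw.symm

theorem ae_tendsto_prod (hp0 : p 0 = 0)
    (hpm : HasSum (fun k : ℕ => (k : ℝ) * (p k).toReal) m) :
    ∀ᵐ q ∂(offspringLaw p).prod (offspringLaw p), ∃ L : ℝ,
      Tendsto (fun k : ℕ => (generationSize q.2 k : ℝ) / m ^ k) atTop (𝓝 L) :=
  Measure.quasiMeasurePreserving_snd.ae
    (ae_tendsto_generationSize (zero_lt_one.trans_le (one_le_mean hp0 hpm)) hpm)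

theorem augmentedLaw_ae_rootGoodClass (hp0 : p 0 = 0) (hp : p.support.Nontrivial)
    (hpm : HasSum (fun k : ℕ => (k : ℝ) * (p k).toReal) m) :
    ∀ᵐ x ∂augmentedLaw p, x ∈ RootGoodClass m := by
  rw [augmentedLaw_eq]
  refine (ae_map_iff (p := fun x => x ∈ RootGoodClass m) (aemeasurable_treeClass_root hp0)
    measurableSet_rootGoodClass).2 ?_
  filter_upwards [ae_augmented_one_le hp0, ae_all_iff.2 fun i => ae_augmented
    ((ae_treeGraft_distinct hp0 hp).and (ae_tendsto_prod hp0 hpm)) i] with N hN hN'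
  have hn := genealogicalTree_nice hN.1
  have hr := rootGood_genealogicalTree (m := m) hN.2 fun i _ => hN' i
  obtain ⟨g, e, he⟩ := exists_rootedGraph_iso hn (progenitor N)
  rw [classOf_eq_clAt e, clAt_mem_rootGoodClass]
  exact hr.congr hn.2.1 e

theorem reversibleLaw_ae_goodClass (hp0 : p 0 = 0) (hp : p.support.Nontrivial)
    (hpm : HasSum (fun k : ℕ => (k : ℝ) * (p k).toReal) m) :
    ∀ᵐ x ∂reversibleLaw p, x ∈ GoodClass m :=
  (reversible_reversibleLaw hp0).ae_goodClass
    ((withDensity_absolutelyContinuous _ _).ae_le (augmentedLaw_ae_rootGoodClass hp0 hp hpm))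

/-- The density, the inverse of a finite degree, vanishes nowhere, so null sets of `reversibleLaw p`
are null for the augmented law. -/
theorem augmentedLaw_ae_goodClass (hp0 : p 0 = 0) (hp : p.support.Nontrivial)
    (hpm : HasSum (fun k : ℕ => (k : ℝ) * (p k).toReal) m) :
    ∀ᵐ x ∂augmentedLaw p, x ∈ GoodClass m :=
  (withDensity_absolutelyContinuous' (measurable_nbr_apply .univ).inv.aemeasurable
    (ae_of_all _ fun x => ENNReal.inv_ne_zero.2 (nbr_univ_lt_top x).ne)).ae_le
    (reversibleLaw_ae_goodClass hp0 hp hpm)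

/-- The test function in `lintegral_reversibleLaw` that charges bad roots carries goodness from
classes to grafts of independent trees. -/
theorem ae_treeGraft_good (hp0 : p 0 = 0) (hp : p.support.Nontrivial)
    (hpm : HasSum (fun k : ℕ => (k : ℝ) * (p k).toReal) m) :
    ∀ᵐ q ∂(offspringLaw p).prod (offspringLaw p), Good m (treeGraft q.1 q.2) := by
  have h1 := reversibleLaw_ae_goodClass hp0 hp hpm
  have h2 := lintegral_reversibleLaw hp0 (p := p) (h := fun x _ => (GoodClass m)ᶜ.indicator 1 x)
    ((measurable_one.indicator measurableSet_goodClass.compl).comp measurable_fst)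
  rw [lintegral_congr_ae (g := fun _ => 0) (h1.mono fun x hx => by
    simp only [Set.indicator_of_notMem (show x ∉ (GoodClass m)ᶜ from fun h => h hx),
      lintegral_zero]), lintegral_zero, eq_comm, lintegral_eq_zero_iff'] at h2
  · filter_upwards [h2, ae_prod_one_le hp0] with q hq hq1
    have hn := treeGraft_nice (Y := q.2) hq1.1
    obtain ⟨g, e, he⟩ := exists_rootedGraph_iso hn (.inl (progenitor q.1))
    by_contra hbad
    have h3 : classOf (treeGraft q.1 q.2) (.inl (progenitor q.1)) ∈ (GoodClass m)ᶜ := by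
      rw [classOf_eq_clAt e]
      intro h
      exact hbad ((clAt_mem_goodClass.1 h).congr g.connected e.symm)
    rw [Set.indicator_of_mem h3] at hq
    exact one_ne_zero hq
  · exact (measurable_one.indicator measurableSet_goodClass.compl).comp_aemeasurable
      (aemeasurable_graftClass_left hp0)

end AugmentedGoodness
end HorosphericGW

namespace HorosphericGW

/-! ### Branching measures of grafts -/

section GraftBranching

variable {V : Type*} [Countable V] {m : ℝ}

theorem WalkDistinct.classOf_injective {G : SimpleGraph V} (hn : IsInfiniteLocallyFiniteConnected G)
    (h : WalkDistinct G) : Function.Injective (classOf G) := by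
  intro u v huv
  obtain ⟨g, e, -⟩ := exists_rootedGraph_iso hn u
  rw [classOf_eq_clAt e, classOf_eq_clAt e] at huv
  exact e.injective ((h.congr e).clAt_injective huv)

theorem tendsto_cnt_bray_classOf (hm : 0 < m) {G : SimpleGraph V}
    (hn : IsInfiniteLocallyFiniteConnected G) (hg : Good m G) (o : V) {D : Set (ℕ → GraphSpace)}
    (hD : MeasurableSet D) {n : ℕ} (hdep : DepOn n D) :
    Tendsto (fun k : ℕ => (cnt G o k {a | (fun i => classOf G (a i)) ∈ D} : ℝ) / m ^ k) atTop
      (𝓝 ((bray m (classOf G o)).real D)) := by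
  obtain ⟨g, e, -⟩ := exists_rootedGraph_iso hn o
  have h1 := tendsto_cnt_bray hm (hg.congr hn.2.1 e) (e o) hD hdep
  rw [← classOf_eq_clAt e] at h1
  refine h1.congr fun k => ?_
  rw [cnt_iso (hg.isTree hn.2.1)]
  congr 3
  ext a
  change (fun i => g.clAt (e (a i))) ∈ D ↔ (fun i => classOf G (a i)) ∈ D
  simp only [classOf_eq_clAt e]

variable {H : SimpleGraph V} {r : V} {X : List ℕ → ℕ}

/-- A cone of `H` seen from `r` is a cone of the graft seen from the progenitor of `X`, one step
farther away; hence the factor `m` in the limit. -/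
theorem conv_of_good_graft (hm : 0 < m) (hH : H.Connected) (hg : Good m (graft X H r)) :
    Conv m H r := by
  intro w
  obtain ⟨L, hL⟩ := hg.conv (graft_dist_left hH).1 (.inl (progenitor X)) (.inr w)
  refine ⟨L * m, fun _ => ?_⟩
  have h1 := ((tendsto_add_atTop_iff_nat 1).2 (hL (by simp))).mul_const m
  refine h1.congr fun k => ?_
  have hs : {u | (graft X H r).dist (.inl (progenitor X)) u = k + 1 ∧
      (graft X H r).dist (.inl (progenitor X)) (.inr w) + (graft X H r).dist (.inr w) u = k + 1} =
      Sum.inr '' {u | H.dist r u = k ∧ H.dist r w + H.dist w u = k} := by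
    ext u
    simp only [Set.mem_setOf_eq, (graft_dist_left hH).2, graft_dist_right hH]
    rcases u with u | u
    · simp only [Sum.elim_inl, Sum.elim_inr, Set.mem_image, reduceCtorEq, and_false, exists_false,
        iff_false]
      omega
    · simp only [Sum.elim_inr, Set.mem_image, Set.mem_setOf_eq, Sum.inr.injEq, exists_eq_right]
      omega
  rw [hs, Set.ncard_image_of_injective _ Sum.inr_injective, pow_succ]
  field_simp

theorem measurable_boundary_classOf {W : Type*} {o : V} (f : V → W) (G : SimpleGraph W) :
    Measurable fun (γ : Boundary H o) n => classOf G (f (γ.1 n)) := by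
  refine measurable_pi_iff.2 fun n => ?_
  let : MeasurableSpace V := ⊤
  have h1 : Measurable fun γ : Boundary H o => γ.1 :=
    Measurable.mono (comap_measurable fun γ : Boundary H o => γ.1)
      (le_of_eq boundary_measurableSpace.symm) le_rfl
  exact (measurable_from_top (f := fun v => classOf G (f v))).comp ((measurable_pi_apply n).comp h1)

/-- The branching measure of a graft on the rays which start at `r` and stay in `H`. -/
theorem bray_graft (hm : 0 < m) (hn : IsInfiniteLocallyFiniteConnected (graft X H r))
    (hg : Good m (graft X H r)) (hH : H.IsTree) (hf : ∀ v, (H.neighborSet v).Finite)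
    {ν : Measure (Boundary H r)} (hν : IsBranchingMeasure H r m ν) :
    (bray m (classOf (graft X H r) (.inr r))).restrict
      {s | s 1 ≠ classOf (graft X H r) (.inl (progenitor X))} =
      ν.map fun γ n => classOf (graft X H r) (.inr (γ.1 n)) := by
  have hT := hg.isTree hn.2.1
  have hinj := hg.walkDistinct.classOf_injective hn
  have hE : MeasurableSet {s : ℕ → GraphSpace | s 1 ≠ classOf (graft X H r) (.inl (progenitor X))} :=
    (measurableSet_seq_eq 1 _).compl
  have hd := graft_dist_right (N := X) (r := r) hH.connected
  have hfin := hν.1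
  refine measure_ext_of_depOn fun n D hD hdep => ?_
  rw [Measure.restrict_apply hD, Measure.map_apply (measurable_boundary_classOf _ _) hD,
    ← ofReal_measureReal, ← ofReal_measureReal]
  congr 1
  have h1 := tendsto_cnt_bray_classOf hm hn hg (.inr r) (hD.inter hE) (n := n + 1) fun s t hst =>
    and_congr (hdep s t fun i hi => hst i (by omega)) (by
      change s 1 ≠ _ ↔ t 1 ≠ _
      rw [hst 1 (by omega)])
  have h2 := hν.tendsto_cnt hH hf (n := n)
    (D := {a | (fun i => classOf (graft X H r) (.inr (a i))) ∈ D}) fun a b hab =>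
      hdep _ _ fun i hi => by rw [hab i hi]
  refine tendsto_nhds_unique h1 (h2.congr' ?_)
  filter_upwards [eventually_ge_atTop 1] with k hk
  congr 2
  -- Geodesics between vertices of `H` stay in `H`, while the geodesic from `r` to an individual of
  -- `X` starts through the progenitor. The restriction on the first step thus selects exactly the
  -- vertices of `H`.
  have hseg : ∀ u i, geodesicSegment (graft X H r) (.inr r) (.inr u) i =
      .inr (geodesicSegment H r u i) := fun u i => by
    rcases le_total i (H.dist r u) with hi | hi
    · have e1 := geodesicSegment_dist hH.connected hi
      have e2 := geodesicSegment_dist_right hH.connected hi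
      refine geodesicSegment_eq hT ?_ ?_
      · rw [hd]; exact e1
      · rw [hd, hd, Sum.elim_inr, Sum.elim_inr]; omega
    · rw [geodesicSegment_of_le hn.2.1 (by rw [hd]; exact hi), geodesicSegment_of_le hH.connected hi]
  rw [cnt, cnt, ← Set.ncard_image_of_injective _ Sum.inr_injective]
  congr 1
  ext u
  constructor
  · rintro ⟨u, ⟨h3, h4⟩, rfl⟩
    refine ⟨by rw [hd]; exact h3, ?_, ?_⟩
    · simp only [hseg]; exact h4
    · change classOf _ (geodesicSegment _ _ _ 1) ≠ _
      rw [hseg]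
      exact fun h => by simpa using hinj h
  · rintro ⟨h3, h4, h5⟩
    rcases u with u | u
    · refine (h5 ?_).elim
      change classOf _ (geodesicSegment _ _ _ 1) = _
      congr 1
      have hl := (graft_dist_left (N := X) (r := r) hH.connected).2 (.inl u)
      refine geodesicSegment_eq hT ?_ ?_
      · rw [hd]; simp [progenitor]
      · rw [hl, hd]; simp; omega
    · refine ⟨u, ⟨by rw [hd] at h3; exact h3, ?_⟩, rfl⟩
      simp only [hseg] at h4
      exact h4

open Classical in
theorem lintegral_bray_graft (hm : 0 < m) (hn : IsInfiniteLocallyFiniteConnected (graft X H r))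
    (hg : Good m (graft X H r)) (hH : H.IsTree) (hf : ∀ v, (H.neighborSet v).Finite)
    {ν : Measure (Boundary H r)} (hν : IsBranchingMeasure H r m ν)
    {Φ : (ℕ → GraphSpace) → ℝ≥0∞} (hΦ : Measurable Φ) :
    ∫⁻ s, (if s 1 = classOf (graft X H r) (.inl (progenitor X)) then 0 else Φ s)
      ∂bray m (classOf (graft X H r) (.inr r)) =
      ∫⁻ γ, Φ (fun n => classOf (graft X H r) (.inr (γ.1 n))) ∂ν := by
  have hE : MeasurableSet {s : ℕ → GraphSpace | s 1 ≠ classOf (graft X H r) (.inl (progenitor X))} :=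
    (measurableSet_seq_eq 1 _).compl
  rw [← lintegral_map hΦ (measurable_boundary_classOf _ _), ← bray_graft hm hn hg hH hf hν,
    ← lintegral_indicator hE]
  refine lintegral_congr fun s => ?_
  by_cases h : s 1 = classOf (graft X H r) (.inl (progenitor X))
  · rw [if_pos h, Set.indicator_of_notMem
      (show s ∉ {s : ℕ → GraphSpace | s 1 ≠ _} from fun h' => h' h)]
  · rw [if_neg h, Set.indicator_of_mem (show s ∈ {s : ℕ → GraphSpace | s 1 ≠ _} from h)]

end GraftBranching

/-! ### Extended Galton–Watson measures -/

section ExtendedLaw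

variable {p : PMF ℕ} {m : ℝ}

/-- The boundary extension of `reversibleLaw p`, as a law of sequences of rooted trees. -/
def rayLaw (p : PMF ℕ) (m : ℝ) : Measure (ℕ → GraphSpace) := (reversibleLaw p).bind (bray m)

-- The branching measure is split along the first edge and the degree-biased law is described by
-- grafts. The random ray thus crosses the grafted edge and then stays in the second tree, so that
-- with this tree and the ray fixed the first tree is a free source of randomness.
open Classical in
theorem lintegral_rayLaw (hp0 : p 0 = 0) (hp : p.support.Nontrivial)
    (hpm : HasSum (fun k : ℕ => (k : ℝ) * (p k).toReal) m) {F : (ℕ → GraphSpace) → ℝ≥0∞}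
    (hF : Measurable F) :
    ∫⁻ s, F s ∂rayLaw p m = (ENNReal.ofReal m)⁻¹ * ∫⁻ q,
      ∫⁻ s, (if s 1 = classOf (treeGraft q.1 q.2) (.inl (progenitor q.1)) then 0 else
        F (scons (classOf (treeGraft q.1 q.2) (.inl (progenitor q.1))) s))
        ∂bray m (classOf (treeGraft q.1 q.2) (.inr (progenitor q.2)))
        ∂(offspringLaw p).prod (offspringLaw p) := by
  have hm : 0 < m := zero_lt_one.trans_le (one_le_mean hp0 hpm)
  have hav := measurable_avoid hF
  have hm2 : Measurable (Function.uncurry fun x y : GraphSpace =>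
      ∫⁻ s, (if s 1 = x then 0 else F (scons x s)) ∂bray m y) :=
    measurable_lintegral_bray (f := fun (p : GraphSpace × GraphSpace) s =>
      if s 1 = p.1 then 0 else F (scons p.1 s))
      (hav.comp ((measurable_fst.comp measurable_fst).prodMk measurable_snd)) measurable_snd
  rw [rayLaw, Measure.lintegral_bind measurable_bray.aemeasurable hF.aemeasurable,
    lintegral_congr_ae ((reversibleLaw_ae_goodClass hp0 hp hpm).mono fun x hx =>
      lintegral_bray_eq hm hx hF), lintegral_const_mul' _ _ (by simp [hm]),
    lintegral_reversibleLaw hp0 hm2]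

theorem shiftInvariant_rayLaw (hp0 : p 0 = 0) (hp : p.support.Nontrivial)
    (hpm : HasSum (fun k : ℕ => (k : ℝ) * (p k).toReal) m) : ShiftInvariant m (rayLaw p m) := by
  have hm : 0 < m := zero_lt_one.trans_le (one_le_mean hp0 hpm)
  intro F hF
  rw [rayLaw, (reversible_reversibleLaw hp0).lintegral_bind_bray hm
    (reversibleLaw_ae_goodClass hp0 hp hpm) hF, ← mul_assoc, ENNReal.mul_inv_cancel (by simp [hm])
    (by simp), one_mul]

theorem rayLaw_ae_raySet (p : PMF ℕ) (m : ℝ) : ∀ᵐ s ∂rayLaw p m, s ∈ RaySet m := by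
  change rayLaw p m (RaySet m)ᶜ = 0
  rw [rayLaw, Measure.bind_apply measurableSet_raySet.compl measurable_bray.aemeasurable]
  refine (lintegral_congr fun x => ?_).trans lintegral_zero
  exact (bray_ae x).mono fun s hs => hs.1

theorem treeGraft_branching {X Y : List ℕ → ℕ} (hm : 0 < m) (hg : Good m (treeGraft X Y)) :
    ∃ ν, IsBranchingMeasure (genealogicalTree Y) (progenitor Y) m ν :=
  exists_isBranchingMeasure (genealogicalTree_isTree Y) (genealogicalTree_finite Y) hm
    (conv_of_good_graft hm (genealogicalTree_dist Y).1 hg)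

/-- Up to the factor `1/m` the mass is the mean of the limit of the normalized generation sizes of
the second tree. Each normalized size has mean one, and Fatou's lemma bounds the mean of the limit.
-/
theorem rayLaw_univ_lt_top (hp0 : p 0 = 0) (hp : p.support.Nontrivial)
    (hpm : HasSum (fun k : ℕ => (k : ℝ) * (p k).toReal) m) : rayLaw p m Set.univ < ⊤ := by
  classical
  have hm : 0 < m := zero_lt_one.trans_le (one_le_mean hp0 hpm)
  rw [← lintegral_one, lintegral_rayLaw hp0 hp hpm measurable_const]
  refine ENNReal.mul_lt_top (by simp [hm]) ?_
  have h1 : ∀ᵐ q ∂(offspringLaw p).prod (offspringLaw p),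
      ∫⁻ s, (if s 1 = classOf (treeGraft q.1 q.2) (.inl (progenitor q.1)) then 0 else 1)
        ∂bray m (classOf (treeGraft q.1 q.2) (.inr (progenitor q.2))) =
      liminf (fun k : ℕ => ENNReal.ofReal ((generationSize q.2 k : ℝ) / m ^ k)) atTop := by
    filter_upwards [ae_treeGraft_good hp0 hp hpm, ae_prod_one_le hp0] with q hq hq1
    obtain ⟨ν, hν⟩ := treeGraft_branching hm hq
    have hT := genealogicalTree_isTree q.2
    have hfin := hν.1
    rw [lintegral_bray_graft hm (treeGraft_nice hq1.1) hq hT (genealogicalTree_finite q.2) hν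
      measurable_const, lintegral_one]
    have h2 := hν.tendsto_cnt hT (genealogicalTree_finite q.2) (n := 0) (D := Set.univ)
      fun a b _ => by simp
    have h3 := (ENNReal.continuous_ofReal.tendsto _).comp h2
    rw [ofReal_measureReal] at h3
    have h4 : ∀ k, cnt (genealogicalTree q.2) (progenitor q.2) k Set.univ = generationSize q.2 k := by
      intro k
      rw [cnt, generationSize, ← Set.ncard_image_of_injective _ Subtype.val_injective]
      congr 1
      ext u
      simp only [(genealogicalTree_dist q.2).2, Set.mem_image]
      constructor
      · rintro ⟨v, hv, rfl⟩
        exact ⟨v.2, hv.1⟩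
      · exact fun h => ⟨⟨u, h.1⟩, ⟨h.2, trivial⟩, rfl⟩
    simp only [h4] at h3
    exact h3.liminf_eq.symm
  rw [lintegral_congr_ae h1, lintegral_prod_symm]
  · simp only [lintegral_const, measure_univ, mul_one]
    refine (lintegral_liminf_le fun k => ?_).trans_lt ?_
    · exact ((measurable_generationSize k).div_const _).ennreal_ofReal
    · simp [lintegral_generationSize_div hm hpm]
  · refine (Measurable.liminf fun k => ?_).aemeasurable
    exact (((measurable_generationSize k).comp measurable_snd).div_const _).ennreal_ofReal

end ExtendedLaw
end HorosphericGW

namespace HorosphericGW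

/-! ### Twins in horospheric products -/

section Twins

variable {m : ℝ}

theorem Twin.congr {V V' W W' : Type*} {G : SimpleGraph V} {G' : SimpleGraph V'}
    {H : SimpleGraph W} {H' : SimpleGraph W'} {o : V} {o' : V'} {r : W} {r' : W'}
    {γ : Boundary G o} {γ' : Boundary G' o'} {δ : Boundary H r} {δ' : Boundary H' r'}
    (hG : G.Connected) (hG' : G'.Connected) (e : G ≃g H) (e' : G' ≃g H')
    (he : ∀ n, δ.1 n = e (γ.1 n)) (he' : ∀ n, δ'.1 n = e' (γ'.1 n)) (h : Twin γ γ') :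
    Twin δ δ' := by
  have b1 := busemann_iso (γ := γ) (γ₂ := δ) (i := 0) (j := 0) hG e he
  have b2 := busemann_iso (γ := γ') (γ₂ := δ') (i := 0) (j := 0) hG' e' he'
  have hr : e o = r := by rw [← γ.2.1, ← he, δ.2.1]
  have hr' : e' o' = r' := by rw [← γ'.2.1, ← he', δ'.2.1]
  let E := horosphericIso e e' 0 (fun x => by simpa using b1 x) (fun x => by simpa using b2 x)
  obtain ⟨w, hw, hn⟩ := h
  refine ⟨E w, ?_, fun n => ?_⟩
  · change busemann H δ r (e w.1.1) ≠ H.dist r (e w.1.1)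
    rw [b1, ← hr, dist_iso hG]
    simpa using hw
  · have hE : E (horosphericRoot G γ G' γ') = horosphericRoot H δ H' δ' :=
      Subtype.ext (Prod.ext hr hr')
    rw [← hE, wcount_iso, wcount_iso, hn]

theorem measurable_twin : Measurable fun p : LabelledRay m × LabelledRay m =>
    Twin p.1.bdry p.2.bdry := by
  let A : LabelledRay m × LabelledRay m → ℕ × ℕ → ℕ × ℕ → Prop := fun p u v =>
    ∃ x y : HorosphericVertex p.1.1.1.graph p.1.bdry p.2.1.1.graph p.2.bdry, x.1 = u ∧ y.1 = v ∧
      (horosphericProduct p.1.1.1.graph p.1.bdry p.2.1.1.graph p.2.bdry).Adj x y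
  have hA : ∀ (p : LabelledRay m × LabelledRay m) n
      (w : HorosphericVertex p.1.1.1.graph p.1.bdry p.2.1.1.graph p.2.bdry),
      wcount (A p) n w.1 =
        wcount (horosphericProduct p.1.1.1.graph p.1.bdry p.2.1.1.graph p.2.bdry).Adj n w :=
    fun p n w => wcount_range Subtype.val_injective n w
  have key : ∀ p : LabelledRay m × LabelledRay m, Twin p.1.bdry p.2.bdry ↔ ∃ u v : ℕ × ℕ,
      (busemann p.1.1.1.graph p.1.bdry p.1.1.1.root u.1 +
        busemann p.2.1.1.graph p.2.bdry p.2.1.1.root u.2 = 0) ∧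
      (horosphericRoot p.1.1.1.graph p.1.bdry p.2.1.1.graph p.2.bdry).1 = v ∧
      (¬ ∃ k : ℕ, busemann p.1.1.1.graph p.1.bdry p.1.1.1.root u.1 = k ∧
        p.1.1.1.graph.dist p.1.1.1.root u.1 = k) ∧
      ∀ n, wcount (A p) n u = wcount (A p) n v := fun p => by
    constructor
    · rintro ⟨w, h1, h2⟩
      refine ⟨w.1, _, w.2, rfl, ?_, fun n => ?_⟩
      · rintro ⟨k, h3, h4⟩
        exact h1 (by rw [h3, h4])
      · rw [hA, hA, h2]
    · rintro ⟨u, _, hu, rfl, h1, h2⟩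
      refine ⟨⟨u, hu⟩, fun h => h1 ⟨_, h, rfl⟩, fun n => ?_⟩
      exact (hA p n ⟨u, hu⟩).symm.trans ((h2 n).trans (hA p n _))
  simp only [key]
  have hroot : Measurable fun p : LabelledRay m × LabelledRay m => p.1.1.1 :=
    measurable_fst.comp (measurable_subtype_coe.comp measurable_fst)
  refine .exists fun u => .exists fun v => .and (measurable_horosphericVertex u)
    (.and (measurable_horosphericRoot v) (.and (.not (.exists fun k => .and
      ((LabelledRay.measurable_busemann _ _).comp measurable_fst) ?_)) (.forall fun n => ?_)))
  · exact measurableSet_setOfPred.1 (measurable_dist_comp hroot (measurable_root.comp hroot)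
      measurable_const (measurableSet_singleton k))
  · exact measurableSet_setOfPred.1 (measurableSet_eq_fun
      (measurable_wcount measurable_horospheric_adj n u)
      (measurable_wcount measurable_horospheric_adj n v))

/-- The pairs of sequences of classes along rays with a twin of the root. -/
def TwinSet (m : ℝ) : Set ((ℕ → GraphSpace) × (ℕ → GraphSpace)) :=
  {q | ∃ p : LabelledRay m × LabelledRay m, p.1.seq = q.1 ∧ p.2.seq = q.2 ∧
    Twin p.1.bdry p.2.bdry}

theorem mem_twinSet_iff {V : Type*} [Countable V] {G : SimpleGraph V}
    (hG : IsInfiniteLocallyFiniteConnected G) (hg : Good m G) {o : V} (γ : Boundary G o)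
    (p' : LabelledRay m) :
    (fun n => classOf G (γ.1 n), p'.seq) ∈ TwinSet m ↔ Twin γ p'.bdry := by
  constructor
  · rintro ⟨q, h1, h2, h⟩
    obtain ⟨e, he⟩ := q.1.exists_iso hG γ h1
    obtain ⟨e', he'⟩ := q.2.exists_iso p'.1.1.nice p'.bdry
      (h2.trans (funext fun n => (classOf_graph _ _).symm))
    refine h.congr q.1.1.1.connected q.2.1.1.connected e.symm e'.symm (fun n => ?_) fun n => ?_
    · exact (e.symm_apply_eq.2 (he n)).symm
    · exact (e'.symm_apply_eq.2 (he' n)).symm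
  · intro h
    obtain ⟨q, hq⟩ := LabelledRay.exists_seq_eq hG hg γ
    obtain ⟨e, he⟩ := q.exists_iso hG γ hq
    exact ⟨(q, p'), hq, rfl, h.congr hG.2.1 p'.1.1.connected e (RelIso.refl _) he fun n => rfl⟩

theorem seq_mem_twinSet_iff (p p' : LabelledRay m) :
    (p.seq, p'.seq) ∈ TwinSet m ↔ Twin p.bdry p'.bdry := by
  have h := mem_twinSet_iff p.1.1.nice p.2.1 p.bdry p'
  simp only [classOf_graph] at h
  exact h

/-- The condition descends from labelled rays to sequences of classes by the same quotient argument
as for `hpClass`. -/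
theorem measurableSet_twinSet : MeasurableSet (TwinSet m) := by
  have h1 : MeasurableSet {q : RaySet m × RaySet m | (q.1.1, q.2.1) ∈ TwinSet m} := by
    refine (measurable_rays.measurableSet_preimage_iff_of_surjective surjective_rays).1 ?_
    refine measurableSet_setOfPred.2 ?_
    change Measurable fun p : LabelledRay m × LabelledRay m => (p.1.seq, p.2.seq) ∈ TwinSet m
    simp only [seq_mem_twinSet_iff]
    exact measurable_twin
  have he : MeasurableEmbedding (Prod.map (Subtype.val : RaySet m → _) (Subtype.val : RaySet m → _)) :=
    (MeasurableEmbedding.subtype_coe measurableSet_raySet).prodMap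
      (MeasurableEmbedding.subtype_coe measurableSet_raySet)
  convert he.measurableSet_image.2 h1
  ext ⟨s, s'⟩
  constructor
  · rintro ⟨p, rfl, rfl, h⟩
    exact ⟨(⟨_, p.1.seq_mem⟩, ⟨_, p.2.seq_mem⟩), (seq_mem_twinSet_iff _ _).2 h, rfl⟩
  · rintro ⟨⟨s, s'⟩, h, h'⟩
    rw [← h']
    exact h

/-- A horospheric product without twins of the root on either side has distinguishable root. -/
theorem eq_root_of_not_twin {V V' : Type*} {G : SimpleGraph V} {G' : SimpleGraph V'} {o : V}
    {o' : V'} {γ : Boundary G o} {γ' : Boundary G' o'} (hG : G.Connected) (hG' : G'.Connected)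
    (h : ¬ Twin γ γ') (h' : ¬ Twin γ' γ) {w : HorosphericVertex G γ G' γ'}
    (hw : ∀ n, wcount (horosphericProduct G γ G' γ').Adj n w =
      wcount (horosphericProduct G γ G' γ').Adj n (horosphericRoot G γ G' γ')) :
    w = horosphericRoot G γ G' γ' := by
  let E : horosphericProduct G γ G' γ' ≃g horosphericProduct G' γ' G γ :=
    { toFun := fun w => ⟨w.1.swap, (add_comm _ _).trans w.2⟩
      invFun := fun w => ⟨w.1.swap, (add_comm _ _).trans w.2⟩
      left_inv := fun _ => rfl
      right_inv := fun _ => rfl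
      map_rel_iff' := and_comm }
  -- With no twin on either side, both horofunctions of `w` equal distances and are nonnegative;
  -- since they sum to zero, both distances vanish.
  have h1 : busemann G γ o w.1.1 = G.dist o w.1.1 := by
    by_contra hne
    exact h ⟨w, hne, hw⟩
  have h2 : busemann G' γ' o' w.1.2 = G'.dist o' w.1.2 := by
    by_contra hne
    refine h' ⟨E w, hne, fun n => ?_⟩
    change wcount _ n (E w) = wcount _ n (E (horosphericRoot G γ G' γ'))
    rw [wcount_iso, wcount_iso, hw]
  have h3 : busemann G γ o w.1.1 + busemann G' γ' o' w.1.2 = 0 := w.2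
  refine Subtype.ext (Prod.ext ?_ ?_)
  · exact (hG.dist_eq_zero_iff.1 (show G.dist o w.1.1 = 0 by omega)).symm
  · exact (hG'.dist_eq_zero_iff.1 (show G'.dist o' w.1.2 = 0 by omega)).symm

end Twins

/-! ### Horospheric products of Galton–Watson trees have distinguishable vertices -/

section DistinctProducts

variable {p q : PMF ℕ} {m : ℝ}

theorem aemeasurable_graftRay (hp0 : p 0 = 0) {Y : List ℕ → ℕ}
    (ν : Measure (Boundary (genealogicalTree Y) (progenitor Y))) [SFinite ν] :
    AEMeasurable (fun a : (List ℕ → ℕ) × Boundary (genealogicalTree Y) (progenitor Y) =>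
      fun n => classOf (treeGraft a.1 Y)
        ((graftRay a.1 (genealogicalTree_dist Y).1 a.2).1 n)) ((offspringLaw p).prod ν) := by
  refine aemeasurable_pi_lambda _ fun n => ?_
  have hc : Measurable fun a : (List ℕ → ℕ) × Boundary (genealogicalTree Y) (progenitor Y) =>
      (a.1, Y) := measurable_fst.prodMk measurable_const
  refine aemeasurable_classOf (ι := fun a => graftWord a.1 Y) (fun a => graftWord_injective a.1 Y)
    ((Measure.quasiMeasurePreserving_fst.ae (ae_one_le hp0)).mono fun a ha => treeGraft_nice ha)
    (fun u v => (measurable_treeGraft_adj u v).comp hc)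
    fun v => ?_
  cases n with
  | zero => exact measurable_const (a := (Sum.inl [] : List ℕ ⊕ List ℕ) = v)
  | succ n =>
    let : MeasurableSpace {u : List ℕ // IsIndividual Y u} := ⊤
    have h1 : Measurable fun γ : Boundary (genealogicalTree Y) (progenitor Y) => γ.1 n :=
      (measurable_pi_apply n).comp (Measurable.mono (comap_measurable
        fun γ : Boundary (genealogicalTree Y) (progenitor Y) => γ.1)
        (le_of_eq boundary_measurableSpace.symm) le_rfl)
    exact (measurable_from_top (f := fun u : {u : List ℕ // IsIndividual Y u} =>
      (Sum.inr u.1 : List ℕ ⊕ List ℕ) = v)).comp (h1.comp measurable_snd)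

/-- With the other pointed tree fixed, the random ray is disintegrated by `lintegral_rayLaw` into a
tree `X`, a tree `Y` and a ray of `Y`. For given `Y` and ray, `ae_not_twin` applies to the random
`X`. -/
theorem rayLaw_twin (hp0 : p 0 = 0) (hp : p.support.Nontrivial)
    (hpm : HasSum (fun k : ℕ => (k : ℝ) * (p k).toReal) m) {s' : ℕ → GraphSpace}
    (hs' : s' ∈ RaySet m) : ∀ᵐ s ∂rayLaw p m, (s, s') ∉ TwinSet m := by
  classical
  obtain ⟨p', rfl⟩ := LabelledRay.exists_of_mem hs'
  have hm : 0 < m := zero_lt_one.trans_le (one_le_mean hp0 hpm)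
  let S : Set (ℕ → GraphSpace) := {s | (s, p'.seq) ∈ TwinSet m}
  have hS : MeasurableSet S := measurable_prodMk_right measurableSet_twinSet
  let F : (ℕ → GraphSpace) → ℝ≥0∞ := S.indicator 1
  have hF : Measurable F := measurable_one.indicator hS
  change rayLaw p m {s | ¬ s ∉ S} = 0
  simp only [not_not]
  rw [show {s | s ∈ S} = S from rfl, ← lintegral_indicator_one hS,
    lintegral_rayLaw hp0 hp hpm hF]
  refine mul_eq_zero.2 (.inr ?_)
  have hmeas : AEMeasurable (fun q : (List ℕ → ℕ) × (List ℕ → ℕ) =>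
      ∫⁻ s, (if s 1 = classOf (treeGraft q.1 q.2) (.inl (progenitor q.1)) then 0 else
        F (scons (classOf (treeGraft q.1 q.2) (.inl (progenitor q.1))) s))
        ∂bray m (classOf (treeGraft q.1 q.2) (.inr (progenitor q.2))))
      ((offspringLaw p).prod (offspringLaw p)) := by
    have hm2 : Measurable fun z : GraphSpace × GraphSpace =>
        ∫⁻ s, (if s 1 = z.1 then 0 else F (scons z.1 s)) ∂bray m z.2 :=
      measurable_lintegral_bray (f := fun (z : GraphSpace × GraphSpace) s =>
        if s 1 = z.1 then 0 else F (scons z.1 s))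
        ((measurable_avoid hF).comp ((measurable_fst.comp measurable_fst).prodMk measurable_snd))
        measurable_snd
    exact hm2.comp_aemeasurable
      ((aemeasurable_graftClass_left hp0).prodMk (aemeasurable_graftClass_right hp0))
  rw [lintegral_prod_symm _ hmeas]
  refine (lintegral_congr_ae ?_).trans lintegral_zero
  have hgood : ∀ᵐ Y ∂offspringLaw p, ∀ᵐ X ∂offspringLaw p, Good m (treeGraft X Y) :=
    Measure.ae_ae_of_ae_prod
    ((Measure.measurePreserving_swap (μ := offspringLaw p)
      (ν := offspringLaw p)).quasiMeasurePreserving.ae (ae_treeGraft_good hp0 hp hpm))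
  filter_upwards [hgood] with Y hY
  -- One good graft with `Y` shows that `Y` has a branching measure `ν`, which does not depend on
  -- the tree to which `Y` is grafted.
  obtain ⟨X₀, hX₀⟩ := hY.exists
  obtain ⟨ν, hν⟩ := treeGraft_branching hm (X := X₀) hX₀
  have hfin := hν.1
  have hT := genealogicalTree_isTree Y
  have h1 : ∀ᵐ X ∂offspringLaw p,
      ∫⁻ s, (if s 1 = classOf (treeGraft X Y) (.inl (progenitor X)) then 0 else
        F (scons (classOf (treeGraft X Y) (.inl (progenitor X))) s))
        ∂bray m (classOf (treeGraft X Y) (.inr (progenitor Y))) =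
      ∫⁻ γ, F (fun n => classOf (treeGraft X Y)
        ((graftRay X (genealogicalTree_dist Y).1 γ).1 n)) ∂ν := by
    filter_upwards [hY, ae_one_le hp0] with X hX hX1
    rw [lintegral_bray_graft hm (treeGraft_nice hX1) hX hT (genealogicalTree_finite Y) hν
      (Φ := fun s => F (scons (classOf (treeGraft X Y) (.inl (progenitor X))) s))
      (hF.comp (measurable_scons.comp (measurable_const.prodMk measurable_id)))]
    refine lintegral_congr fun γ => congrArg F ?_
    ext n
    cases n <;> rfl
  refine (lintegral_congr_ae h1).trans ?_
  -- Since `ν` does not depend on `X`, the ray can be fixed before `X` is sampled.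
  rw [lintegral_lintegral_swap]
  · refine (lintegral_congr fun γ => ?_).trans lintegral_zero
    refine (lintegral_congr_ae ?_).trans lintegral_zero
    filter_upwards [hY, ae_one_le hp0, ae_not_twin hp0 hp (genealogicalTree_finite Y)
      (genealogicalTree_dist Y).1 γ p'.1.1.locallyFinite p'.isTree p'.bdry] with X hX hX1 hXt
    refine Set.indicator_of_notMem ?_ _
    exact fun h => hXt ((mem_twinSet_iff (treeGraft_nice hX1) hX _ p').1 h)
  · exact hF.comp_aemeasurable (aemeasurable_graftRay hp0 ν)

theorem isFiniteMeasure_rayLaw (hp0 : p 0 = 0) (hp : p.support.Nontrivial)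
    (hpm : HasSum (fun k : ℕ => (k : ℝ) * (p k).toReal) m) : IsFiniteMeasure (rayLaw p m) :=
  ⟨rayLaw_univ_lt_top hp0 hp hpm⟩

theorem ae_prod_not_twin (hp0 : p 0 = 0) (hp : p.support.Nontrivial)
    (hpm : HasSum (fun k : ℕ => (k : ℝ) * (p k).toReal) m) (Q : Measure (ℕ → GraphSpace))
    [SFinite Q] (hQ : ∀ᵐ s ∂Q, s ∈ RaySet m) :
    ∀ᵐ z ∂Q.prod (rayLaw p m), (z.2, z.1) ∉ TwinSet m := by
  have := isFiniteMeasure_rayLaw hp0 hp hpm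
  refine (Measure.ae_prod_iff_ae_ae ?_).2 (hQ.mono fun s' hs' => rayLaw_twin hp0 hp hpm hs')
  exact measurable_swap measurableSet_twinSet.compl

/-- The classes of rooted graphs whose root is distinguishable from the other vertices. -/
def RootDistinctClass : Set GraphSpace :=
  {Γ | ∃ g : RootedGraph, g.toClass = Γ ∧
    ∀ v, (∀ n, wcount g.graph.Adj n v = wcount g.graph.Adj n g.root) → v = g.root}

theorem classOf_mem_rootDistinctClass {V : Type*} [Countable V] {G : SimpleGraph V}
    (hG : IsInfiniteLocallyFiniteConnected G) {o : V} : classOf G o ∈ RootDistinctClass ↔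
      ∀ v, (∀ n, wcount G.Adj n v = wcount G.Adj n o) → v = o := by
  constructor
  · rintro ⟨g, hg, h⟩ v hv
    rw [← RootedGraph.clAt_root, ← classOf_graph] at hg
    obtain ⟨e, he⟩ := (classOf_eq_iff g.nice hG).1 hg
    have h1 := h (e.symm v) fun n => by rw [wcount_iso, hv, ← he, wcount_iso]
    rw [← he, ← h1, e.apply_symm_apply]
  · intro h
    obtain ⟨g, e, he⟩ := exists_rootedGraph_iso hG o
    refine ⟨g, ?_, fun v hv => ?_⟩
    · rw [classOf_eq_clAt e, he, RootedGraph.clAt_root]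
    · have h1 := h (e.symm v) fun n => by rw [wcount_iso, hv, ← he, wcount_iso]
      rw [← he, ← h1, e.apply_symm_apply]

theorem clAt_mem_rootDistinctClass {g : RootedGraph} {o : ℕ} : g.clAt o ∈ RootDistinctClass ↔
    ∀ v, (∀ n, wcount g.graph.Adj n v = wcount g.graph.Adj n o) → v = o := by
  rw [← classOf_graph]
  exact classOf_mem_rootDistinctClass g.nice

theorem measurableSet_rootDistinctClass : MeasurableSet RootDistinctClass := by
  refine measurableSet_setOfPred.2 (measurable_of_toClass ?_)
  have h : ∀ o : ℕ, Measurable fun g : RootedGraph =>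
      ∀ v, (∀ n, wcount g.graph.Adj n v = wcount g.graph.Adj n o) → v = o := fun o =>
    .forall fun v => Measurable.imp (.forall fun n => measurableSet_setOfPred.1
      (measurableSet_eq_fun (measurable_wcount measurable_adj n v)
        (measurable_wcount measurable_adj n o))) measurable_const
  have key : ∀ g : RootedGraph, g.toClass ∈ RootDistinctClass ↔ ∃ o, g.root = o ∧
      ∀ v, (∀ n, wcount g.graph.Adj n v = wcount g.graph.Adj n o) → v = o := fun g => by
    rw [← RootedGraph.clAt_root, clAt_mem_rootDistinctClass]
    simp
  change Measurable fun g : RootedGraph => g.toClass ∈ RootDistinctClass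
  simp only [key]
  exact .exists fun o => .and
    (measurableSet_setOfPred.1 (measurable_root (measurableSet_singleton o))) (h o)

/-- Horospheric products of extended Galton–Watson trees almost surely have distinguishable
vertices. -/
theorem ae_hpClass_distinct (hp0 : p 0 = 0) (hq0 : q 0 = 0) (hp : p.support.Nontrivial)
    (hq : q.support.Nontrivial) (hpm : HasSum (fun k : ℕ => (k : ℝ) * (p k).toReal) m)
    (hqm : HasSum (fun k : ℕ => (k : ℝ) * (q k).toReal) m) :
    ∀ᵐ x ∂((rayLaw p m).prod (rayLaw q m)).map fun z => hpClass m z.1 z.2, x ∈ DistinctClass := by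
  have := isFiniteMeasure_rayLaw hp0 hp hpm
  have := isFiniteMeasure_rayLaw hq0 hq hqm
  have hrev := reversible_hpClass (shiftInvariant_rayLaw hp0 hp hpm)
    (shiftInvariant_rayLaw hq0 hq hqm) (rayLaw_ae_raySet p m) (rayLaw_ae_raySet q m)
  have h1 : ∀ᵐ z ∂(rayLaw p m).prod (rayLaw q m), (z.1, z.2) ∉ TwinSet m :=
    (Measure.measurePreserving_swap (μ := rayLaw p m)
      (ν := rayLaw q m)).quasiMeasurePreserving.ae
      (ae_prod_not_twin hp0 hp hpm (rayLaw q m) (rayLaw_ae_raySet q m))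
  have h2 := ae_prod_not_twin hq0 hq hqm (rayLaw p m) (rayLaw_ae_raySet p m)
  have h3 : ∀ᵐ x ∂((rayLaw p m).prod (rayLaw q m)).map fun z => hpClass m z.1 z.2,
      x ∈ RootDistinctClass := by
    refine (ae_map_iff (p := fun x => x ∈ RootDistinctClass) measurable_hpClass.aemeasurable
      measurableSet_rootDistinctClass).2 ?_
    filter_upwards [h1, h2, Measure.quasiMeasurePreserving_fst.ae (rayLaw_ae_raySet p m),
      Measure.quasiMeasurePreserving_snd.ae (rayLaw_ae_raySet q m)] with z hz1 hz2 hz3 hz4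
    obtain ⟨a, ha⟩ := LabelledRay.exists_of_mem hz3
    obtain ⟨b, hb⟩ := LabelledRay.exists_of_mem hz4
    rw [← ha, ← hb, seq_mem_twinSet_iff] at hz1 hz2
    rw [← ha, ← hb, hpClass_seq]
    exact (classOf_mem_rootDistinctClass
      (hp_nice a.bdry b.bdry a.1.1.nice b.1.1.nice a.2.1 b.2.1)).2 fun v hv =>
      eq_root_of_not_twin a.1.1.connected b.1.1.connected hz1 hz2 hv
  -- Only the root has been treated so far; reversibility of the image measure extends the
  -- conclusion to every vertex.
  refine (hrev.ae_forall_clAt measurableSet_rootDistinctClass h3).mono fun x hx => ?_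
  obtain ⟨g, rfl⟩ := exists_rep x
  exact ⟨g, rfl, fun o => clAt_mem_rootDistinctClass.1 (hx g rfl o)⟩

end DistinctProducts
end HorosphericGW

namespace HorosphericGW

/-! ### Leafwise trees of good classes -/

section Leaves

variable {m : ℝ}

theorem leafGraph_nice_of_goodClass {x : GraphSpace} (hx : x ∈ GoodClass m) :
    IsInfiniteLocallyFiniteConnected x.leafGraph := by
  obtain ⟨g, rfl⟩ := exists_rep x
  exact leafGraph_nice (toClass_mem_goodClass.1 hx).walkDistinct g.root

theorem good_leafGraph_of_goodClass {x : GraphSpace} (hx : x ∈ GoodClass m) :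
    Good m x.leafGraph := by
  obtain ⟨g, rfl⟩ := exists_rep x
  exact good_leafGraph (toClass_mem_goodClass.1 hx) g.root

theorem classOf_leafGraph {x : GraphSpace} (hx : x ∈ GoodClass m) (a : x.Leaf) :
    classOf x.leafGraph a = a.1 := by
  obtain ⟨g, rfl⟩ := exists_rep x
  let e : g.graph ≃g g.toClass.leafGraph := leafIso (toClass_mem_goodClass.1 hx).walkDistinct g.root
  rw [classOf_eq_clAt e.symm]
  exact congrArg Subtype.val (e.apply_symm_apply a)

/-- The leafwise degree counts neighbouring classes, `nbr` counts neighbouring vertices; these agree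
because a good tree is isomorphic to its leafwise graph. -/
theorem degree_eq_nbr_univ {x : GraphSpace} (hx : x ∈ GoodClass m) :
    (x.degree : ℝ≥0∞) = nbr x Set.univ := by
  classical
  obtain ⟨g, rfl⟩ := exists_rep x
  let e : g.graph ≃g g.toClass.leafGraph := leafIso (toClass_mem_goodClass.1 hx).walkDistinct g.root
  have he : e g.root = g.toClass.leafRoot := Subtype.ext rfl
  have h1 : g.toClass.leafGraph.neighborSet g.toClass.leafRoot = e '' g.graph.neighborSet g.root := by
    ext a
    obtain ⟨v, rfl⟩ := e.surjective a
    rw [← he, e.injective.mem_set_image]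
    exact e.map_rel_iff
  rw [GraphSpace.degree, h1, Set.ncard_image_of_injective _ e.injective, ← lintegral_one,
    lintegral_nbr, tsum_eq_sum (s := (g.locallyFinite g.root).toFinset) fun v hv =>
      if_neg (show ¬ g.graph.Adj g.root v from fun h =>
        hv ((g.locallyFinite g.root).mem_toFinset.2 h)),
    Finset.sum_congr rfl fun v hv => if_pos (show g.graph.Adj g.root v from
      (g.locallyFinite g.root).mem_toFinset.1 hv),
    Set.ncard_eq_toFinset_card _ (g.locallyFinite g.root)]
  simp

theorem BoundaryBundle.measurable_ray : Measurable BoundaryBundle.ray := comap_measurable _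

theorem BoundaryBundle.measurable_mk (x : RigidTree) : Measurable (BoundaryBundle.mk x) := by
  rintro _ ⟨D, hD, rfl⟩
  exact measurable_leafRay x hD

theorem map_mk_apply (hm : 0 < m) {x : RigidTree} (hx : x.1 ∈ GoodClass m)
    {D : Set (ℕ → GraphSpace)} (hD : MeasurableSet D) :
    (branchingMeasure m x).map (BoundaryBundle.mk x) (BoundaryBundle.ray ⁻¹' D) = bray m x.1 D := by
  rw [Measure.map_apply (BoundaryBundle.measurable_mk x) (BoundaryBundle.measurable_ray hD),
    bray_of_good hm hx, Measure.map_apply (measurable_leafRay _) hD]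
  rfl

theorem isMeasurableSystem_branchingMeasure (hm : 0 < m) {μ : Measure RigidTree}
    (hμ : ∀ᵐ x ∂μ, x.1 ∈ GoodClass m) : IsMeasurableSystem μ (branchingMeasure m) := by
  classical
  refine ⟨fun x => if x.1 ∈ GoodClass m then (branchingMeasure m x).map (BoundaryBundle.mk x) else 0,
    ?_, hμ.mono fun x hx => (if_pos hx).symm⟩
  refine Measure.measurable_of_measurable_coe _ ?_
  rintro _ ⟨D, hD, rfl⟩
  have h : Measurable fun x : RigidTree => bray m x.1 D :=
    (Measure.measurable_coe hD).comp (measurable_bray.comp measurable_subtype_coe)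
  convert h with x
  split_ifs with hx
  · exact map_mk_apply hm hx hD
  · rw [bray_of_not_good hx]; rfl

end Leaves

/-! ### Augmented Galton–Watson measures on the boundary bundle -/

section BundleMeasures

variable {p q : PMF ℕ} {m : ℝ}

/-- `Measure.comap` is only meaningful when images of measurable sets are null measurable. This
holds because the classes of rigid trees contain the Borel set `GoodClass m` of full measure. -/
theorem map_val_augmentedGW (hp0 : p 0 = 0) (hp : p.support.Nontrivial)
    (hpm : HasSum (fun k : ℕ => (k : ℝ) * (p k).toReal) m) :
    (augmentedGW p).map Subtype.val = augmentedLaw p := by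
  have hval : Measurable (Subtype.val : RigidTree → GraphSpace) := measurable_subtype_coe
  have hnull : augmentedLaw p (Set.range (Subtype.val : RigidTree → GraphSpace))ᶜ = 0 :=
    measure_mono_null (Set.compl_subset_compl.2 fun x hx => ⟨goodTree hx, rfl⟩)
      (augmentedLaw_ae_goodClass hp0 hp hpm)
  have hrange : NullMeasurableSet (Set.range (Subtype.val : RigidTree → GraphSpace))
      (augmentedLaw p) := (NullMeasurableSet.of_null hnull).of_compl
  have himage : ∀ s : Set RigidTree, MeasurableSet s →
      NullMeasurableSet (Subtype.val '' s) (augmentedLaw p) := by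
    rintro _ ⟨S, hS, rfl⟩
    rw [Set.image_preimage_eq_inter_range]
    exact hS.nullMeasurableSet.inter hrange
  ext S hS
  rw [Measure.map_apply hval hS, augmentedGW, Measure.comap_apply₀ _ _ Subtype.val_injective himage
    (hval hS).nullMeasurableSet, Set.image_preimage_eq_inter_range]
  exact measure_inter_conull' (measure_mono_null (Set.diff_subset_compl _ _) hnull)

theorem augmentedGW_ae_goodClass (hp0 : p 0 = 0) (hp : p.support.Nontrivial)
    (hpm : HasSum (fun k : ℕ => (k : ℝ) * (p k).toReal) m) :
    ∀ᵐ x ∂augmentedGW p, x.1 ∈ GoodClass m := by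
  have h := augmentedLaw_ae_goodClass hp0 hp hpm
  rw [← map_val_augmentedGW hp0 hp hpm] at h
  exact ae_of_ae_map measurable_subtype_coe.aemeasurable h

theorem isProbabilityMeasure_augmentedGW (hp0 : p 0 = 0) (hp : p.support.Nontrivial)
    (hpm : HasSum (fun k : ℕ => (k : ℝ) * (p k).toReal) m) :
    IsProbabilityMeasure (augmentedGW p) := by
  have h : IsProbabilityMeasure (augmentedLaw p) := by
    rw [augmentedLaw_eq]
    exact Measure.isProbabilityMeasure_map (aemeasurable_treeClass_root hp0)
  refine ⟨?_⟩
  rw [← h.measure_univ, ← map_val_augmentedGW hp0 hp hpm,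
    Measure.map_apply measurable_subtype_coe .univ, Set.preimage_univ]

theorem map_val_invariantGW (hp0 : p 0 = 0) (hp : p.support.Nontrivial)
    (hpm : HasSum (fun k : ℕ => (k : ℝ) * (p k).toReal) m) :
    (invariantGW p).map Subtype.val = reversibleLaw p := by
  have hval : Measurable (Subtype.val : RigidTree → GraphSpace) := measurable_subtype_coe
  have hw : Measurable fun x : GraphSpace => (nbr x Set.univ)⁻¹ := (measurable_nbr_apply .univ).inv
  ext S hS
  rw [Measure.map_apply hval hS, reversibleLaw, withDensity_apply _ hS,
    ← map_val_augmentedGW hp0 hp hpm, setLIntegral_map hS hw hval, invariantGW,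
    withDensity_congr_ae ((augmentedGW_ae_goodClass hp0 hp hpm).mono fun x hx =>
      congrArg Inv.inv (degree_eq_nbr_univ hx)), withDensity_apply _ (hval hS)]

/-- The σ-algebra of the bundle is pulled back along `BoundaryBundle.ray`, so nothing is lost in
passing to sequences of classes, where all the estimates were made. -/
theorem map_ray_extendedGW (hp0 : p 0 = 0) (hp : p.support.Nontrivial)
    (hpm : HasSum (fun k : ℕ => (k : ℝ) * (p k).toReal) m) :
    (extendedGW p m).map BoundaryBundle.ray = rayLaw p m := by
  have hm : 0 < m := zero_lt_one.trans_le (one_le_mean hp0 hpm)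
  have hgood : ∀ᵐ x ∂invariantGW p, x.1 ∈ GoodClass m :=
    (withDensity_absolutelyContinuous _ _).ae_le (augmentedGW_ae_goodClass hp0 hp hpm)
  ext D hD
  rw [Measure.map_apply BoundaryBundle.measurable_ray hD, extendedGW, boundaryExtension,
    Measure.bind_apply (BoundaryBundle.measurable_ray hD)
      (isMeasurableSystem_branchingMeasure hm hgood),
    lintegral_congr_ae (hgood.mono fun x hx => map_mk_apply hm hx hD), rayLaw,
    Measure.bind_apply hD measurable_bray.aemeasurable, ← map_val_invariantGW hp0 hp hpm,
    lintegral_map (f := fun x => bray m x D) ((Measure.measurable_coe hD).comp measurable_bray)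
      measurable_subtype_coe]

theorem isFiniteMeasure_extendedGW (hp0 : p 0 = 0) (hp : p.support.Nontrivial)
    (hpm : HasSum (fun k : ℕ => (k : ℝ) * (p k).toReal) m) :
    IsFiniteMeasure (extendedGW p m) := by
  refine ⟨?_⟩
  have h := rayLaw_univ_lt_top hp0 hp hpm
  rwa [← map_ray_extendedGW hp0 hp hpm, Measure.map_apply BoundaryBundle.measurable_ray .univ,
    Set.preimage_univ] at h

/-- A pair of rays as a pair of sequences of classes. -/
def rayPair (z : BoundaryBundle × BoundaryBundle) : (ℕ → GraphSpace) × (ℕ → GraphSpace) :=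
  (z.1.ray, z.2.ray)

theorem measurable_rayPair : Measurable rayPair :=
  (BoundaryBundle.measurable_ray.comp measurable_fst).prodMk
    (BoundaryBundle.measurable_ray.comp measurable_snd)

theorem map_rayPair (hp0 : p 0 = 0) (hq0 : q 0 = 0) (hp : p.support.Nontrivial)
    (hq : q.support.Nontrivial) (hpm : HasSum (fun k : ℕ => (k : ℝ) * (p k).toReal) m)
    (hqm : HasSum (fun k : ℕ => (k : ℝ) * (q k).toReal) m) :
    ((extendedGW p m).prod (extendedGW q m)).map rayPair = (rayLaw p m).prod (rayLaw q m) := by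
  have := isFiniteMeasure_extendedGW hp0 hp hpm
  have := isFiniteMeasure_extendedGW hq0 hq hqm
  rw [← map_ray_extendedGW hp0 hp hpm, ← map_ray_extendedGW hq0 hq hqm,
    Measure.map_prod_map _ _ BoundaryBundle.measurable_ray BoundaryBundle.measurable_ray]
  rfl

theorem bundleProduct_spec {z : BoundaryBundle × BoundaryBundle} (h1 : z.1.base.1 ∈ GoodClass m)
    (h2 : z.2.base.1 ∈ GoodClass m)
    (h : hpClass m (rayPair z).1 (rayPair z).2 ∈ DistinctClass) :
    (IsInfiniteLocallyFiniteConnected (bundleProduct z) ∧ IsRigidGraph (bundleProduct z)) ∧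
      bundleProductClass z = ⟨hpClass m (rayPair z).1 (rayPair z).2, distinctClass_isRigid h⟩ := by
  have n1 := leafGraph_nice_of_goodClass h1
  have n2 := leafGraph_nice_of_goodClass h2
  have g1 := good_leafGraph_of_goodClass h1
  have g2 := good_leafGraph_of_goodClass h2
  have hn : IsInfiniteLocallyFiniteConnected (bundleProduct z) := hp_nice _ _ n1 n2 g1 g2
  have hc : hpClass m (rayPair z).1 (rayPair z).2 =
      classOf (bundleProduct z) (horosphericRoot _ z.1.point _ z.2.point) := by
    have := hpClass_eq n1 n2 g1 g2 z.1.point z.2.point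
    simp only [classOf_leafGraph h1, classOf_leafGraph h2] at this
    exact this
  refine ⟨⟨hn, ?_⟩, ?_⟩
  · obtain ⟨g, e, -⟩ := exists_rootedGraph_iso hn (horosphericRoot _ z.1.point _ z.2.point)
    rw [hc, classOf_eq_clAt e, clAt_mem_distinctClass] at h
    exact (h.congr e.symm).isRigidGraph
  · have hr : (classOf (bundleProduct z) (horosphericRoot _ z.1.point _ z.2.point)).IsRigid :=
      hc ▸ distinctClass_isRigid h
    rw [bundleProductClass, rigidClassOf, dif_pos hr]
    exact Subtype.ext hc.symm

theorem ae_bundleProduct_spec (hp0 : p 0 = 0) (hq0 : q 0 = 0) (hp : p.support.Nontrivial)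
    (hq : q.support.Nontrivial) (hpm : HasSum (fun k : ℕ => (k : ℝ) * (p k).toReal) m)
    (hqm : HasSum (fun k : ℕ => (k : ℝ) * (q k).toReal) m) :
    ∀ᵐ z ∂(extendedGW p m).prod (extendedGW q m),
      z.1.base.1 ∈ GoodClass m ∧ z.2.base.1 ∈ GoodClass m ∧
      hpClass m (rayPair z).1 (rayPair z).2 ∈ DistinctClass := by
  have hbase : ∀ z : BoundaryBundle, z.ray ∈ RaySet m → z.base.1 ∈ GoodClass m := fun z hz => by
    have h0 : z.ray 0 = z.base.1 := congrArg Subtype.val z.point.2.1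
    exact h0 ▸ hz.1
  have := isFiniteMeasure_extendedGW hp0 hp hpm
  have := isFiniteMeasure_extendedGW hq0 hq hqm
  have h1 := rayLaw_ae_raySet p m
  have h2 := rayLaw_ae_raySet q m
  have h3 := ae_hpClass_distinct hp0 hq0 hp hq hpm hqm
  rw [← map_ray_extendedGW hp0 hp hpm] at h1
  rw [← map_ray_extendedGW hq0 hq hqm] at h2
  rw [← map_rayPair hp0 hq0 hp hq hpm hqm] at h3
  filter_upwards [Measure.quasiMeasurePreserving_fst.ae
      (ae_of_ae_map BoundaryBundle.measurable_ray.aemeasurable h1),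
    Measure.quasiMeasurePreserving_snd.ae
      (ae_of_ae_map BoundaryBundle.measurable_ray.aemeasurable h2),
    ae_of_ae_map measurable_rayPair.aemeasurable (ae_of_ae_map measurable_hpClass.aemeasurable h3)]
    with z hz1 hz2 hz3
  exact ⟨hbase _ hz1, hbase _ hz2, hz3⟩

theorem aemeasurable_bundleProductClass (hp0 : p 0 = 0) (hq0 : q 0 = 0) (hp : p.support.Nontrivial)
    (hq : q.support.Nontrivial) (hpm : HasSum (fun k : ℕ => (k : ℝ) * (p k).toReal) m)
    (hqm : HasSum (fun k : ℕ => (k : ℝ) * (q k).toReal) m) :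
    AEMeasurable bundleProductClass ((extendedGW p m).prod (extendedGW q m)) := by
  classical
  have hh : Measurable fun z => hpClass m (rayPair z).1 (rayPair z).2 :=
    measurable_hpClass.comp measurable_rayPair
  have hs : MeasurableSet {z | hpClass m (rayPair z).1 (rayPair z).2 ∈ DistinctClass} :=
    hh measurableSet_distinctClass
  refine ⟨fun z => if h : z ∈ {z | hpClass m (rayPair z).1 (rayPair z).2 ∈ DistinctClass} then
    ⟨hpClass m (rayPair z).1 (rayPair z).2, distinctClass_isRigid h⟩ else
    ⟨rootedRay.toClass, rootedRay_isRigid⟩, ?_, ?_⟩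
  · exact Measurable.dite (f := fun z : {z | hpClass m (rayPair z).1 (rayPair z).2 ∈ DistinctClass} =>
      (⟨hpClass m (rayPair z.1).1 (rayPair z.1).2, distinctClass_isRigid z.2⟩ : RigidGraph))
      (g := fun _ => ⟨rootedRay.toClass, rootedRay_isRigid⟩)
      (hh.comp measurable_subtype_coe).subtype_mk measurable_const hs
  · filter_upwards [ae_bundleProduct_spec hp0 hq0 hp hq hpm hqm] with z hz
    rw [(bundleProduct_spec hz.1 hz.2.1 hz.2.2).2]
    simp only [Set.mem_setOf_eq, hz.2.2, dite_true]

theorem isRelInvariant_bundleProductClass (hp0 : p 0 = 0) (hq0 : q 0 = 0)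
    (hp : p.support.Nontrivial) (hq : q.support.Nontrivial)
    (hpm : HasSum (fun k : ℕ => (k : ℝ) * (p k).toReal) m)
    (hqm : HasSum (fun k : ℕ => (k : ℝ) * (q k).toReal) m) :
    IsRelInvariant (((extendedGW p m).prod (extendedGW q m)).map bundleProductClass) := by
  have := isFiniteMeasure_rayLaw hp0 hp hpm
  have := isFiniteMeasure_rayLaw hq0 hq hqm
  refine (reversible_hpClass (shiftInvariant_rayLaw hp0 hp hpm) (shiftInvariant_rayLaw hq0 hq hqm)
    (rayLaw_ae_raySet p m) (rayLaw_ae_raySet q m)).isRelInvariant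
    (ae_hpClass_distinct hp0 hq0 hp hq hpm hqm) ?_
  rw [AEMeasurable.map_map_of_aemeasurable measurable_subtype_coe.aemeasurable
    (aemeasurable_bundleProductClass hp0 hq0 hp hq hpm hqm), ← map_rayPair hp0 hq0 hp hq hpm hqm,
    Measure.map_map measurable_hpClass measurable_rayPair]
  refine Measure.map_congr ((ae_bundleProduct_spec hp0 hq0 hp hq hpm hqm).mono fun z hz => ?_)
  exact congrArg Subtype.val (bundleProduct_spec hz.1 hz.2.1 hz.2.2).2

end BundleMeasures
end HorosphericGW

end

/-! ### The theorem, assembled from good classes and the measures on the bundle -/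

theorem mainTheorem3 (p q : PMF ℕ) (m : ℝ)
    (hp0 : p 0 = 0) (hq0 : q 0 = 0)
    (hp : p.support.Nontrivial) (hq : q.support.Nontrivial)
    (hplog : Summable fun k : ℕ => (k : ℝ) * Real.log k * (p k).toReal)
    (hqlog : Summable fun k : ℕ => (k : ℝ) * Real.log k * (q k).toReal)
    (hpm : HasSum (fun k : ℕ => (k : ℝ) * (p k).toReal) m)
    (hqm : HasSum (fun k : ℕ => (k : ℝ) * (q k).toReal) m) :
    -- the augmented Galton--Watson trees are almost surely rigid trees
    (IsProbabilityMeasure (augmentedGW p) ∧ IsProbabilityMeasure (augmentedGW q)) ∧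
    -- the branching measures exist almost surely and form measurable systems
    ((∀ᵐ x ∂augmentedGW p, IsBranchingMeasure (leafTree x) x.1.leafRoot m (branchingMeasure m x)) ∧
      (∀ᵐ x ∂augmentedGW q, IsBranchingMeasure (leafTree x) x.1.leafRoot m (branchingMeasure m x)) ∧
      IsMeasurableSystem (augmentedGW p) (branchingMeasure m) ∧
      IsMeasurableSystem (augmentedGW q) (branchingMeasure m)) ∧
    -- almost every horospheric product is a rigid rooted graph, depending measurably on the pair
    (∀ᵐ z ∂(extendedGW p m).prod (extendedGW q m),
      IsInfiniteLocallyFiniteConnected (bundleProduct z) ∧ IsRigidGraph (bundleProduct z)) ∧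
    AEMeasurable bundleProductClass ((extendedGW p m).prod (extendedGW q m)) ∧
    -- the image measure is finite and invariant
    IsFiniteMeasure (((extendedGW p m).prod (extendedGW q m)).map bundleProductClass) ∧
    IsRelInvariant (((extendedGW p m).prod (extendedGW q m)).map bundleProductClass) := by
  have hm : 0 < m := zero_lt_one.trans_le (one_le_mean hp0 hpm)
  have hgp := augmentedGW_ae_goodClass hp0 hp hpm
  have hgq := augmentedGW_ae_goodClass hq0 hq hqm
  have := isFiniteMeasure_extendedGW hp0 hp hpm
  have := isFiniteMeasure_extendedGW hq0 hq hqm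
  exact ⟨⟨isProbabilityMeasure_augmentedGW hp0 hp hpm, isProbabilityMeasure_augmentedGW hq0 hq hqm⟩,
    ⟨hgp.mono fun x hx => isBranchingMeasure_branchingMeasure hm x hx,
      hgq.mono fun x hx => isBranchingMeasure_branchingMeasure hm x hx,
      isMeasurableSystem_branchingMeasure hm hgp, isMeasurableSystem_branchingMeasure hm hgq⟩,
    (ae_bundleProduct_spec hp0 hq0 hp hq hpm hqm).mono fun z hz =>
      (bundleProduct_spec hz.1 hz.2.1 hz.2.2).1,
    aemeasurable_bundleProductClass hp0 hq0 hp hq hpm hqm, inferInstance,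
    isRelInvariant_bundleProductClass hp0 hq0 hp hq hpm hqm⟩
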